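/- For a set $V\subset\mathbb R^3$ let $\operatorname{udg}(V)$ be the graph with vertex set $V$ in which two points are adjacent iff their distance is $1$. For unit distance graphs $G_1=(V_1,E_1)$, $G_2=(V_2,E_2)$ with vertices on a common sphere centred at the origin, let $\mathcal F(G_1,G_2)$ be the set of all $f\in O(3)$ such that $f(\{u_2,v_2\})=\{u_1,v_1\}$ for some edges $u_1v_1\in E_1$, $u_2v_2\in E_2$, and define the distance product $$G_1\circ G_2=\operatorname{udg}\Big(\bigcup_{f\in\mathcal F(G_1,G_2)}f(V_2)\Big).$$ Let $r_2=\cos\frac{3\pi}{10}$, $\tau=\frac{1+\sqrt5}{2}$ and $h=\frac1{2\tau}$. Let $H_{12,2}$ be the unit distance graph of the 12 vertices $(0,\pm h,\pm\tfrac12)$, $(\pm h,\pm\tfrac12,0)$, $(\pm\tfrac12,0,\pm h)$ of a great icosahedron with unit edge length. Let $L_{10,1}$ be the graph with vertices $0,1,\dots,9$ and the 17 edges $01,02,12,03,13$; $45,56,46$; $78,89,79$; $24,35,37,28,58,69$. Let $\beta=\sqrt{2\sqrt5-1}$ and $\gamma=\sqrt{8\beta+6\sqrt5-26}$. For $g\in\mathbb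 R$ and $a,b\in\mathbb Z^4$ put $$[a\,|\,b]_g=\tfrac1{6560}\big(a_0+a_1\sqrt5+a_2\beta+a_3\sqrt5\beta+(b_0+b_1\sqrt5+b_2\beta+b_3\sqrt5\beta)g\big),$$ let $A(g)$, $B(g)$, $C(g)$ be the points whose three coordinates are, respectively, - $A(g)$: $[-2570,1190,470,-90\,|\,-275,23,-55,-61]_g$, $[-1740,560,-20,440\,|\,-455,-199,-255,-7]_g$, $[-1590,-690,10,190\,|\,-80,-126,-180,-58]_g$; - $B(g)$: $[930,450,-470,90\,|\,-275,23,-55,-61]_g$, $[720,-260,-840,-380\,|\,45,-47,-155,89]_g$, $[1690,-690,10,190\,|\,80,126,180,58]_g$; - $C(g)$: $[0,-820,820,0\,|\,145,213,275,59]_g$, $[-730,890,510,-150\,|\,410,164,0,82]_g$, $[2210,170,-50,-130\,|\,-205,-123,-205,41]_g$; and let $R(x,y,z)=(x,-y,-z)$. Let $H_{10,1}$ be the unit distance graph of the ten points $$p_0=(h,\tfrac12,0),\; p_1=(h,-\tfrac12,0),\; p_2=(-\tfrac12,0,h),\; p_3=(-\tfrac12,0,-h),$$ $$p_4=A(\gamma),\;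 p_5=B(\gamma),\; p_6=C(\gamma),\; p_7=R\,A(-\gamma),\; p_8=R\,B(-\gamma),\; p_9=R\,C(-\gamma).$$ **Proposition.** The vertices of $H_{12,2}$ lie on the sphere $S^2(r_2)$ of radius $r_2$ centred at the origin, and $i\mapsto p_i$ is an embedding of $L_{10,1}$ in $S^2(r_2)$ as a unit distance graph: the $p_i$ are distinct points of $S^2(r_2)$, and $|p_i-p_j|=1$ iff $ij$ is an edge of $L_{10,1}$. The graph $H_{12,2}\circ H_{10,1}$ has chromatic number exactly $$\chi(H_{12,2}\circ H_{10,1})=5,$$ and it has 3132 vertices and 10230 edges. Iterative removal of vertices of degree at most 4 reduces it to a graph $G_{972}$ with 972 vertices and 4110 edges, and $\chi(G_{972})=5$. -/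

import Mathlib

noncomputable section

namespace SphereGraphs

/-- Euclidean three-space. -/
abbrev E3 := EuclideanSpace ℝ (Fin 3)

/-- The (faithful) unit distance graph `udg V` on a set of points `V`. -/
def udg (V : Set E3) : SimpleGraph V where
  Adj u v := dist (u : E3) (v : E3) = 1
  symm := ⟨fun u v h => by rw [dist_comm]; exact h⟩
  loopless := ⟨fun u h => by simp at h⟩

/-- `P(u₁, v₁; u₂, v₂)`: the linear isometries of space (that is, the isometries of every sphere
centred at the origin) that carry the pair `{u₂, v₂}` to the pair `{u₁, v₁}`. -/
def edgeIsometries (u₁ v₁ u₂ v₂ : E3) : Set (E3 ≃ₗᵢ[ℝ] E3) :=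
  {f | f '' {u₂, v₂} = {u₁, v₁}}

/-- `𝓕(G₁, G₂)`: the union of the sets `P(u₁, v₁; u₂, v₂)` over all edges `u₁v₁` of `G₁` and
`u₂v₂` of `G₂`. -/
def gluings {V₁ V₂ : Set E3} (G₁ : SimpleGraph V₁) (G₂ : SimpleGraph V₂) :
    Set (E3 ≃ₗᵢ[ℝ] E3) :=
  {f | ∃ u₁ v₁ : V₁, ∃ u₂ v₂ : V₂, G₁.Adj u₁ v₁ ∧ G₂.Adj u₂ v₂ ∧
    f ∈ edgeIsometries u₁ v₁ u₂ v₂}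

/-- The vertex set of the distance product `G₁ ∘ G₂`. -/
def distanceProductVerts {V₁ V₂ : Set E3} (G₁ : SimpleGraph V₁) (G₂ : SimpleGraph V₂) : Set E3 :=
  ⋃ f ∈ gluings G₁ G₂, f '' V₂

/-- The distance product `G₁ ∘ G₂`. -/
def distanceProduct {V₁ V₂ : Set E3} (G₁ : SimpleGraph V₁) (G₂ : SimpleGraph V₂) :
    SimpleGraph (distanceProductVerts G₁ G₂) :=
  udg (distanceProductVerts G₁ G₂)

/-- The radius `r₂ = cos (3π/10)`. -/
def r₂ : ℝ := Real.cos (3 * Real.pi / 10)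

/-- The twelve vertices of a great icosahedron with unit edge length centred at the origin. -/
def greatIcosahedron : Set E3 :=
  {p | ∃ s t : ℝ, (s = 1 ∨ s = -1) ∧ (t = 1 ∨ t = -1) ∧
    (p = !₂[0, s / (2 * Real.goldenRatio), t / 2] ∨
     p = !₂[s / (2 * Real.goldenRatio), t / 2, 0] ∨
     p = !₂[t / 2, 0, s / (2 * Real.goldenRatio)])}

/-- `H₁₂,₂`: the unit distance graph of the vertices of the great icosahedron. -/
def H12_2 : SimpleGraph greatIcosahedron := udg greatIcosahedron

/-- The abstract graph `L₁₀,₁`: two triangles `012`, `013` with a common edge, two further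
triangles `456`, `789`, and the six edges `24`, `35`, `37`, `28`, `58`, `69`. -/
def L10_1 : SimpleGraph (Fin 10) :=
  SimpleGraph.fromEdgeSet
    {s(0, 1), s(0, 2), s(1, 2), s(0, 3), s(1, 3),
     s(4, 5), s(5, 6), s(4, 6), s(7, 8), s(8, 9), s(7, 9),
     s(2, 4), s(3, 5), s(3, 7), s(2, 8), s(5, 8), s(6, 9)}

/-- The points `p` are the vertices of an embedding of the abstract graph `L` in the sphere of
radius `r` about the origin as a (faithful) unit distance graph. -/
def IsUnitDistanceEmbedding {ι : Type*} (L : SimpleGraph ι) (r : ℝ) (p : ι → E3) : Prop :=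
  Function.Injective p ∧ (∀ i, p i ∈ Metric.sphere (0 : E3) r) ∧
    ∀ i j, dist (p i) (p j) = 1 ↔ L.Adj i j

/-- `β = √(2√5 - 1)`. -/
def β : ℝ := √(2 * √5 - 1)

/-- `γ = √(8β + 6√5 - 26)`. -/
def γ : ℝ := √(8 * β + 6 * √5 - 26)

/-- The element of `ℚ(√5, β, g)` with the given coefficients, divided by `6560`. -/
def elt (g a₀ a₁ a₂ a₃ b₀ b₁ b₂ b₃ : ℝ) : ℝ :=
  ((a₀ + a₁ * √5 + a₂ * β + a₃ * √5 * β) + (b₀ + b₁ * √5 + b₂ * β + b₃ * √5 * β) * g) / 6560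

def ptA (g : ℝ) : E3 :=
  !₂[elt g (-2570) 1190 470 (-90) (-275) 23 (-55) (-61),
     elt g (-1740) 560 (-20) 440 (-455) (-199) (-255) (-7),
     elt g (-1590) (-690) 10 190 (-80) (-126) (-180) (-58)]

def ptB (g : ℝ) : E3 :=
  !₂[elt g 930 450 (-470) 90 (-275) 23 (-55) (-61),
     elt g 720 (-260) (-840) (-380) 45 (-47) (-155) 89,
     elt g 1690 (-690) 10 190 80 126 180 58]

def ptC (g : ℝ) : E3 :=
  !₂[elt g 0 (-820) 820 0 145 213 275 59,
     elt g (-730) 890 510 (-150) 410 164 0 82,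
     elt g 2210 170 (-50) (-130) (-205) (-123) (-205) 41]

/-- The half-turn about the first coordinate axis. -/
def halfTurn (p : E3) : E3 := !₂[p 0, -p 1, -p 2]

/-- The vertices of the embedding of `L₁₀,₁` in the sphere of radius `r₂`. The vertices `0, 1, 2, 3`
are vertices of the great icosahedron; the remaining ones are approximately
`4 = (-0.04462, -0.12687, -0.57219)`, `5 = (0.08400, -0.45374, 0.36408)`,
`6 = (0.27396, 0.50154, 0.13746)`, `7 = (0.22502, -0.52572, 0.13592)`,
`8 = (0.35363, 0.46392, 0.07219)`, `9 = (-0.36713, 0.01818, -0.45867)`. -/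
def h10_1 : Fin 10 → E3 :=
  ![!₂[1 / (2 * Real.goldenRatio), 1 / 2, 0],
    !₂[1 / (2 * Real.goldenRatio), -1 / 2, 0],
    !₂[-1 / 2, 0, 1 / (2 * Real.goldenRatio)],
    !₂[-1 / 2, 0, -1 / (2 * Real.goldenRatio)],
    ptA γ, ptB γ, ptC γ,
    halfTurn (ptA (-γ)), halfTurn (ptB (-γ)), halfTurn (ptC (-γ))]

/-- `H₁₀,₁`: the unit distance graph of the embedded vertices of `L₁₀,₁`. -/
def H10_1 : SimpleGraph (Set.range h10_1) := udg (Set.range h10_1)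

/-- One round of removal: keep the vertices of `S` that have more than `d` neighbours in `S`. -/
def removeLowDegree {V : Type*} (G : SimpleGraph V) (d : ℕ) (S : Set V) : Set V :=
  {v ∈ S | (d : ℕ∞) < (G.neighborSet v ∩ S).encard}

/-- The vertices that survive the iterative removal of vertices of degree at most `d`. -/
def survivors {V : Type*} (G : SimpleGraph V) (d : ℕ) : Set V :=
  ⋂ n : ℕ, (removeLowDegree G d)^[n] Set.univ

/-- `G₉₇₂`: the graph that remains of `H₁₂,₂ ∘ H₁₀,₁` after the iterative removal of vertices of
degree at most `4`. -/
def G972 : SimpleGraph (survivors (distanceProduct H12_2 H10_1) 4) :=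
  (distanceProduct H12_2 H10_1).induce (survivors (distanceProduct H12_2 H10_1) 4)

end SphereGraphs

end

open SphereGraphs

namespace SphereGraphs

noncomputable section

/-! ### Exact arithmetic in `ℤ[√5, β, γ]` -/

/-- The integer `p - m`. -/
structure Diff where
  p : ℕ
  m : ℕ

namespace Diff

def add (x y : Diff) : Diff := ⟨Nat.add x.p y.p, Nat.add x.m y.m⟩
def neg (x : Diff) : Diff := ⟨x.m, x.p⟩
def mul (x y : Diff) : Diff :=
  ⟨Nat.add (Nat.mul x.p y.p) (Nat.mul x.m y.m), Nat.add (Nat.mul x.p y.m) (Nat.mul x.m y.p)⟩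
def scale (n : ℕ) (x : Diff) : Diff := ⟨Nat.mul n x.p, Nat.mul n x.m⟩
def beq (x y : Diff) : Bool := Nat.beq (Nat.add x.p y.m) (Nat.add y.p x.m)
def toInt (x : Diff) : ℤ := x.p - x.m

end Diff

/-- `a + b √5`. -/
structure Zs where
  a : Diff
  b : Diff

/-- `x + y β`. -/
structure Zb where
  x : Zs
  y : Zs

/-- `x + y γ`. -/
structure Zg where
  x : Zb
  y : Zb

namespace Zs

def zero : Zs := ⟨⟨0, 0⟩, ⟨0, 0⟩⟩
def ofInt (a b : ℤ) : Zs := ⟨⟨a.toNat, (-a).toNat⟩, ⟨b.toNat, (-b).toNat⟩⟩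
def add (p q : Zs) : Zs := ⟨p.a.add q.a, p.b.add q.b⟩
def neg (p : Zs) : Zs := ⟨p.a.neg, p.b.neg⟩
def mul (p q : Zs) : Zs :=
  ⟨(p.a.mul q.a).add ((p.b.mul q.b).scale 5), (p.a.mul q.b).add (p.b.mul q.a)⟩
def mulBetaSq (p : Zs) : Zs := ⟨(p.b.scale 10).add p.a.neg, (p.a.scale 2).add p.b.neg⟩
def mulConst (p : Zs) : Zs :=
  ⟨(p.b.scale 30).add (p.a.scale 26).neg, (p.a.scale 6).add (p.b.scale 26).neg⟩
def scale (n : ℕ) (p : Zs) : Zs := ⟨p.a.scale n, p.b.scale n⟩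
def beq (p q : Zs) : Bool := p.a.beq q.a && p.b.beq q.b
def ev (p : Zs) : ℝ := p.a.toInt + p.b.toInt * √5

end Zs

namespace Zb

def add (p q : Zb) : Zb := ⟨p.x.add q.x, p.y.add q.y⟩
def neg (p : Zb) : Zb := ⟨p.x.neg, p.y.neg⟩
def smul (s : Zs) (p : Zb) : Zb := ⟨s.mul p.x, s.mul p.y⟩
def mul (p q : Zb) : Zb :=
  ⟨(p.x.mul q.x).add (p.y.mul q.y).mulBetaSq, (p.x.mul q.y).add (p.y.mul q.x)⟩
def mulGammaSq (p : Zb) : Zb :=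
  ⟨p.x.mulConst.add (p.y.mulBetaSq.scale 8), p.y.mulConst.add (p.x.scale 8)⟩
def beq (p q : Zb) : Bool := p.x.beq q.x && p.y.beq q.y
def ev (p : Zb) : ℝ := p.x.ev + p.y.ev * β

end Zb

namespace Zg

def add (p q : Zg) : Zg := ⟨p.x.add q.x, p.y.add q.y⟩
def neg (p : Zg) : Zg := ⟨p.x.neg, p.y.neg⟩
def smul (s : Zs) (p : Zg) : Zg := ⟨p.x.smul s, p.y.smul s⟩
def mul (p q : Zg) : Zg :=
  ⟨(p.x.mul q.x).add (p.y.mul q.y).mulGammaSq, (p.x.mul q.y).add (p.y.mul q.x)⟩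
def beq (p q : Zg) : Bool := p.x.beq q.x && p.y.beq q.y
def ev (p : Zg) : ℝ := p.x.ev + p.y.ev * γ
def ofZs (s : Zs) : Zg := ⟨⟨s, Zs.zero⟩, ⟨Zs.zero, Zs.zero⟩⟩

end Zg

instance : Neg Zg := ⟨Zg.neg⟩

/-! ### The group generated by the sign changes and the cyclic permutations of the coordinates

Its 24 elements are coded by `t = 8 * c + s`: change the signs of the coordinates in the binary
expansion of `s`, then shift the coordinates cyclically `c` times. -/

section action

variable {α : Type*} [Neg α]

def flipIf (b : ℕ) (x : α) : α := cond (Nat.beq b 1) (-x) x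

def signs (s : ℕ) (p : α × α × α) : α × α × α :=
  (flipIf (Nat.mod s 2) p.1, flipIf (Nat.mod (Nat.div s 2) 2) p.2.1,
    flipIf (Nat.mod (Nat.div s 4) 2) p.2.2)

def shift (c : ℕ) (p : α × α × α) : α × α × α :=
  cond (Nat.beq c 0) p (cond (Nat.beq c 1) (p.2.2, p.1, p.2.1) (p.2.1, p.2.2, p.1))

def act (t : ℕ) (p : α × α × α) : α × α × α := shift (Nat.div t 8) (signs (Nat.mod t 8) p)

end action

/-- Multiplication of codes of group elements. -/
def tMul (t u : ℕ) : ℕ :=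
  Nat.add (Nat.mul 8 (Nat.mod (Nat.add (Nat.div t 8) (Nat.div u 8)) 3))
    (Nat.xor (Nat.mod u 8) (Nat.mod (Nat.add
      (Nat.shiftRight (Nat.mod t 8) (Nat.div u 8))
      (Nat.shiftLeft (Nat.mod t 8) (Nat.sub 3 (Nat.div u 8)))) 8))

/-- The code of the inverse. -/
def tInv (t : ℕ) : ℕ :=
  Nat.add (Nat.mul 8 (Nat.mod (Nat.sub 3 (Nat.div t 8)) 3))
    (Nat.mod (Nat.add (Nat.shiftLeft (Nat.mod t 8) (Nat.div t 8))
      (Nat.shiftRight (Nat.mod t 8) (Nat.sub 3 (Nat.div t 8)))) 8)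

/-! ### The points

The point with code `24 * q + t` is the image under `t` of the representative `q`. The
representative `0` is a vertex of the icosahedron, with a stabiliser of order two; the representative
`1 + 5 * a + i` is the `i`-th image of the base point `a` under a rotation of order five. -/

/-- The coordinates of the base points, multiplied by `6560`. -/
def basePoints : List ℕ := [
  0x7b4c015fdee7f83c4b91e48e70815bfc6066fb58194a2a85ccae8074191fe905a8af470a0dcbfa,
  0x7efc245ffefa18693769b64baa81c3fd9fa0fce7ab43e995d4e27d1bc7dda6ecf7563b02c589c0,
  0x7ebbcce0f6f338003332668998814c99e23f0cd733399a99ce667d74001eb919a733466a3354ce,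
  0x800399a00119a73346696654ce814c33623ef3399a4000cc96687c2bccdfaed99733533a334b32,
  0x84bbfee02318183c4b91e48e707eac03df9b04b8194a2a85ccae7f93e72018fa68af470a0dcbfa,
  0x810bdbe00305f8693769b64baa7e4402a0610327ab43e995d4e282ec38625b1317563b02c589c0,
  0x814c335f0b0cd80033326689987ebb665dc2f33733399a99ce668294002148e66733466a3354ce,
  0x800466a000e6673346696654ce7ebbccddc30cd99a4000cc966883dc336053267733533a334b32,
  0x83e3e4a10110e805353a064f56801be0ded70c374232e1df92d07efc245ffefa182d38aa3853a2,
  0x83e3e4a10110e7fb4ac9f9d0aa801be0ded70c38be4d22208d30810bdbe00305f82d38aa3853a2,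
  0x81943c21f517c7973bcab04dee809bc2e01b0058963ce1ee8c1882fc0160831b378d4489d6cc0e,
  0x7e73c41e0ce847973bcab04dee7f6c3d5fe6ffb8963ce1ee8c187d0bfedf7ee4d78d4489d6cc0e,
  0x8163ada11519084133f9ead7627dbc08de6f0af7f648c18d1154871c3d608b32f6ed36ca4257b2,
  0x7ea4529eece7084133f9ead762824bf76192f517f648c18d115478ebc2df76cd16ed36ca4257b2,
  0x8013c91e28d4e7e742a9e0ccea7e2bbb5e56f6f8143b527f8d58814bccdf0af33733399a335802,
  0x8013c91e28d4e8193d5a1f53167e2bbb5e56f6f7ec44b18092a87ebc3360f70cd733399a335802,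
  0x7e83f39f68f067834d4a974a2e7e7bdbdebaec571a3c41ad9820801c47620b0c37ab3719fc54e2,
  0x81840ca0990fa7834d4a974a2e818c24614713b71a3c41ad98207febb8ddf6f3d7ab3719fc54e2,
  0x837be361c70f56f73ad9e859928364029fbd1cc7b547fa6f4d26814c33623f2678004cd1999000,
  0x837be361c70f5909452a17c66e8364029fbd1cc84b380990d2da7ebbccddc2d998004cd1999000,
  0x800c17e0af0417fb57999350aa81840ca0990fa7bf3269485bd680abf2617708786442327d0c54,
  0x7ffbe85f52fbf7fb57999350aa7e83f39f68f067bf3269485bd67f5c0dde8af7986442327d0c54,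
  0x7fec1f612af3d90e3a6284829082dc6f60ff24973d3daaa64d127b940a1f950c8779493a24551e,
  0x801be0ded70c390e3a628482907d2b90df02db773d3daaa64d128473f6206cf38779493a24551e,
  0x7dabd95d12cf97424c81129fa07e1bf2602eeed693457a9ed06e7e33d31f04fb07a1597a5642fe,
  0x825c26e2ef3077424c81129fa081ec0ddfd3113693457a9ed06e81d42d20fd0507a1597a5642fe]

def coeff (n k : ℕ) : Diff := ⟨Nat.mod (Nat.shiftRight n (Nat.mul 13 k)) 8192, 4096⟩

def coordinate (n j : ℕ) : Zg :=
  ⟨⟨⟨coeff n j, coeff n (Nat.add j 1)⟩, ⟨coeff n (Nat.add j 2), coeff n (Nat.add j 3)⟩⟩,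
    ⟨⟨coeff n (Nat.add j 4), coeff n (Nat.add j 5)⟩,
      ⟨coeff n (Nat.add j 6), coeff n (Nat.add j 7)⟩⟩⟩

def basePoint (a : ℕ) : Zg × Zg × Zg :=
  (coordinate (basePoints.getD a 0) 0, coordinate (basePoints.getD a 0) 8,
    coordinate (basePoints.getD a 0) 16)

def linComb (r : Zs × Zs × Zs) (p : Zg × Zg × Zg) : Zg :=
  ((p.1.smul r.1).add (p.2.1.smul r.2.1)).add (p.2.2.smul r.2.2)

/-- The powers of a rotation of order five, multiplied by `4`. -/
def rotations : List ((Zs × Zs × Zs) × (Zs × Zs × Zs) × (Zs × Zs × Zs)) := [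
  ((⟨⟨4, 0⟩, ⟨0, 0⟩⟩, ⟨⟨0, 0⟩, ⟨0, 0⟩⟩, ⟨⟨0, 0⟩, ⟨0, 0⟩⟩),
    (⟨⟨0, 0⟩, ⟨0, 0⟩⟩, ⟨⟨4, 0⟩, ⟨0, 0⟩⟩, ⟨⟨0, 0⟩, ⟨0, 0⟩⟩),
    (⟨⟨0, 0⟩, ⟨0, 0⟩⟩, ⟨⟨0, 0⟩, ⟨0, 0⟩⟩, ⟨⟨4, 0⟩, ⟨0, 0⟩⟩)),
  ((⟨⟨2, 0⟩, ⟨0, 0⟩⟩, ⟨⟨0, 1⟩, ⟨1, 0⟩⟩, ⟨⟨1, 0⟩, ⟨1, 0⟩⟩),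
    (⟨⟨0, 1⟩, ⟨1, 0⟩⟩, ⟨⟨1, 0⟩, ⟨1, 0⟩⟩, ⟨⟨0, 2⟩, ⟨0, 0⟩⟩),
    (⟨⟨0, 1⟩, ⟨0, 1⟩⟩, ⟨⟨2, 0⟩, ⟨0, 0⟩⟩, ⟨⟨0, 1⟩, ⟨1, 0⟩⟩)),
  ((⟨⟨1, 0⟩, ⟨0, 1⟩⟩, ⟨⟨1, 0⟩, ⟨1, 0⟩⟩, ⟨⟨2, 0⟩, ⟨0, 0⟩⟩),
    (⟨⟨1, 0⟩, ⟨1, 0⟩⟩, ⟨⟨2, 0⟩, ⟨0, 0⟩⟩, ⟨⟨1, 0⟩, ⟨0, 1⟩⟩),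
    (⟨⟨0, 2⟩, ⟨0, 0⟩⟩, ⟨⟨0, 1⟩, ⟨1, 0⟩⟩, ⟨⟨0, 1⟩, ⟨0, 1⟩⟩)),
  ((⟨⟨1, 0⟩, ⟨0, 1⟩⟩, ⟨⟨1, 0⟩, ⟨1, 0⟩⟩, ⟨⟨0, 2⟩, ⟨0, 0⟩⟩),
    (⟨⟨1, 0⟩, ⟨1, 0⟩⟩, ⟨⟨2, 0⟩, ⟨0, 0⟩⟩, ⟨⟨0, 1⟩, ⟨1, 0⟩⟩),
    (⟨⟨2, 0⟩, ⟨0, 0⟩⟩, ⟨⟨1, 0⟩, ⟨0, 1⟩⟩, ⟨⟨0, 1⟩, ⟨0, 1⟩⟩)),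
  ((⟨⟨2, 0⟩, ⟨0, 0⟩⟩, ⟨⟨0, 1⟩, ⟨1, 0⟩⟩, ⟨⟨0, 1⟩, ⟨0, 1⟩⟩),
    (⟨⟨0, 1⟩, ⟨1, 0⟩⟩, ⟨⟨1, 0⟩, ⟨1, 0⟩⟩, ⟨⟨2, 0⟩, ⟨0, 0⟩⟩),
    (⟨⟨1, 0⟩, ⟨1, 0⟩⟩, ⟨⟨0, 2⟩, ⟨0, 0⟩⟩, ⟨⟨0, 1⟩, ⟨1, 0⟩⟩))]

def rotate (r : (Zs × Zs × Zs) × (Zs × Zs × Zs) × (Zs × Zs × Zs)) (p : Zg × Zg × Zg) :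
    Zg × Zg × Zg :=
  (linComb r.1 p, linComb r.2.1 p, linComb r.2.2 p)

def icoRep : Zg × Zg × Zg :=
  (Zg.ofZs ⟨⟨0, 6560⟩, ⟨6560, 0⟩⟩, Zg.ofZs ⟨⟨13120, 0⟩, ⟨0, 0⟩⟩, Zg.ofZs Zs.zero)

/-- The coordinates of the representatives, multiplied by `26240`. -/
def rep (q : ℕ) : Zg × Zg × Zg :=
  cond (Nat.beq q 0) icoRep
    (rotate (rotations.getD (Nat.mod (Nat.sub q 1) 5)
        ((Zs.zero, Zs.zero, Zs.zero), (Zs.zero, Zs.zero, Zs.zero), (Zs.zero, Zs.zero, Zs.zero)))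
      (basePoint (Nat.div (Nat.sub q 1) 5)))

/-- The coordinates of the point with a given code, multiplied by `26240`. -/
def pointK (v : ℕ) : Zg × Zg × Zg := act (Nat.mod v 24) (rep (Nat.div v 24))

def dotK (p q : Zg × Zg × Zg) : Zg := ((p.1.mul q.1).add (p.2.1.mul q.2.1)).add (p.2.2.mul q.2.2)

/-- The codes in use: those below `24 * 131` without redundant ones for the icosahedron. -/
def valid (v : ℕ) : Bool := Nat.blt v 3144 && (Nat.ble 24 v || Nat.blt (Nat.mod v 8) 4)

/-- The code of the image under `t` of the point with code `v`. -/
def codeAct (t v : ℕ) : ℕ :=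
  cond (Nat.blt v 24)
    (cond (Nat.blt (Nat.mod (tMul t v) 8) 4) (tMul t v) (Nat.sub (tMul t v) 4))
    (Nat.add (Nat.sub v (Nat.mod v 24)) (tMul t (Nat.mod v 24)))

/-- The neighbours of the representatives. -/
def repNeighbors : List (List ℕ) := [
  [2, 9, 11, 18, 19, 26, 30, 70, 71, 85, 87, 105, 107, 138, 139, 162, 163, 170, 174, 214, 215,
    229, 231, 249, 251, 273, 275, 306, 307, 314, 318, 358, 359, 373, 375, 506, 510, 550,
    551, 565, 567, 585, 587, 618, 619, 642, 643, 650, 654, 694, 695, 709, 711, 729,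
    731, 753, 755, 786, 787, 794, 798, 838, 839, 853, 855],
  [2, 67, 81, 111, 142, 144, 418, 571, 1224, 2018, 2506, 2782],
  [11, 37, 95, 118, 122, 168, 481, 622, 1248, 1959, 2449, 2677],
  [19, 42, 63, 102, 133, 192, 444, 517, 1272, 2063, 2532, 2742],
  [18, 47, 59, 78, 129, 216, 476, 582, 1296, 2010, 2444, 2699],
  [9, 35, 50, 91, 114, 240, 401, 539, 1320, 1977, 2489, 2731],
  [9, 24, 179, 194, 235, 258, 652, 795, 1081, 1201, 1224, 1529, 2021, 2509, 2813, 3086],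
  [2, 48, 166, 211, 225, 255, 628, 771, 1044, 1164, 1248, 1546, 1952, 2454, 2864, 3125],
  [11, 72, 146, 181, 239, 262, 724, 747, 1076, 1196, 1272, 1489, 2056, 2531, 2848, 3056],
  [19, 96, 157, 186, 207, 246, 700, 843, 1001, 1121, 1296, 1572, 2013, 2443, 2805, 3040],
  [18, 120, 153, 191, 203, 222, 676, 819, 1018, 1138, 1320, 1484, 1982, 2494, 2894, 3117],
  [18, 297, 335, 347, 366, 456, 675, 854, 863, 926, 1674, 1818, 1866, 2734, 3114],
  [9, 282, 323, 338, 379, 480, 651, 773, 810, 965, 1641, 1785, 1833, 2749, 3081],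
  [2, 279, 310, 355, 369, 384, 627, 777, 824, 896, 1682, 1706, 1874, 2694, 3122],
  [11, 286, 290, 325, 383, 408, 723, 808, 818, 880, 1623, 1767, 1935, 2771, 3063],
  [19, 270, 301, 330, 351, 432, 699, 759, 765, 957, 1607, 1751, 1919, 2683, 3047],
  [132, 312, 824, 903, 931], [44, 336, 808, 887, 982], [89, 360, 765, 877, 954],
  [106, 264, 854, 921, 942], [49, 288, 773, 899, 962],
  [2, 91, 547, 561, 591, 622, 624, 898, 1344, 2138, 2626, 2902],
  [11, 142, 517, 575, 598, 602, 648, 961, 1368, 2079, 2569, 2797],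
  [19, 37, 522, 543, 582, 613, 672, 924, 1392, 2183, 2652, 2862],
  [18, 102, 527, 539, 558, 609, 696, 956, 1416, 2130, 2564, 2819],
  [9, 59, 515, 530, 571, 594, 720, 881, 1440, 2097, 2609, 2851],
  [9, 172, 315, 504, 659, 674, 715, 738, 1041, 1161, 1344, 1649, 2141, 2629, 2693, 2966],
  [2, 148, 291, 528, 646, 691, 705, 735, 1082, 1202, 1368, 1666, 2072, 2574, 2744, 3005],
  [11, 244, 267, 552, 626, 661, 719, 742, 1023, 1143, 1392, 1609, 2176, 2651, 2728, 2936],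
  [19, 220, 363, 576, 637, 666, 687, 726, 1007, 1127, 1416, 1692, 2133, 2563, 2685, 2920],
  [18, 196, 339, 600, 633, 671, 683, 702, 1074, 1194, 1440, 1604, 2102, 2614, 2774, 2997],
  [18, 195, 374, 383, 446, 777, 815, 827, 846, 936, 1554, 1778, 1876, 2854, 2994],
  [9, 171, 293, 330, 485, 762, 803, 818, 859, 960, 1521, 1719, 1852, 2869, 2961],
  [2, 147, 297, 344, 416, 759, 790, 835, 849, 864, 1562, 1823, 1828, 2814, 3002],
  [11, 243, 328, 338, 400, 766, 770, 805, 863, 888, 1503, 1770, 1924, 2891, 2943],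
  [19, 219, 279, 285, 477, 750, 781, 810, 831, 912, 1487, 1737, 1900, 2803, 2927],
  [344, 423, 451, 612, 792], [328, 407, 502, 524, 816], [285, 397, 474, 569, 840],
  [374, 441, 462, 586, 744], [293, 419, 482, 529, 768], [228, 711, 1104], [260, 695, 1128],
  [185, 642, 1152], [202, 729, 1176], [145, 650, 1200], [228, 711, 984], [260, 695, 1008],
  [185, 642, 1032], [202, 729, 1056], [145, 650, 1080], [24, 144, 1411, 2021, 2506],
  [48, 168, 1462, 1952, 2449], [72, 192, 1357, 2056, 2532], [96, 216, 1422, 2013, 2444],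
  [120, 240, 1379, 1982, 2489], [504, 624, 1291, 2141, 2626], [528, 648, 1342, 2072, 2569],
  [552, 672, 1237, 2176, 2652], [576, 696, 1302, 2133, 2564], [600, 720, 1259, 2102, 2609],
  [250, 855, 2904], [193, 839, 2928], [156, 786, 2952], [188, 753, 2976], [233, 794, 3000],
  [375, 730, 3024], [359, 673, 3048], [306, 636, 3072], [273, 668, 3096], [314, 713, 3120],
  [314, 791, 1831, 2184, 2304], [375, 858, 1855, 2208, 2328], [359, 825, 1879, 2232, 2352],
  [306, 746, 1903, 2256, 2376], [273, 807, 1927, 2280, 2400], [306, 796, 1711, 2184, 2304],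
  [273, 772, 1735, 2208, 2328], [314, 748, 1759, 2232, 2352], [375, 844, 1783, 2256, 2376],
  [359, 820, 1807, 2280, 2400], [71, 184, 1264, 2106, 2470], [138, 261, 1341, 2073, 2485],
  [105, 230, 1310, 2114, 2430], [26, 149, 1229, 2175, 2507], [87, 200, 1280, 2159, 2539],
  [551, 664, 1384, 1986, 2590], [618, 741, 1461, 1953, 2605], [585, 710, 1430, 1994, 2550],
  [506, 629, 1349, 2055, 2627], [567, 680, 1400, 2039, 2659], [1704, 1824, 2304],
  [1728, 1848, 2328], [1752, 1872, 2352], [1776, 1896, 2376], [1800, 1920, 2400],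
  [1704, 1824, 2184], [1728, 1848, 2208], [1752, 1872, 2232], [1776, 1896, 2256],
  [1800, 1920, 2280], [106, 229, 1306, 1998], [49, 174, 1249, 1955], [132, 251, 1332, 1987],
  [44, 163, 1244, 2038], [89, 214, 1289, 2053], [586, 709, 1426, 2118], [529, 654, 1369, 2075],
  [612, 731, 1452, 2107], [524, 643, 1364, 2158], [569, 694, 1409, 2173], [67, 373, 710],
  [118, 318, 629], [133, 275, 680], [78, 307, 664], [35, 358, 741], [230, 547, 853],
  [149, 598, 798], [200, 613, 755], [184, 558, 787], [261, 515, 838], [704, 855, 1464],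
  [688, 839, 1488], [645, 786, 1512], [734, 753, 1536], [653, 794, 1560], [224, 375, 1584],
  [208, 359, 1608], [165, 306, 1632], [254, 273, 1656], [173, 314, 1680]]

/-- The neighbours of the point with a given code. -/
def nbr (v : ℕ) : List ℕ :=
  (repNeighbors.getD (Nat.div v 24) []).map (codeAct (Nat.mod v 24))

/-- The codes of the vertices of `H₁₀,₁`. -/
def h10Code : List ℕ := [0, 2, 18, 19, 702, 582, 1422, 216, 96, 1296]

/-- The edges of `L₁₀,₁`. -/
def h10Edges : List (ℕ × ℕ) :=
  [(0, 1), (0, 2), (1, 2), (0, 3), (1, 3), (4, 5), (5, 6), (4, 6), (7, 8), (8, 9), (7, 9),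
    (2, 4), (3, 5), (3, 7), (2, 8), (5, 8), (6, 9)]

/-- Representatives of the pairs of adjacent vertices of the icosahedron. -/
def icoArcs : List (ℕ × ℕ) := [(0, 2), (0, 18), (18, 0)]

/-- For each pair of an element of `icoArcs` and one of `h10Edges`, the two possible images of each
of the other vertices of `H₁₀,₁` under the isometries that map the edge to the arc. -/
def gluedPoints : List (List (ℕ × ℕ)) := [
  [(18, 19), (19, 18), (702, 698), (582, 578), (1422, 1418), (216, 220), (96, 100), (1296, 1300)],
  [(19, 18), (9, 11), (691, 690), (571, 570), (1411, 1410), (144, 148), (24, 28), (1224, 1228)],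
  [(18, 19), (11, 9), (648, 652), (528, 532), (1368, 1372), (262, 263), (142, 143), (1342, 1343)],
  [(18, 19), (11, 9), (742, 743), (622, 623), (1462, 1463), (168, 172), (48, 52), (1248, 1252)],
  [(19, 18), (9, 11), (624, 628), (504, 508), (1344, 1348), (211, 210), (91, 90), (1291, 1290)],
  [(1998, 1994), (2424, 2428), (229, 231), (106, 104), (18, 19), (456, 460), (854, 852), (264, 268)],
  [(1944, 1948), (2470, 2471), (184, 185), (71, 70), (18, 19), (502, 503), (787, 786), (310, 311)],
  [(1987, 1986), (2472, 2476), (251, 249), (132, 134), (19, 18), (384, 388), (824, 826), (312, 316)],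
  [(2544, 2548), (2118, 2114), (586, 584), (709, 711), (936, 940), (374, 372), (744, 748), (18, 19)],
  [(2590, 2591), (2064, 2068), (551, 550), (664, 665), (982, 983), (307, 306), (790, 791), (18, 19)],
  [(2592, 2596), (2107, 2106), (612, 614), (731, 729), (864, 868), (344, 346), (792, 796), (19, 18)],
  [(695, 694), (650, 654), (704, 706), (228, 230), (250, 248), (2904, 2908), (855, 853), (1464, 1468)],
  [(618, 619), (506, 510), (590, 588), (104, 106), (67, 66), (373, 375), (710, 708), (2664, 2668)],
  [(170, 174), (215, 214), (224, 226), (3024, 3028), (375, 373), (1584, 1588), (708, 710), (730, 728)],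
  [(26, 30), (138, 139), (110, 108), (853, 855), (230, 228), (2784, 2788), (584, 586), (547, 546)],
  [(984, 988), (1104, 1108), (228, 230), (711, 709), (855, 853), (786, 787), (372, 374), (311, 310)],
  [(2184, 2188), (2304, 2308), (1704, 1708), (1824, 1828), (314, 318), (306, 307), (796, 792), (791, 790)],
  [(11, 2), (2, 11), (742, 690), (622, 570), (1462, 1410), (168, 148), (48, 28), (1248, 1228)],
  [(2, 11), (19, 9), (702, 639), (582, 519), (1422, 1359), (216, 196), (96, 76), (1296, 1276)],
  [(11, 2), (9, 19), (720, 700), (600, 580), (1440, 1420), (179, 218), (59, 98), (1259, 1298)],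
  [(11, 2), (9, 19), (659, 698), (539, 578), (1379, 1418), (240, 220), (120, 100), (1320, 1300)],
  [(2, 11), (19, 9), (696, 676), (576, 556), (1416, 1396), (222, 159), (102, 39), (1302, 1239)],
  [(2038, 1986), (2496, 2476), (163, 249), (44, 134), (11, 2), (408, 388), (808, 826), (336, 316)],
  [(2016, 1996), (2507, 2426), (149, 228), (26, 107), (11, 2), (419, 458), (798, 855), (347, 266)],
  [(1998, 2055), (2424, 2524), (229, 215), (106, 88), (2, 11), (456, 436), (854, 764), (264, 364)],
  [(2616, 2596), (2158, 2106), (524, 614), (643, 729), (888, 868), (328, 346), (816, 796), (11, 2)],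
  [(2627, 2546), (2136, 2116), (506, 587), (629, 708), (899, 938), (318, 375), (827, 746), (11, 2)],
  [(2544, 2644), (2118, 2175), (586, 568), (709, 695), (936, 916), (374, 284), (744, 844), (2, 11)],
  [(650, 731), (642, 694), (734, 644), (202, 184), (188, 158), (2976, 2956), (753, 787), (1536, 1516)],
  [(567, 510), (618, 550), (544, 562), (134, 44), (78, 135), (307, 273), (664, 682), (2736, 2716)],
  [(162, 214), (170, 251), (254, 164), (3096, 3076), (273, 307), (1656, 1636), (682, 664), (668, 638)],
  [(138, 70), (87, 30), (64, 82), (787, 753), (184, 202), (2856, 2836), (614, 524), (558, 615)],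
  [(1056, 1036), (1176, 1156), (202, 184), (729, 643), (753, 787), (855, 798), (346, 328), (266, 347)],
  [(2256, 2236), (2376, 2356), (1776, 1756), (1896, 1876), (306, 358), (375, 318), (844, 744), (746, 827)],
  [(2, 11), (11, 2), (648, 628), (528, 508), (1368, 1348), (262, 210), (142, 90), (1342, 1290)],
  [(11, 2), (16, 10), (731, 650), (611, 530), (1451, 1370), (190, 258), (70, 138), (1270, 1338)],
  [(2, 11), (10, 16), (694, 642), (574, 522), (1414, 1362), (150, 207), (30, 87), (1230, 1287)],
  [(2, 11), (10, 16), (630, 687), (510, 567), (1350, 1407), (214, 162), (94, 42), (1294, 1242)],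
  [(11, 2), (16, 10), (670, 738), (550, 618), (1390, 1458), (251, 170), (131, 50), (1331, 1250)],
  [(1944, 2044), (2470, 2538), (184, 202), (71, 85), (2, 11), (502, 450), (787, 753), (310, 378)],
  [(1990, 2058), (2478, 2535), (248, 193), (135, 78), (2, 11), (390, 447), (827, 746), (318, 375)],
  [(2027, 1946), (2518, 2466), (158, 188), (33, 67), (11, 2), (430, 498), (805, 791), (358, 306)],
  [(2590, 2658), (2064, 2164), (551, 565), (664, 682), (982, 930), (307, 273), (790, 858), (2, 11)],
  [(2598, 2655), (2110, 2178), (615, 558), (728, 673), (870, 927), (347, 266), (798, 855), (2, 11)],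
  [(2638, 2586), (2147, 2066), (513, 547), (638, 668), (910, 978), (325, 311), (838, 786), (11, 2)],
  [(639, 702), (700, 720), (685, 671), (249, 163), (215, 229), (2950, 3018), (826, 808), (1510, 1578)],
  [(578, 539), (556, 576), (523, 609), (85, 71), (107, 26), (328, 346), (643, 729), (2710, 2778)],
  [(220, 240), (159, 222), (205, 191), (3070, 3138), (346, 328), (1630, 1698), (729, 643), (695, 709)],
  [(76, 96), (98, 59), (43, 129), (808, 826), (163, 249), (2830, 2898), (565, 551), (587, 506)],
  [(1030, 1098), (1150, 1218), (249, 163), (682, 664), (826, 808), (746, 827), (273, 307), (375, 318)],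
  [(2230, 2298), (2350, 2418), (1750, 1818), (1870, 1938), (364, 264), (266, 347), (786, 838), (855, 798)]]

/-! ### Interval arithmetic modulo `2 ^ 192` -/

def modulus : ℕ := 2 ^ 192

def residueMul (x : Diff) (b : ℕ) : ℕ :=
  Nat.add (Nat.mul x.p b) (Nat.mul x.m (Nat.sub modulus b))

/-- An approximation of the real number, multiplied by `10 ^ 20`, as a residue. -/
def residue (z : Zg) : ℕ :=
  Nat.mod (Nat.add (Nat.add (Nat.add (residueMul z.x.x.a 100000000000000000000)
    (residueMul z.x.x.b 223606797749978969640))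
    (Nat.add (residueMul z.x.y.a 186336683318115850615)
    (residueMul z.x.y.b 416661490601158111923)))
    (Nat.add (Nat.add (residueMul z.y.x.a 152425146562107862312)
    (residueMul z.y.x.b 340832989193241550261))
    (Nat.add (residueMul z.y.y.a 284023962646608877053)
    (residueMul z.y.y.b 635096887716678527686)))) modulus

/-- The residue `e` is not close to that of the inner product of adjacent points. -/
def farFromEdge (e : ℕ) : Bool :=
  Nat.ble 88046829568000000000000000000001 (Nat.mod
    (Nat.add e 1063849098330699041603395584000000000000000000000) modulus)

def signTest (l : List ℕ) (v e : ℕ) : Bool :=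
  farFromEdge e || (l.any (Nat.beq v) || !valid v)

def signTests (l : List ℕ) (v a b c a' b' c' : ℕ) : Bool :=
  signTest l v (Nat.add (Nat.add a b) c) &&
  signTest l (Nat.add v 1) (Nat.add (Nat.add a' b) c) &&
  signTest l (Nat.add v 2) (Nat.add (Nat.add a b') c) &&
  signTest l (Nat.add v 3) (Nat.add (Nat.add a' b') c) &&
  signTest l (Nat.add v 4) (Nat.add (Nat.add a b) c') &&
  signTest l (Nat.add v 5) (Nat.add (Nat.add a' b) c') &&
  signTest l (Nat.add v 6) (Nat.add (Nat.add a b') c') &&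
  signTest l (Nat.add v 7) (Nat.add (Nat.add a' b') c')

def nonEdgeTest (X Y : ℕ × ℕ × ℕ) (l : List ℕ) (v : ℕ) : Bool :=
  signTests l v (Nat.mul X.1 Y.1) (Nat.mul X.2.1 Y.2.1) (Nat.mul X.2.2 Y.2.2)
    (Nat.mul X.1 (Nat.sub modulus Y.1)) (Nat.mul X.2.1 (Nat.sub modulus Y.2.1))
    (Nat.mul X.2.2 (Nat.sub modulus Y.2.2))

def residues (p : Zg × Zg × Zg) : ℕ × ℕ × ℕ := (residue p.1, residue p.2.1, residue p.2.2)

def unshift (c : ℕ) (p : ℕ × ℕ × ℕ) : ℕ × ℕ × ℕ :=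
  cond (Nat.beq c 0) p (cond (Nat.beq c 1) (p.2.1, p.2.2, p.1) (p.2.2, p.1, p.2.1))

theorem nonEdge_check :
    ((List.range 131).all fun q => (List.range 131).all fun k => (List.range 3).all fun c =>
      nonEdgeTest (unshift c (residues (rep q))) (residues (rep k)) (repNeighbors.getD q [])
        (Nat.add (Nat.mul 24 k) (Nat.mul 8 c))) = true := by
  decide +kernel

theorem norm_check :
    ((List.range 131).all fun q => (dotK (rep q) (rep q)).beq
      (Zg.ofZs ⟨⟨430336000, 0⟩, ⟨0, 86067200⟩⟩)) = true := by
  decide +kernel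

/-- `26240 ^ 2` times the inner product of adjacent vertices. -/
def edgeInner : Zg := Zg.ofZs ⟨⟨86067200, 0⟩, ⟨0, 86067200⟩⟩

theorem edge_check :
    ((List.range 131).all fun q => (repNeighbors.getD q []).all fun w =>
      (dotK (rep q) (pointK w)).beq edgeInner) = true := by
  decide +kernel

/-- The vertex of `H₁₀,₁` with a given index. -/
def h10Point (k : ℕ) : Zg × Zg × Zg := pointK (h10Code.getD k 0)

def h10Gram : List (List Zg) :=
  (List.range 10).map fun i => (List.range 10).map fun k => dotK (h10Point i) (h10Point k)

/-- `4` times the coordinates of the ends of the elements of `icoArcs`. -/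
def arcEnd (v : ℕ) : Zs × Zs × Zs :=
  cond (Nat.beq v 0) (⟨⟨0, 1⟩, ⟨1, 0⟩⟩, ⟨⟨2, 0⟩, ⟨0, 0⟩⟩, Zs.zero)
    (cond (Nat.beq v 2) (⟨⟨0, 1⟩, ⟨1, 0⟩⟩, ⟨⟨0, 2⟩, ⟨0, 0⟩⟩, Zs.zero)
      (⟨⟨0, 2⟩, ⟨0, 0⟩⟩, Zs.zero, ⟨⟨0, 1⟩, ⟨1, 0⟩⟩))

def arcTest (u i k : ℕ) (p : Zg × Zg × Zg) : Bool :=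
  ((linComb (arcEnd u) p).smul ⟨⟨6560, 0⟩, ⟨0, 0⟩⟩).beq
    ((h10Gram.getD i []).getD k (Zg.ofZs Zs.zero))

/-- The point `v` has the same inner products with the arc `a` as the vertex `k` of `H₁₀,₁` has with
the edge `e`. -/
def gluedTest (a e : ℕ × ℕ) (k v : ℕ) : Bool :=
  arcTest a.1 e.1 k (pointK v) && arcTest a.2 e.2 k (pointK v)

/-- The vertices of `H₁₀,₁` that are not ends of the edge `e`. -/
def otherVertices (e : ℕ × ℕ) : List ℕ :=
  (List.range 10).filter fun k => !(Nat.beq k e.1 || Nat.beq k e.2)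

def arcEdgePairs : List ((ℕ × ℕ) × (ℕ × ℕ)) :=
  icoArcs.flatMap fun a => h10Edges.map fun e => (a, e)

def gluedList : List (((ℕ × ℕ) × (ℕ × ℕ)) × (ℕ × (ℕ × ℕ))) :=
  (arcEdgePairs.zip gluedPoints).flatMap fun x =>
    ((otherVertices x.1.2).zip x.2).map fun y => (x.1, y)

theorem glued_check :
    (gluedList.all fun x => valid x.2.2.1 && (valid x.2.2.2 && (!(Nat.beq x.2.2.1 x.2.2.2) &&
      (gluedTest x.1.1 x.1.2 x.2.1 x.2.2.1 && gluedTest x.1.1 x.1.2 x.2.1 x.2.2.2)))) = true := by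
  decide +kernel

theorem glued_complete :
    (arcEdgePairs.all fun x => (otherVertices x.2).all fun k =>
      gluedList.any fun y => (Nat.beq x.1.1 y.1.1.1 && Nat.beq x.1.2 y.1.1.2) &&
        ((Nat.beq x.2.1 y.1.2.1 && Nat.beq x.2.2 y.1.2.2) && Nat.beq k y.2.1)) = true := by
  decide +kernel

theorem glued_cover :
    ((List.range 131).all fun q => gluedList.any fun y => Nat.beq q (Nat.div y.2.2.1 24) ||
      Nat.beq q (Nat.div y.2.2.2 24)) = true := by
  decide +kernel

/-! ### The values of the exact numbers -/

theorem sqrt_five_sq : √5 * √5 = (5 : ℝ) := Real.mul_self_sqrt (by norm_num)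

theorem sqrt_five_bounds :
    (2.236067977499789696409173668731 : ℝ) ≤ √5 ∧
      √5 ≤ (2.236067977499789696409173668732 : ℝ) :=
  ⟨Real.le_sqrt_of_sq_le (by norm_num), Real.sqrt_le_iff.2 ⟨by norm_num, by norm_num⟩⟩

theorem β_bounds :
    (1.86336683318115850615913826 : ℝ) ≤ β ∧ β ≤ (1.86336683318115850615913827 : ℝ) := by
  obtain ⟨h, h'⟩ := sqrt_five_bounds
  exact ⟨Real.le_sqrt_of_sq_le (by norm_num; linarith),
    Real.sqrt_le_iff.2 ⟨by norm_num, by norm_num; linarith⟩⟩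

theorem β_sq : β * β = 2 * √5 - 1 :=
  Real.mul_self_sqrt (by linarith [sqrt_five_bounds.1])

theorem γ_bounds :
    (1.52425146562107862312023 : ℝ) ≤ γ ∧ γ ≤ (1.52425146562107862312024 : ℝ) := by
  obtain ⟨h, h'⟩ := sqrt_five_bounds
  obtain ⟨k, k'⟩ := β_bounds
  exact ⟨Real.le_sqrt_of_sq_le (by norm_num; linarith),
    Real.sqrt_le_iff.2 ⟨by norm_num, by norm_num; linarith⟩⟩

theorem γ_sq : γ * γ = 8 * β + 6 * √5 - 26 :=
  Real.mul_self_sqrt (by linarith [sqrt_five_bounds.1, β_bounds.1])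

namespace Diff

variable (x y : Diff)

theorem toInt_add : (x.add y).toInt = x.toInt + y.toInt := by
  simp only [toInt, add, Nat.add_eq]; push_cast; ring

theorem toInt_neg : x.neg.toInt = -x.toInt := by simp only [toInt, neg]; ring

theorem toInt_mul : (x.mul y).toInt = x.toInt * y.toInt := by
  simp only [toInt, mul, Nat.add_eq, Nat.mul_eq]; push_cast; ring

theorem toInt_scale (n : ℕ) : (x.scale n).toInt = n * x.toInt := by
  simp only [toInt, scale, Nat.mul_eq]; push_cast; ring

theorem toInt_eq_of_beq {x y : Diff} (h : x.beq y = true) : x.toInt = y.toInt := by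
  have := Nat.eq_of_beq_eq_true h
  simp only [Nat.add_eq] at this
  simp only [toInt]; omega

end Diff

namespace Zs

variable (p q : Zs)

theorem ev_add : (p.add q).ev = p.ev + q.ev := by
  simp only [ev, add, Diff.toInt_add]; push_cast; ring

theorem ev_neg : p.neg.ev = -p.ev := by simp only [ev, neg, Diff.toInt_neg]; push_cast; ring

theorem ev_scale (n : ℕ) : (p.scale n).ev = n * p.ev := by
  simp only [ev, scale, Diff.toInt_scale]; push_cast; ring

theorem ev_mul : (p.mul q).ev = p.ev * q.ev := by
  simp only [ev, mul, Diff.toInt_add, Diff.toInt_mul, Diff.toInt_scale]; push_cast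
  linear_combination (-(p.b.toInt : ℝ) * q.b.toInt) * sqrt_five_sq

theorem ev_mulBetaSq : p.mulBetaSq.ev = β * β * p.ev := by
  simp only [ev, mulBetaSq, Diff.toInt_add, Diff.toInt_neg, Diff.toInt_scale, β_sq]; push_cast
  linear_combination (-2 * (p.b.toInt : ℝ)) * sqrt_five_sq

theorem ev_mulConst : p.mulConst.ev = (6 * √5 - 26) * p.ev := by
  simp only [ev, mulConst, Diff.toInt_add, Diff.toInt_neg, Diff.toInt_scale]; push_cast
  linear_combination (-6 * (p.b.toInt : ℝ)) * sqrt_five_sq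

theorem ev_ofInt (a b : ℤ) : (ofInt a b).ev = a + b * √5 := by
  have h (z : ℤ) : (z.toNat : ℤ) - ((-z).toNat : ℤ) = z := by omega
  simp only [ev, ofInt, Diff.toInt, h]

theorem ev_eq_of_beq {p q : Zs} (h : p.beq q = true) : p.ev = q.ev := by
  simp only [beq, Bool.and_eq_true] at h
  simp only [ev, Diff.toInt_eq_of_beq h.1, Diff.toInt_eq_of_beq h.2]

end Zs

namespace Zb

variable (p q : Zb)

theorem ev_add : (p.add q).ev = p.ev + q.ev := by simp only [ev, add, Zs.ev_add]; ring

theorem ev_neg : p.neg.ev = -p.ev := by simp only [ev, neg, Zs.ev_neg]; ring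

theorem ev_smul (s : Zs) : (p.smul s).ev = s.ev * p.ev := by
  simp only [ev, smul, Zs.ev_mul]; ring

theorem ev_mul : (p.mul q).ev = p.ev * q.ev := by
  simp only [ev, mul, Zs.ev_add, Zs.ev_mul, Zs.ev_mulBetaSq]; ring

theorem ev_mulGammaSq : p.mulGammaSq.ev = γ * γ * p.ev := by
  simp only [ev, mulGammaSq, Zs.ev_add, Zs.ev_mulConst, Zs.ev_scale, Zs.ev_mulBetaSq, γ_sq]
  push_cast; ring

theorem ev_eq_of_beq {p q : Zb} (h : p.beq q = true) : p.ev = q.ev := by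
  simp only [beq, Bool.and_eq_true] at h
  simp only [ev, Zs.ev_eq_of_beq h.1, Zs.ev_eq_of_beq h.2]

end Zb

namespace Zg

variable (p q : Zg)

theorem ev_add : (p.add q).ev = p.ev + q.ev := by simp only [ev, add, Zb.ev_add]; ring

theorem ev_neg : (-p).ev = -p.ev := by
  change p.neg.ev = _
  simp only [ev, neg, Zb.ev_neg]; ring

theorem ev_smul (s : Zs) : (p.smul s).ev = s.ev * p.ev := by
  simp only [ev, smul, Zb.ev_smul]; ring

theorem ev_mul : (p.mul q).ev = p.ev * q.ev := by
  simp only [ev, mul, Zb.ev_add, Zb.ev_mul, Zb.ev_mulGammaSq]; ring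

theorem ev_ofZs (s : Zs) : (ofZs s).ev = s.ev := by
  simp [ev, ofZs, Zb.ev, Zs.ev, Zs.zero, Diff.toInt]

theorem ev_eq_of_beq {p q : Zg} (h : p.beq q = true) : p.ev = q.ev := by
  simp only [beq, Bool.and_eq_true] at h
  simp only [ev, Zb.ev_eq_of_beq h.1, Zb.ev_eq_of_beq h.2]

end Zg

/-! ### Points with real coordinates -/

def real3 (p : Zg × Zg × Zg) : ℝ × ℝ × ℝ := (p.1.ev, p.2.1.ev, p.2.2.ev)

def dot3 (x y : ℝ × ℝ × ℝ) : ℝ := x.1 * y.1 + x.2.1 * y.2.1 + x.2.2 * y.2.2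

/-- The point with given coordinates, divided by `26240`. -/
def toE (x : ℝ × ℝ × ℝ) : E3 := !₂[x.1 / 26240, x.2.1 / 26240, x.2.2 / 26240]

/-- The point with a given code. -/
def pt (v : ℕ) : E3 := toE (real3 (pointK v))

theorem inner_toE (x y : ℝ × ℝ × ℝ) : inner ℝ (toE x) (toE y) = dot3 x y / 26240 ^ 2 := by
  simp [toE, dot3, PiLp.inner_apply, Fin.sum_univ_three]; ring

theorem ev_dotK (p q : Zg × Zg × Zg) : (dotK p q).ev = dot3 (real3 p) (real3 q) := by
  simp only [dotK, dot3, real3, Zg.ev_add, Zg.ev_mul]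

theorem toE_injective : Function.Injective toE := fun x y h => by
  have h0 := congrArg (· 0) h
  have h1 := congrArg (· 1) h
  have h2 := congrArg (· 2) h
  simp [toE] at h0 h1 h2
  exact Prod.ext h0 (Prod.ext h1 h2)

theorem toE_surjective : Function.Surjective toE := fun p =>
  ⟨(p 0 * 26240, p 1 * 26240, p 2 * 26240), by ext i; fin_cases i <;> simp [toE]⟩

theorem dot3_act (t : ℕ) (x y : ℝ × ℝ × ℝ) : dot3 (act t x) (act t y) = dot3 x y := by
  have hf (b : ℕ) (x y : ℝ) : flipIf b x * flipIf b y = x * y := by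
    unfold flipIf; cases Nat.beq b 1 <;> simp
  have hs (c : ℕ) (x y : ℝ × ℝ × ℝ) : dot3 (shift c x) (shift c y) = dot3 x y := by
    unfold shift dot3; cases Nat.beq c 0 <;> cases Nat.beq c 1 <;> simp <;> ring
  rw [act, act, hs]
  simp only [dot3, signs, hf]

theorem real3_act (t : ℕ) (p : Zg × Zg × Zg) : real3 (act t p) = act t (real3 p) := by
  have hf (b : ℕ) (x : Zg) : (flipIf b x).ev = flipIf b x.ev := by
    unfold flipIf; cases Nat.beq b 1 <;> simp [Zg.ev_neg]
  have hs (c : ℕ) (x : Zg × Zg × Zg) : real3 (shift c x) = shift c (real3 x) := by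
    unfold shift real3; cases Nat.beq c 0 <;> cases Nat.beq c 1 <;> simp
  rw [act, act, hs]
  simp only [real3, signs, hf]

/-! ### The action on points -/

theorem nat_mod_eq (a b : ℕ) : Nat.mod a b = a % b := rfl

theorem nat_div_eq (a b : ℕ) : Nat.div a b = a / b := rfl

theorem nat_beq_eq (a b : ℕ) : Nat.beq a b = decide (a = b) := by
  rw [Bool.eq_iff_iff, Nat.beq_eq, decide_eq_true_iff]

theorem shift_shift {α : Type*} [Neg α] {c d : ℕ} (hc : c < 3) (hd : d < 3) (x : α × α × α) :
    shift c (shift d x) = shift ((c + d) % 3) x := by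
  interval_cases c <;> interval_cases d <;> rfl

theorem flipIf_flipIf {α : Type*} [InvolutiveNeg α] (b c : ℕ) (x : α) :
    flipIf (b % 2) (flipIf (c % 2) x) = flipIf ((b + c) % 2) x := by
  rcases Nat.mod_two_eq_zero_or_one b with h | h <;>
    rcases Nat.mod_two_eq_zero_or_one c with h' | h' <;>
    simp [flipIf, nat_beq_eq, Nat.add_mod, h, h']

theorem signs_signs {α : Type*} [InvolutiveNeg α] {s r : ℕ} (hs : s < 8) (hr : r < 8)
    (x : α × α × α) : signs s (signs r x) = signs (s ^^^ r) x := by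
  have h : ∀ s < 8, ∀ r < 8, (s + r) % 2 = (s ^^^ r) % 2 ∧
      (s / 2 + r / 2) % 2 = (s ^^^ r) / 2 % 2 ∧ (s / 4 + r / 4) % 2 = (s ^^^ r) / 4 % 2 := by
    decide
  obtain ⟨h0, h1, h2⟩ := h s hs r hr
  simp only [signs, nat_mod_eq, nat_div_eq, flipIf_flipIf, h0, h1, h2]

theorem signs_shift {α : Type*} [Neg α] {s d : ℕ} (hs : s < 8) (hd : d < 3) (x : α × α × α) :
    signs s (shift d x) = shift d (signs ((s >>> d + s <<< (3 - d)) % 8) x) := by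
  interval_cases d <;> interval_cases s <;> rfl

theorem tMul_spec : ∀ t < 24, ∀ u < 24, tMul t u < 24 ∧
    tMul t u / 8 = (t / 8 + u / 8) % 3 ∧
    tMul t u % 8 = ((t % 8) >>> (u / 8) + (t % 8) <<< (3 - u / 8)) % 8 ^^^ (u % 8) := by
  decide +kernel

theorem tMul_lt {t u : ℕ} (ht : t < 24) (hu : u < 24) : tMul t u < 24 := (tMul_spec t ht u hu).1

theorem act_tMul {α : Type*} [InvolutiveNeg α] {t u : ℕ} (ht : t < 24) (hu : u < 24)
    (x : α × α × α) : act (tMul t u) x = act t (act u x) := by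
  obtain ⟨-, h1, h2⟩ := tMul_spec t ht u hu
  simp only [act, nat_mod_eq, nat_div_eq, h1, h2]
  rw [signs_shift (by omega) (by omega), shift_shift (by omega) (by omega),
    signs_signs (by omega) (by omega)]

theorem tInv_spec : ∀ t < 24, tInv t < 24 ∧ tMul t (tInv t) = 0 ∧ tMul (tInv t) t = 0 := by
  decide +kernel

theorem tMul_assoc : ∀ t < 24, ∀ u < 24, ∀ v < 24, tMul (tMul t u) v = tMul t (tMul u v) := by
  decide +kernel

theorem zero_tMul : ∀ t < 24, tMul 0 t = t := by decide

theorem tMul_tInv_cancel {t u : ℕ} (ht : t < 24) (hu : u < 24) :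
    tMul t (tMul (tInv t) u) = u := by
  obtain ⟨h1, h2, -⟩ := tInv_spec t ht
  rw [← tMul_assoc t ht _ h1 u hu, h2, zero_tMul u hu]

theorem act_zero {α : Type*} [Neg α] (x : α × α × α) : act 0 x = x := rfl

theorem act_tInv {α : Type*} [InvolutiveNeg α] {t : ℕ} (ht : t < 24) (x : α × α × α) :
    act (tInv t) (act t x) = x := by
  obtain ⟨h1, -, h3⟩ := tInv_spec t ht
  rw [← act_tMul h1 ht, h3, act_zero]

theorem act_act_tInv {α : Type*} [InvolutiveNeg α] {t : ℕ} (ht : t < 24) (x : α × α × α) :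
    act t (act (tInv t) x) = x := by
  obtain ⟨h1, h3, -⟩ := tInv_spec t ht
  rw [← act_tMul ht h1, h3, act_zero]

/-- The real coordinates of the point with a given code, multiplied by `26240`. -/
def point3 (v : ℕ) : ℝ × ℝ × ℝ := real3 (pointK v)

theorem point3_eq (v : ℕ) : point3 v = act (v % 24) (real3 (rep (v / 24))) :=
  real3_act _ _

theorem point3_rep (q : ℕ) : point3 (24 * q) = real3 (rep q) := by
  rw [point3_eq, Nat.mul_mod_right, Nat.mul_div_cancel_left _ (by norm_num), act_zero]

/-- The code that is valid for the same point. -/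
def normalize (v : ℕ) : ℕ := cond (Nat.blt v 24) (cond (Nat.blt (Nat.mod v 8) 4) v (Nat.sub v 4)) v

theorem codeAct_eq (t v : ℕ) : codeAct t v =
    if v < 24 then if tMul t v % 8 < 4 then tMul t v else tMul t v - 4
    else v - v % 24 + tMul t (v % 24) := by
  simp only [codeAct, Bool.cond_eq_ite, Nat.blt_eq]; rfl

theorem normalize_eq (v : ℕ) :
    normalize v = if v < 24 then if v % 8 < 4 then v else v - 4 else v := by
  simp only [normalize, Bool.cond_eq_ite, Nat.blt_eq]; rfl

theorem rep_zero_third : (real3 (rep 0)).2.2 = 0 := by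
  change (Zg.ofZs Zs.zero).ev = 0
  rw [Zg.ev_ofZs]
  simp [Zs.ev, Zs.zero, Diff.toInt]

theorem act_sub_four {t : ℕ} (h : t < 24) (h' : 4 ≤ t % 8) {x : ℝ × ℝ × ℝ} (hx : x.2.2 = 0) :
    act (t - 4) x = act t x := by
  obtain ⟨a, b, c⟩ := x
  obtain rfl : c = 0 := hx
  interval_cases t <;> simp_all [act, signs, shift, flipIf, nat_mod_eq, nat_div_eq, nat_beq_eq]

theorem point3_normalize (v : ℕ) : point3 (normalize v) = point3 v := by
  rw [normalize_eq]
  split_ifs with h h' <;> try rfl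
  rw [point3_eq, point3_eq, Nat.mod_eq_of_lt h, Nat.mod_eq_of_lt (by omega), Nat.div_eq_of_lt h,
    Nat.div_eq_of_lt (by omega)]
  exact act_sub_four h (by omega) rep_zero_third

theorem codeAct_eq_normalize {t v : ℕ} (ht : t < 24) :
    codeAct t v = normalize (24 * (v / 24) + tMul t (v % 24)) := by
  have hlt := tMul_lt ht (Nat.mod_lt v (by norm_num : 24 > 0))
  rw [codeAct_eq, normalize_eq]
  by_cases h : v < 24
  · rw [Nat.mod_eq_of_lt h] at hlt ⊢
    rw [Nat.div_eq_of_lt h]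
    simp [h, hlt]
  · rw [if_neg h, if_neg (by omega)]
    omega

theorem point3_codeAct {t : ℕ} (ht : t < 24) (v : ℕ) :
    point3 (codeAct t v) = act t (point3 v) := by
  have hlt := tMul_lt ht (Nat.mod_lt v (by norm_num : 24 > 0))
  rw [codeAct_eq_normalize ht, point3_normalize, point3_eq, point3_eq,
    ← act_tMul ht (Nat.mod_lt v (by norm_num)),
    show (24 * (v / 24) + tMul t (v % 24)) % 24 = tMul t (v % 24) by omega,
    show (24 * (v / 24) + tMul t (v % 24)) / 24 = v / 24 by omega]

theorem valid_iff (v : ℕ) : valid v = true ↔ v < 3144 ∧ (24 ≤ v ∨ v % 8 < 4) := by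
  simp only [valid, Bool.and_eq_true, Bool.or_eq_true, Nat.blt_eq, Nat.ble_eq]; rfl

theorem valid_normalize {v : ℕ} (h : v < 3144) : valid (normalize v) = true := by
  rw [valid_iff, normalize_eq]
  split_ifs with h1 h2 <;> omega

theorem normalize_of_valid {v : ℕ} (h : valid v = true) : normalize v = v := by
  rw [valid_iff] at h
  rw [normalize_eq]
  split_ifs <;> omega

theorem valid_codeAct {t v : ℕ} (ht : t < 24) (h : v < 3144) : valid (codeAct t v) = true := by
  have hlt := tMul_lt ht (Nat.mod_lt v (by norm_num : 24 > 0))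
  rw [codeAct_eq_normalize ht]
  exact valid_normalize (by omega)

theorem codeAct_div {t v : ℕ} (ht : t < 24) : codeAct t v / 24 = v / 24 := by
  have hlt := tMul_lt ht (Nat.mod_lt v (by norm_num : 24 > 0))
  rw [codeAct_eq_normalize ht, normalize_eq]
  split_ifs <;> omega

theorem codeAct_tInv_ico : ∀ t < 24, ∀ v < 24, v % 8 < 4 →
    codeAct t (codeAct (tInv t) v) = v := by decide +kernel

theorem codeAct_of_le {t v : ℕ} (ht : t < 24) (h : 24 ≤ v) :
    codeAct t v = 24 * (v / 24) + tMul t (v % 24) := by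
  rw [codeAct_eq_normalize ht, normalize_eq, if_neg (by omega)]

theorem codeAct_tInv {t v : ℕ} (ht : t < 24) (h : valid v = true) :
    codeAct t (codeAct (tInv t) v) = v := by
  rw [valid_iff] at h
  by_cases h' : v < 24
  · exact codeAct_tInv_ico t ht v h' (by omega)
  · have h1 := (tInv_spec t ht).1
    have h2 := tMul_lt h1 (Nat.mod_lt v (by norm_num : 24 > 0))
    rw [codeAct_of_le h1 (by omega), codeAct_of_le ht (by omega)]
    rw [show (24 * (v / 24) + tMul (tInv t) (v % 24)) % 24 = tMul (tInv t) (v % 24) by omega,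
      tMul_tInv_cancel ht (Nat.mod_lt v (by norm_num))]
    omega

theorem mem_nbr {v w : ℕ} :
    w ∈ nbr v ↔ ∃ u ∈ repNeighbors.getD (v / 24) [], codeAct (v % 24) u = w := by
  simp only [nbr, List.mem_map]; rfl

theorem pt_eq (v : ℕ) : pt v = toE (point3 v) := rfl

/-! ### Distances -/

theorem getD_eq_true_of_all_range {n : ℕ} {f : ℕ → Bool} (h : (List.range n).all f = true) {k : ℕ}
    (hk : k < n) : f k = true :=
  List.all_eq_true.1 h k (List.mem_range.2 hk)

theorem dot3_self_rep {q : ℕ} (h : q < 131) :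
    dot3 (real3 (rep q)) (real3 (rep q)) = 430336000 - 86067200 * √5 := by
  rw [← ev_dotK, Zg.ev_eq_of_beq (getD_eq_true_of_all_range norm_check h), Zg.ev_ofZs]
  simp [Zs.ev, Diff.toInt, sub_eq_add_neg]

theorem dot3_self {v : ℕ} (h : v < 3144) :
    dot3 (point3 v) (point3 v) = 430336000 - 86067200 * √5 := by
  rw [point3_eq, dot3_act, dot3_self_rep (by omega)]

theorem norm_sq_pt {v : ℕ} (h : v < 3144) : ‖pt v‖ ^ 2 = (5 - √5) / 8 := by
  rw [← real_inner_self_eq_norm_sq, pt_eq, inner_toE, dot3_self h]; ring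

theorem dist_toE_eq_one_iff {x y : ℝ × ℝ × ℝ} (hx : dot3 x x = 430336000 - 86067200 * √5)
    (hy : dot3 y y = 430336000 - 86067200 * √5) :
    dist (toE x) (toE y) = 1 ↔ dot3 x y = 86067200 - 86067200 * √5 := by
  have h : dist (toE x) (toE y) ^ 2 = 2 * (430336000 - 86067200 * √5) / 26240 ^ 2 -
      2 * dot3 x y / 26240 ^ 2 := by
    rw [dist_eq_norm, norm_sub_sq_real, ← real_inner_self_eq_norm_sq,
      ← real_inner_self_eq_norm_sq, inner_toE, inner_toE, inner_toE, hx, hy]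
    ring
  rw [← sq_eq_sq₀ dist_nonneg zero_le_one, h]
  constructor <;> intro h' <;> linarith

theorem dist_pt_eq_one_iff {v w : ℕ} (hv : v < 3144) (hw : w < 3144) :
    dist (pt v) (pt w) = 1 ↔ dot3 (point3 v) (point3 w) = 86067200 - 86067200 * √5 :=
  dist_toE_eq_one_iff (dot3_self hv) (dot3_self hw)

theorem repNeighbors_valid :
    (repNeighbors.all fun l => l.all valid) = true := by decide +kernel

theorem valid_of_mem_repNeighbors {q w : ℕ} (h : w ∈ repNeighbors.getD q []) :
    valid w = true := by
  by_cases hq : q < repNeighbors.length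
  · rw [List.getD_eq_getElem _ _ hq] at h
    exact List.all_eq_true.1 (List.all_eq_true.1 repNeighbors_valid _ (List.getElem_mem hq)) w h
  · rw [List.getD_eq_default _ _ (by omega)] at h
    simp at h

theorem lt_of_valid {v : ℕ} (h : valid v = true) : v < 3144 := ((valid_iff v).1 h).1

theorem dist_rep_of_mem {q w : ℕ} (hq : q < 131) (h : w ∈ repNeighbors.getD q []) :
    dot3 (real3 (rep q)) (point3 w) = 86067200 - 86067200 * √5 := by
  have := List.all_eq_true.1 (getD_eq_true_of_all_range edge_check hq) w h
  rw [point3, ← ev_dotK, Zg.ev_eq_of_beq this, edgeInner, Zg.ev_ofZs]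
  simp [Zs.ev, Diff.toInt, sub_eq_add_neg]

/-! ### The soundness of the interval arithmetic -/

theorem residueMul_modEq (x : Diff) {b : ℕ} (h : b ≤ modulus) :
    (residueMul x b : ℤ) ≡ x.toInt * b [ZMOD modulus] := by
  simp only [residueMul, Nat.add_eq, Nat.mul_eq, Nat.sub_eq, Diff.toInt]
  rw [Int.modEq_iff_dvd]
  push_cast [h]
  exact ⟨-x.m, by ring⟩

/-- The approximation of `10 ^ 20` times a real number by an integer. -/
def approx (z : Zg) : ℤ :=
  (z.x.x.a.toInt * 100000000000000000000 + z.x.x.b.toInt * 223606797749978969640 +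
    (z.x.y.a.toInt * 186336683318115850615 + z.x.y.b.toInt * 416661490601158111923)) +
  (z.y.x.a.toInt * 152425146562107862312 + z.y.x.b.toInt * 340832989193241550261 +
    (z.y.y.a.toInt * 284023962646608877053 + z.y.y.b.toInt * 635096887716678527686))

theorem residue_modEq (z : Zg) : (residue z : ℤ) ≡ approx z [ZMOD modulus] := by
  rw [residue, nat_mod_eq]
  push_cast
  refine (Int.mod_modEq _ _).trans ?_
  simp only [Nat.add_eq, approx]
  push_cast
  have h (x : Diff) (b : ℕ) (hb : b ≤ modulus := by norm_num [modulus]) :=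
    residueMul_modEq x hb
  exact (((h _ _).add (h _ _)).add ((h _ _).add (h _ _))).add
    (((h _ _).add (h _ _)).add ((h _ _).add (h _ _)))

theorem residue_le (z : Zg) : residue z ≤ modulus :=
  (Nat.mod_lt _ (by norm_num [modulus])).le

def Diff.size (x : Diff) : ℕ := Nat.add x.p x.m

def Zg.size (z : Zg) : ℕ :=
  (z.x.x.a.size.add z.x.x.b.size).add (z.x.y.a.size.add z.x.y.b.size) |>.add
    ((z.y.x.a.size.add z.y.x.b.size).add (z.y.y.a.size.add z.y.y.b.size))

theorem size_check :
    ((List.range 131).all fun q => Nat.ble (rep q).1.size 2097152 &&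
      (Nat.ble (rep q).2.1.size 2097152 && Nat.ble (rep q).2.2.size 2097152)) = true := by
  decide +kernel

theorem Diff.abs_toInt_le (x : Diff) : |(x.toInt : ℝ)| ≤ (x.size : ℝ) := by
  simp only [toInt, size, Nat.add_eq]
  push_cast
  rw [abs_le]
  constructor <;> linarith [(x.p.cast_nonneg : (0 : ℝ) ≤ x.p), (x.m.cast_nonneg : (0 : ℝ) ≤ x.m)]

theorem mul_bounds {x y a b c d : ℝ} (ha : 0 ≤ a) (hc : 0 ≤ c) (h : a ≤ x ∧ x ≤ b)
    (h' : c ≤ y ∧ y ≤ d) : a * c ≤ x * y ∧ x * y ≤ b * d :=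
  ⟨mul_le_mul h.1 h'.1 hc (ha.trans h.1),
    mul_le_mul h.2 h'.2 (hc.trans h'.1) (ha.trans (h.1.trans h.2))⟩

theorem abs_ev_sub_approx_le (z : Zg) : |10 ^ 20 * z.ev - approx z| ≤ (z.size : ℝ) := by
  have key (x : Diff) (u : ℝ) (b : ℝ) (h : |10 ^ 20 * u - b| ≤ 1) :
      |(x.toInt : ℝ) * (10 ^ 20 * u - b)| ≤ (x.size : ℝ) := by
    rw [abs_mul]
    exact (mul_le_of_le_one_right (abs_nonneg _) h).trans x.abs_toInt_le
  have h5 := sqrt_five_bounds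
  have hβ := β_bounds
  have hγ := γ_bounds
  have h5β := mul_bounds (by norm_num) (by norm_num) h5 hβ
  have h5γ := mul_bounds (by norm_num) (by norm_num) h5 hγ
  have hβγ := mul_bounds (by norm_num) (by norm_num) hβ hγ
  have h5βγ := mul_bounds (by norm_num) (by norm_num) h5β hγ
  have e1 := key z.x.x.a 1 100000000000000000000 (by norm_num)
  have e2 := key z.x.x.b (√5) 223606797749978969640 (by
    rw [abs_le]; constructor <;> linarith)
  have e3 := key z.x.y.a β 186336683318115850615 (by
    rw [abs_le]; constructor <;> linarith)
  have e4 := key z.x.y.b (√5 * β) 416661490601158111923 (by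
    rw [abs_le]; constructor <;> linarith)
  have e5 := key z.y.x.a γ 152425146562107862312 (by
    rw [abs_le]; constructor <;> linarith)
  have e6 := key z.y.x.b (√5 * γ) 340832989193241550261 (by
    rw [abs_le]; constructor <;> linarith)
  have e7 := key z.y.y.a (β * γ) 284023962646608877053 (by
    rw [abs_le]; constructor <;> linarith)
  have e8 := key z.y.y.b (√5 * β * γ) 635096887716678527686 (by
    rw [abs_le]; constructor <;> linarith)
  have e : 10 ^ 20 * z.ev - approx z =
      z.x.x.a.toInt * (10 ^ 20 * 1 - 100000000000000000000) +
      z.x.x.b.toInt * (10 ^ 20 * √5 - 223606797749978969640) +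
      (z.x.y.a.toInt * (10 ^ 20 * β - 186336683318115850615) +
      z.x.y.b.toInt * (10 ^ 20 * (√5 * β) - 416661490601158111923)) +
      (z.y.x.a.toInt * (10 ^ 20 * γ - 152425146562107862312) +
      z.y.x.b.toInt * (10 ^ 20 * (√5 * γ) - 340832989193241550261) +
      (z.y.y.a.toInt * (10 ^ 20 * (β * γ) - 284023962646608877053) +
      z.y.y.b.toInt * (10 ^ 20 * (√5 * β * γ) - 635096887716678527686))) := by
    simp only [Zg.ev, Zb.ev, Zs.ev, approx]
    push_cast
    ring
  have hs : (z.size : ℝ) = z.x.x.a.size + z.x.x.b.size + (z.x.y.a.size + z.x.y.b.size) +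
      (z.y.x.a.size + z.y.x.b.size + (z.y.y.a.size + z.y.y.b.size)) := by
    simp only [Zg.size, Nat.add_eq]
    push_cast
    ring
  rw [e, hs]
  refine (abs_add_le _ _).trans (add_le_add ((abs_add_le _ _).trans (add_le_add
    ((abs_add_le _ _).trans (add_le_add e1 e2)) ((abs_add_le _ _).trans (add_le_add e3 e4))))
    ((abs_add_le _ _).trans (add_le_add ((abs_add_le _ _).trans (add_le_add e5 e6))
      ((abs_add_le _ _).trans (add_le_add e7 e8)))))

theorem farFromEdge_eq_false {e : ℕ} {A : ℤ} (h : (e : ℤ) ≡ A [ZMOD modulus])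
    (hA : |(A : ℝ) - 10 ^ 40 * (86067200 - 86067200 * √5)| ≤ 4 * 10 ^ 31) :
    farFromEdge e = false := by
  have h5 := sqrt_five_bounds
  rw [abs_le] at hA
  have h1 : (0 : ℝ) ≤ A + 1063849098330699041603395584000000000000000000000 := by linarith
  have h2 : (A : ℝ) + 1063849098330699041603395584000000000000000000000 ≤
    88046829568000000000000000000000 := by linarith
  have h1' : (0 : ℤ) ≤ A + 1063849098330699041603395584000000000000000000000 := by exact_mod_cast h1
  have h2' : A + 1063849098330699041603395584000000000000000000000 ≤
    88046829568000000000000000000000 := by exact_mod_cast h2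
  have h3 : ((e + 1063849098330699041603395584000000000000000000000 : ℕ) : ℤ) % modulus =
      A + 1063849098330699041603395584000000000000000000000 := by
    push_cast
    rw [(h.add_right _).eq, Int.emod_eq_of_lt h1' (h2'.trans_lt (by norm_num [modulus]))]
  rw [farFromEdge, ← Bool.not_eq_true, Nat.ble_eq, nat_mod_eq, Nat.add_eq, not_le]
  zify
  push_cast at h3
  rw [h3]
  omega

def signInt (s i : ℕ) : ℤ := if s / 2 ^ i % 2 = 1 then -1 else 1

theorem mul_sub_modEq (a : ℕ) {b : ℕ} (h : b ≤ modulus) :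
    ((a * (modulus - b) : ℕ) : ℤ) ≡ -(a * b : ℤ) [ZMOD modulus] := by
  rw [Int.modEq_iff_dvd]
  push_cast [h]
  exact ⟨-a, by ring⟩

theorem exists_of_nonEdgeTest {X Y : ℕ × ℕ × ℕ} {l : List ℕ} {v s : ℕ}
    (h : nonEdgeTest X Y l v = true) (hs : s < 8)
    (hY : Y.1 ≤ modulus ∧ Y.2.1 ≤ modulus ∧ Y.2.2 ≤ modulus) :
    ∃ e : ℕ, signTest l (v + s) e = true ∧
      (e : ℤ) ≡ signInt s 0 * (X.1 * Y.1) + signInt s 1 * (X.2.1 * Y.2.1) +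
        signInt s 2 * (X.2.2 * Y.2.2) [ZMOD modulus] := by
  simp only [nonEdgeTest, signTests, Bool.and_eq_true, Nat.add_eq, Nat.mul_eq, Nat.sub_eq] at h
  obtain ⟨⟨⟨⟨⟨⟨⟨h0, h1⟩, h2⟩, h3⟩, h4⟩, h5⟩, h6⟩, h7⟩ := h
  have p (a b : ℕ) : ((a * b : ℕ) : ℤ) ≡ 1 * (a * b : ℤ) [ZMOD modulus] := by
    rw [one_mul]; push_cast; rfl
  have n (a : ℕ) {b : ℕ} (h : b ≤ modulus) :
      ((a * (modulus - b) : ℕ) : ℤ) ≡ -1 * (a * b : ℤ) [ZMOD modulus] := by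
    rw [neg_one_mul]; exact mul_sub_modEq a h
  interval_cases s
  · exact ⟨_, h0, by rw [Nat.cast_add, Nat.cast_add]; exact ((p _ _).add (p _ _)).add (p _ _)⟩
  · exact ⟨_, h1, by rw [Nat.cast_add, Nat.cast_add]; exact ((n _ hY.1).add (p _ _)).add (p _ _)⟩
  · exact ⟨_, h2, by rw [Nat.cast_add, Nat.cast_add]; exact ((p _ _).add (n _ hY.2.1)).add (p _ _)⟩
  · exact ⟨_, h3, by
      rw [Nat.cast_add, Nat.cast_add]; exact ((n _ hY.1).add (n _ hY.2.1)).add (p _ _)⟩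
  · exact ⟨_, h4, by rw [Nat.cast_add, Nat.cast_add]; exact ((p _ _).add (p _ _)).add (n _ hY.2.2)⟩
  · exact ⟨_, h5, by
      rw [Nat.cast_add, Nat.cast_add]; exact ((n _ hY.1).add (p _ _)).add (n _ hY.2.2)⟩
  · exact ⟨_, h6, by
      rw [Nat.cast_add, Nat.cast_add]; exact ((p _ _).add (n _ hY.2.1)).add (n _ hY.2.2)⟩
  · exact ⟨_, h7, by
      rw [Nat.cast_add, Nat.cast_add]; exact ((n _ hY.1).add (n _ hY.2.1)).add (n _ hY.2.2)⟩

theorem dot3_signs (s : ℕ) (x y : ℝ × ℝ × ℝ) :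
    dot3 x (signs s y) = signInt s 0 * (x.1 * y.1) + signInt s 1 * (x.2.1 * y.2.1) +
        signInt s 2 * (x.2.2 * y.2.2) := by
  have h (i : ℕ) (x y : ℝ) : x * flipIf (s / 2 ^ i % 2) y = signInt s i * (x * y) := by
    unfold flipIf signInt
    rw [nat_beq_eq]
    split_ifs with h <;> simp [h]
  have h0 := h 0
  have h1 := h 1
  have h2 := h 2
  norm_num at h0 h1 h2
  simp only [dot3, signs, nat_mod_eq, nat_div_eq, h0, h1, h2]

theorem signInt_abs (s i : ℕ) : |(signInt s i : ℝ)| = 1 := by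
  unfold signInt; split_ifs <;> simp

/-- The number is small enough for its residue to be meaningful. -/
def Zg.IsSmall (z : Zg) : Prop := z.size ≤ 2097152 ∧ |z.ev| ≤ 16000

theorem Zg.IsSmall.abs_mul_sub_le {z w : Zg} (hz : z.IsSmall) (hw : w.IsSmall) {σ : ℝ}
    (hσ : |σ| = 1) : |σ * (approx z * approx w) - 10 ^ 40 * (σ * (z.ev * w.ev))| ≤ 10 ^ 31 := by
  have bound {z : Zg} (hz : z.IsSmall) : |approx z - 10 ^ 20 * z.ev| ≤ 2097152 := by
    rw [abs_sub_comm]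
    exact (abs_ev_sub_approx_le z).trans (by exact_mod_cast hz.1)
  have ha := bound hz
  have hb := bound hw
  rw [show σ * (approx z * approx w) - 10 ^ 40 * (σ * (z.ev * w.ev)) =
    σ * ((approx z - 10 ^ 20 * z.ev) * (approx w - 10 ^ 20 * w.ev) + 10 ^ 20 *
      (z.ev * (approx w - 10 ^ 20 * w.ev)) + 10 ^ 20 *
      ((approx z - 10 ^ 20 * z.ev) * w.ev)) by ring, abs_mul, hσ, one_mul]
  have e1 := mul_le_mul ha hb (abs_nonneg _) (by norm_num)
  have e2 := mul_le_mul hz.2 hb (abs_nonneg _) (by norm_num)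
  have e3 := mul_le_mul ha hw.2 (abs_nonneg _) (by norm_num)
  refine (abs_add_le _ _).trans ?_
  refine (add_le_add_left (abs_add_le _ _) _).trans ?_
  simp only [abs_mul] at e1 e2 e3 ⊢
  rw [abs_of_nonneg (by norm_num : (0 : ℝ) ≤ 10 ^ 20)]
  norm_num at e1 e2 e3 ⊢
  linarith

theorem signTest_of_dot {p r : Zg × Zg × Zg} (hp : p.1.IsSmall ∧ p.2.1.IsSmall ∧ p.2.2.IsSmall)
    (hr : r.1.IsSmall ∧ r.2.1.IsSmall ∧ r.2.2.IsSmall) {l : List ℕ} {v s : ℕ} (hs : s < 8)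
    (h : nonEdgeTest (residues p) (residues r) l v = true)
    (hd : dot3 (real3 p) (signs s (real3 r)) = 86067200 - 86067200 * √5)
    (hv : valid (v + s) = true) : v + s ∈ l := by
  obtain ⟨e, he, hmod⟩ := exists_of_nonEdgeTest h hs
    ⟨residue_le _, residue_le _, residue_le _⟩
  have m (a b : Zg) (i : ℕ) : signInt s i * ((residue a : ℤ) * residue b) ≡
      signInt s i * (approx a * approx b) [ZMOD modulus] :=
    ((residue_modEq a).mul (residue_modEq b)).mul_left _
  have hA := hmod.trans (((m p.1 r.1 0).add (m p.2.1 r.2.1 1)).add (m p.2.2 r.2.2 2))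
  have hf := farFromEdge_eq_false hA (by
    rw [← hd, dot3_signs]
    have e0 := hp.1.abs_mul_sub_le hr.1 (signInt_abs s 0)
    have e1 := hp.2.1.abs_mul_sub_le hr.2.1 (signInt_abs s 1)
    have e2 := hp.2.2.abs_mul_sub_le hr.2.2 (signInt_abs s 2)
    simp only [real3]
    push_cast
    rw [abs_le] at e0 e1 e2 ⊢
    constructor <;> linarith [e0.1, e0.2, e1.1, e1.2, e2.1, e2.2])
  simpa [signTest, hf, hv, nat_beq_eq] using he

theorem abs_le_of_dot3_self {x : ℝ × ℝ × ℝ} (h : dot3 x x ≤ 256000000) :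
    |x.1| ≤ 16000 ∧ |x.2.1| ≤ 16000 ∧ |x.2.2| ≤ 16000 := by
  simp only [dot3] at h
  refine ⟨abs_le_of_sq_le_sq ?_ (by norm_num), abs_le_of_sq_le_sq ?_ (by norm_num),
    abs_le_of_sq_le_sq ?_ (by norm_num)⟩ <;>
    nlinarith [mul_self_nonneg x.1, mul_self_nonneg x.2.1, mul_self_nonneg x.2.2]

theorem isSmall_rep {q : ℕ} (h : q < 131) :
    (rep q).1.IsSmall ∧ (rep q).2.1.IsSmall ∧ (rep q).2.2.IsSmall := by
  have h1 := getD_eq_true_of_all_range size_check h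
  simp only [Bool.and_eq_true, Nat.ble_eq] at h1
  have h2 := abs_le_of_dot3_self (x := real3 (rep q)) (by
    rw [dot3_self_rep h]; linarith [sqrt_five_bounds.1])
  exact ⟨⟨h1.1, h2.1⟩, ⟨h1.2.1, h2.2.1⟩, ⟨h1.2.2, h2.2.2⟩⟩

theorem mem_repNeighbors_of_dot {q w : ℕ} (hq : q < 131) (hw : valid w = true)
    (hd : dot3 (real3 (rep q)) (point3 w) = 86067200 - 86067200 * √5) :
    w ∈ repNeighbors.getD q [] := by
  have hw' := lt_of_valid hw
  have h := getD_eq_true_of_all_range (getD_eq_true_of_all_range (getD_eq_true_of_all_range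
    nonEdge_check hq) (by omega : w / 24 < 131)) (by omega : w % 24 / 8 < 3)
  have hs := isSmall_rep hq
  have hk := isSmall_rep (by omega : w / 24 < 131)
  have e : 24 * (w / 24) + 8 * (w % 24 / 8) + w % 24 % 8 = w := by omega
  have hc : w % 24 / 8 < 3 := by omega
  rw [point3_eq] at hd
  simp only [act, nat_mod_eq, nat_div_eq, Nat.add_eq, Nat.mul_eq] at hd h
  rw [← e] at hw ⊢
  generalize w % 24 / 8 = c at *
  interval_cases c
  · exact signTest_of_dot (p := rep q) hs hk (by omega) h hd hw
  · refine signTest_of_dot (p := ((rep q).2.1, (rep q).2.2, (rep q).1)) ⟨hs.2.1, hs.2.2, hs.1⟩ hk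
      (by omega) h ?_ hw
    rw [← hd]; simp only [dot3, shift, real3, nat_beq_eq]; norm_num; ring
  · refine signTest_of_dot (p := ((rep q).2.2, (rep q).1, (rep q).2.1)) ⟨hs.2.2, hs.1, hs.2.1⟩ hk
      (by omega) h ?_ hw
    rw [← hd]; simp only [dot3, shift, real3, nat_beq_eq]; norm_num; ring

theorem dot_iff_mem_nbr {v w : ℕ} (hv : v < 3144) (hw : valid w = true) :
    dot3 (point3 v) (point3 w) = 86067200 - 86067200 * √5 ↔ w ∈ nbr v := by
  have ht : v % 24 < 24 := Nat.mod_lt _ (by norm_num)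
  rw [mem_nbr]
  constructor
  · intro h
    refine ⟨codeAct (tInv (v % 24)) w, ?_, codeAct_tInv ht hw⟩
    have h1 := (tInv_spec _ ht).1
    refine mem_repNeighbors_of_dot (by omega) (valid_codeAct h1 (lt_of_valid hw)) ?_
    rw [point3_codeAct h1, ← h, point3_eq v, ← dot3_act (v % 24) (real3 (rep (v / 24))),
      act_act_tInv ht]
  · rintro ⟨u, hu, rfl⟩
    rw [point3_codeAct ht, point3_eq v, dot3_act]
    exact dist_rep_of_mem (by omega) hu

/-- The points with codes `v` and `w` have distance `1` if and only if `w` is in the list of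
neighbours. -/
theorem dist_pt_eq_one_iff_mem_nbr {v w : ℕ} (hv : v < 3144) (hw : valid w = true) :
    dist (pt v) (pt w) = 1 ↔ w ∈ nbr v := by
  rw [dist_pt_eq_one_iff hv (lt_of_valid hw), dot_iff_mem_nbr hv hw]

/-! ### Isometries with prescribed values -/

theorem exists_reflection {x y : E3} (h : ‖x‖ = ‖y‖) :
    ∃ f : E3 ≃ₗᵢ[ℝ] E3, f x = y ∧ ∀ z, inner ℝ z x = inner ℝ z y → f z = z := by
  refine ⟨(ℝ ∙ (x - y))ᗮ.reflection, Submodule.reflection_sub h, fun z hz => ?_⟩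
  rw [Submodule.reflection_eq_self_iff, Submodule.mem_orthogonal_singleton_iff_inner_left,
    inner_sub_right, hz, sub_self]

theorem exists_isometry_of_gram {x₁ x₂ x₃ y₁ y₂ y₃ : E3} (h₁ : ‖x₁‖ = ‖y₁‖) (h₂ : ‖x₂‖ = ‖y₂‖)
    (h₃ : ‖x₃‖ = ‖y₃‖) (h₁₂ : inner ℝ x₁ x₂ = inner ℝ y₁ y₂)
    (h₁₃ : inner ℝ x₁ x₃ = inner ℝ y₁ y₃) (h₂₃ : inner ℝ x₂ x₃ = inner ℝ y₂ y₃) :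
    ∃ f : E3 ≃ₗᵢ[ℝ] E3, f x₁ = y₁ ∧ f x₂ = y₂ ∧ f x₃ = y₃ := by
  obtain ⟨f, hf, -⟩ := exists_reflection h₁
  obtain ⟨g, hg, hg'⟩ := exists_reflection (x := f x₂) (y := y₂) (by rw [f.norm_map, h₂])
  have hg1 : g y₁ = y₁ := hg' _ (by rw [← hf, f.inner_map_map, hf, h₁₂])
  obtain ⟨k, hk, hk'⟩ := exists_reflection (x := g (f x₃)) (y := y₃)
    (by rw [g.norm_map, f.norm_map, h₃])
  have hk1 : k y₁ = y₁ := hk' _ (by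
    rw [← h₁₃]
    nth_rewrite 1 [← hg1]
    rw [g.inner_map_map, ← hf, f.inner_map_map])
  have hk2 : k y₂ = y₂ := hk' _ (by
    rw [← h₂₃]
    nth_rewrite 1 [← hg]
    rw [g.inner_map_map, f.inner_map_map])
  refine ⟨(f.trans g).trans k, ?_, ?_, hk⟩
  · simp [hf, hg1, hk1]
  · simp [hg, hk2]

/-- There are at most two points with given inner products with two points and a given norm. -/
theorem eq_or_eq_of_dot3 {y y' z z' w : ℝ × ℝ × ℝ}
    (hy : dot3 y y * dot3 y' y' - dot3 y y' ^ 2 ≠ 0) (hne : z ≠ z')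
    (h1 : dot3 y z = dot3 y w) (h1' : dot3 y' z = dot3 y' w) (h2 : dot3 y z' = dot3 y w)
    (h2' : dot3 y' z' = dot3 y' w) (h : dot3 z z = dot3 w w) (h' : dot3 z' z' = dot3 w w) :
    w = z ∨ w = z' := by
  obtain ⟨a, b, c⟩ := y
  obtain ⟨a', b', c'⟩ := y'
  obtain ⟨z1, z2, z3⟩ := z
  obtain ⟨u1, u2, u3⟩ := z'
  obtain ⟨w1, w2, w3⟩ := w
  simp only [dot3] at *
  obtain ⟨n1, e1⟩ : ∃ n, n = b * c' - c * b' := ⟨_, rfl⟩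
  obtain ⟨n2, e2⟩ : ∃ n, n = c * a' - a * c' := ⟨_, rfl⟩
  obtain ⟨n3, e3⟩ : ∃ n, n = a * b' - b * a' := ⟨_, rfl⟩
  have hN : n1 * n1 + n2 * n2 + n3 * n3 ≠ 0 := by
    rw [e1, e2, e3]; intro hN; apply hy; rw [← hN]; ring
  have prop (d1 d2 d3 : ℝ) (hd : a * d1 + b * d2 + c * d3 = 0)
      (hd' : a' * d1 + b' * d2 + c' * d3 = 0) : ∃ s, d1 = s * n1 ∧ d2 = s * n2 ∧ d3 = s * n3 := by
    refine ⟨(d1 * n1 + d2 * n2 + d3 * n3) / (n1 * n1 + n2 * n2 + n3 * n3), ?_, ?_, ?_⟩ <;>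
      rw [div_mul_eq_mul_div, eq_div_iff hN, e1, e2, e3]
    · linear_combination (b' * (a * b' - b * a') - c' * (c * a' - a * c')) * hd -
        (b * (a * b' - b * a') - c * (c * a' - a * c')) * hd'
    · linear_combination (c' * (b * c' - c * b') - a' * (a * b' - b * a')) * hd -
        (c * (b * c' - c * b') - a * (a * b' - b * a')) * hd'
    · linear_combination (a' * (c * a' - a * c') - b' * (b * c' - c * b')) * hd -
        (a * (c * a' - a * c') - b * (b * c' - c * b')) * hd'
  obtain ⟨s, s1, s2, s3⟩ := prop (z1 - w1) (z2 - w2) (z3 - w3) (by linarith) (by linarith)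
  obtain ⟨r, r1, r2, r3⟩ := prop (u1 - w1) (u2 - w2) (u3 - w3) (by linarith) (by linarith)
  obtain rfl : z1 = w1 + s * n1 := by linarith
  obtain rfl : z2 = w2 + s * n2 := by linarith
  obtain rfl : z3 = w3 + s * n3 := by linarith
  obtain rfl : u1 = w1 + r * n1 := by linarith
  obtain rfl : u2 = w2 + r * n2 := by linarith
  obtain rfl : u3 = w3 + r * n3 := by linarith
  have hs : s * (2 * (w1 * n1 + w2 * n2 + w3 * n3) + s * (n1 * n1 + n2 * n2 + n3 * n3)) = 0 := by
    linear_combination h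
  have hr : r * (2 * (w1 * n1 + w2 * n2 + w3 * n3) + r * (n1 * n1 + n2 * n2 + n3 * n3)) = 0 := by
    linear_combination h'
  rcases mul_eq_zero.1 hs with rfl | hs
  · left; simp
  rcases mul_eq_zero.1 hr with rfl | hr
  · right; simp
  have : (s - r) * (n1 * n1 + n2 * n2 + n3 * n3) = 0 := by linear_combination hs - hr
  rcases mul_eq_zero.1 this with h0 | h0
  · obtain rfl : s = r := by linarith
    exact absurd rfl hne
  · exact absurd h0 hN

/-! ### The vertices of the two factors -/

theorem one_div_two_goldenRatio : 1 / (2 * Real.goldenRatio) = (√5 - 1) / 4 := by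
  have h : (1 + √5 : ℝ) ≠ 0 := by positivity
  rw [Real.goldenRatio]
  field_simp
  linear_combination -sqrt_five_sq

theorem real3_rep_zero : real3 (rep 0) = (6560 * (√5 - 1), 13120, 0) := by
  change ((Zg.ofZs _).ev, (Zg.ofZs _).ev, (Zg.ofZs _).ev) = _
  simp only [Zg.ev_ofZs]
  refine Prod.ext ?_ (Prod.ext ?_ ?_) <;> simp [Zs.ev, Zs.zero, Diff.toInt]
  ring

theorem pt_ico {t : ℕ} (h : t < 24) :
    pt t = toE (act t (6560 * (√5 - 1), 13120, 0)) := by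
  rw [pt_eq, point3_eq, Nat.mod_eq_of_lt h, Nat.div_eq_of_lt h, real3_rep_zero]

/-- The codes of the vertices of the icosahedron. -/
def icoCodes : List ℕ := [0, 1, 2, 3, 8, 9, 10, 11, 16, 17, 18, 19]

theorem greatIcosahedron_eq : greatIcosahedron = pt '' {v | v ∈ icoCodes} := by
  have e1 : 1 / (2 * Real.goldenRatio) = (√5 - 1) / 4 := one_div_two_goldenRatio
  have e2 : -1 / (2 * Real.goldenRatio) = -((√5 - 1) / 4) := by rw [← e1]; ring
  ext p
  simp only [greatIcosahedron, icoCodes, Set.mem_ofPred_eq, Set.mem_image, List.mem_cons,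
    List.not_mem_nil, or_false]
  constructor
  · rintro ⟨s, t, rfl | rfl, rfl | rfl, rfl | rfl | rfl⟩
    on_goal 1 => refine ⟨8, by simp, ?_⟩
    on_goal 2 => refine ⟨0, by simp, ?_⟩
    on_goal 3 => refine ⟨16, by simp, ?_⟩
    on_goal 4 => refine ⟨10, by simp, ?_⟩
    on_goal 5 => refine ⟨2, by simp, ?_⟩
    on_goal 6 => refine ⟨18, by simp, ?_⟩
    on_goal 7 => refine ⟨9, by simp, ?_⟩
    on_goal 8 => refine ⟨1, by simp, ?_⟩
    on_goal 9 => refine ⟨17, by simp, ?_⟩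
    on_goal 10 => refine ⟨11, by simp, ?_⟩
    on_goal 11 => refine ⟨3, by simp, ?_⟩
    on_goal 12 => refine ⟨19, by simp, ?_⟩
    all_goals
      rw [pt_ico (by norm_num)]
      ext i
      fin_cases i <;>
        simp [toE, act, signs, shift, flipIf, nat_mod_eq, nat_div_eq, nat_beq_eq, e1, e2] <;>
        ring
  · rintro ⟨v, rfl | rfl | rfl | rfl | rfl | rfl | rfl | rfl | rfl | rfl | rfl | rfl, rfl⟩
    on_goal 1 => refine ⟨1, 1, by simp, by simp, Or.inr (Or.inl ?_)⟩
    on_goal 2 => refine ⟨-1, 1, by simp, by simp, Or.inr (Or.inl ?_)⟩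
    on_goal 3 => refine ⟨1, -1, by simp, by simp, Or.inr (Or.inl ?_)⟩
    on_goal 4 => refine ⟨-1, -1, by simp, by simp, Or.inr (Or.inl ?_)⟩
    on_goal 5 => refine ⟨1, 1, by simp, by simp, Or.inl ?_⟩
    on_goal 6 => refine ⟨-1, 1, by simp, by simp, Or.inl ?_⟩
    on_goal 7 => refine ⟨1, -1, by simp, by simp, Or.inl ?_⟩
    on_goal 8 => refine ⟨-1, -1, by simp, by simp, Or.inl ?_⟩
    on_goal 9 => refine ⟨1, 1, by simp, by simp, Or.inr (Or.inr ?_)⟩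
    on_goal 10 => refine ⟨-1, 1, by simp, by simp, Or.inr (Or.inr ?_)⟩
    on_goal 11 => refine ⟨1, -1, by simp, by simp, Or.inr (Or.inr ?_)⟩
    on_goal 12 => refine ⟨-1, -1, by simp, by simp, Or.inr (Or.inr ?_)⟩
    all_goals
      rw [pt_ico (by norm_num)]
      ext i
      fin_cases i <;>
        simp [toE, act, signs, shift, flipIf, nat_mod_eq, nat_div_eq, nat_beq_eq, e1, e2] <;>
        ring

/-- The element `elt γ a₀ a₁ a₂ a₃ b₀ b₁ b₂ b₃`, multiplied by `26240`. -/
def ofCoeffs (a₀ a₁ a₂ a₃ b₀ b₁ b₂ b₃ : ℤ) : Zg :=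
  Zg.smul ⟨⟨4, 0⟩, ⟨0, 0⟩⟩ ⟨⟨Zs.ofInt a₀ a₁, Zs.ofInt a₂ a₃⟩, ⟨Zs.ofInt b₀ b₁, Zs.ofInt b₂ b₃⟩⟩

theorem ev_ofCoeffs (a₀ a₁ a₂ a₃ b₀ b₁ b₂ b₃ : ℤ) :
    (ofCoeffs a₀ a₁ a₂ a₃ b₀ b₁ b₂ b₃).ev / 26240 = elt γ a₀ a₁ a₂ a₃ b₀ b₁ b₂ b₃ := by
  have h : Zs.ev ⟨⟨4, 0⟩, ⟨0, 0⟩⟩ = 4 := by simp [Zs.ev, Diff.toInt]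
  rw [ofCoeffs, Zg.ev_smul, h]
  simp only [Zg.ev, Zb.ev, Zs.ev_ofInt, elt]
  ring

def beq3 (x y : Zg × Zg × Zg) : Bool := x.1.beq y.1 && (x.2.1.beq y.2.1 && x.2.2.beq y.2.2)

theorem pt_eq_of_beq {v : ℕ} {x : Zg × Zg × Zg} (h : beq3 (pointK v) x = true) :
    pt v = !₂[x.1.ev / 26240, x.2.1.ev / 26240, x.2.2.ev / 26240] := by
  simp only [beq3, Bool.and_eq_true] at h
  simp only [pt, toE, real3, Zg.ev_eq_of_beq h.1, Zg.ev_eq_of_beq h.2.1, Zg.ev_eq_of_beq h.2.2]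

theorem ptA_eq : ptA γ = pt 702 := by
  rw [pt_eq_of_beq (x := (ofCoeffs (-2570) 1190 470 (-90) (-275) 23 (-55) (-61),
    ofCoeffs (-1740) 560 (-20) 440 (-455) (-199) (-255) (-7),
    ofCoeffs (-1590) (-690) 10 190 (-80) (-126) (-180) (-58))) (by decide +kernel)]
  simp only [ev_ofCoeffs, ptA]
  push_cast
  rfl

theorem ptB_eq : ptB γ = pt 582 := by
  rw [pt_eq_of_beq (x := (ofCoeffs 930 450 (-470) 90 (-275) 23 (-55) (-61),
    ofCoeffs 720 (-260) (-840) (-380) 45 (-47) (-155) 89,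
    ofCoeffs 1690 (-690) 10 190 80 126 180 58)) (by decide +kernel)]
  simp only [ev_ofCoeffs, ptB]
  push_cast
  rfl

theorem ptC_eq : ptC γ = pt 1422 := by
  rw [pt_eq_of_beq (x := (ofCoeffs 0 (-820) 820 0 145 213 275 59,
    ofCoeffs (-730) 890 510 (-150) 410 164 0 82,
    ofCoeffs 2210 170 (-50) (-130) (-205) (-123) (-205) 41)) (by decide +kernel)]
  simp only [ev_ofCoeffs, ptC]
  push_cast
  rfl

theorem halfTurn_mk (a b c : ℝ) : halfTurn !₂[a, b, c] = !₂[a, -b, -c] := by simp [halfTurn]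

theorem elt_neg (g a₀ a₁ a₂ a₃ b₀ b₁ b₂ b₃ : ℝ) :
    elt (-g) a₀ a₁ a₂ a₃ b₀ b₁ b₂ b₃ = elt g a₀ a₁ a₂ a₃ (-b₀) (-b₁) (-b₂) (-b₃) := by
  simp only [elt]; ring

theorem neg_elt (g a₀ a₁ a₂ a₃ b₀ b₁ b₂ b₃ : ℝ) : -elt g a₀ a₁ a₂ a₃ b₀ b₁ b₂ b₃ =
    elt g (-a₀) (-a₁) (-a₂) (-a₃) (-b₀) (-b₁) (-b₂) (-b₃) := by
  simp only [elt]; ring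

theorem halfTurn_ptA_eq : halfTurn (ptA (-γ)) = pt 216 := by
  rw [pt_eq_of_beq (x := (ofCoeffs (-2570) 1190 470 (-90) 275 (-23) 55 61,
    ofCoeffs 1740 (-560) 20 (-440) (-455) (-199) (-255) (-7),
    ofCoeffs 1590 690 (-10) (-190) (-80) (-126) (-180) (-58))) (by decide +kernel)]
  simp only [ev_ofCoeffs, ptA, halfTurn_mk, elt_neg, neg_elt]
  push_cast
  simp only [neg_neg]

theorem halfTurn_ptB_eq : halfTurn (ptB (-γ)) = pt 96 := by
  rw [pt_eq_of_beq (x := (ofCoeffs 930 450 (-470) 90 275 (-23) 55 61,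
    ofCoeffs (-720) 260 840 380 45 (-47) (-155) 89,
    ofCoeffs (-1690) 690 (-10) (-190) 80 126 180 58)) (by decide +kernel)]
  simp only [ev_ofCoeffs, ptB, halfTurn_mk, elt_neg, neg_elt]
  push_cast
  simp only [neg_neg]

theorem halfTurn_ptC_eq : halfTurn (ptC (-γ)) = pt 1296 := by
  rw [pt_eq_of_beq (x := (ofCoeffs 0 (-820) 820 0 (-145) (-213) (-275) (-59),
    ofCoeffs 730 (-890) (-510) 150 410 164 0 82,
    ofCoeffs (-2210) (-170) 50 130 (-205) (-123) (-205) 41)) (by decide +kernel)]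
  simp only [ev_ofCoeffs, ptC, halfTurn_mk, elt_neg, neg_elt]
  push_cast
  simp only [neg_neg, neg_zero]

theorem h10_1_eq (k : Fin 10) : h10_1 k = pt (h10Code.getD k 0) := by
  have e1 : 1 / (2 * Real.goldenRatio) = (√5 - 1) / 4 := one_div_two_goldenRatio
  have e2 : -1 / (2 * Real.goldenRatio) = -((√5 - 1) / 4) := by rw [← e1]; ring
  fin_cases k
  on_goal 5 => exact ptA_eq
  on_goal 5 => exact ptB_eq
  on_goal 5 => exact ptC_eq
  on_goal 5 => exact halfTurn_ptA_eq
  on_goal 5 => exact halfTurn_ptB_eq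
  on_goal 5 => exact halfTurn_ptC_eq
  on_goal 1 => change _ = pt 0
  on_goal 2 => change _ = pt 2
  on_goal 3 => change _ = pt 18
  on_goal 4 => change _ = pt 19
  all_goals
    rw [pt_ico (by norm_num)]
    ext i
    fin_cases i <;>
      simp [h10_1, toE, act, signs, shift, flipIf, nat_mod_eq, nat_div_eq, nat_beq_eq, e1, e2] <;>
      ring

/-! ### Distinct codes belong to distinct points -/

theorem distinct_check :
    ((List.range 131).all fun q =>
      (nbr ((repNeighbors.getD q []).getD 0 0)).all fun w => Nat.beq w (Nat.mul 24 q) ||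
        (repNeighbors.getD q []).any fun u => !((nbr u).any fun w' => Nat.beq w w')) = true := by
  decide +kernel

theorem valid_of_mem_nbr {v w : ℕ} (h : w ∈ nbr v) : valid w = true := by
  obtain ⟨u, hu, rfl⟩ := mem_nbr.1 h
  exact valid_codeAct (Nat.mod_lt _ (by norm_num)) (lt_of_valid (valid_of_mem_repNeighbors hu))

theorem mem_nbr_comm {v w : ℕ} (hv : valid v = true) (hw : valid w = true) :
    w ∈ nbr v ↔ v ∈ nbr w := by
  rw [← dist_pt_eq_one_iff_mem_nbr (lt_of_valid hv) hw,
    ← dist_pt_eq_one_iff_mem_nbr (lt_of_valid hw) hv, dist_comm]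

theorem nbr_rep (q : ℕ) : nbr (24 * q) = repNeighbors.getD q [] := by
  have h : ∀ l : List ℕ, (∀ u ∈ l, valid u = true) → l.map (codeAct 0) = l := fun l hl => by
    conv_rhs => rw [← List.map_id l]
    refine List.map_congr_left fun u hu => ?_
    rw [codeAct_eq_normalize (by norm_num), zero_tMul _ (Nat.mod_lt u (by norm_num)),
      Nat.div_add_mod, normalize_of_valid (hl u hu), id]
  rw [nbr, nat_div_eq, nat_mod_eq, Nat.mul_mod_right, Nat.mul_div_cancel_left _ (by norm_num)]
  exact h _ fun u hu => valid_of_mem_repNeighbors hu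

theorem eq_of_pt_eq_rep {q w : ℕ} (hq : q < 131) (hw : valid w = true)
    (h : pt (24 * q) = pt w) : w = 24 * q := by
  have hmem (u : ℕ) (hu : u ∈ repNeighbors.getD q []) : w ∈ nbr u := by
    have hv := valid_of_mem_repNeighbors hu
    rw [← nbr_rep, ← dist_pt_eq_one_iff_mem_nbr (by omega) hv, h, dist_comm,
      dist_pt_eq_one_iff_mem_nbr (lt_of_valid hv) hw] at hu
    exact hu
  have hne : ∀ q < 131, repNeighbors.getD q [] ≠ [] := by decide +kernel
  have h0 : (repNeighbors.getD q []).getD 0 0 ∈ repNeighbors.getD q [] := by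
    cases hl : repNeighbors.getD q [] with
    | nil => exact absurd hl (hne q hq)
    | cons a l => simp
  have h1 := List.all_eq_true.1 (getD_eq_true_of_all_range distinct_check hq) w (hmem _ h0)
  rw [Bool.or_eq_true, Nat.beq_eq, List.any_eq_true] at h1
  rcases h1 with h1 | ⟨u, hu, h1⟩
  · exact h1
  · have : ((nbr u).any fun w' => Nat.beq w w') = true :=
      List.any_eq_true.2 ⟨w, hmem u hu, Nat.beq_refl w⟩
    simp [this] at h1

theorem codeAct_rep {v : ℕ} (hv : valid v = true) : codeAct (v % 24) (24 * (v / 24)) = v := by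
  have h : ∀ t < 24, tMul t 0 = t := by decide
  have ht := Nat.mod_lt v (by norm_num : 24 > 0)
  rw [codeAct_eq_normalize ht, Nat.mul_mod_right, Nat.mul_div_cancel_left _ (by norm_num), h _ ht,
    Nat.div_add_mod, normalize_of_valid hv]

theorem pt_injOn : Set.InjOn pt {v | valid v = true} := by
  intro v hv w hw h
  have ht : v % 24 < 24 := Nat.mod_lt _ (by norm_num)
  have h1 := (tInv_spec _ ht).1
  have hlt := lt_of_valid hv
  have hw' := valid_codeAct h1 (lt_of_valid hw)
  have := eq_of_pt_eq_rep (q := v / 24) (by omega) hw' (by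
    have h' : point3 v = point3 w := toE_injective h
    have e : point3 v = act (v % 24) (point3 (24 * (v / 24))) := by rw [point3_eq, point3_rep]
    rw [pt_eq, pt_eq, point3_codeAct h1, ← h', e, act_tInv ht])
  rw [← codeAct_rep hv, ← this, codeAct_tInv ht hw]

/-! ### The vertices of the distance product -/

theorem dot3_point3_arcEnd {u : ℕ} (hu : u = 0 ∨ u = 2 ∨ u = 18) (p : Zg × Zg × Zg) :
    ((linComb (arcEnd u) p).smul ⟨⟨6560, 0⟩, ⟨0, 0⟩⟩).ev = dot3 (point3 u) (real3 p) := by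
  have h : Zs.ev ⟨⟨6560, 0⟩, ⟨0, 0⟩⟩ = 6560 := by simp [Zs.ev, Diff.toInt]
  rw [Zg.ev_smul, h, linComb, Zg.ev_add, Zg.ev_add, Zg.ev_smul, Zg.ev_smul, Zg.ev_smul, dot3,
    point3_eq]
  rcases hu with rfl | rfl | rfl <;>
    simp only [Nat.zero_div, Nat.reduceDiv, real3_rep_zero] <;>
    simp [real3, arcEnd, act, signs, shift, flipIf, nat_beq_eq, nat_mod_eq,
      nat_div_eq, Zs.ev, Zs.zero, Diff.toInt] <;>
    ring

theorem ev_h10Gram {i k : ℕ} (hi : i < 10) (hk : k < 10) :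
    ((h10Gram.getD i []).getD k (Zg.ofZs Zs.zero)).ev =
      dot3 (point3 (h10Code.getD i 0)) (point3 (h10Code.getD k 0)) := by
  simp only [h10Gram, List.getD_eq_getElem?_getD, List.getElem?_map, List.getElem?_range, hi, hk,
    Option.map_some, Option.getD_some, ev_dotK, h10Point, point3]

theorem dot3_of_arcTest {u i k v : ℕ} (hu : u = 0 ∨ u = 2 ∨ u = 18) (hi : i < 10) (hk : k < 10)
    (h : arcTest u i k (pointK v) = true) : dot3 (point3 u) (point3 v) =
      dot3 (point3 (h10Code.getD i 0)) (point3 (h10Code.getD k 0)) := by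
  rw [← ev_h10Gram hi hk, ← Zg.ev_eq_of_beq h, dot3_point3_arcEnd hu]
  rfl

theorem mem_of_mem_gluedList {x : ((ℕ × ℕ) × (ℕ × ℕ)) × (ℕ × (ℕ × ℕ))} (h : x ∈ gluedList) :
    x.1.1 ∈ icoArcs ∧ x.1.2 ∈ h10Edges ∧ x.2.1 ∈ otherVertices x.1.2 := by
  obtain ⟨y, hy, hx⟩ := List.mem_flatMap.1 h
  obtain ⟨z, hz, rfl⟩ := List.mem_map.1 hx
  have h1 := (List.of_mem_zip (a := y.1) (b := y.2) hy).1
  obtain ⟨a, ha, h2⟩ := List.mem_flatMap.1 h1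
  obtain ⟨e, he, h3⟩ := List.mem_map.1 h2
  simp only [← h3]
  refine ⟨ha, he, ?_⟩
  have := (List.of_mem_zip (a := z.1) (b := z.2) hz).1
  rwa [← h3] at this

theorem icoArcs_orbit : ∀ c ∈ icoCodes, ∀ d ∈ icoCodes, d ∈ nbr c →
    ∃ t < 24, ∃ a ∈ icoArcs, codeAct t a.1 = c ∧ codeAct t a.2 = d := by
  decide +kernel

theorem icoArcs_spec : ∀ a ∈ icoArcs, (a.1 = 0 ∨ a.1 = 2 ∨ a.1 = 18) ∧
    (a.2 = 0 ∨ a.2 = 2 ∨ a.2 = 18) ∧ valid a.1 = true ∧ valid a.2 = true ∧ a.2 ∈ nbr a.1 := by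
  decide +kernel

theorem mem_icoCodes_iff : ∀ v, v ∈ icoCodes ↔ v < 24 ∧ valid v = true := by
  have h : ∀ v < 24, v ∈ icoCodes ↔ valid v = true := by decide +kernel
  have h' : ∀ v ∈ icoCodes, v < 24 := by decide
  intro v
  constructor
  · exact fun hv => ⟨h' v hv, (h v (h' v hv)).1 hv⟩
  · exact fun hv => (h v hv.1).2 hv.2

theorem h10Code_valid : ∀ i < 10, valid (h10Code.getD i 0) = true := by decide +kernel

theorem h10Code_check : ((List.range 10).all fun i => (List.range 10).all fun k =>
    (nbr (h10Code.getD i 0)).contains (h10Code.getD k 0) ==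
      (h10Edges.contains (i, k) || h10Edges.contains (k, i))) = true := by
  decide +kernel

theorem h10Code_spec (i : ℕ) (hi : i < 10) : valid (h10Code.getD i 0) = true ∧ ∀ k < 10,
    (h10Code.getD k 0 ∈ nbr (h10Code.getD i 0) ↔ (i, k) ∈ h10Edges ∨ (k, i) ∈ h10Edges) :=
  ⟨h10Code_valid i hi, fun k hk => by
    have h := getD_eq_true_of_all_range (getD_eq_true_of_all_range h10Code_check hi) hk
    rw [beq_iff_eq, Bool.eq_iff_iff] at h
    simpa using h⟩

theorem h10Edges_lt : ∀ e ∈ h10Edges, e.1 < 10 ∧ e.2 < 10 := by decide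

theorem dist_h10_1_iff (i k : Fin 10) : dist (h10_1 i) (h10_1 k) = 1 ↔
    ((i : ℕ), (k : ℕ)) ∈ h10Edges ∨ ((k : ℕ), (i : ℕ)) ∈ h10Edges := by
  rw [h10_1_eq, h10_1_eq, dist_pt_eq_one_iff_mem_nbr (lt_of_valid (h10Code_spec i i.2).1)
    (h10Code_spec k k.2).1]
  exact (h10Code_spec i i.2).2 k k.2

theorem inner_pt (v w : ℕ) : inner ℝ (pt v) (pt w) = dot3 (point3 v) (point3 w) / 26240 ^ 2 :=
  inner_toE _ _

theorem norm_pt_eq {v w : ℕ} (hv : v < 3144) (hw : w < 3144) : ‖pt v‖ = ‖pt w‖ := by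
  rw [← sq_eq_sq₀ (norm_nonneg _) (norm_nonneg _), norm_sq_pt hv, norm_sq_pt hw]

theorem gram_ne_zero {x y : ℝ × ℝ × ℝ} (hx : dot3 x x = 430336000 - 86067200 * √5)
    (hy : dot3 y y = 430336000 - 86067200 * √5) (hxy : dot3 x y = 86067200 - 86067200 * √5) :
    dot3 x x * dot3 y y - dot3 x y ^ 2 ≠ 0 := by
  rw [hx, hy, hxy]
  nlinarith [sqrt_five_bounds.1, sqrt_five_bounds.2, sqrt_five_sq]

/-- An isometry that maps an edge of `H₁₀,₁` to an element of `icoArcs` maps `H₁₀,₁` to points with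
codes. -/
theorem exists_code_of_arc {a e : ℕ × ℕ} (ha : a ∈ icoArcs) (he : e ∈ h10Edges) {k : ℕ}
    (hk : k < 10) {z : ℝ × ℝ × ℝ} (hz : dot3 z z = 430336000 - 86067200 * √5)
    (h1 : dot3 (point3 a.1) z = dot3 (point3 (h10Code.getD e.1 0)) (point3 (h10Code.getD k 0)))
    (h2 : dot3 (point3 a.2) z = dot3 (point3 (h10Code.getD e.2 0)) (point3 (h10Code.getD k 0)))
    (hke : k ≠ e.1) (hke' : k ≠ e.2) : ∃ v, valid v = true ∧ z = point3 v := by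
  have hx : (a, e) ∈ arcEdgePairs := List.mem_flatMap.2 ⟨a, ha, List.mem_map.2 ⟨e, he, rfl⟩⟩
  have hko : k ∈ otherVertices e := by
    simp [otherVertices, hk, nat_beq_eq, hke, hke']
  obtain ⟨y, hy, h⟩ := List.any_eq_true.1
    (List.all_eq_true.1 (List.all_eq_true.1 glued_complete _ hx) k hko)
  simp only [Bool.and_eq_true, Nat.beq_eq] at h
  obtain ⟨⟨e1, e2⟩, ⟨e3, e4⟩, e5⟩ := h
  have hg := List.all_eq_true.1 glued_check y hy
  simp only [Bool.and_eq_true, gluedTest, Bool.not_eq_true', ← e1, ← e2, ← e3, ← e4, ← e5] at hg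
  obtain ⟨v1, v2, hne, ⟨g1, g2⟩, g3, g4⟩ := hg
  obtain ⟨s1, s2, s3, s4, s5⟩ := icoArcs_spec a ha
  obtain ⟨l1, l2⟩ := h10Edges_lt e he
  have hne' : point3 y.2.2.1 ≠ point3 y.2.2.2 := fun h => by
    have := pt_injOn v1 v2 (congrArg toE h)
    rw [this, Nat.beq_refl] at hne
    exact absurd hne (by simp)
  have ha' := (dot_iff_mem_nbr (lt_of_valid s3) s4).2 s5
  rcases eq_or_eq_of_dot3 (w := z) (gram_ne_zero (dot3_self (lt_of_valid s3))
    (dot3_self (lt_of_valid s4)) ha') hne' ((dot3_of_arcTest s1 l1 hk g1).trans h1.symm)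
    ((dot3_of_arcTest s2 l2 hk g2).trans h2.symm) ((dot3_of_arcTest s1 l1 hk g3).trans h1.symm)
    ((dot3_of_arcTest s2 l2 hk g4).trans h2.symm) ((dot3_self (lt_of_valid v1)).trans hz.symm)
    ((dot3_self (lt_of_valid v2)).trans hz.symm) with h | h
  · exact ⟨_, v1, h⟩
  · exact ⟨_, v2, h⟩

theorem exists_code_of_isometry {f : E3 ≃ₗᵢ[ℝ] E3} {i j : Fin 10} {c d : ℕ} (hc : c ∈ icoCodes)
    (hd : d ∈ icoCodes) (hcd : dist (pt c) (pt d) = 1) (he : ((i : ℕ), (j : ℕ)) ∈ h10Edges)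
    (hi : f (h10_1 i) = pt c) (hj : f (h10_1 j) = pt d) (k : Fin 10) :
    ∃ v, valid v = true ∧ f (h10_1 k) = pt v := by
  rw [mem_icoCodes_iff] at hc hd
  by_cases hki : k = i
  · exact ⟨c, hc.2, by rw [hki, hi]⟩
  by_cases hkj : k = j
  · exact ⟨d, hd.2, by rw [hkj, hj]⟩
  obtain ⟨t, ht, a, ha, rfl, rfl⟩ := icoArcs_orbit c ((mem_icoCodes_iff c).2 hc) d
    ((mem_icoCodes_iff d).2 hd) ((dist_pt_eq_one_iff_mem_nbr (lt_of_valid hc.2) hd.2).1 hcd)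
  obtain ⟨z, hz⟩ := toE_surjective (f (h10_1 k))
  have h0 (i : Fin 10) (u : ℕ) (h : f (h10_1 i) = pt u) : dot3 (point3 u) z =
      dot3 (point3 (h10Code.getD i 0)) (point3 (h10Code.getD k 0)) := by
    have h' := f.inner_map_map (h10_1 i) (h10_1 k)
    rw [h, ← hz, pt_eq, inner_toE, h10_1_eq, h10_1_eq, inner_pt] at h'
    exact (div_left_inj' (by norm_num)).1 h'
  have hzz : dot3 z z = 430336000 - 86067200 * √5 := by
    have h' := f.inner_map_map (h10_1 k) (h10_1 k)
    rw [← hz, inner_toE, h10_1_eq, inner_pt, dot3_self (lt_of_valid (h10Code_spec k k.2).1)] at h'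
    exact (div_left_inj' (by norm_num)).1 h'
  have h1 := h0 i _ hi
  have h2 := h0 j _ hj
  rw [point3_codeAct ht, ← act_act_tInv ht z, dot3_act] at h1 h2
  obtain ⟨v, hv, hv'⟩ := exists_code_of_arc ha he k.2
    (by rwa [← dot3_act t, act_act_tInv ht]) h1 h2
    (fun h => hki (Fin.ext h)) (fun h => hkj (Fin.ext h))
  exact ⟨codeAct t v, valid_codeAct ht (lt_of_valid hv), by
    rw [← hz, pt_eq, point3_codeAct ht, ← hv', act_act_tInv ht]⟩

theorem exists_codeAct_eq {v w : ℕ} (hv : valid v = true) (hw : valid w = true)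
    (h : v / 24 = w / 24) : ∃ t < 24, codeAct t v = w := by
  have h1 : ∀ v < 24, ∀ w < 24, v % 8 < 4 → w % 8 < 4 → ∃ t < 24, codeAct t v = w := by
    decide +kernel
  rw [valid_iff] at hv hw
  by_cases hlt : v < 24
  · exact h1 v hlt w (by omega) (by omega) (by omega)
  · have h2 : ∀ a < 24, ∀ b < 24, ∃ t < 24, tMul t a = b := by decide +kernel
    obtain ⟨t, ht, h3⟩ := h2 (v % 24) (Nat.mod_lt _ (by norm_num)) (w % 24)
      (Nat.mod_lt _ (by norm_num))
    exact ⟨t, ht, by rw [codeAct_of_le ht (by omega), h3, h, Nat.div_add_mod]⟩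

theorem exists_isometry_of_gluedTest {a e : ℕ × ℕ} (ha : a ∈ icoArcs) (he : e ∈ h10Edges) {k v : ℕ}
    (hk : k < 10) (hv : valid v = true) (h : gluedTest a e k v = true) {t : ℕ} (ht : t < 24) :
    ∃ f : E3 ≃ₗᵢ[ℝ] E3, f (pt (h10Code.getD e.1 0)) = pt (codeAct t a.1) ∧
      f (pt (h10Code.getD e.2 0)) = pt (codeAct t a.2) ∧
      f (pt (h10Code.getD k 0)) = pt (codeAct t v) := by
  obtain ⟨s1, s2, s3, s4, s5⟩ := icoArcs_spec a ha
  obtain ⟨l1, l2⟩ := h10Edges_lt e he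
  simp only [gluedTest, Bool.and_eq_true] at h
  have n {i w : ℕ} (hi : i < 10) (hw : valid w = true) :
      ‖pt (h10Code.getD i 0)‖ = ‖pt (codeAct t w)‖ :=
    norm_pt_eq (lt_of_valid (h10Code_spec i hi).1) (lt_of_valid (valid_codeAct ht (lt_of_valid hw)))
  refine exists_isometry_of_gram (n l1 s3) (n l2 s4) (n hk hv) ?_ ?_ ?_ <;>
    rw [inner_pt, inner_pt, point3_codeAct ht, point3_codeAct ht, dot3_act]
  · rw [(dot_iff_mem_nbr (lt_of_valid s3) s4).2 s5,
      (dot_iff_mem_nbr (lt_of_valid (h10Code_spec _ l1).1) (h10Code_spec _ l2).1).2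
        (((h10Code_spec _ l1).2 _ l2).2 (Or.inl he))]
  · rw [dot3_of_arcTest s1 l1 hk h.1]
  · rw [dot3_of_arcTest s2 l2 hk h.2]

theorem distanceProductVerts_eq :
    distanceProductVerts H12_2 H10_1 = pt '' {v | valid v = true} := by
  ext p
  simp only [distanceProductVerts, gluings, edgeIsometries, Set.mem_iUnion, Set.mem_ofPred_eq]
  constructor
  · rintro ⟨f, ⟨⟨u, hu⟩, ⟨w, hw⟩, ⟨_, ⟨i, rfl⟩⟩, ⟨_, ⟨j, rfl⟩⟩, h1, h2, h3⟩, _, ⟨k, rfl⟩, rfl⟩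
    rw [greatIcosahedron_eq] at hu hw
    obtain ⟨c, hc, rfl⟩ := hu
    obtain ⟨d, hd, rfl⟩ := hw
    have h1' : dist (pt c) (pt d) = 1 := h1
    have h1'' : dist (pt d) (pt c) = 1 := by rwa [dist_comm]
    have h2' := (dist_h10_1_iff i j).1 h2
    rw [Set.image_pair, Set.pair_eq_pair_iff] at h3
    suffices h : ∃ v, valid v = true ∧ f (h10_1 k) = pt v by
      obtain ⟨v, hv, h⟩ := h
      exact ⟨v, hv, h.symm⟩
    rcases h3 with ⟨h3, h4⟩ | ⟨h3, h4⟩ <;> rcases h2' with he | he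
    · exact exists_code_of_isometry hc hd h1' he h3 h4 k
    · exact exists_code_of_isometry hd hc h1'' he h4 h3 k
    · exact exists_code_of_isometry hd hc h1'' he h3 h4 k
    · exact exists_code_of_isometry hc hd h1' he h4 h3 k
  · rintro ⟨v, hv, rfl⟩
    have hv' := lt_of_valid hv
    obtain ⟨y, hy, h⟩ := List.any_eq_true.1
      (getD_eq_true_of_all_range glued_cover (by omega : v / 24 < 131))
    obtain ⟨ha, he, hk⟩ := mem_of_mem_gluedList hy
    have hk' : y.2.1 < 10 := List.mem_range.1 (List.mem_filter.1 hk).1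
    have hg := List.all_eq_true.1 glued_check y hy
    simp only [Bool.and_eq_true] at hg
    obtain ⟨v1, v2, -, g1, g2⟩ := hg
    obtain ⟨v₀, hv₀, hq, hg⟩ : ∃ v₀, valid v₀ = true ∧ v₀ / 24 = v / 24 ∧
        gluedTest y.1.1 y.1.2 y.2.1 v₀ = true := by
      rw [Bool.or_eq_true, Nat.beq_eq, Nat.beq_eq] at h
      rcases h with h | h
      · exact ⟨_, v1, h.symm, g1⟩
      · exact ⟨_, v2, h.symm, g2⟩
    obtain ⟨t, ht, rfl⟩ := exists_codeAct_eq hv₀ hv hq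
    obtain ⟨f, f1, f2, f3⟩ := exists_isometry_of_gluedTest ha he hk' hv₀ hg ht
    obtain ⟨s1, s2, s3, s4, s5⟩ := icoArcs_spec _ ha
    obtain ⟨l1, l2⟩ := h10Edges_lt _ he
    have hc {a : ℕ} (h : valid a = true) (h' : a = 0 ∨ a = 2 ∨ a = 18) :
        pt (codeAct t a) ∈ greatIcosahedron := by
      rw [greatIcosahedron_eq]
      refine ⟨_, (mem_icoCodes_iff _).2 ⟨?_, valid_codeAct ht (lt_of_valid h)⟩, rfl⟩
      have := codeAct_div (v := a) ht
      omega
    have hr (i : ℕ) (hi : i < 10) : pt (h10Code.getD i 0) = h10_1 ⟨i, hi⟩ := (h10_1_eq ⟨i, hi⟩).symm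
    rw [hr _ l1] at f1
    rw [hr _ l2] at f2
    rw [hr _ hk'] at f3
    refine ⟨f, ⟨⟨_, hc s3 s1⟩, ⟨_, hc s4 s2⟩, ⟨h10_1 ⟨_, l1⟩, ⟨_, rfl⟩⟩, ⟨h10_1 ⟨_, l2⟩, ⟨_, rfl⟩⟩,
      ?_, (dist_h10_1_iff _ _).2 (Or.inl he), ?_⟩, _, ⟨_, rfl⟩, f3⟩
    · change dist (pt (codeAct t _)) (pt (codeAct t _)) = 1
      rw [← f1, ← f2, f.dist_map]
      exact (dist_h10_1_iff _ _).2 (Or.inl he)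
    · rw [Set.image_pair, f1, f2]

/-! ### The graphs on codes -/

theorem codeAct_injOn {t : ℕ} (ht : t < 24) : Set.InjOn (codeAct t) {v | valid v = true} := by
  intro v hv w hw h
  refine pt_injOn hv hw (show toE (point3 v) = toE (point3 w) from congrArg toE ?_)
  have h' := congrArg (fun u => act (tInv t) (point3 u)) h
  simpa only [point3_codeAct ht, act_tInv ht] using h'

theorem repNeighbors_nodup : ∀ l ∈ repNeighbors, l.Nodup := by decide +kernel

theorem nodup_nbr (v : ℕ) : (nbr v).Nodup := by
  have h : (repNeighbors.getD (v / 24) []).Nodup := by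
    by_cases hq : v / 24 < repNeighbors.length
    · rw [List.getD_eq_getElem _ _ hq]
      exact repNeighbors_nodup _ (List.getElem_mem hq)
    · rw [List.getD_eq_default _ _ (by omega)]
      exact List.nodup_nil
  exact h.map_on fun u hu w hw => codeAct_injOn (Nat.mod_lt _ (by norm_num))
    (valid_of_mem_repNeighbors hu) (valid_of_mem_repNeighbors hw)

/-- The codes of the points in the orbits selected by `Q`. -/
def codes (Q : ℕ → Bool) : Finset ℕ := (Finset.range 3144).filter fun v => valid v && Q (v / 24)

theorem mem_codes {Q : ℕ → Bool} {v : ℕ} : v ∈ codes Q ↔ valid v = true ∧ Q (v / 24) = true := by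
  rw [codes, Finset.mem_filter, Finset.mem_range, Bool.and_eq_true]
  exact ⟨fun h => h.2, fun h => ⟨lt_of_valid h.1, h⟩⟩

attribute [irreducible] codes

/-- The number of neighbours of the representative `q` in the orbits selected by `Q`. -/
def degreeIn (Q : ℕ → Bool) (q : ℕ) : ℕ :=
  ((repNeighbors.getD q []).filter fun w => Q (Nat.div w 24)).length

theorem card_filter_nbr (Q : ℕ → Bool) (v : ℕ) :
    ((nbr v).filter fun w => Q (w / 24)).toFinset.card = degreeIn Q (v / 24) := by
  rw [List.toFinset_card_of_nodup ((nodup_nbr v).filter _), nbr, List.filter_map, List.length_map,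
    degreeIn]
  congr 2
  funext w
  simp only [Function.comp, nat_mod_eq, codeAct_div (Nat.mod_lt v (by norm_num : 24 > 0)),
    nat_div_eq]

/-- The graph on the codes in the orbits selected by `Q`. -/
def codeGraph (Q : ℕ → Bool) : SimpleGraph (codes Q) where
  Adj v w := (w : ℕ) ∈ nbr v
  symm := ⟨fun v w h => (mem_nbr_comm (mem_codes.1 v.2).1 (mem_codes.1 w.2).1).1 h⟩
  loopless := ⟨fun v h => by
    have h1 := (mem_codes.1 v.2).1
    rw [← dist_pt_eq_one_iff_mem_nbr (lt_of_valid h1) h1, dist_self] at h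
    exact zero_ne_one h⟩

theorem two_mul_card_edgeSet (Q : ℕ → Bool) :
    2 * (codeGraph Q).edgeSet.ncard = ∑ v ∈ codes Q, degreeIn Q (v / 24) := by
  classical
  rw [← SimpleGraph.coe_edgeFinset, Set.ncard_coe_finset,
    ← SimpleGraph.sum_degrees_eq_twice_card_edges,
    ← Finset.sum_coe_sort (codes Q) fun v => degreeIn Q (v / 24)]
  refine Finset.sum_congr rfl fun v _ => ?_
  rw [← card_filter_nbr, ← SimpleGraph.card_neighborFinset_eq_degree,
    ← Finset.card_map (Function.Embedding.subtype _)]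
  congr 1
  ext w
  simp only [Finset.mem_map, SimpleGraph.mem_neighborFinset, Function.Embedding.subtype_apply,
    List.mem_toFinset, List.mem_filter]
  constructor
  · rintro ⟨u, hu, rfl⟩
    exact ⟨hu, (mem_codes.1 u.2).2⟩
  · rintro ⟨h1, h2⟩
    exact ⟨⟨w, mem_codes.2 ⟨valid_of_mem_nbr h1, h2⟩⟩, h1, rfl⟩

/-! ### The distance product and its reduction -/

/-- The distance product of the icosahedron and `H₁₀,₁`. -/
abbrev product := distanceProduct H12_2 H10_1

theorem pt_mem {v : ℕ} (h : valid v = true) : pt v ∈ distanceProductVerts H12_2 H10_1 := by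
  rw [distanceProductVerts_eq]; exact ⟨v, h, rfl⟩

/-- The vertices of the product in the orbits selected by `Q`. -/
def verts (Q : ℕ → Bool) : Set (distanceProductVerts H12_2 H10_1) :=
  {x | ∃ v ∈ codes Q, pt v = x}

theorem verts_true : verts (fun _ => true) = Set.univ := by
  refine Set.eq_univ_of_forall fun ⟨x, hx⟩ => ?_
  rw [distanceProductVerts_eq] at hx
  obtain ⟨v, hv, rfl⟩ := hx
  exact ⟨v, mem_codes.2 ⟨hv, rfl⟩, rfl⟩

theorem removeLowDegree_verts (d : ℕ) (Q : ℕ → Bool) : removeLowDegree product d (verts Q) =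
    verts fun q => Q q && Nat.blt d (degreeIn Q q) := by
  have key (v : ℕ) (hv : valid v = true) :
      (product.neighborSet ⟨pt v, pt_mem hv⟩ ∩ verts Q).encard = degreeIn Q (v / 24) := by
    rw [← card_filter_nbr, ← Set.encard_coe_eq_coe_finsetCard,
      ← Function.Injective.encard_image Subtype.val_injective,
      ← Set.InjOn.encard_image (pt_injOn.mono (s₁ := _) fun w hw => ?_)]
    · congr 1
      ext x
      constructor
      · rintro ⟨_, ⟨h1, w, hw, h2⟩, rfl⟩
        have hw' := mem_codes.1 hw
        refine ⟨w, ?_, h2⟩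
        rw [Finset.mem_coe, List.mem_toFinset, List.mem_filter,
          ← dist_pt_eq_one_iff_mem_nbr (lt_of_valid hv) hw'.1, h2]
        exact ⟨h1, hw'.2⟩
      · rintro ⟨w, hw, rfl⟩
        rw [Finset.mem_coe, List.mem_toFinset, List.mem_filter] at hw
        have hw' := valid_of_mem_nbr hw.1
        refine ⟨⟨pt w, pt_mem hw'⟩, ⟨?_, w, mem_codes.2 ⟨hw', hw.2⟩, rfl⟩, rfl⟩
        exact (dist_pt_eq_one_iff_mem_nbr (lt_of_valid hv) hw').2 hw.1
    · rw [Finset.mem_coe, List.mem_toFinset, List.mem_filter] at hw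
      exact valid_of_mem_nbr hw.1
  ext ⟨x, hx⟩
  rw [distanceProductVerts_eq] at hx
  obtain ⟨v, hv, rfl⟩ := hx
  have hmem (Q : ℕ → Bool) : (⟨pt v, hx⟩ : distanceProductVerts H12_2 H10_1) ∈ verts Q ↔
      Q (v / 24) = true := by
    constructor
    · rintro ⟨w, hw, h⟩
      have hw' := mem_codes.1 hw
      rw [← pt_injOn hw'.1 hv h]
      exact hw'.2
    · exact fun h => ⟨v, mem_codes.2 ⟨hv, h⟩, rfl⟩
  rw [removeLowDegree, Set.mem_sep_iff, hmem, hmem, key v hv, Bool.and_eq_true, Nat.blt_eq,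
    Nat.cast_lt]

/-! ### The size of the product and of its reduction -/

theorem verts_congr {Q Q' : ℕ → Bool} (h : ∀ q < 131, Q q = Q' q) : verts Q = verts Q' := by
  have (v : ℕ) : v ∈ codes Q ↔ v ∈ codes Q' := by
    rw [mem_codes, mem_codes]
    refine and_congr_right fun hv => ?_
    rw [h _ (Nat.div_lt_of_lt_mul (lt_of_valid hv))]
  simp only [verts, this]

theorem core_degrees :
    (∀ q < 131, (Nat.blt 4 (degreeIn (fun _ => true) q) &&
      Nat.blt 4 (degreeIn (fun q => Nat.blt 4 (degreeIn (fun _ => true) q)) q)) = Nat.blt q 41) ∧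
    ∀ q < 131, (Nat.blt q 41 && Nat.blt 4 (degreeIn (fun q => Nat.blt q 41) q)) = Nat.blt q 41 := by
  decide +kernel

/-- The vertices that survive the removal of vertices of degree at most `4`. -/
abbrev core (q : ℕ) : Bool := Nat.blt q 41

theorem survivors_eq : survivors product 4 = verts core := by
  have h1 : removeLowDegree product 4 Set.univ =
      verts fun q => Nat.blt 4 (degreeIn (fun _ => true) q) := by
    rw [← verts_true, removeLowDegree_verts]; rfl
  have h2 : removeLowDegree product 4 (removeLowDegree product 4 Set.univ) = verts core := by
    rw [h1, removeLowDegree_verts]; exact verts_congr core_degrees.1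
  have h3 : removeLowDegree product 4 (verts core) = verts core := by
    rw [removeLowDegree_verts]; exact verts_congr core_degrees.2
  have h4 (n : ℕ) : (removeLowDegree product 4)^[n + 2] Set.univ = verts core := by
    rw [Function.iterate_add_apply]
    exact (congrArg _ h2).trans (Function.iterate_fixed h3 n)
  refine (Set.iInter_subset _ 2).trans (h4 0).subset |>.antisymm (Set.subset_iInter fun n => ?_)
  match n with
  | 0 => exact Set.subset_univ _
  | 1 => exact h2.symm.subset.trans (Set.sep_subset _ _)
  | n + 2 => exact (h4 n).symm.subset

theorem ncard_verts (Q : ℕ → Bool) : (verts Q).ncard = (codes Q).card := by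
  rw [← Set.ncard_image_of_injective _ Subtype.val_injective, ← Set.ncard_coe_finset,
    ← (pt_injOn.mono fun v (hv : v ∈ (codes Q : Set ℕ)) => (mem_codes.1 hv).1).ncard_image]
  congr 1
  ext x
  constructor
  · rintro ⟨_, ⟨v, hv, h⟩, rfl⟩
    exact ⟨v, hv, h⟩
  · rintro ⟨v, hv, rfl⟩
    exact ⟨⟨pt v, pt_mem (mem_codes.1 hv).1⟩, ⟨v, hv, rfl⟩, rfl⟩

theorem card_codes : (codes fun _ => true).card = 3132 ∧ (codes core).card = 972 := by
  decide +kernel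

theorem sum_degreeIn : ∑ v ∈ codes (fun _ => true), degreeIn (fun _ => true) (v / 24) = 20460 ∧
    ∑ v ∈ codes core, degreeIn core (v / 24) = 8220 := by
  decide +kernel

theorem nonempty_iso (Q : ℕ → Bool) {S : Set (distanceProductVerts H12_2 H10_1)}
    (h : S = verts Q) : Nonempty (codeGraph Q ≃g product.induce S) := by
  subst h
  refine ⟨⟨Equiv.ofBijective (fun v => ⟨⟨pt v, pt_mem (mem_codes.1 v.2).1⟩, v, v.2, rfl⟩)
    ⟨fun v w h => ?_, ?_⟩, ?_⟩⟩
  · exact Subtype.ext (pt_injOn (mem_codes.1 v.2).1 (mem_codes.1 w.2).1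
      (congrArg (fun x => x.1.1) h))
  · rintro ⟨⟨x, hx⟩, v, hv, h⟩
    exact ⟨⟨v, hv⟩, Subtype.ext (Subtype.ext h)⟩
  · intro v w
    exact dist_pt_eq_one_iff_mem_nbr (lt_of_valid (mem_codes.1 v.2).1) (mem_codes.1 w.2).1

theorem nonempty_iso_product : Nonempty (codeGraph (fun _ => true) ≃g product) := by
  obtain ⟨e⟩ := nonempty_iso (fun _ => true) verts_true.symm
  exact ⟨e.trans (SimpleGraph.induceUnivIso product)⟩

theorem nonempty_iso_G972 : Nonempty (codeGraph core ≃g G972) := nonempty_iso core survivors_eq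

theorem ncard_edgeSet_congr {V W : Type*} {G : SimpleGraph V} {H : SimpleGraph W}
    (e : Nonempty (G ≃g H)) : G.edgeSet.ncard = H.edgeSet.ncard :=
  e.elim fun e => Nat.card_congr e.mapEdgeSet

theorem ncard_distanceProductVerts : (distanceProductVerts H12_2 H10_1).ncard = 3132 := by
  rw [← card_codes.1, ← ncard_verts, verts_true, Set.ncard_univ]; rfl

theorem ncard_survivors : (survivors product 4).ncard = 972 := by
  rw [survivors_eq, ncard_verts, card_codes.2]

theorem ncard_edgeSet_product : product.edgeSet.ncard = 10230 := by
  have := two_mul_card_edgeSet fun _ => true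
  rw [sum_degreeIn.1, ncard_edgeSet_congr nonempty_iso_product] at this
  omega

theorem ncard_edgeSet_G972 : G972.edgeSet.ncard = 4110 := by
  have := two_mul_card_edgeSet core
  rw [sum_degreeIn.2, ncard_edgeSet_congr nonempty_iso_G972] at this
  omega

/-! ### A colouring with five colours -/

/-- The colours of the points, with three bits for each point. -/
def fiveColors : List ℕ := [
0x22400025a0006c4, 0x4db25184311a240214, 0x69a282640464220822, 0x6c28c030a61a042098,
  0x2c832224a0124d06cc, 0x8096e42e028211a60a, 0x2644e32e44914230c9, 0x2534d40d30034c4490,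
  0x29b40c0d8323309514, 0x9c08351c24828c082, 0x4a429b4540582130db, 0x2a462488a20a102249,
  0x2ca6902c36802d4, 0x4190912d82106d4211, 0x6a206168b5002446c4, 0x2e22a305a65951a4d8,
  0x2e041c0616c3481843, 0x859500022263918809, 0x40b1046cc8e2211082, 0x7088924d84a065891b,
  0x65c124809608911401, 0x2844d42132e3211420, 0x4ca80c0436db110103, 0x2db4a201c48c48b204,
  0x30309c85c45a41405c, 0x44949b2540508a3810, 0x6161952064872204a, 0x65169291a9022426d0,
  0x222092826e0651718, 0x8c8220601891649500, 0xc26c289870c2da682, 0x40820b40940c400114,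
  0x5004513242534c4661, 0x842d32634dc220489, 0x6631220512a28204a2, 0x7030820015246db2c2,
  0x4596488cc00a4c2652, 0x2542c0453051203, 0x41850b8886d1481418, 0x251062243099093240,
  0x20a68a08188908828a, 0x208200240200001048, 0x200050200008041001, 0x1020a001040040001,
  0x1021009008200, 0x2000000200200040, 0x49b48948b4514da691, 0x44949a45325948a68a,
  0x25945325a68b4894db, 0x4516ca28a65a25148a, 0x68b2492c9651452292, 0x712808090223719700,
  0x80170b29968a84a2c1, 0x111053483441898201, 0x8528d18a08e4042251, 0x2d09026898c9481441,
  0x81a84865a092048283, 0x89c44061101168b221, 0x4416d884981181a049, 0x1164a4c82c40da80a,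
  0x81300800a89a00c121, 0x24989024929800229b, 0x2d22ca2522000920c0, 0x20b0502020522cc25a,
  0x44b409242290243450, 0x25325205b08904141b, 0x2c84012c96824c8002, 0x48141008b252503290,
  0x25244445a40045248a, 0x28a0cb2510410c8052, 0x28a089082282051092, 0x8c96885006996886d1,
  0x6d4049913042912003, 0x2416d20429120084da, 0x70b5014828c26db6c9, 0x7132e20822da10a102,
  0x68a4c86824c86d0489, 0x9a00a6da00189a010, 0xc169b04069260169a, 0x4c94888c169b511489,
  0x2832d210328a0c3084, 0x40b3180d900a108481, 0x11a480498281001040, 0x2814c02202c0051020,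
  0x2080002102c8254201, 0x60311284a110608288, 0x20b31349164a049099, 0x20921220825a4494cb,
  0x41b24a0da4516d304a, 0x45069965b0596c308a, 0x25a803692202459642, 0x240241251242241240,
  0x449480249288249289, 0x40824940b2492d3248, 0x240252258248248240, 0x59041259051251449,
  0x1301b01b02301b023, 0x20091b0007240004e4, 0x6930006a400051a001, 0x1a02302401100201b,
  0x420608420400420820, 0x2c82106dc09105969a, 0x2192238916086cb299, 0x25845b08a2ca08849b,
  0x41b4194c24424c0489, 0x1148a205a2590d224b, 0x28b200448048002, 0x60a4414400482c2,
  0x24c01060a020483008, 0x450010058252001048, 0x408208218212401049, 0x20824069a0c80e340a,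
  0x29808209b050082009, 0x21201a2890da00064a, 0x24224c4c14022484d8, 0x21948030b0800490c9,
  0x8802882102496590c2, 0x160b040002498241, 0x44840161b282410248, 0x20b01a04320945b40b,
  0x81243008211040640, 0x180410230124c9442, 0x4300100911984024a, 0x9a20b459200403410,
  0x2012d848c444489003, 0x80c0014022405130c1, 0x6410d84408586048d1, 0x21024140060800804a,
  0x8310208709280241, 0x2082208060825a200, 0x1620261051608801]

def fiveColor (v : ℕ) : ℕ :=
  Nat.mod (Nat.shiftRight (fiveColors.getD (Nat.div v 24) 0) (Nat.mul 3 (Nat.mod v 24))) 8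

theorem fiveColor_check : (List.range 3144).all (fun v => !valid v || Nat.blt (fiveColor v) 5 &&
    (nbr v).all fun w => !Nat.beq (fiveColor v) (fiveColor w)) = true := by decide +kernel

theorem colorable_five (Q : ℕ → Bool) : (codeGraph Q).Colorable 5 := by
  have h (v : ℕ) (hv : valid v = true) :
      fiveColor v < 5 ∧ ∀ w ∈ nbr v, fiveColor v ≠ fiveColor w := by
    have := List.all_eq_true.1 fiveColor_check v (List.mem_range.2 (lt_of_valid hv))
    rw [hv, Bool.not_true, Bool.false_or, Bool.and_eq_true, List.all_eq_true, Nat.blt_eq] at this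
    refine ⟨this.1, fun w hw heq => ?_⟩
    have h2 := this.2 w hw
    rw [heq, nat_beq_eq] at h2
    simp at h2
  exact ⟨SimpleGraph.Coloring.mk (fun v => ⟨fiveColor v, (h v (mem_codes.1 v.2).1).1⟩)
    fun {v w} hvw heq => (h v (mem_codes.1 v.2).1).2 w hvw (Fin.mk.inj heq)⟩

theorem codeGraph_hom (Q : ℕ → Bool) : Nonempty (codeGraph Q →g codeGraph fun _ => true) :=
  ⟨⟨fun v => ⟨v, mem_codes.2 ⟨(mem_codes.1 v.2).1, rfl⟩⟩, id⟩⟩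

theorem chromaticNumber_eq_five (h : ¬ (codeGraph core).Colorable 4) :
    product.chromaticNumber = 5 ∧ G972.chromaticNumber = 5 := by
  obtain ⟨e⟩ := nonempty_iso_product
  obtain ⟨e'⟩ := nonempty_iso_G972
  obtain ⟨i⟩ := codeGraph_hom core
  constructor
  · refine (SimpleGraph.chromaticNumber_eq_iff_colorable_not_colorable).2 ⟨?_, fun hc => h ?_⟩
    · exact (colorable_five _).of_hom e.symm.toHom
    · exact hc.of_hom (e.toHom.comp i)
  · refine (SimpleGraph.chromaticNumber_eq_iff_colorable_not_colorable).2 ⟨?_, fun hc => h ?_⟩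
    · exact (colorable_five _).of_hom e'.symm.toHom
    · exact hc.of_hom e'.toHom

/-! ### The embeddings of the factors -/

theorem r₂_sq : r₂ ^ 2 = (5 - √5) / 8 := by
  rw [r₂, show 3 * Real.pi / 10 = Real.pi / 2 - Real.pi / 5 by ring, Real.cos_pi_div_two_sub,
    Real.sin_sq, Real.cos_pi_div_five]
  ring_nf
  rw [pow_two, sqrt_five_sq]
  ring

theorem r₂_nonneg : 0 ≤ r₂ :=
  Real.cos_nonneg_of_mem_Icc ⟨by linarith [Real.pi_pos], by linarith [Real.pi_pos]⟩

theorem norm_pt_eq_r₂ {v : ℕ} (hv : v < 3144) : ‖pt v‖ = r₂ := by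
  rw [← sq_eq_sq₀ (norm_nonneg _) r₂_nonneg, norm_sq_pt hv, r₂_sq]

theorem greatIcosahedron_subset_sphere : greatIcosahedron ⊆ Metric.sphere 0 r₂ := by
  rw [greatIcosahedron_eq]
  rintro _ ⟨v, hv, rfl⟩
  rw [mem_sphere_zero_iff_norm]
  exact norm_pt_eq_r₂ (((mem_icoCodes_iff v).1 hv).1.trans (by norm_num))

theorem L10_1_adj_iff (i j : Fin 10) :
    L10_1.Adj i j ↔ ((i : ℕ), (j : ℕ)) ∈ h10Edges ∨ ((j : ℕ), (i : ℕ)) ∈ h10Edges := by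
  simp only [L10_1, SimpleGraph.fromEdgeSet_adj, Set.mem_insert_iff, Set.mem_singleton_iff]
  revert i j
  decide +kernel

theorem isUnitDistanceEmbedding_h10_1 : IsUnitDistanceEmbedding L10_1 r₂ h10_1 := by
  refine ⟨fun i j h => ?_, fun i => ?_, fun i j => ?_⟩
  · rw [h10_1_eq, h10_1_eq] at h
    have h' := pt_injOn (h10Code_spec i i.2).1 (h10Code_spec j j.2).1 h
    have key : ∀ i j : Fin 10, h10Code.getD i 0 = h10Code.getD j 0 → i = j := by decide +kernel
    exact key i j h'
  · rw [mem_sphere_zero_iff_norm, h10_1_eq]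
    exact norm_pt_eq_r₂ (lt_of_valid (h10Code_spec i i.2).1)
  · rw [dist_h10_1_iff, L10_1_adj_iff]

/-! ### Checking a refutation of four-colourability

The surviving vertices are the points with codes below `984`. A set of excluded colours is coded by
the natural number whose bit `4 * p + c` says that the vertex `p` does not have the colour `c`. A
clause is a list of pairs `(p, S)`, read as: some `p` has its colour in `S`. A lemma comes with a
list of hints, each of which is either a vertex or an earlier lemma together with a symmetry. -/

/-- The neighbours of a surviving vertex among the surviving vertices. -/
def coreNbr (p : ℕ) : List ℕ := cond (Nat.blt p 984) ((nbr p).filter fun w => Nat.blt w 984) []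

/-- The set of surviving neighbours, with one bit out of four. -/
def nbrMask (p : ℕ) : ℕ :=
  (coreNbr p).foldr (fun w m => Nat.lor (Nat.shiftLeft 1 (Nat.mul 4 w)) m) 0

/-- If only one colour is left for `p`, exclude it for the neighbours of `p`. The result is `0` if
no colour is left for `p`, and otherwise the successor of the new set of excluded colours. -/
def propagate (p F : ℕ) : ℕ :=
  (fun n => cond (Nat.beq n 7) (Nat.succ (Nat.lor F (Nat.shiftLeft (nbrMask p) 3)))
    (cond (Nat.beq n 11) (Nat.succ (Nat.lor F (Nat.shiftLeft (nbrMask p) 2)))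
    (cond (Nat.beq n 13) (Nat.succ (Nat.lor F (Nat.shiftLeft (nbrMask p) 1)))
    (cond (Nat.beq n 14) (Nat.succ (Nat.lor F (nbrMask p)))
    (cond (Nat.beq n 15) 0 (Nat.succ F))))))
    (Nat.mod (Nat.shiftRight F (Nat.mul 4 p)) 16)

/-- `k n`, in a form that makes the kernel evaluate `n` first. -/
def force {α : Type} (n : ℕ) (k : ℕ → α) : α := Nat.rec (k 0) (fun m _ => k (Nat.succ m)) n

/-- A combinatorial symmetry of the graph of the surviving vertices: the conjugation `γ ↦ -γ`. -/
def conjCode (p : ℕ) : ℕ :=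
  cond (Nat.blt p 24) p (cond (Nat.blt p 504) (Nat.add p 480) (Nat.sub p 480))

/-- The rows of the multiplication table of the codes of group elements. -/
def mulRows : List ℕ := [
  0xbdab49ca307b9ac5a928398a418820, 0xad2f68c2725a9287b9ac31c8510c01,
  0x9ca30bdab473d8d52d09290e608062, 0x8c272ad2f652d0973d8d214c700443,
  0xb5e9594e116b1ee4a16a18820398a4, 0xa56d7846534a16a6b1ee10c0131c85,
  0x94e11b5e95635cf4254b08062290e6, 0x84653a56d74254b635cf00443214c7,
  0x398a418820bdab49ca307b9ac5a928, 0x290e6080629ca30bdab473d8d52d09,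
  0x18820398a4b5e9594e116b1ee4a16a, 0x8062290e694e11b5e95635cf4254b,
  0x31c8510c01ad2f68c2725a9287b9ac, 0x214c7004438c272ad2f652d0973d8d,
  0x10c0131c85a56d7846534a16a6b1ee, 0x443214c784653a56d74254b635cf,
  0x7b9ac5a928398a418820bdab49ca30, 0x6b1ee4a16a18820398a4b5e9594e11,
  0x5a9287b9ac31c8510c01ad2f68c272, 0x4a16a6b1ee10c0131c85a56d784653,
  0x73d8d52d09290e6080629ca30bdab4, 0x635cf4254b08062290e694e11b5e95,
  0x52d0973d8d214c7004438c272ad2f6, 0x4254b635cf00443214c784653a56d7]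

/-- The action of the rotations on sets of colours. The entries for the other group elements are
such that all colours belong to the image of every set. -/
def colorRows : List ℕ := [
  0xfedcba9876543210, 0xffffffffffffffff, 0xffffffffffffffff, 0xf7b3d591e6a2c480,
  0xffffffffffffffff, 0xfdec7564b9a83120, 0xfb73ea62d951c840, 0xffffffffffffffff,
  0xfe76dc54ba329810, 0xffffffffffffffff, 0xffffffffffffffff, 0xfbd97351eac86240,
  0xffffffffffffffff, 0xf7e6b3a2d5c49180, 0xfdb9eca875316420, 0xffffffffffffffff,
  0xfeba7632dc985410, 0xffffffffffffffff, 0xffffffffffffffff, 0xfd75b931ec64a820,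
  0xffffffffffffffff, 0xfbead9c873625140, 0xf7d5e6c4b391a280, 0xffffffffffffffff]

def symCode (row p : ℕ) : ℕ :=
  Nat.add (Nat.sub p (Nat.mod p 24)) (Nat.mod (Nat.shiftRight row (Nat.mul 5 (Nat.mod p 24))) 32)

/-- Use the image of the clause `C` under a symmetry: unless the colours of two of its vertices are
not excluded, exclude all colours but those in the clause for its remaining vertex. The result is as
in `propagate`. The remaining vertex `p` and its colours `S` are kept as `16 * p + S`. -/
def useClause (row crow e F fuel : ℕ) : ℕ → ℕ → ℕ :=
  Nat.rec (fun _ _ => Nat.succ F) (fun _ ih C a =>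
    cond (Nat.beq C 0)
      (cond (Nat.beq a 0) 0
        (force (Nat.div a 16) fun p =>
          force (Nat.lor F (Nat.shiftLeft (Nat.xor (Nat.mod a 16) 15) (Nat.mul 4 p))) fun F' =>
            propagate p F'))
      (force (Nat.mod C 1024) fun p =>
        force (symCode row (cond (Nat.beq e 1) (conjCode p) p)) fun p' =>
          force (Nat.land (Nat.shiftRight crow (Nat.mul 4 (Nat.mod (Nat.shiftRight C 10) 16)))
            (Nat.sub 15 (Nat.mod (Nat.shiftRight F (Nat.mul 4 p')) 16))) fun r =>
              cond (Nat.beq r 0) (ih (Nat.shiftRight C 14) a)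
                (cond (Nat.beq a 0) (ih (Nat.shiftRight C 14) (Nat.add (Nat.mul 16 p') r))
                  (Nat.succ F)))) fuel

inductive Tree where
  | leaf (n : ℕ)
  | node (l r : Tree)

def Tree.get (t : Tree) : ℕ → ℕ :=
  Tree.rec (fun n _ => n)
    (fun _ _ gl gr i => cond (Nat.beq (Nat.mod i 2) 0) (gl (Nat.div i 2)) (gr (Nat.div i 2))) t

/-- Exclude the colours of the clause `C`; the result is as in `propagate`. -/
def assume (fuel : ℕ) : ℕ → ℕ → ℕ :=
  Nat.rec (fun _ F => Nat.succ F) (fun _ ih C F =>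
    cond (Nat.beq C 0) (Nat.succ F)
      (Nat.rec 0 (fun F' _ => force (Nat.shiftRight C 14) fun C' => ih C' F')
        (force (Nat.mod C 1024) fun p =>
          force (Nat.lor F (Nat.shiftLeft (Nat.mod (Nat.shiftRight C 10) 16) (Nat.mul 4 p)))
            fun F' => propagate p F'))) fuel

/-- Use an image of an earlier lemma. -/
def useLemma (db : Tree) (i j t e F : ℕ) : ℕ :=
  cond (Nat.blt j i)
    (force (mulRows.getD t 0) fun row => force (colorRows.getD t 0xffffffffffffffff) fun crow =>
      force (db.get j) fun C => useClause row crow e F 64 C 0)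
    (Nat.succ F)

def runHints (db : Tree) (i fuel : ℕ) : ℕ → ℕ → Bool :=
  Nat.rec (fun _ _ => false) (fun _ ih h F =>
    cond (Nat.ble h 1) false
      (cond (Nat.beq (Nat.mod h 2) 0)
        (Nat.rec true (fun F' _ => force (Nat.shiftRight h 11) fun h' => ih h' F')
          (force (Nat.mod (Nat.shiftRight h 1) 1024) fun p => propagate p F))
        (Nat.rec true (fun F' _ => force (Nat.shiftRight h 18) fun h' => ih h' F')
          (force (Nat.mod (Nat.shiftRight h 1) 2048) fun j =>
            force (Nat.mod (Nat.shiftRight h 12) 32) fun t =>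
              force (Nat.mod (Nat.shiftRight h 17) 2) fun e => useLemma db i j t e F)))) fuel

/-- The colours of the vertices of the icosahedron. -/
def icoColor (p : ℕ) : ℕ := Nat.mod (Nat.shiftRight 0x78789c9ce4e4 (Nat.mul 2 p)) 4

/-- The colours excluded by the colouring of the icosahedron. -/
def initialMask : ℕ :=
  icoCodes.foldr (fun p m => Nat.lor (Nat.lor (Nat.shiftLeft (nbrMask p) (icoColor p))
    (Nat.shiftLeft (Nat.sub 15 (Nat.shiftLeft 1 (icoColor p))) (Nat.mul 4 p))) m) 0

def checkLemma (db : Tree) (i h : ℕ) : Bool :=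
  Nat.rec true (fun F _ => runHints db i 256 h F) (force initialMask (assume 64 (db.get i)))

def checkLemmas (db : Tree) (hs : List ℕ) : ℕ → Bool :=
  List.rec (fun _ => true) (fun h _ ih i => checkLemma db i h && ih (Nat.add i 1)) hs

/-- The clauses of the lemmas; the last one is empty. -/
def clauses : Tree :=
  .node (.node (.node (.node (.node (.node (.node (.node (.node (.node (.node (.leaf 0x568b4b450e)
  (.leaf 0x740bc74af1)) (.leaf 0x6d3930e1c25ef52bbc6e28b692d04a2d27e25fc94524ac50622d48a9)) (.node
  (.leaf 0x13371cc36fe2a60975453853984b090b237489b) (.leaf 0x8d27b3b2c3a2ef))) (.node (.node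
  (.leaf 0xa981a5527275a914e242d0fc43d08f382b90a9428c89b) (.leaf
  0x2f371ca07051bf86f219d617cb525127242c4f423cd097)) (.node (.leaf 0x20d982fec9e) (.leaf
  0x7548d4cb4f4ce171b4c34890)))) (.node (.node (.node (.node (.leaf 0x3b538c6e3107bd4957254051e)
  (.leaf 0xebb84a5)) (.leaf 0x85e05509516142)) (.node (.leaf 0x1a5d290b3688be827089b) (.leaf
  0x4d387282c3b961844c8e2a2b94a9))) (.node (.node (.leaf
  0x1d50b2f1ca37021bf86f22ba22b91a8067525d616d45a8961c57913e34e612c44ac91444310fc43688ce82b90a9428e09c)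
  (.leaf 0x8d7e3304c9d3228c823051bf9acf2b186c12a55292853c52e23f08fb23964c34278899)) (.node (.leaf
  0xb227bfa67549cb15e84b212b143110b) (.leaf 0x3b281c146fe4be516d4525cae))))) (.node (.node (.node
  (.node (.node (.leaf 0x35a515b24a5108) (.leaf
  0x7488c292fb1bba2a88a7469585ae15d854614144d452814820e5)) (.leaf
  0x1cccb302c953224c04efe4be3af28b692d42af86baea7d2982a1528275a910c242e0f443ce0ec13ad0dd82fc4b5))
  (.node (.leaf 0x8d4d33b7c6c6f24b762b58a3316d857ad4924048ef23008b2) (.leaf 0x1585d3e14d0914)))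
  (.node (.node (.leaf 0x1b222a72a4b675) (.leaf 0x2f532d0a7171c41d7f)) (.node (.leaf
  0x85f1155150f927) (.leaf 0xb4e1ca0efe84b090b43d08f3)))) (.node (.node (.node (.leaf
  0x85b616ab53890b) (.leaf 0x2f5c75d513424cd113)) (.node (.leaf 0x1d523538bbc552552512b1482d0b)
  (.leaf 0x3b1b1bf890b43d10dd))) (.node (.node (.leaf 0x4cdc725dc887051bf897545c9166) (.leaf
  0x2d3871b1bf9e75453ad4984b090b)) (.node (.leaf 0x12bd1ae86842a0d0b8427a099) (.leaf
  0x3b281c6d14e4431d0bb3d08f3)))))) (.node (.node (.node (.node (.node (.node (.leaf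
  0x13554c64b132bd0969857092ee4a490f) (.leaf 0x4d776eb45b85681561d18)) (.leaf
  0x2d386fe99d497514e490b)) (.node (.leaf
  0x135c2d6ef1b4c3630a1bca2ee2ba52dd4b322b81aa229a4a4e28c8a1e67549c917f25e092bb431d0b13ae0d5)
  (.leaf 0x2cdc7304c8b6fe45b456124e45372452113))) (.node (.node (.leaf 0x8cdcb303bf869589d50a9)
  (.leaf 0x728dc8b70e1bf867514e490b)) (.node (.leaf 0x12dd8ad4680841890173bc8c0) (.leaf
  0x8d623301ca3722dc3a12c443090b43d08f3)))) (.node (.node (.node (.node (.leaf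
  0x232a2b9a2da1b20aa71a30a7529cb97c1594962250c537449d120247511a14548f3b3248bc82e489b) (.leaf
  0x1bb9133)) (.leaf 0x30f443cd8dd)) (.node (.leaf 0x1ca0b0e1bf8a9819d497514e490b82b90a9428c89b)
  (.leaf 0x2353ecc2325ec6e2b98a8069f4a6069525548fc43ef0f423cc4eb43760da82e60ae42908a3))) (.node
  (.node (.leaf
  0x23582cf13371ca231b2c3b7021bfa2b92a609756584d3984b112b443090b43f10f482b90a9428c89b) (.leaf
  0x1d5071b1c412f545fc578)) (.node (.leaf 0x4cdcb221bfa67549c8975453853984b090b43d04d122f90a3)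
  (.leaf 0x1b4e1ca0b023bf92dd2a9ed4984b090b23748ce))))) (.node (.node (.node (.node (.node (.leaf
  0x2f1a8c486f6) (.leaf 0x2ed11ae22af8aa229a29e88ed13a8494)) (.leaf
  0x8d7fb587d50b4e8d253458cc0f282c953221c6d3101c263054bd46e24b762da1b5cac62afa2a01a7d29899d527225fe16d45a914e84dd12c24ad127244910c442c908141a101b3d10e0e3688b52265090))
  (.node (.leaf 0xb4e4cdc7281c94b0e1bf8a9819d7561453913e14e612c242c89b) (.leaf
  0x3722ec6e31a1bf86b98a8216d45a914e242e0b9))) (.node (.node (.leaf 0xd3f08e513450a3) (.leaf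
  0x2d38b0e1bf9e754539149143c90b)) (.node (.leaf 0xbb512bd1aea1371454912) (.leaf
  0x7281bf890b43d08f3)))) (.node (.node (.node (.leaf 0x4afae9819f90fc23950e223448a4) (.leaf
  0x7492cf073b2c3b57584f8539)) (.node (.leaf 0x2d093378c6cb0e1bf86f229f867525d616a14e792c242c89b)
  (.leaf 0x4d38b2f1ca0efe8b3cac89a81292245110c83d20ce82e60aeb27209b))) (.node (.node (.leaf
  0x725dc887051bf897545c9166) (.leaf 0x7053bfa6751584534b4310f4)) (.node (.leaf
  0x4d3b6fe99d527225d4539242d0f4) (.leaf 0x8d7917d75e9156))))))) (.node (.node (.node (.node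
  (.node (.node (.node (.leaf 0x8d5531ebc652f445bd14d84b512a) (.leaf 0x13224c086fe)) (.leaf
  0x7458c72f1b44add0b)) (.node (.leaf 0x373c1ca096124f8539844dd0b) (.leaf
  0x4d6e32f4c90b234b422b92a7d29849fad73851514224de113))) (.node (.node (.leaf
  0x1b58ad18ae12a843f2ce543890d613460ae) (.leaf
  0x4d4d2e82afbab94aad27e25fe17e15e0976855e15384e0526448491f22d60b2)) (.node (.leaf
  0x1f5f99d453714550f423cc4eb836849e1270899) (.leaf
  0x23531c6cae6db862da2af86974a4227529c8565857ad4314dd1272474515242f0f423cd0dd22f88bc82e60aed2a4890))))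
  (.node (.node (.node (.node (.leaf 0x117c4555143449c51d) (.leaf 0x48f11a9c54414e01c)) (.leaf
  0x2d3a3492cf3b28156514944ad10c)) (.node (.leaf 0x23534c6faf245a915e453890b) (.leaf
  0x7491ca130e1bf92dd4b422b51a0127e85fc975358515e151514274b210682bb4a9))) (.node (.node (.leaf
  0x4d38b492cbe31b4b40abea5b612c242d0da23390a3) (.leaf
  0x7541c6c6f22b94abe8ae4aab45fc578156510c642f8a9)) (.node (.leaf
  0x8cc23228c086fe8a8267525d6d3e14e6133) (.leaf 0x2cc06fe2a9d14e74b090b))))) (.node (.node (.node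
  (.node (.node (.leaf 0x1c7231bd5b612c44ae10b) (.leaf 0x110313aa0b612c4494)) (.leaf
  0x7568d463181b7cac64ad128173964c3)) (.node (.leaf
  0x7282c386fe2a6067525d4539242d0fc82b90a9428c89b) (.leaf 0x6fe19d490b))) (.node (.node (.leaf
  0xdafa2b91a7ca98) (.leaf 0x25e09571542942)) (.node (.leaf
  0x1d707421ca07231c71f1b1c246f51bbcae82b406c42afbaa04a4868029e5e7545ec948450913543d04c922f84b5)
  (.leaf 0x374e1ca37223bf914e84b090b23cd0dd82bb49b)))) (.node (.node (.node (.leaf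
  0x25ff9782540945) (.leaf 0x1bf8675b53853984b090b)) (.node (.leaf 0x7d7d2a799d453714544eb1278899)
  (.leaf 0x134e1ca3b1b457990bb3d18f3))) (.node (.node (.leaf 0x7d7e67549c853714544eb) (.leaf
  0x7542d38b3cdcde32f1ca071b1bfa2f98ae7561b53914984f8534)) (.node (.leaf
  0x8c2a2ee8b1a27529cad7222a70a3) (.leaf 0x6fe242f4f3)))))) (.node (.node (.node (.node (.node
  (.node (.leaf 0x131e45bc969b4ba12d24a5108) (.leaf 0x1d4234ddbc2111)) (.leaf
  0x7d7cb582cdd32299d527214544eb)) (.node (.leaf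
  0x8d7fb58dd3a3301ca071b8c163021bc92dd8ae628c8a1c67525d4961853e14eb52454844f8d3924add0b43f10e243690d683544d1233a0ae12910a3)
  (.leaf 0x4ced3372c88b0e1bfa2ef158514eb52613e14d090b))) (.node (.node (.leaf
  0xb5f8cc07258c08afe2be497525c893e) (.leaf 0x73ceca0709)) (.node (.leaf
  0x22b5ea8068b19d50f483b04c9125d090) (.leaf 0x1f3c2c392e825d896343fc8f8)))) (.node (.node (.node
  (.leaf 0xb4e8cbc7282c3a309) (.leaf 0x8d4cb3c1ca3b1b15ec9662554552450e13e44add1313d08f3)) (.node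
  (.leaf 0x2d62353ecc23252c73b1b2abc6a845f09552416c90) (.leaf
  0x8d4fb30eca2325ec6c6c81a5528585b516a2599161457895524dd13044ac515844b10c242d0f413ad0dd82baca9)))
  (.node (.node (.leaf 0x2cf07282c3a2b92a6113e14534dd) (.leaf 0x8ccd2f5253ad49242d89b)) (.node
  (.leaf 0x4d7d3444cdcb301c44f051bfa67549c8975152093924520ec) (.leaf
  0x7283bf914eb52612c242f4f3))))) (.node (.node (.node (.node (.node (.leaf 0x96184f8d3924d2113)
  (.leaf 0x8637134429)) (.leaf 0x1d4cb1c1b762c3aac928b15ec552450c4ec4315090)) (.node (.leaf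
  0xb301c807013bf92ce9a806974a4367535ba16a853d14e14fe138148211724420ff23e08f343b08eb13684d312bc89b)
  (.leaf 0x3b1b4af86b9242ecf443760b9))) (.node (.node (.leaf 0xb5f4cdcb301c9631bdbe490b83b10eb)
  (.leaf 0x1ca37221c24efe4ba0ac62afa2a04a09e7575a856124e45344452cf443748ae)) (.node (.leaf
  0x135c4d387281c8cb0e1b9cae54b812dd8b692ce1b24ac41b0d2a48a4128b49c4a7025d457215ac961156a137b44c91243e60e743810d6)
  (.leaf 0x37221bf914e84b090b43d08f343760ae)))) (.node (.node (.node (.leaf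
  0xb0e1c246ef8ae4a9844f893314534dd) (.leaf 0x6fe19d514914e490b)) (.node (.leaf
  0x8d4d33f2c7130a7bd52ee85f057b1548520) (.leaf 0x1ca06fe242d0f423cecdd))) (.node (.node (.leaf
  0x4d73b494c8e2fa2b946e24afa2b92aada9814bc50d82b90a3) (.leaf 0x15ec9551548544450d11a)) (.node
  (.leaf 0x36fe99d497514e490b) (.leaf 0x23554c78b13457dd5814b450e)))))))) (.node (.node (.node
  (.node (.node (.node (.node (.node (.leaf 0x857354f24b9108) (.leaf 0x7598ccf951249111b)) (.leaf
  0x7282c886fe99d497514e490b)) (.node (.leaf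
  0x7253bf86d74af86b919d7561753893e14e5121446090bb3d10dd136889b) (.leaf
  0x1d523532c162ef154ad4e84b290b))) (.node (.node (.leaf 0x43f08fb23948e2235a0ae42a50a3) (.leaf
  0x2d2533b2ca130e4ba269f4a604e883950dd13688d6431c8b582c84a4)) (.node (.leaf
  0x1ca0b0e1bf867525d453984b090b82b90a9428c89b) (.leaf 0x6afa2b943f10e282bb4a9)))) (.node (.node
  (.node (.node (.leaf 0x97b248091d) (.leaf 0x6de4b046b32ac228a1a15258d8ee212240c494)) (.leaf
  0x2c886fe2be514eb52490b)) (.node (.leaf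
  0x1d44b492ca12e82b952be8a8229f4a49e7525e0975258715e2552d49b4f85394485118143d0f423ce0e523588c412d74b2129049e226c899)
  (.leaf 0x1ea01a5616514dc515))) (.node (.node (.leaf
  0x374e1ca0efe1bc867525d4961b53913e242d0fc43688ce82b90a9428e09c) (.leaf
  0x1d50b258c9071b1c40af92b99acf8b20a954a4917f15e0962255c54525089201454899)) (.node (.leaf
  0x1d253371ca0b222c386fe1af8961b524539242c4a4) (.leaf 0x1bf890b43d08f3))))) (.node (.node (.node
  (.node (.node (.leaf 0x15e45404487918) (.leaf 0x750dbc2111)) (.leaf 0xc3d10f363748be)) (.node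
  (.leaf 0x1c94b223bf867525d514e44f8d3924cc90b237489b) (.leaf 0x71cec6e3095bd4945))) (.node (.node
  (.leaf 0x8a9dea019d4975658491443f20ae42a50a3) (.leaf 0x2152248211a)) (.node (.leaf
  0x4d4e31bebca0ec13af097) (.leaf 0xb4e1ca0efe8a8090b43d08f3)))) (.node (.node (.node (.leaf
  0x216ab53a10c) (.leaf 0x1ca06fe19d5272b53853984b090b)) (.node (.leaf
  0x7542c8871b1bf86f229f8978857914e84b090b12d60b2) (.leaf 0xec6c6fe242d0dd))) (.node (.node (.leaf
  0x1ca07252c386fe2a6097545c9166258715e453893e14e51334485118244d0fc43744da82b90a9229089b) (.leaf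
  0x7d4c7421c412d08ae569849f8a79843090b)) (.node (.leaf
  0x2d7c7542cc0b0e3bf86f2458615e253914924fb539242d0da432509b) (.leaf 0x1bf914e84b090b)))))) (.node
  (.node (.node (.node (.node (.node (.leaf 0x1d4531e1c586f745bc56e15a215c453492e84b512a243d108)
  (.leaf 0xdbf4aeb)) (.leaf 0x2a1528243754da42f84b9)) (.node (.leaf
  0x7544d1471b4c412f54b77aa08a3267513ac4c5) (.leaf
  0x1d70b5b1d523531ca1f1b1c246ef2ba12d04b3c6c48a8229f6a612921a0127e79d61652520537449c51584050f422f84b51278899)))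
  (.node (.node (.leaf 0xb5f4cdcb301ca0efe1a806754585d4e14e50fc82b84a4b28c89b) (.leaf
  0xbcdc7281bf867514e490b)) (.node (.leaf 0x4cdcefe1b9a2e18a54975b4f8539b4320ae) (.leaf
  0x2cbd2e82b1a16624e4d3444508fb23950e243588a4)))) (.node (.node (.node (.node (.leaf
  0x396c257510a) (.leaf 0x278ece0d7782d547418cf13371c3a30557da5ebc781597962b981)) (.leaf
  0x1bfa67514e490b)) (.node (.leaf
  0x2d7c74e2d27b303ca0b22ec6c6e82abc6a899d527245fc97844c212c242e0fb22920a3) (.leaf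
  0x23532d3bb28ec6d12bc43090b))) (.node (.node (.leaf
  0x2d62353ecc2325ec6e2f52abc6a845f09552416c90) (.leaf 0x3b542d386fe79d514e84b090b)) (.node (.leaf
  0x2337dc886fe8a8267514dc51513ac49e) (.leaf 0x1ca0efe453a12c242f4f3b3760ae))))) (.node (.node
  (.node (.node (.node (.leaf 0x2d6c56524e4537e4d211323eece543588d1) (.leaf 0x25bc909)) (.leaf
  0x8d7fb588cc23058be46c82b1b675152090873964c3)) (.node (.leaf
  0xb301c807013bf8ae17b3d2ce2a9c6972a5529019d4d6e85aa14f453853f84e0520845c910242e0ff23e08f313684d312bc89b)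
  (.leaf 0x12be8ae44a92291ca3))) (.node (.node (.leaf
  0x2d7c7548ca87252c8930d1bf8af91bca2ee2ba6ecf1aa117545a915e154993e44ce12c44ad113443090b) (.leaf
  0xac61b050fb43890d6d2b90a9)) (.node (.leaf
  0x235fed623301c463058be46d41b222c6d9d614f152213724489084388899) (.leaf 0x453912b4431d0b))))
  (.node (.node (.node (.leaf 0x216ab57890b) (.leaf 0x2c387058c0b6fe1b9a2a079d497514e613723ce0b9))
  (.node (.leaf 0xb0e3bf9e7525d514e44f853924cc89b) (.leaf 0x738e58691382b94a9))) (.node (.node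
  (.leaf 0x1b371c152f9) (.leaf 0x2c886fe158514eb524534445090b)) (.node (.leaf
  0x4d393371cc36fe1a7c9752584955154114e14e612c449d114242d0da42fa0ae1292ca3825d090) (.leaf
  0xcd78b598ccd17d))))))) (.node (.node (.node (.node (.node (.node (.node (.leaf
  0x4d1094f64a9d291439108) (.leaf 0x568156114d84b6d2a)) (.leaf
  0x133b4c38aef2a9e16d857ad4984b050c43690be)) (.node (.leaf 0x50613a34b2) (.leaf
  0x6fe19d6d4e84b090b))) (.node (.node (.leaf 0x1b4e1ca0b0e7bfa16a453890b) (.leaf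
  0x6ec4bae69f4a608ef43744da22d60b2)) (.node (.leaf 0x7544d4e71b1bc92cf1a2de7545560ec13ad097)
  (.leaf 0x23532d3bb3b4c3aef5ebc8aef4b762da8ad46b21a0127e45548fb83b04eb22d48a4)))) (.node (.node
  (.node (.node (.leaf 0x45f1155450d127) (.leaf 0xebd8849)) (.leaf
  0x4d7cb4e2cf23301ca1302dbfa2f92b1a2b94a6267549c917585b513e444c90b)) (.node (.leaf 0x20d9d32d0b8)
  (.leaf 0x1cc07284c8b6fe4be515e14ddd2c13d08f3))) (.node (.node (.leaf
  0x8d4cb492cbfb1b2af867e156592b83688ce) (.leaf 0xb4e1bf8675d5d490b)) (.node (.leaf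
  0x1d253371ca071b2c386fe1bc86be19d49754538539242e0ae42a50a3) (.leaf 0x6fe242d0f4))))) (.node
  (.node (.node (.node (.node (.leaf 0x8d182baca3) (.leaf 0x8cf06fe4ba217525b61662587939)) (.leaf
  0x8d7fb581d3a3438cc07281c3a3058be4af01ba06c8d9d617e85405294487519)) (.node (.leaf
  0x1d4774e4cdc7282c14efe19d49752584539242c89b) (.leaf 0x3b1b8c686b985b516a453890bb3d20b9)))
  (.node (.node (.leaf 0x12d04afba9f) (.leaf 0xeca06fe19d490b)) (.node (.leaf
  0x4cdc7282c38efe8a81e7525d6d3e14e50f423744c922fa0ae) (.leaf 0x36a01a56272)))) (.node (.node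
  (.node (.leaf 0x25d496184f8d39) (.leaf 0x7491cec6feb56613e14e612b)) (.node (.leaf
  0x2f371bf92a78a8067514560f413ae0ae) (.leaf 0x6fe258ad4e))) (.node (.node (.leaf
  0x3b251bf92be1ae46ab99d5272b4fb53984b090b43f10dd428c89b) (.leaf 0x2d3871b1bf9e7584b090b)) (.node
  (.leaf 0xbcde309dbf867525d516d4524539242e0ae) (.leaf 0x71b2a5d15e156512b742c8dd83390c9))))))
  (.node (.node (.node (.node (.node (.node (.leaf 0x231845bc969256e15824ba12d243d108) (.leaf
  0x4fc13460a3)) (.leaf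
  0x8d463182c2c6df2afa2b94ad069f4a60a844a0e17e8572153149990843744daa3660bf82b90a3)) (.node (.leaf
  0x2c38709abbcae8b52490b) (.leaf 0xdc8871b1bf9e75b52490b))) (.node (.node (.leaf
  0x13371ca07252c3b7023bf86a02a611614538539242d0fc43d20ae42a489b) (.leaf 0x24f423cd0dd836a0b9))
  (.node (.leaf 0x2cf2f371ca0b0e1bf86f279d514eb4f8539e4b090b23760ae) (.leaf
  0x3bfa2a084b2d0ce3d08f3)))) (.node (.node (.node (.leaf 0x6c81a54675) (.leaf
  0x135c8c90b234bea16524dd130)) (.node (.leaf 0x7282c386fe19d7561b53913e14e490b82b90a9428c89b)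
  (.leaf 0xb4e2cf07252c3a2f94ba22b94a6356143748a3))) (.node (.node (.leaf 0x4586d3e14e4914) (.leaf
  0xb4e1c6c6fe1bc9e75453ad4984b090b)) (.node (.leaf 0x23588cc3702bbe667549c8975b53853984b090b)
  (.leaf 0x6fe453a12c242f4f3))))) (.node (.node (.node (.node (.node (.leaf 0xb35ec1cafd) (.leaf
  0xabb4a7367f)) (.leaf 0x7b75eda)) (.node (.leaf 0x22a3da5e276) (.leaf
  0x8d4f722ec6c6fe8a8114e242e0f4))) (.node (.node (.leaf 0x96be568928) (.leaf
  0x2d607544c8871b7bf9acf2a55292759854524e4920244e0a3)) (.node (.leaf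
  0x134e4cdf7222c386feebca2ddba5e675156514e14e612c844c90b43ce0ce82e60ae127209b) (.leaf
  0xefe453a12c242d0f423ce0ae)))) (.node (.node (.node (.leaf 0xb3f7bb856b757494b) (.leaf
  0x1c6df10ebca2b5ea8068b19d50f483b04eb)) (.node (.leaf 0x1bf914e84b290b) (.leaf 0xae1da80695)))
  (.node (.node (.leaf
  0xb4e4cdc7301ca0b0e8c286fe2a6267525d453914de12c145490b43f04eb82b90a9428c89b) (.leaf
  0x23538cbcb232c77b1b8b86ea74a6216d55a915e24dd130844c90b43d20f3836a09b)) (.node (.leaf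
  0xae6ab8467583548d2) (.leaf 0x2d5897515c9d13))))))))) (.node (.node (.node (.node (.node (.node
  (.node (.node (.node (.leaf 0x25a5d5c256c92e24a490f) (.leaf 0x1d60b027bb751d)) (.leaf
  0x1d50b4e2cc0f281c6c7093bfa2f91bc8aef2af89758599161653854914e612c24ad10c242c4fdb3d20f313908d222d60ae22a6097))
  (.node (.leaf 0x1ca3b252c386fe2a6067525d4539242d0fc82b90a9428c89b) (.leaf
  0x135bdd3a32f1ca13242c8cb222c77b1b8c24b052be4a9f4a61e7555a855224dd130844c90b))) (.node (.node
  (.leaf 0x1d38b491c94b0e7bf869519d527275d5d4e24cd130444ecf423cc89b) (.leaf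
  0x2d39337dc89efe9b222a019d4975453a13e14e612c42b90a3)) (.node (.leaf
  0x2b94a9c1a6c677d9c20fa838c8d282b20a0) (.leaf
  0x1d523536d3871b1c4130e1c24aef4b762da8ad46b21a0090522d4890)))) (.node (.node (.node (.node
  (.leaf 0x231b8c41ef5255c950149451e) (.leaf 0x6b2ea2d280)) (.leaf
  0x1d52b302c953221bc9eddea8267585b516a453ad49449c4eb)) (.node (.leaf
  0x1d707291c8c71b8bb06cc1a4c67025e0957754dd4e1525121446110c242f90623a08c712d4892) (.leaf
  0x3353ec6d30e8b686c82af8aa049c8975258515e4555d2c449dcf423cf0b982b94a9))) (.node (.node (.leaf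
  0xb5fdd38b301ca231b3bf9161857894e452493ed4e512b43688ce) (.leaf
  0xb4e4cdf7222c386fe4b88ac619d516a459ad49244c90b)) (.node (.leaf 0xb222c386fe2bbed4984b090b)
  (.leaf 0x6fe453890b43d08f3))))) (.node (.node (.node (.node (.node (.leaf 0xb564d10b16) (.leaf
  0x20e513444a9)) (.leaf 0xb0e1c246ef2afa2b91a7e27944f893314534dd23104c3)) (.node (.leaf
  0x13371ca0b0e2c086fe2a6067525d496114e612c242d0fc82b90a9428c89b) (.leaf 0x1c6c6fe19d490b)))
  (.node (.node (.leaf 0x975e58713e) (.leaf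
  0xb1c1bf867545fc97825c896d255c55024fa52c844c90b83688a4)) (.node (.leaf 0x85f097b4554543449c51a)
  (.leaf
  0xb5f2cdeb251c8f7228c6e30a2c146fe8bba2da8b1869f4a2c97515ca166458493e844c90b73d08f313248b382b90a3))))
  (.node (.node (.node (.leaf 0x6e6da81272) (.leaf
  0x2d6d3531d38b3b1ca0b0e2c162ef8b192c18ae469f4a6214e452514244ad10c742e0ef83688ae)) (.node (.leaf
  0x1ca0b0e1bf867525d6d4e14e490b82b90a9428c89b) (.leaf 0x2d38b3c2cee32f1ca0b0e))) (.node (.node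
  (.leaf 0x2f371c976fe) (.leaf 0x13598c14efe4be62c81a80675b53a10b)) (.node (.leaf
  0x8d62330dc0a67549c8975b53853984b090b) (.leaf 0x3b4e2cf133b1ca10fb82b84a942908a3)))))) (.node
  (.node (.node (.node (.node (.node (.leaf 0x37561d447431c586f7248c51c) (.leaf
  0x2d6c7077bcc570158391e)) (.leaf 0x8cc23022bfa675d5d514e4524539742e0f4)) (.node (.leaf
  0x754cd4c71b4c406f2) (.leaf 0x374e1ca1e754539149742d0dd))) (.node (.node (.leaf
  0xb4e2cf0b2f2c38aef) (.leaf 0xb221bf867514e490b)) (.node (.leaf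
  0x4d4f74ebcdc7288c6e3091bf867525d516d452453984ac515c4304eb82b90a3) (.leaf
  0x2358bd38b378cc3b0e1c247051a5d29025848fb73d08f323948a4)))) (.node (.node (.node (.node (.leaf
  0x234f8cb56ee) (.leaf 0x88cc516)) (.leaf
  0x7541c6c6a099d527285d756d154913e24e612c44ac520842c8eb)) (.node (.leaf
  0x2f4e2d2533b2ca231b1bc89784524942242e0dd43688ce) (.leaf
  0x8d4fb30eca2325ec6e2b98a806954a15175d58495524dd13044ac515844910c242c8fc43ed0f423cc4eb43760ae42908a3)))
  (.node (.node (.leaf 0x2d63b308c94aaf1aa117c255491dd316c90) (.leaf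
  0x2d3871b1bfa2c819d514e84fa12c242ecdd)) (.node (.leaf
  0x4cdcb221bfa67525d514e14e612c242d0f423744d122f90a3) (.leaf
  0x4d3a3302c38b022bf8ae84b7514eb52510c742ecf423748ce))))) (.node (.node (.node (.node (.node
  (.leaf 0x73d08f382e489b) (.leaf 0xaf04b060e5)) (.leaf
  0x235f8d247431ca13228c14b023bf86e22b1a67549c916ab52513e84dc93384b0920145090b83d10e282b90a3))
  (.node (.leaf 0xb271c808f3136a8be427089b) (.leaf 0x1b212be1ae7aa029c90f443760b9))) (.node (.node
  (.leaf 0x2d7c7548ca87252c8930d1bf8af91bca2ee2ba46a845f1175d5b495d156455264f913384b112b444d0eb)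
  (.leaf 0xb3d20f3136a0b9)) (.node (.leaf 0x50673004b5) (.leaf 0xdbf92be8ae514e742e0ae)))) (.node
  (.node (.node (.leaf 0x8cf073b2cbef28) (.leaf 0x8cc07058c0a6fe2be46e619d497514e6099)) (.node
  (.leaf 0x2c386fe1bc8ad72ae4aab29fb67525d514e44f853924cf92c242d0a9428c89b) (.leaf
  0x374e8cc07281bfa2cf2b226a04a4910c83d20ce82e60aeb27209b))) (.node (.node (.leaf
  0x1ca0b0e1bf8a9819d4975b4f8539242d0fc82b90a9428c89b) (.leaf 0x2d3bb1b1bf8675453890b)) (.node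
  (.leaf 0x25561521511143849d11a) (.leaf 0x135f1d60b021bf92f9))))))) (.node (.node (.node (.node
  (.node (.node (.node (.leaf 0xb565c7d16f457d109) (.leaf 0xbcce3302cb2eff1bfa2f82bac57045b915b))
  (.leaf 0x1c977228c286fe1b5c69f49fa27529c8975859ad6143f10d623104c322a50a3)) (.node (.leaf
  0x2d393371ca0b0e1bf8a9819d497514e612c242d0fc82b90a9428c89b) (.leaf
  0x135b8d61f531d093378cbe2b94a62d4e84b2113843090b43d20da))) (.node (.node (.leaf
  0x134e2cbc728b3ec8e522910a3) (.leaf 0x83948e223598a4)) (.node (.leaf 0x43d1cf323760da132449c)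
  (.leaf 0xcd4cb4e4ceef1b4c38709ebc8aef4b762da8ad46b21a020ec13ac8b5)))) (.node (.node (.node
  (.node (.leaf 0x2d38b0eb9c853943f20ae42a50a3) (.leaf 0x7084baa2bd1a65a5b284620114588c12205060))
  (.leaf 0xdb5e2b98ab069f)) (.node (.leaf
  0x1f5f1d447282c3a29f2a6067525d4961b4f853914dc515143d90b43d08f313ae0e523588d243450a9129049e226c899)
  (.leaf 0x1ca370e8c2617f1515142))) (.node (.node (.leaf
  0xdd387281bf8a9819d4975b53913e14e490b43f2cf482b90a9428c89b) (.leaf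
  0x1d50b258c9071b1c40b023bf8af98a81e7545fc57824805154432cf422f8899)) (.node (.leaf
  0x1ca07234c1cad34b406cb29e6178255e1508514506d4044b5) (.leaf 0x30f463748ce))))) (.node (.node
  (.node (.node (.node (.leaf 0x8cc0b251bf9ef9) (.leaf 0x10fca3960a3)) (.leaf
  0x8d4c7194bd3af24b752d01b122b95a6068b49f8a7945f217715811272480890)) (.node (.leaf
  0x4cdc725dc08efe19d4975458514e14e490b237489b) (.leaf 0xec6e31a45a914e242ecdd42fa0b9))) (.node
  (.node (.leaf 0x2f488cfe32a) (.leaf 0x8ae7a9f4a609571542145)) (.node (.leaf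
  0x2353dd38b498cbc728dc8930e1bfb2f9ebc86ef8b692cf8a8229f4a49e7525e21654554948b4f8539449e0ff43d08f383b04eb12d449e)
  (.leaf 0x23324c8d172859916124d2113)))) (.node (.node (.node (.leaf 0x1efe85ab14e84b090b) (.leaf
  0x1ca36fe4be453974b090b)) (.node (.leaf
  0x71b1bf92f91bcb69819d4978857914e84b090b43744da12d60b282b90a3) (.leaf 0xec6c6fe242ecf4))) (.node
  (.node (.leaf 0x1d0ef1a4c446f62bc5173159754624f0512) (.leaf 0x2cdc71b1bf86f279d6d4e84b090b))
  (.node (.leaf 0x1bfa67525d6d4e14e490b) (.leaf 0x135fdc089744594912)))))) (.node (.node (.node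
  (.node (.node (.node (.leaf 0x1c7d31e2c652f445bc568856094f84b5d291439108) (.leaf
  0x8b446b88abe2a88a74a7a)) (.leaf
  0x235fed607438cc07282c953228c146f21bbd2e82b1a67549c916a453ad4984de12c449d118244890b24220f443890dd12d4899))
  (.node (.leaf 0xae54b890fc43590a9d2910a3) (.leaf
  0x2f371c6c6fe9bc92e279d617c85aad49449c90b83d30ce))) (.node (.node (.leaf
  0x13442d0c7251c477021bfb6f94af8aac29f9121446090b) (.leaf 0x20f423cd0dde36a0b9)) (.node (.leaf
  0x4b762da8a81e7543d08f383b08dd125d090) (.leaf 0x71bbbd497b44add0b)))) (.node (.node (.node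
  (.leaf 0xed5231b457a10c) (.leaf 0x23582c8a71b2c14af9b53a12c242ecec)) (.node (.leaf
  0x7548d4df1b1c406d71a7f69825e0957250890b) (.leaf 0x1bf8af9eb9a2a01a5494f152093744c0515143e0d5)))
  (.node (.node (.leaf 0x7282c386fe2a6067525d6d4e44f8539242d0fc82b90a9428c89b) (.leaf
  0x2c886fe4bd5e75453ad4984b090b43d10dd)) (.node (.leaf
  0x2d27af2d9d5272154954944ac520b42ecf423ac4c5) (.leaf 0x71b1b20aa725b514e742ecf423748ce)))))
  (.node (.node (.node (.node (.node (.leaf 0x75c6d6e3321c8c6fa) (.leaf 0x2065812d02c)) (.leaf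
  0x7532c716dd9b6928b15ec552450c4ec43148bc12ed090)) (.node (.leaf
  0x7514cdc7282c38b053bf86c68a7ca9825d4539242e0e523590d142a489b) (.leaf
  0x2cdc7308c95b221c146fe1b2116d14dd0f3))) (.node (.node (.leaf
  0x1ceef388c2b6ef45d495a44f913324a1113) (.leaf 0x7541c6c6f24b77ada443190b)) (.node (.leaf
  0xb148c28af38bb8ac8450d1272474ceb825c890) (.leaf 0x2d3bb281a5514e642d0f423cecdd)))) (.node
  (.node (.node (.leaf 0x1ca0b0e1a54675258453984cc51443f2cf423ce0ae42a489b) (.leaf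
  0x1ca06fe19d757514e490b)) (.node (.leaf 0x4cdc7282c386fe79d4975b52453984b090b82b90a9428c89b)
  (.leaf 0x7281bf9ea0b53890b))) (.node (.node (.leaf 0x25d4961c4f8539) (.leaf
  0x135b8d4e32f4c90b23ec6e2a02a7d29879d517f24dd130844ecf463760ae)) (.node (.leaf
  0x13378cbc7282c88b0e1bf8961b524539242f8da) (.leaf 0x551748c51c)))))))) (.node (.node (.node
  (.node (.node (.node (.node (.node (.leaf 0x2d7b8548920) (.leaf 0xd47490b)) (.leaf
  0x2c886fe99d497514e490b)) (.node (.leaf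
  0xb4e4cdc7281c94b0edc08efe2a6067549c8975258514e44f8539242d0fc42a489b) (.leaf
  0x23548d14f1c8c40af2))) (.node (.node (.leaf 0x6d38b3c1ca0b0e) (.leaf
  0x8c306ec4bacae5bb8867729c20fa83544d282ca0ac8280495)) (.node (.leaf 0xb021bf92f9d584539) (.leaf
  0x23531c6eef52b9b6e18b68abe8ae6a7529c8565b50c537449c91d14570f423cd0dd22f88bc1270890)))) (.node
  (.node (.node (.node (.leaf 0x1a5767583b04eb) (.leaf 0x373dbca87082bfca9775f6d5614584d4)) (.leaf
  0x6fe99d514e14e490b)) (.node (.leaf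
  0x7511ca0b0e8a7ca9879d49752586d3e14e450f742d0f423ce0e523590d1129049e226c899) (.leaf
  0x1d51f531d147104bd46f24555127))) (.node (.node (.leaf 0x1c95302dbfa2f915c8966) (.leaf
  0x1d50b3cecee324dc8871b3bf8af94b762da2b18abe4a09e7515e1d6a4450913443190b43750a3)) (.node (.leaf
  0x13371c14a9f25d4539d2b90a3) (.leaf 0x6feb53a12c242d0f4))))) (.node (.node (.node (.node (.node
  (.leaf 0x45bed2d74a850e) (.leaf 0xdbc2111)) (.leaf 0x3ad78ae5298)) (.node (.leaf 0x1322dc086fe)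
  (.leaf 0x1d70b5b8d4df45ec6c6f54b77ada45fe14224048efc3548c0))) (.node (.node (.leaf
  0x2d7cb492cecb303bf9172458615e253914924fb539) (.leaf 0x117f1541d45)) (.node (.leaf
  0xb494cec723dc8a71b1bfb2f9ebc92e28b692cf8a8129279d517f25e2165455512783fd0f423ce0ec13ac8dd129049e)
  (.leaf 0x2353dd387283bf92dd4a9e2a04539d2c242c8f3)))) (.node (.node (.node (.leaf
  0xb4e7cf0b2f2c38aef) (.leaf 0xad6073bdc0a2e12b222b98a8229589ca165857914984f8d3944c112b443110b))
  (.node (.leaf 0x13371c6c6fe4be46f229f8978857914e84b090b12d60b2) (.leaf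
  0x7254c0b6fe8be46be8ae469f15ca16d2452113))) (.node (.node (.leaf 0x267549c8537145611283b04eb)
  (.leaf 0xb4e1d08b3c8cbc7281c9471b1c422f94ba22b9d58613e44af10c242c4da)) (.node (.leaf
  0x1d5130e154a12c44ac520b42ecf483cc4c9) (.leaf
  0x2f1d1bd86c04a1613b84a08f343690ce23290c942f909b)))))) (.node (.node (.node (.node (.node (.node
  (.leaf 0x4c78b1945bf96884b752a) (.leaf 0x235c2cd6307)) (.leaf
  0x8d7fb581d263301ca0b254c8a3051bc86ef4ba22b58a3228799d527245a914eb52613784b11274460912242c90812d4899))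
  (.node (.leaf 0x8b44aaf1aa227d23af4c543090b4) (.leaf 0x1c6c6fe79d490b43d10dd))) (.node (.node
  (.leaf 0x4cde3302bf86a019d5272753b4f3437489b) (.leaf 0x6fe19d497514e490b)) (.node (.leaf
  0x13378c086fe1b9a2e14afa29525d613e14e6137b4308dd13260b982b90a3) (.leaf
  0xb2f4ba117514d1114744c8e5438b0d6)))) (.node (.node (.node (.node (.leaf
  0xdc886fe8be497b85a8555453a144146890b) (.leaf 0x0)) (.leaf
  0xb3c4cdc7281c95302dbfa2f92a81e7545d616d14e490b)) (.node (.leaf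
  0x7542d2632f2ca071b1bc86d71a7f69825e1149250a12c843090b) (.leaf
  0x8d4f74eecc3b288c97b1b8b3e2b98a806954a1616d45a8966458515e255493744c112b1456112443090b23f10fb43d08f313ad0e543760ae42908a3)))
  (.node (.node (.leaf 0x10f4a37489b) (.leaf 0x13372c886fe4598561453ad4984f890b)) (.node (.leaf
  0x23584cdcb228c6cb052be767549cad4ec4b090b43d04c5) (.leaf 0x7541c6d30e4bd4aefbba2290443190b)))))
  (.node (.node (.node (.node (.node (.leaf 0x6e62b3c6958a4a675) (.leaf 0x2bf517e)) (.leaf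
  0x1edd7b6928b839d0e0)) (.node (.leaf 0x7514cdc7282c38b053bfa29f6a6067525d514e44f8539242c89b)
  (.leaf 0x3b1b4a9e2a0242d0f4d3760b9))) (.node (.node (.leaf 0x6e61a81272) (.leaf
  0xb374c886fe1bbd2e84b88ac699d516a459ad492481118242e0f443744b522b8899)) (.node (.leaf
  0x974e4dc912) (.leaf 0x2d3bb281c6c9752586d0c742d0dd83260ae52a609b)))) (.node (.node (.node
  (.leaf 0x2166b4f9134) (.leaf 0x23582d38b3c4cee3301ca0b0e1c146fe19d497514e5133242d0a9)) (.node
  (.leaf 0x2cf443744c9) (.leaf 0x7281bfa2a0242d0f423cecdd))) (.node (.node (.leaf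
  0x1cc07282c387051bf8975258514e14e5d2c242c89b) (.leaf 0x859856124f893914d0914)) (.node (.leaf
  0x1173c59653784c0912) (.leaf 0x1d607304522d08))))))) (.node (.node (.node (.node (.node (.node
  (.node (.leaf 0x116f457dd2a1439109) (.leaf 0x12fb1bd8af08bb517315a21664595d2d)) (.leaf
  0xb4e4cee30a1c262b91a7c975859ad6143f10d622d50a912910a3)) (.node (.leaf 0x25ac95de4a110a) (.leaf
  0x97445cf16584c0912))) (.node (.node (.leaf 0xb302c563123bfa16a453890b) (.leaf
  0xb282c246ec4bad2e84b88ab99a7ca9c1a6da9819dd12144620fa83960e343744da23488b582cb4ae82b20a0))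
  (.node (.leaf 0xdb3de7583b04eb) (.leaf 0x7541c6c7104c392f52bbeee8)))) (.node (.node (.node
  (.node (.leaf 0x8ca8ae68b686c82a9c68c29d4a72e5f0565258894314dd127448091d446851523ce0be22f049c)
  (.leaf 0x2cd46ee)) (.leaf 0x135f4cdcb303c146fe99d527215220ec)) (.node (.leaf
  0x13378c976fe4a9ca9819d4975459914e74f853984ded2c242c4da82e489b) (.leaf 0xec6c6fe74b090b)))
  (.node (.node (.leaf 0x1a5667583b04eb) (.leaf 0x7541d4cb303bfa2f965385494432cf4b3744da)) (.node
  (.leaf 0x1ca0b0e1bf867525d514e14e490bb3d20ae42a50a3) (.leaf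
  0x134e1ca0b223bf8aa7453a12c242e0ae))))) (.node (.node (.node (.node (.node (.leaf 0xae11b21e75)
  (.leaf 0x1b20aa099d5272)) (.leaf
  0x1d507534d16b302c953222c7071b4c412f54b762da8ad7aa08a3228799d616d45a914e449d10c141a10113ad090))
  (.node (.leaf 0x751dd393371ca0b053bfa29f2a6067525d4539242c89b) (.leaf 0x1bfbae6859514e138c8d2)))
  (.node (.node (.leaf 0x231b1bf8abea5b612c242e0ec43ad0da2338497) (.leaf 0x2f338c812ff)) (.node
  (.leaf 0x7282c386fe79d49754538539242e0ae428f49b) (.leaf 0x7283bf890b43d08f3)))) (.node (.node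
  (.node (.leaf 0x2c71f1b4bd46f225e0950) (.leaf 0x12be1a7ca9853d08f323748be)) (.node (.leaf
  0x1ca0b0e2ae4aab1a7c675453913e94b090b82b889b) (.leaf
  0x23388cc07058c08afe4be517c85d4961449c91423ec8e523448a4228c890))) (.node (.node (.leaf
  0xb4e1ca0b0e1bf8a9819d49752586d3e14e612c242d0fc82b90a9428c89b) (.leaf 0x1b4e1bf8675453890b))
  (.node (.leaf 0xbcdc6fe99d497514e490b) (.leaf 0x134e8d2773b85a895e)))))) (.node (.node (.node
  (.node (.node (.node (.leaf 0x94f24a7908) (.leaf 0x2d58af04b05ce5)) (.leaf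
  0x23519d247331ca23182c2c7092c093012bf92f81bbd2e81b7cabe4ad12982a14a844a0d28275aa15c14fd11864220f443cd0dda3644c982fe0ae))
  (.node (.leaf 0xbc6c6f28ad6d4964add0b2406097) (.leaf 0x1c6c6fe79d490b))) (.node (.node (.leaf
  0x12f51bc8978c5789504538549) (.leaf
  0x23252c7131b8c086f28b692be1ae52a779d517f25e115e843190b836a0b9)) (.node (.leaf
  0xae54b898fc23890a912910a3) (.leaf 0x7287bf92e884b2d0c242dcf4a3cd0dd82bb49b)))) (.node (.node
  (.node (.leaf 0x7bfa2f98a8215e853a12cd42d0f4) (.leaf 0x3d38b492cf0b3b)) (.node (.leaf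
  0x6d74b40abeda6067e) (.leaf 0x2d38b3c1ca11752598539145211343948a3))) (.node (.node (.leaf
  0x13371ca07252c3b7021bf8a984538539242d0fcc3d20ae42a489b) (.leaf
  0x1cf372f2ca12f91bb12eb4ba12e22af8ab92a7069b2a6067775d5172459855344cd121446111443744d212d60b242b90a3))
  (.node (.leaf 0x85b754fb538548842d108) (.leaf 0x71bb526d0c242e0ce))))) (.node (.node (.node
  (.node (.node (.leaf 0x23538c6e3108bd616a257612c843390a) (.leaf 0x2057b10041d)) (.leaf
  0x2ee25b752d62b2cac42acaeab4a2d27e15ec57815b096b857495a25545521542145450c942249491e147610113b2ceb82ca097))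
  (.node (.leaf 0xda5de90) (.leaf 0x8d4df45ec6c6f545fc578))) (.node (.node (.leaf 0x2348bcfcae9)
  (.leaf 0x7541c6d2f54ba12dd1b1068b49f897815d8957151453f642c89b)) (.node (.leaf
  0x1ca0b0e1bfbaf22a5e675453853984b090bb3d08be82b84a4) (.leaf 0x296d4539d0b13d08f343760da))))
  (.node (.node (.node (.leaf 0x7c6e16a857a10c242dcf423cc89b) (.leaf
  0x23588d4cb4e8cc0728dc88709ebc8abeea81e7525d615e456453984b110b83b08b542b90a3)) (.node (.leaf
  0x13371ca0b0e1bf867525d453984b090b82b90a9428c89b) (.leaf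
  0x2d38b3c1ca0b222c386fe453ad4984b090b43ee0ae42908a3))) (.node (.node (.leaf 0xd57452f143490a)
  (.leaf 0x4d6e3534c90b23ec6e3094bd517f15ec9551549143)) (.node (.leaf 0xb222c386fe99d497514e490b)
  (.leaf 0xb561c7d17d249111b)))))))))) (.node (.node (.node (.node (.node (.node (.node (.node
  (.node (.node (.leaf 0x568752850e) (.leaf 0x7501d0131d25d1d65)) (.leaf
  0x4b4127e25d4972258593e14e493322d60b212910a3)) (.node (.leaf
  0x7301ca0b0e1c146fe2a6067525d496114e4537242d0fc82b90a9428c89b) (.leaf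
  0x4d6e3538cbd3242c8fb1b8c262b99a80a9f4a61e7545fe16d45a915e24dd130844e0ae))) (.node (.node (.leaf
  0x2d39f3c1ca0b0e85a895e) (.leaf 0x2d38728dc886feea8067585f0539242c8b542b90a3)) (.node (.leaf
  0xae52a7069b19df67023920e382b20a0) (.leaf 0x4d4c71cbc6c7101bd52dd1ac868024148b582c8890))))
  (.node (.node (.node (.node (.leaf 0x117ce555127) (.leaf 0x1c7f6fd)) (.leaf
  0x3b548c5d6dd99d5272154ad49742c4eb)) (.node (.leaf 0x2b97ae2b4f8539245291314184b5d2c84ac) (.leaf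
  0x33531ca3b1b4c392dd4b422b51a0127e25d49614579d2c13d08f382b94a9))) (.node (.node (.leaf
  0x7542cc0b2f1ca13023bf86f22ba22b91a8067525d516a258715e44fa12c44ac91444310fc43688ce82b90a9428e09c)
  (.leaf
  0x6cdd3344c9d3228c81b0e7bfbaf24ba12ddab686d76b3cac62af86ab5a60a954a4856124e453414b89204450913642c8fb835a0a3427889b))
  (.node (.leaf 0x1d253371c6cb0e1bf86f21afa675d58514e44f853984b090b) (.leaf
  0x2cdfb288c953228c0b6fe45b514982b84a9))))) (.node (.node (.node (.node (.node (.leaf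
  0x25a495b2520929) (.leaf 0x4d312f58bb4aea35ec57015820aa)) (.leaf 0x22b99a7d29843744da)) (.node
  (.leaf 0x2f1b1bc92dd8ad52a799d527285b6d4924044eb) (.leaf
  0x1f5f3bfa67525d51724598561453914914d1d0b))) (.node (.node (.leaf
  0x725dc086fedb846c819d497544f8d3924cd130) (.leaf 0x8cbc972259893e844e0ae32920a3)) (.node (.leaf
  0x1345dd093278c6c7107bd52e2eb692c345fe17c25ec978455512783fc8f883b10ca82ec4a4) (.leaf
  0x2d7cb582cdeb254c8a30a2c162ee8b1869f89d497515ca166658611382bb0a3)))) (.node (.node (.node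
  (.leaf 0x1efe743090b) (.leaf 0x210183bf4b5)) (.node (.leaf 0x1f53ebc8978255c545843090b) (.leaf
  0x3b1b242c8f343690c912e509b))) (.node (.node (.leaf
  0x13371ca07252c386fe2a6097545c9166258715e453893e14e51334485118244d0fc43744da82b90a9229089b)
  (.leaf 0xb4e1c6c6fe79d514e84b090b)) (.node (.leaf 0x4c78b194c4d2f4754891d) (.leaf
  0x1d523531c6c90b23cf8c9)))))) (.node (.node (.node (.node (.node (.node (.leaf 0x969e56c929)
  (.leaf 0x117f1541122)) (.leaf 0x6fe99d497514e490b)) (.node (.leaf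
  0x1d513451c6d3104bd52dd8a308eb1316097) (.leaf 0x71b1bf867574b090b))) (.node (.node (.leaf
  0xb5f2cc0efe1a80a72458615e14e750b) (.leaf 0x1ca370e1bf867514e490b)) (.node (.leaf
  0x2353ec6e6f54b77ada45fe142b4f8539245211324048efc3548c0) (.leaf 0x6974a408f3d2fa09b)))) (.node
  (.node (.node (.node (.leaf 0x3abe8ab127e) (.leaf 0x4ba06be)) (.leaf 0x555154a144148091d))
  (.node (.leaf 0xed72ae4aabda7d298) (.leaf
  0x23531d3bb302ca2325ec6ef0e8ae62a04a606954a15d75255493924dc93344c051584488fc43ed0f423cc4eb43760ae42908a3)))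
  (.node (.node (.leaf 0x8d4e31cec6e2f5) (.leaf 0x7542d3871b1bfa2c819d4966453a12c242ecdd)) (.node
  (.leaf 0xb223bf8ae12b20aa719d4975453893e84b0913242d0f423748be) (.leaf
  0x7548d4c71b242ecf4237489b))))) (.node (.node (.node (.node (.node (.leaf 0x231a8c486f6) (.leaf
  0xb56bb462ce4b046b88abe2a82a912a34a04a7a14520bf)) (.leaf
  0x8d7fb581d50b4e8d247432cf23303ca0b254c8a3051bc8aef1b8a2da2b18abe4a6128299d527245a8559453a137c4b11272480912443090b2422cf422d4899))
  (.node (.leaf 0x1d523531c6c6f225e315e453854912d74b2) (.leaf 0x4a9e2a01a550f4b3760b9))) (.node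
  (.node (.leaf 0x232a2c8a31b4c34b051bf8af9ebb8ae91aa117c45d495d156593e44ced2c444d0eb) (.leaf
  0x6fe2be756d4539149)) (.node (.leaf 0x8d463181c44ad88b1b90843894de132d09e) (.leaf
  0xb221bf914e84b090b53d28f322fa0b9)))) (.node (.node (.node (.leaf 0x4cecb2f8c252e8) (.leaf
  0x3b282c7131b1c14efe1bca2da4af867525d515e14e6137b43190b)) (.node (.leaf
  0x230a7bfa2ee2b5e2c62ae4aab1a7d29815c9d6a458514e24ce11312910a3) (.leaf 0x2330dbf914e443090b)))
  (.node (.node (.leaf 0xdd386fe25d6d3e14e489b) (.leaf 0x23301c176fe25d514e24f890b)) (.node (.leaf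
  0x2edd8b686b52a3128b) (.leaf 0x97614fe936))))))) (.node (.node (.node (.node (.node (.node
  (.node (.leaf 0x131e2c652f445bd14de4b512a) (.leaf 0x235e8cce2f8)) (.leaf
  0x1cef6ef8bb927e45d4572e58495564fa117245211343f10e243584d1430a0ae12910a3)) (.node (.leaf
  0x2d393371ca07252c38efe2a6067549c8975453913e14e612c242d0fc42a489b) (.leaf
  0x2d7d35b8d607422cc232f4c90b231c6c7102c146fe8bbca9f4a61e7545fe15eb53893784b211383b2cdd83684c9)))
  (.node (.node (.leaf 0x7481ce232d73ed0e2435a0ae) (.leaf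
  0x1d52f4e1d247281c6f70e3c24abe2ae52ab49f8a7925e08ef)) (.node (.leaf 0xdb3de7583b04eb) (.leaf
  0x2353bcdf7222c146fe2bc62da2afa2a01a5d290859615ec3d08f343748d2)))) (.node (.node (.node (.node
  (.leaf 0xb4eecf0b0e) (.leaf 0x106d414dc1c)) (.leaf 0x1d523535c6e127)) (.node (.leaf
  0xb1c5c6c6f28b77ada25fc978457a10c642d097) (.leaf 0x374e1ca130e25d796113d08f382b94a9))) (.node
  (.node (.leaf 0xb3f7ca8ae9) (.leaf
  0x7542cdd3221c6cefe2be52dd2b18abe4a0a67545fc57875a91665564920443190b22b88a4)) (.node (.leaf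
  0x1c6c6f28bba2c61afa67549c8961453914944f8539844dd0b43f04eb42a50a3) (.leaf
  0x1c6c96d4539d0b43d08ce))))) (.node (.node (.node (.node (.node (.leaf 0xb258c146fedbe516e)
  (.leaf 0x233c1ced2e885d61662587939)) (.leaf 0x742bc6c7104b746c41a2e1771580890)) (.node (.leaf
  0x13378cc23022bfa16d74b090b) (.leaf 0x6c81a55e75))) (.node (.node (.leaf
  0xb5f2d24b3b2cc0efe458615e2539149d4e4914) (.leaf 0x232f29e49722598957154214524fa113e2a48a4))
  (.node (.leaf
  0x1d707548d4c7281c8df1b1c27af21bbcae82b412cf1b10abe8a812921a00a7979d4948449d0f422f84b51278899)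
  (.leaf 0x2c89efe453a12c242dcf483ce0ce22fa0b9)))) (.node (.node (.node (.leaf 0x8d247282c3baef)
  (.leaf 0x6fe19d6d4e14e490b)) (.node (.leaf
  0x1f5f2afa2a0da6067515aa15e14de12c145450c442d0f413ac4da1278899) (.leaf 0xb5ca1664584914)))
  (.node (.node (.leaf 0x1f2a4c292ee247511a) (.leaf
  0x23581c9671b1c363028b23561b53854384fa12c445090b)) (.node (.leaf 0x6fe99d4975b53853984b090b)
  (.leaf 0xafd851611323584a9)))))) (.node (.node (.node (.node (.node (.node (.leaf
  0x71f15a2158253ed4d74a5108) (.leaf 0x8b446b88abe2a8ba74a7a)) (.leaf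
  0x235fed623301ca0b254c8a3051bbd2e899d527245a914eb52613784b11274460912242c908b3d10dd12d4899))
  (.node (.leaf 0xb491ced3281c24aef2ba22b9da7da9825fe157) (.leaf
  0x133b2c386fe8bbc966158514eb52613e14d110c242ecf4))) (.node (.node (.leaf
  0x4cdc7281c94b0edc08efe1a806754538539145090b43f10f482b90a9428c89b) (.leaf
  0x2c7131b1bca2da45fc978457a10c642c8f3b375097)) (.node (.leaf
  0xdd38b42bcde31b1bf92f51bc92e24b3d29279d617885aa144150f92c642c8bc12ec497) (.leaf
  0x2d387287bfa12c443090b43d08f3)))) (.node (.node (.node (.leaf 0x231285aad2c843090b) (.leaf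
  0xb3c4cdc7282c8bb1b2c14af98ae457b2598552450e13e34e612c44ad10c242c4f423cc8ae)) (.node (.leaf
  0xb5f1d50b49ecc232f3ca0b221bc86d72abc6a81a7f69899d527225e1149250913084b112b843090b83ee0a3)
  (.leaf 0x1b986c82a9ca72))) (.node (.node (.leaf
  0x1ca0b0e1bf8a9819d4975b53913e14e612c242d0fc82b90a9428c89b) (.leaf
  0x2d3871b1bf9e75453a12c242ecf4)) (.node (.leaf
  0x23584d4d3372c8a31c2c14af9d9d5272154ad4ec4b0520242f0f423ac4c5) (.leaf
  0x1ca0efe453a12c242f4f3))))) (.node (.node (.node (.node (.node (.leaf 0x459a133b452113) (.leaf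
  0x220d06480e5c2e)) (.leaf 0x1d4cb1c8b68ac4da3128b8a1e28015ec552450c4ec4315090)) (.node (.leaf
  0x26c88a48675) (.leaf 0x3b1b1bf914e84b090b))) (.node (.node (.leaf
  0xb5b1d507281bc8ae819fb56d4527934c4b112b43688ce) (.leaf 0x12ddeb68ab2141a101)) (.node (.leaf
  0x8d7fb584d3a3458cc07289c6c7108c152f51b9d2dd8b686c91b0ee978a4267549c897815ac961154a14f152053984dd127844c912642c90843890d612d4899)
  (.leaf 0x23588cc07058a8069543d1cae)))) (.node (.node (.node (.leaf 0x85b616ab53a149) (.leaf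
  0x135c1d523241c6c6f21b88ac61b04abe8ae4a9f45fc578156590b22b10a9)) (.node (.leaf 0x85f2144148251a)
  (.leaf 0x1c74efe45f2d4ea42d0eb))) (.node (.node (.leaf
  0xbcdc7301ca0b0edbf8a9819d4975258453984b0515242d0fc82b90a9428c89b) (.leaf 0x2d386fe19d490b))
  (.node (.leaf 0xb223bfa67525d515e453914914e5d0b) (.leaf 0x4d4d345854b51d)))))))) (.node (.node
  (.node (.node (.node (.node (.node (.node (.leaf 0x23551c662f3) (.leaf 0x541d49111b)) (.leaf
  0x12d049f8a7225d4972258593e14e493322d60b222a50a3)) (.node (.leaf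
  0xb4e4cdc7281c94b0e1bf8a9819d7561453913e14e612c242c89b) (.leaf 0x1a90a97ca40671))) (.node (.node
  (.leaf 0x235fdd5a3432c177021bfa2f9) (.leaf
  0x3b491ca370e8c306ec4bacae51b88abe19dca7083e88e2235a0d5134a0ac228e0a0)) (.node (.leaf
  0x7282c386fe19d497514e490b82b90a9428c89b) (.leaf
  0xb4e4ced3371ca37221bf8aef84b110c242d0f423cc8b5)))) (.node (.node (.node (.node (.leaf
  0x84fb539a4ce113) (.leaf 0x1bd8551)) (.leaf 0x1bfa675453853984b090b)) (.node (.leaf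
  0x7512d24b284ba0ae54afa29f4a49e7525e09752584954753ad3e14e5121446050f742d0f423ce0e523588c412d74b2129049e226c899)
  (.leaf 0x13531d17b288c7231b1c4130e8c249752585155450a11a82b94a9))) (.node (.node (.leaf
  0xdd387281bf86f219d49752586d4e242d0fc43688ce82b90a9428e09c) (.leaf
  0x2d607542cf3b3b2cdcb258c913221c6cb027bf8af94b762da2b18abe2a1528279d457875a856124e45342481114244d90b43d10dd22b90a3))
  (.node (.leaf 0x1d253371ca0b221c6cb0e1bf86f21afa67525d514e44f853984b090b13460ae12910a3) (.leaf
  0x1bfad4e642d0f4))))) (.node (.node (.node (.node (.node (.leaf 0x8b622c68ad22868a0516ee56c948)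
  (.leaf 0x1bdb6f0)) (.leaf 0x6df2b1a2c14ad128184024c3)) (.node (.leaf
  0x13371ca0b0e1bf8a9819d497514e612c242d0fc82b90a9428c89b) (.leaf
  0x75c2d6e3532c9471cec6e31a8c246f52bc52dd4b422b98ad629f6a6068049f917f857892bc3548c4430c4b5)))
  (.node (.node (.leaf 0x2d7e3301c963022bf8af925d516124f8913) (.leaf 0x10f483cecdd43384c9)) (.node
  (.leaf
  0xb494cec723dc8a71b1bfb2f9ebc92e28b692cf9a8129279d517f25e2165455512783fd0f423ce0ec13ac8dd129049e)
  (.leaf 0x1f53dd387283bf92dd2b6a2b9453890b)))) (.node (.node (.node (.leaf 0x2c15efe25b754e)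
  (.leaf 0x3b2884b112b4432d0b)) (.node (.leaf 0xb221bfad49143090b) (.leaf
  0xb302c887053bf86c82a9e2a01a544a9))) (.node (.node (.leaf 0x229219d5272753ad2c242d0f423cc89b)
  (.leaf 0x23538c72ef5ea7d29829e4578)) (.node (.leaf
  0xb5f1d50b302c38efe458615e253914924fb539242ecf4) (.leaf 0x6fe453890b)))))) (.node (.node (.node
  (.node (.node (.node (.leaf 0x2318856092e84b7529243d108) (.leaf 0x2f5c2cd6307)) (.leaf
  0x8d7fb588cc23058be52dd9a8228cd9d527285f854884dc912242050684044b52265090)) (.node (.leaf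
  0x235fed623538cc071b2c58b0e8c162f91bc8af08bbd2ddeb1a28c99d5272853ed49152390c242c90813178c3)
  (.leaf 0x754dc8871b3bf86ef8b68abe79d512c443090b73d20f312d50a3))) (.node (.node (.leaf
  0xb5fdd393378cc07252bf86a019d5d4e14e451443f10f482b90a9428c89b) (.leaf 0x7281bf867514e490b))
  (.node (.leaf 0x13373bf86e68b8629525d613e14e6137b4320ae) (.leaf 0x2cbc7282bbe0fbd2a50a3))))
  (.node (.node (.node (.node (.leaf 0x1d523539c6e2f54b462b815b0905125c890) (.leaf 0x22f8)) (.leaf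
  0x1f301c962f9)) (.node (.leaf
  0x2d7c7542cf3b303ca0b222c386d72abc6a81a7f69899d5272452494244c212c843090b83eecf4828c89b) (.leaf
  0x2353ec6e3098b462cf1aa26a08a6869589f4978154093924df93444c0515844c4eb))) (.node (.node (.leaf
  0x8d60b3c4cdfb301ca231b2c3b7028ae4a9819d497534e513084b112b443090b43f10f482b90a9428c89b) (.leaf
  0x4cdf7224ba128225d456a158514e84f853443750da42f84b9)) (.node (.leaf
  0x7282c386fe19d49754538539242e0ae42a50a3) (.leaf 0x1c6dd0bb3d18dd))))) (.node (.node (.node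
  (.node (.node (.leaf 0x96624d3514) (.leaf 0x25bed1b)) (.leaf
  0x1d4d345acc0b254c8871b4c412f54b762b5ea8228c8a1e67545a91594539127c43050684044eb)) (.node (.leaf
  0x22cf2b226a043b08eb) (.leaf 0x4afa6b982bb4a9))) (.node (.node (.leaf
  0x12cf7b206a019d4975658491443f20ae42a50a3) (.leaf 0x2d393221bf8af92b18675452613e244c90b)) (.node
  (.leaf 0xe27a899) (.leaf 0x374e1bf914e84b090b43d08f3)))) (.node (.node (.node (.leaf
  0xb4e1ca0b0e4579d2c) (.leaf 0xb221c14efe1b9a2e18a5497584f853984ded0c)) (.node (.leaf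
  0x1b9a2e18a55a72) (.leaf
  0x1d523538ca871b4bd4ae68b686c82a9ca7529c917f15e0565258a15e1564555350c53784b1127145510b23ce0be1270890)))
  (.node (.node (.leaf 0x3b494cee309) (.leaf 0xb4e1bf8675453890b)) (.node (.leaf
  0x4d3b6fe99d527225d455014e490b) (.leaf 0x4d7c758456f948))))))) (.node (.node (.node (.node
  (.node (.node (.node (.leaf 0x7414c7916f84b752a1439109) (.leaf 0x752bd18976258e138)) (.leaf
  0xbd3933b1c262ee8b1a2b925d457264f853914508b512910a3)) (.node (.leaf
  0x4d70b5b4c012dd8a3128b8a1c55a8517542147ad0a839d0e0) (.leaf 0x1bf8675b53890b))) (.node (.node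
  (.leaf 0x8c4b16a453890b) (.leaf
  0x7541ca071bdc3a30c1c246ec4bacabe2a7069b19dc9754598961744c8e283744da235a0d533488a3)) (.node
  (.leaf 0x4d4e31b1c4257c15ee11a) (.leaf 0x7542d3bb3b5c6def5ebc927e8579155251510b23ec8a4))))
  (.node (.node (.node (.node (.leaf 0x97f2540945149451e) (.leaf 0xebb927f)) (.leaf
  0x253c548d4b850f)) (.node (.leaf
  0x1d447282c38b053bf86c68a7ca9819d497514e490b83948d643450a9129089b) (.leaf 0xec6c6fe453890b)))
  (.node (.node (.leaf 0x4b3c6a019d527225d596144f891443f20ae42a50a3) (.leaf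
  0x8b686b54a2f0f4b3760ce)) (.node (.leaf
  0x1d24b3c4cdc728dc88b1c8c5c7102c387051bf86f2dafa2a099d497514e60f323ac8dd833a0b982b90a9428e097)
  (.leaf 0x374eecee32f4c8d2fa8bbe1664586ca9))))) (.node (.node (.node (.node (.node (.leaf
  0x10fc23948d1d2b90a3) (.leaf 0x3b482cfd30d4afa16484fe8e5)) (.leaf
  0x8d7fb587d507432cf0f281c263058be4aef4b74abeea7d2982a1528299d527225fc552251512c248110b141acf443808bc12ec8b5125d090))
  (.node (.leaf 0xb5b1d5134e2d2533b2cbc7288c706f22ba067ed5b4559251793484b112b43688ce) (.leaf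
  0x1337dc8bb1b1bf86f61ae62a085b516a453890b43d10dd))) (.node (.node (.leaf 0x24160ec42ce497)
  (.leaf 0xb4e1ca0b0e74b090b)) (.node (.leaf 0x4cdcefe25d514eb52713e14e490b) (.leaf
  0x1ca0efe8a8090b43d08f3)))) (.node (.node (.node (.leaf
  0x2d387282c386ef1a55e7525d496114e50fc82b90a9) (.leaf 0x1bf8675452453974b090b)) (.node (.leaf
  0x1ca0b0e1bf86f2da6067525d514eb4f8539242e0ae428c89b) (.leaf 0x2c88efe8b3cec89a8069544304a9)))
  (.node (.node (.leaf 0xb4e1ca0b0e1bf8a9819d6d3ed4e612c242d0fc82b90a9428c89b) (.leaf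
  0x2d3873c1ca06fe25d456174b090b)) (.node (.leaf 0x1bfa67525d453974b090b) (.leaf 0x1bf890b))))))
  (.node (.node (.node (.node (.node (.node (.leaf 0x757092e243d108) (.leaf 0x12be8ab369f)) (.leaf
  0x1ccd3014be06ef4ba097614ff0f443cd0dd833a8be)) (.node (.leaf
  0x374e1ca071b1c246f22bbe2b9da7da98b525d0b43688ce) (.leaf 0x71b1bf9e75b52490b))) (.node (.node
  (.leaf 0x725dc08efe4af8aac8a9ca7e19d7561753893e14e5121446090b) (.leaf
  0x12be1ae44f423cd0dd836a0b9)) (.node (.leaf 0x22e18b2229519d5a72) (.leaf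
  0x2c89efe84b2d0c242e0f3836a0ceb2fa0b9)))) (.node (.node (.node (.leaf 0x6e67a81272) (.leaf
  0x22e12b222a08a56272d5d616584fad3924dd130)) (.node (.leaf
  0x7282c386fe19d4975b53913e14e490b82b90a9428c89b) (.leaf
  0x2d38b3c1ca07258ae51755584559853912b23888d642908a3))) (.node (.node (.leaf
  0x1ca0b0e1bf8a9819d4975b538539242d0fc82b90a9428c89b) (.leaf 0x1cf413684c9)) (.node (.leaf
  0x1a8229219d527243b08eb) (.leaf 0x1c6c70e1bbd14e4431d0bb3d08f3))))) (.node (.node (.node (.node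
  (.node (.leaf 0x23539c6e3108bd616a84b210c) (.leaf 0x2c3a2ef4ae0a9ab978614481c60024404c4121e065))
  (.leaf
  0x2ee22b2cac4baae28c4a2e28759f857b15e056c25ae15d256855285151432508925247b50113b20b2825d090))
  (.node (.leaf 0x2d40b1d8c68af11a5d29043d08f3233889b) (.leaf 0x1bf92a7da81155449c51a))) (.node
  (.node (.leaf 0x357514c24a110a) (.leaf 0x2f1b7bd4af24b746c41a2c93d)) (.node (.leaf
  0x235f4d387281c44b05dc086fe8be76ef49f8572e58614f2452113430c4a4) (.leaf
  0x6fe453a12c242d0f423ce0ae)))) (.node (.node (.node (.leaf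
  0x8ce232a25d496134e48fb23948d122908a3) (.leaf 0x2d387091ba12d08a7d27e258514284f8539844c8b5))
  (.node (.leaf 0x4cdc7282c386fe19d4975b4f853984b090b82b90a9428c89b) (.leaf
  0x1ca06feb53890b43d08f3))) (.node (.node (.leaf 0x1f1c1bc9d5d14bc50d) (.leaf
  0x1d507452d0931015ec9551549143)) (.node (.leaf 0x235f8cc06fe8be5ee12b222a019d5d4e43b08eb) (.leaf
  0x1f561d1071f))))))))) (.node (.node (.node (.node (.node (.node (.node (.node (.node (.leaf
  0x95b853f929) (.leaf 0xb561c7d17d15e911b)) (.leaf 0x45fcd45250891e)) (.node (.leaf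
  0x2f4e2d2473cdbf9d75259890b) (.leaf 0x1bf86f219d6d4e84b090b))) (.node (.node (.leaf
  0x1d38b494cdc7252c38efe1a5467549c9d75653893344c111323cc89b) (.leaf 0x2ae669f6a61121247d118))
  (.node (.leaf
  0x2d38b491d0ef372ca231a4c45b0e3bf8af12b946e22b5cabe2ae4aab8a80a7e19d6e72154c539136a0ae42a48a4)
  (.leaf
  0x7548d4d33b1c6c709bbd4aef4ba36e14b74abe1ac868089d5d6a24e490523ef0f443890dd43588b582b88a4428c890))))
  (.node (.node (.node (.node (.leaf 0xb3fbcaa2ee) (.leaf 0x8b54aadda7069b)) (.leaf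
  0x37221bfa675453853984b090b)) (.node (.leaf
  0x7511ca471b1c452f78bc22ec2b962e21b112c1da806974a4929049f1e7525e09752584957754dd4e1526d3e14e5121446050f141d0f423cc8be12d74b2127889b2264496)
  (.leaf 0x2353dc8bb1b1bfa2a0453890b))) (.node (.node (.leaf
  0xb5f2d6c7542cc07282c946fe1bc8ae819fb15e452793484b112b43688ce) (.leaf 0xabeaae76ab22910a3))
  (.node (.leaf 0x13372c8a30a1bf86be99d527225d514e452453984b090b13450a3) (.leaf
  0xeca06feb539d2c242d0f4))))) (.node (.node (.node (.node (.node (.leaf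
  0xb4d4ce530b15e45471502518) (.leaf 0x4d452fb1bdcaf02b1bac18ace17e15a2166854d0bd12de096)) (.leaf
  0x8d7fb588d247431ca13222c3a3052c08efe2b1a67549c916ab52513e84dc933145090b83d10e282b90a3)) (.node
  (.leaf 0x4cdc7282c386fe2a6067525d496114e612c242d0fc82b90a9428c89b) (.leaf 0x6fe99d490b))) (.node
  (.node (.leaf 0x7432c5a272d4e4d1443f20ae42a50a3) (.leaf 0x1d513452c73b1b45fc978255c550)) (.node
  (.leaf 0x20db432b4bc) (.leaf 0x2d7c754cd4ef37ac977228c6cb051bfa2da8a83961844c90b23cd0a3))))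
  (.node (.node (.node (.leaf 0x8c4a16a25791594525d2c) (.leaf
  0x8d613371ca07258c08ae62b3faa079d6d4e34e513084b090b83548ae)) (.node (.leaf 0x857914e84b290b)
  (.leaf 0xb1d1c153028a8116a457892b242f4f383388be))) (.node (.node (.leaf 0x2f371c946fe) (.leaf
  0x1c6c6fe1bca2c819d6d4e84b090bc3d10dd)) (.node (.leaf
  0xb5f2cc231b2c38efe458615e253914924fb53943688ce) (.leaf 0x6fe453a12c242e0ae)))))) (.node (.node
  (.node (.node (.node (.node (.leaf 0x7511c586f745bc56e15a215c4536d2e84b490f) (.leaf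
  0x235ce45850e)) (.leaf 0x3b4e1ca0b0eb52490b)) (.node (.leaf 0x26ee45c993e44d2113) (.leaf
  0x374e1ca07098a81e75857ad4984b050c))) (.node (.node (.leaf 0xb3d08dd82e489b) (.leaf
  0x1ca06fe19d4539242d0dd)) (.node (.leaf 0x7282c386fe19d4975453853974b090b82b90a3) (.leaf
  0x23588d4ef378cc37222bc62da2afa2a01a5d290857b0f423cd0dd)))) (.node (.node (.node (.node (.leaf
  0x2ae4a9875a914e242d0fc23950e223448a4) (.leaf 0x4445d0d)) (.leaf
  0x1d50b4e2cf07281c94b223bfaaf999d527285d4559154854844f893944ac90b)) (.node (.leaf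
  0x8d4c74e2d24f288c73b1b1ba117f25e0574159453c44c20fb22920a3) (.leaf 0x8d4e31cec6e30925e0957)))
  (.node (.node (.leaf
  0xb588d4f74e2d27b301ca2325ec6d2d02af867e45f216d156495544ac90543f20da233a0ae42a44a4428ec90)
  (.leaf 0x2d386fe79d5559453912b143090b)) (.node (.leaf
  0x13371bfa67525d514e14e612c242d0f413460ae428f49b) (.leaf 0x134e1ca0b023bf916ab52612c242f4f3)))))
  (.node (.node (.node (.node (.node (.leaf 0x43d08f3237489b) (.leaf 0x4b06111)) (.leaf
  0x4b4369f4a6127e22d60b2)) (.node (.leaf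
  0x2c9c7208b452ce1a5d29014fe138845c91083fc8f823cc4da134c8be42e44af427089b) (.leaf
  0x13502c88b1d2c7231b8c687101c15efe1bd86f21b212be1ae62a01a5615e15761371436d0c43d04e382e44a9)))
  (.node (.node (.leaf 0x8ca8b228c28b051bf8af98bb86a845f116a457b55d44ad10c242d0eb) (.leaf
  0xdc886fe2be46e643d20ae)) (.node (.leaf 0x50613004b5) (.leaf
  0x2c886fe8ae514e84b112b242d0f4a3ce0da22fa0b9)))) (.node (.node (.node (.leaf 0x3b4e1c252e8)
  (.leaf 0xeca0b1c4c6cb0e1c163021bf86f28b692be19d515e14e6137b43190b)) (.node (.leaf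
  0x7282c386fe1bc867525d453984b090b82b90a9428c89b) (.leaf 0x6d387282c386fe453890b))) (.node (.node
  (.leaf 0x4d7f7378c952f9) (.leaf 0x71b4c386fe4ba267525d514e4525d0b)) (.node (.leaf
  0xf541d4cb1c4c6c6f28b762da25fd16a457895585485504538945450d11a242d090) (.leaf
  0x8c6e16a257ad4e))))))) (.node (.node (.node (.node (.node (.node (.node (.leaf
  0x7414c7a14ad4a850e) (.leaf 0xdcd23338cc06fe8be0aeb15c116e456d123)) (.leaf
  0x3b28dc886fe8ae469f99d527265d4572b52513e242d0fc83d10e243590a3)) (.node (.leaf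
  0x13371c976fe25d514e24f890b) (.leaf 0x8b1f68545cc93744c2112))) (.node (.node (.leaf
  0x3b4e1cec7282c38709) (.leaf 0x7541d247281c6f70e3c24abeba60a7925e08ef83948e283748d6)) (.node
  (.leaf 0x4d4e31bebc910213ad0c542cd097) (.leaf 0x234fecee32d4ba127e23ec8a4)))) (.node (.node
  (.node (.node (.leaf 0x3b548d1517c4555127) (.leaf
  0x372c2c387088bbd2ea8b0c6c24ae12b68ad4a9a2a3065e481f555149c516244210613108c1424848722060654181c49))
  (.leaf 0x2d246e699d527245d497244f911383d10dd)) (.node (.leaf 0x10f0437a0bf) (.leaf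
  0x3722ec6c6fe453890b))) (.node (.node (.leaf
  0x1ca0b0e1bf8a9819d4975b53913e14e490b43f2cf482b90a9428c89b) (.leaf
  0x2c963242c08efe2be7af24b762da2afa2a04a09e7545fc57875a8920145510cb374899)) (.node (.leaf
  0x23452d087281c8e3174b752d025ff978251450684044b5125d090) (.leaf 0x23372cc06fed5b514e))))) (.node
  (.node (.node (.node (.node (.leaf 0x1cf423cd0c942fa0b9) (.leaf 0xbcfd2be859213f145e8e5)) (.leaf
  0x235fed623301c6e3052c08afe4b74ac62af92982a15282d9d527275a915915211272481d0b24230f4)) (.node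
  (.leaf 0x1d473372c5b7023bfa2f999d497514e4514) (.leaf 0xec6d2be1ae490b13d08f342fa4b9))) (.node
  (.node (.leaf 0x8cfd3388ca930debb8ae91aa117c25550c2) (.leaf 0x3b5b1be8972259b54224fa113)) (.node
  (.leaf 0x2f371ca0b0e1bf9e7525d514e14e490b23748be82b90a3) (.leaf 0x7283bfa2a0242d0f423ce0ae))))
  (.node (.node (.node (.leaf 0x22a71a57675) (.leaf 0x7281bf8675452453974b090b)) (.node (.leaf
  0x2b992a71a81e75) (.leaf 0x3b1b1bf890b))) (.node (.node (.leaf 0x1b58aafbaa127d) (.leaf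
  0xb4e1c6c6fe8b20675b53a13e84b090b43744c9)) (.node (.leaf 0x2358dcdd2f9) (.leaf
  0x7281bfa90b)))))) (.node (.node (.node (.node (.node (.node (.leaf
  0x71f4c78b194bd116f856094f84b5d291439108) (.leaf 0x4fcb3460a3)) (.leaf
  0x8d463182c2c6df2af92b41a7ca844a0e17e85721531499908a3660bf82bb0a3)) (.node (.leaf
  0xdd38b498cf071b1bc8aef8ae769f6a61d0b43688ce) (.leaf 0x2f5b8c92174b5ce16584c2112))) (.node
  (.node (.leaf
  0x2d38b434cdc7281c947112c3b7023bfa2f91b5c6b91a8129819f867549c8561453913e24e490b43d089b) (.leaf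
  0x12a79a81e75)) (.node (.leaf 0xbcdc7281c246fe8a80675857b95984b110b22fa0ae) (.leaf
  0x4afa2b94539d0b82b94a9)))) (.node (.node (.node (.leaf 0x36c81a54675) (.leaf
  0x2ca130e2bbc97584f8d39)) (.node (.leaf 0x1d523531c6c7108bbc6d71a7f69825e0957452494284b090b)
  (.leaf 0x374e1ca0b1d1bf8af91b9a2cf2b206958a4928524dd130145611243d08f3835789e))) (.node (.node
  (.leaf 0x7282c386feb53ad3e74b090b) (.leaf 0x8d353344bd62a079d61652520537145450fc3d10dd1278899))
  (.node (.leaf 0xb3b08eb1314497) (.leaf 0x8cc071b45b6d0c742f4f3))))) (.node (.node (.node (.node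
  (.node (.leaf 0x75cbc8c6fa) (.leaf 0x12d64ae1e9a)) (.leaf
  0xb421c5def55b746da15ec552450c4ec825d090)) (.node (.leaf
  0x7511c452f78bc12c11acd29249f097545c852ed45050f141e0d91278496) (.leaf
  0xb371cc23254c8a3091c146fe1b2116d452453784ad10c43d2cdd))) (.node (.node (.leaf 0xbd217384c28ae9)
  (.leaf 0xb2f4ba0ac6859856124e453444520d642a60a3)) (.node (.leaf 0xacfea82675) (.leaf
  0x2330eca07252bf9161753910c742c8e282b90a4)))) (.node (.node (.node (.leaf 0x1efe85a895e453890b)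
  (.leaf 0xb4e4cdf72225d613e13d04c9)) (.node (.leaf 0xebc914e4525d0b) (.leaf
  0x36fe8a82d4e242d0f4))) (.node (.node (.leaf
  0xbcdc7301ca0b0e1bf8a9819d4975258453914de12c145490b43f04eb82b90a9428c89b) (.leaf
  0x8a81e75c3d18dd)) (.node (.leaf 0x4fde3488ac) (.leaf 0x85f4551448c51c)))))))) (.node (.node
  (.node (.node (.node (.node (.node (.node (.leaf 0x1f564d10b16) (.leaf 0x36f085d51734596d1b))
  (.leaf 0xeca370e1c262b91a7e11312910a3)) (.node (.leaf
  0x2d38b3c1ca0b0e7bf8aa72a6116a453890b83750da23384a4) (.leaf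
  0x23534c90b231c6c7102c146fe8bbca9779d517f857ad4e24de12c43cc49c))) (.node (.node (.leaf
  0x22c64b05ce582b90a3) (.leaf
  0xb4e2cf230c1bb12eb2b946e22afba9f19dca7083e88e213688d683544d222d60b282b20a0)) (.node (.leaf
  0xdd387288c276fe4be516d4524539) (.leaf
  0x8d4c71b2b9b6e18b68abe8ae627529c8565857ad4314dd1272474515242f0f423cd0dd22f88bc82e60aed2a4890))))
  (.node (.node (.node (.node (.leaf 0x2b862cfda80695) (.leaf 0x217d15e9d24248d11b)) (.leaf
  0xb4e8d26d4e74b090b)) (.node (.leaf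
  0x1d44b492ca130e4ba0ae54b052be8a7d29225e0975c578954753ad49b4f853914b91214460913143e0e583648d623104b5d2c84ac129049e)
  (.leaf 0x728dc386fe25d456174b090b))) (.node (.node (.leaf 0x1c977021bf8aa779d497544f8d3924cd130)
  (.leaf 0xb4e2cf0b288c913221bf8af92bbd2e22b1867584f9114244c90b43748b5)) (.node (.leaf
  0x7494cdc7282c8871b2c386fe1bc86be99d4975453853984b090b13460ae12910a3) (.leaf
  0x1bfad4e242d0f4))))) (.node (.node (.node (.node (.node (.leaf 0x22df8ad3a86) (.leaf
  0x71d8c492f12b98acfbafe2a82a80a7a459615d450e13b84dd127)) (.leaf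
  0x7568d463188c30b0b1b7c6d72b18abe4ad1e9f4a060ae)) (.node (.leaf 0x2f371c946fe) (.leaf
  0x1bf867574b090b))) (.node (.node (.leaf 0x1d513388ca8b051bca2ee45f356d1549149c4b112b) (.leaf
  0x1b422b98a7d29829f89571542145)) (.node (.leaf
  0x7421c71f1b7bd52dd1b1068055ec948c50913584a490123bc8c082d48b2) (.leaf
  0x75b2c392dd8a4114e152d10c742c90123cd0ef83b04eb)))) (.node (.node (.node (.leaf 0x8f34369cce)
  (.leaf 0x6fe19d5272b53853984b090b)) (.node (.leaf
  0x1c6c6f22ae4aab8a8097885b615e455514eb4b112743d10dd82b90a3) (.leaf 0x3b28ec6c6fe242ecf4)))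
  (.node (.node (.leaf 0xb4e1ca0b0e1bbe29279d527225d496114e50fc82b90a9) (.leaf
  0xb4e1c6c6fe8b20675b53a13e84b090bc3d10dd)) (.node (.leaf 0x3bfa67525d6d4e14e490b) (.leaf
  0x6fe74b090b)))))) (.node (.node (.node (.node (.node (.node (.leaf 0x131e2c6516f84b752a) (.leaf
  0x135385df511)) (.leaf 0x2a1528243754da42f84b9)) (.node (.leaf
  0x8d7d35c2d6fb584d39f3c8cc071b2c58b0e4c3630a8c162f91bc8af08bb8ae94b762d14b33ac68ae0aaf1aa229a4a4e28c8a1e27d99d5272853e14eb52454824add0b24210da83548ce13160c3)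
  (.leaf 0x71b1bf9e75242d0dd))) (.node (.node (.leaf 0x8cc0afe1a80675d5d4972753893e14e490b) (.leaf
  0x1bf867514e490b)) (.node (.leaf 0x6fe79d4975453853994b090b23748be82b90a3) (.leaf
  0x373c1ca12e88a7d17514d111443f10e282bb4a9)))) (.node (.node (.node (.leaf 0x85b615e4539d0c)
  (.leaf 0x374e8d2472813d08f3)) (.node (.leaf 0x8d4fb1b1b5c69fda60978d5b495744ac51e) (.leaf
  0x26e61b20aa7))) (.node (.node (.leaf
  0x7542cf07282c393021bfa2b92a6067525d4d3984b112b443090b43f10f482b90a9428c89b) (.leaf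
  0xbd393371bf897515a8561453ad4984f8534242d0da42f84b9)) (.node (.leaf 0x253c54814b8929143c908)
  (.leaf 0x7281c6d14e4431d0bb3d08dd83588ce12a60a3))))) (.node (.node (.node (.node (.node (.leaf
  0x23388caa30a8bb88fb23948d122908a3) (.leaf 0xdbf50ad)) (.leaf
  0x754acc0b254c886f27b77aa099d457b45a914eb525127742c4eb)) (.node (.leaf
  0x3b492ca12e82b6468dba2acf4) (.leaf 0xb222c73b1b8c686fe4af86b98a82137b43090b43d20b9))) (.node
  (.node (.leaf
  0x37561d5232a1c9530ddc086fe1bca2ee2ba6ecf1aa117545ab15e154993e44ce12c44ad11344320c3) (.leaf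
  0x2c08afe2af9d6a23cd0c912e449c)) (.node (.leaf
  0x5d707232bf46e74b812dd8b692ce1b24ac41b0d2a48a4128b49c456b15690f9839d0e0) (.leaf
  0x2d38b378cc3b281c6e3022bf8961742dcf423cd0dd82b94a9)))) (.node (.node (.node (.leaf
  0x8cc23022bf9af9) (.leaf 0x1ca0b0e1c163021bf92be8a8067525d453984ded0c242e0b9)) (.node (.leaf
  0x2d2533b2ca130e4ba0ad72ae4aab9a7d298154d12144620e523584a4) (.leaf
  0x23301bf914ea42f0f4b3760ce82e6c9c))) (.node (.node (.leaf 0xdd3b7491ca06ef) (.leaf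
  0x7258be756124f8534)) (.node (.leaf 0xeca36fe99d497514e490b) (.leaf 0x2f598cccb01))))))) (.node
  (.node (.node (.node (.node (.node (.node (.leaf 0x131e4c64969857094f852b52a24a450e) (.leaf
  0x135d85f89792552153)) (.leaf 0x1bfa67525d6d4914e490b)) (.node (.leaf
  0x7ca930d2ba62b81aa229a25ac92844290c2) (.leaf 0x8bc497445cd16584c0912))) (.node (.node (.leaf
  0x8cdcb302c08efe) (.leaf 0x7281c252e84aad27ea9e4976854e138448511843744da)) (.node (.leaf
  0x13538c6c71085f057b455611a) (.leaf
  0x7542d38b3c1ca130e2bbe2da2af9290455712c443190b23edcf4a3ce0ec13ac8be22d48a4)))) (.node (.node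
  (.node (.node (.leaf 0x13388caa2ee15f0555150c91d) (.leaf 0x2b854ceab08c611d65)) (.leaf
  0x271bd5b612c44ae10b425c490)) (.node (.leaf
  0x13378c976fe2af8a9819d4a7225d516a459914e44f8539242c89b) (.leaf 0x23587c086fe8a80695b5390f4)))
  (.node (.node (.leaf 0x8b446a88a6a27dd316c90) (.leaf
  0x1d50b4e1c6c6fe1bca2c819d4966453a12c242ecdd)) (.node (.leaf
  0x4cdcb221bfa67549c8975453853994b090b43d04d122f90a3) (.leaf
  0x7541c6d30e4bd4aefbba12dd443190b))))) (.node (.node (.node (.node (.node (.leaf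
  0x10fc23974ae42a50a3) (.leaf
  0x37562cfc7164c352fb1bb86c84afa2a82a8127285ae1648576151850613f44d493314a052014520e5)) (.leaf
  0x8d7fb581d507532d387494d163303ca0b254c88b1c1c6d3101c263054bd4aef1b89edd8b686d74b40ac62afa2a01a7d29849fa67549c897f85b516a453894584dc92b449c9124430908141a10122d60b22265090))
  (.node (.leaf 0x2d387282c38a9885b6d4e242e0e523584a4) (.leaf
  0xdc8bb1b1bf86b98a8216d45a914e242d0f443760b9))) (.node (.node (.leaf
  0x73bbce230d8c2b6ef45d513e44cd113) (.leaf 0x233e2c7171b8c5c70c4bd46f225e217715c09674581d0b))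
  (.node (.leaf 0x8cc23228c086fe8a8267525d6d3e14e4914) (.leaf 0x728dbf914e74b090b23cd0dd))))
  (.node (.node (.node (.leaf 0xb1cebd6178855e111) (.leaf
  0x8cc3b28dc88b1c4c6c7058c086fe1bca2da4af92a719d49754578539843190b)) (.node (.leaf
  0x7bf9d5e453890b) (.leaf 0x3bfaef9453910c242e0f4833a0b9b27209b))) (.node (.node (.leaf
  0x3561b4f8539) (.leaf 0xb223bfa2f9158493e14d2d0c)) (.node (.leaf 0xdbfa67549c897514e490b43d10a3)
  (.leaf 0x6fe4be5d6a)))))) (.node (.node (.node (.node (.node (.node (.leaf 0x395b153d108) (.leaf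
  0x6b88abe2a8ba7497b2555143)) (.leaf 0xb022bf8abe2a1528275aa0ce13274be)) (.node (.leaf
  0x2f1b1bc92dd8ad616db525d0b2406097) (.leaf 0xb491c146fe158493e14d091483cecdd833a0b9))) (.node
  (.node (.leaf 0x75b1c977021bfb6e11b2067575d4939e4d1130) (.leaf 0x2cc2325dc886fe)) (.node (.leaf
  0xb5b1c9132313378bc427c898) (.leaf 0x71b44add0b832689b)))) (.node (.node (.node (.leaf
  0x6d7eaf927e) (.leaf 0x2d6c74e2c3aaef1ba0978255e145248891e)) (.node (.leaf
  0x7d4c7421c40978255c545843090b) (.leaf 0xb4e2cf0a9fb59893323888d64291ca3))) (.node (.node (.leaf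
  0x4cdc7281c94b0edc086fe2a6097545c9166258715e453893e4485118244d0fc43744da82b90a9229089b) (.leaf
  0xb4edc887093bf8abe8a81e7525d4561453853443d04c9)) (.node (.leaf 0x4d653014be216db53a10b) (.leaf
  0x71bb431d0b23ce0ce43250be))))) (.node (.node (.node (.node (.node (.leaf 0x214984b2d0b) (.leaf
  0x207470d9026)) (.leaf
  0x235fed623302c953228c146f21b886dd1b5cac6baae2a87a7d27e99d527285e216d45a8550453ad49449dd0b24210fc130e0b242a50a3))
  (.node (.leaf 0x2b9b6a74a49e75) (.leaf 0x33531ca3b1bdc3a309))) (.node (.node (.leaf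
  0xb5b1d50b492cbc7281bc8ae84b3129319fb56d257793484b112b44310da233a09c) (.leaf
  0x4d15f1b1c40978255c545)) (.node (.leaf
  0x1d507494d113371c6c7182c3a309dc08efe1bca2ef1af869f25e114e84b090b) (.leaf
  0x1bf914e84b090b43d08f3)))) (.node (.node (.node (.leaf 0xab92a61d6a453890b43f20aed2a50a3)
  (.leaf 0x8d4c71b1bca17c1565155b5251274339097)) (.node (.leaf 0x7d7e2a099d453714544eb1278899)
  (.leaf 0xb4e1ca0b227bf914e84b110c242d0f4))) (.node (.node (.leaf 0x8d4fb1b8bd495d14bc50d) (.leaf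
  0x4d6e353dd3a32f1ca13242c8cb1dec6e2a02a7d29879d616d55a915e255455224dd130844c90b43760ae)) (.node
  (.leaf 0x2cecb284c38aefd584539) (.leaf 0x8d7a3332c5757a443350b))))))))))

def hints0 : List ℕ := [
  0x2a515f21c, 0xa1c, 0x23001ab64a4b492e21e, 0xa10, 0x29706003, 0x1d5579ad003, 0x552240, 0x716688,
  0x38f12a5e85bda094d25a, 0x1d498f3142544257980011, 0xa125bcaf8600b, 0xa1ccc034600f,
  0x1438ac06017, 0xa12180240017, 0x157c8494a21c, 0x5292d253c0005ab84398c80017,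
  0xeaad0589af46325b8ae12e21e, 0xa52, 0x3a1b5128cbdc91b16238, 0x2a696f25a1802d6862cbdda890f2b8,
  0x2b42f700027a895c21e180040027, 0x3a1b115e0d458f90f25c570afb192120006c60234b4870002953cad958210,
  0x10006f1925a, 0x7500f4249694d2b0cc02c002d, 0x52d00016a690e2b0000bd5c2de5b83005ad242094b600b,
  0xa54438b79680c016000a8c02f9805a10, 0x2300fab00004c003300007300b,
  0xab01805c0015000752d0005a001aa10,
  0x80052300b8002a0009ab0000dd0829e4a4b495c21e1800400310008c002b, 0x14b887b600b, 0x1, 0x2a7929210,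
  0x14209480023, 0x15b8ae12e2100001d0f2525a4a400023, 0x10003f600d,
  0x1400872e6724002e50015e4a01003f, 0x553280, 0x340ac1566a216fab450cc0116c6290, 0x4001d, 0x1,
  0x8a02f8e12b216, 0x7600bcddaf8b00b, 0x76041, 0x26d09c19c3cc5c8c917c, 0x6604f, 0x2728d1146,
  0x4d04f, 0x9f6358520e51c42a4518005b, 0x7125ec, 0x1c497b00061, 0x2002b936, 0x4c9000ca6eae05d,
  0xea07aba35c26ebe8b28d0173402cd61a2, 0x4b043, 0x75065, 0x3a7b0a4c0979c2603d,
  0x29f0b03b001acb03d, 0x76055, 0xeb8be9918b045, 0xdf4, 0xdfa, 0x1b410d0c5ea5a9a992c620,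
  0x36829a96c40ae8007b, 0x1, 0xac012b01dac0877931b500c7a1310638, 0xa4e,
  0x1495283ba8a941e56043401e71b4a0e78800081, 0x7485dc, 0x1ac116d00b, 0x4b03b,
  0x2810c21203417cec1d6b2167aa75c2, 0xd2a, 0x15eca911a2609abe1503b50c8e80083, 0xe1c,
  0x60043800eee869ccbc520e2152cf07e0005f4e45700093, 0x20048e8a, 0x2be127286002440083,
  0x1495283ba8a941e56043,
  0xcc07b404de9036c650bc5e2a01a3ab262ab685f0ce138340fcf32e64756849d4e5886838d90ac1bd20518b402d1a24e,
  0x72d5a1079c2ee6541426d5043, 0x100274b9136, 0x6ac4fc, 0x66043,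
  0x35f2d053e28c728d11f83893c8a45562c2269829c, 0x3682aaba,
  0xd70b593eaa853aafd688c218a581950512ec70b603045d4c480b0a5,
  0x7546362c27d2c6a6942956a234be55822ec012aaad00b, 0x14acb6ae055, 0x18001f2861ccbda715063,
  0x10018c501d, 0x28035e36, 0x6b059, 0x34aae14ea5828c00b7, 0xce4,
  0x1be582b3760006a4b603d3d09614e2da, 0x1b5d3f000a3, 0x56d2b24ac860303b,
  0x4e085cc2a4007fc0895a50a5002bc00c1, 0xce4, 0x40063]

def hints1 : List ℕ := [
  0xa18, 0xe0a5258001ec07bb022ada, 0x1d3997a003b, 0x6e0bb, 0x4009b, 0x1,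
  0xd60e782b0003001ff603d94294b099, 0xdc2, 0x20038a26, 0x3942ef0012b9e000d9b3d7080093,
  0x37aa507100347105e41402c6063, 0x1b824c30739411745684941c71028455cbc0500b,
  0x2728a31a2a7c7e000a3af87127e148, 0xe76800f4e079, 0x1800f50045, 0x6307f, 0x2858b083,
  0x1002c40093, 0x53083, 0x65091, 0x31864e76c380073e9c4509f133530, 0x2a49592da0032400c1,
  0x14f88a133001b66e800d32e4006b9b43cd706299c4016400cf, 0x10035400e9, 0xca1d7283fa96,
  0x1001bc00d9, 0x50077182a4c9001664d80065, 0x10029c005f,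
  0x1270798da000ca7a000c5002e400ffaf8858b089002fd5e5305395c80067, 0x12c20c00b1,
  0x1b424e300f20145509b9818d6526e0031d6d201da007bdcc9c992800cdd822ecf2ccac3474e0012770880c14f94a8dd1720035cf31920033d005926c005ca66,
  0x1524b69592560018f05560eeb5358001df9b800650041400c5002ec00b9, 0x2728fb6c0da6b0005f,
  0x35877e61a28416093d42cf001d, 0x10034f28001638700093, 0x7608d,
  0x67d55eb455c2bf5ac3ec4062d50d823cfc1a2, 0xaa08b96b608f, 0x3941004528d978e5148, 0xe50ced87000e7,
  0x1003dc010d, 0x400af002ce50a5, 0x3a83476340018d591010e95b6025182a7000bd42d6009b003bc011b,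
  0x39b800efac1af603d, 0x1002365091d60283be6ec88548011f, 0x5756c23e0077a729427e722da,
  0x1003340093, 0x12e46e8c9136,
  0x15d5b08fa7200316c84eaa9d583b8a0ee0077e6e8c2fee05d0019c012700476e0b90049400e90048ca41c4,
  0x800be0022a66003153e5909d4984cd4e2c01eb077141dc00efcdd185fa28b81740067,
  0x1a9d70ab077b3da893801df39000c5cdd50230bf, 0xd909d40062ac1460076ca14b583bda14a0077a72,
  0x560d1141dc00ef,
  0x24b8b420a31459a505d3b1640eb000bb67b51279c80062d4042c8038a56383475f60016b049e4a8026c0131004bd140021a004a802560074a9c,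
  0x10c34530efd81be8009b417816079a7c00858008b5631857cd42cf000b8026e60ed,
  0x8018ab051ca14b583b8026b3aab0e5b5db087a7cae5a4ab0d1ca00033aa0c7001d8025a0086801260074a9c,
  0x8025b702e800ce009bd304cc9a1755a10e9c961002660094952, 0x3583bd4e004d675561ca9f1332685d56843a72,
  0x400d1401e550ef2c2950077182a4e0d1cc18f000b, 0xaa21b7d0d017b438e6061c95a859c608ba893a26, 0xd24,
  0xcc0c36871e4a2014750b3004feb0b18c1175127, 0x12c01400d9,
  0x388b435a153b0779c4d822400453f0002f95c, 0x200a0ce4002ec01474cc00a2a28, 0x3b08faea004c400ef,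
  0x480e9d847f49676401c6509f8026c014b, 0x1540ed1a0013f6803ac1d3aa2f26a61405c00510c0f50077,
  0x1b413caab572a613f2ac53e, 0x8029a00a2a28, 0x72a67e,
  0x2405dd34b592863801326876e61da6132d61a942bc0155, 0x1, 0x259a50bb,
  0x6d0090056ed03b2406731b1d63689625089c002cb089, 0x8c1a7283ee14, 0x2728d1146,
  0x460d3941ef0a002ae480eb2c24a00aaca112aea5087,
  0x730451834ef24a0f785050170053c0163141de603d401dc3009,
  0x490002ae758d077584965089ce19831e140c0e550450021e603d, 0x1c002c0163005940167141de603d401dc303b,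
  0xd9e0052560bf, 0x1002ec00c5,
  0xe608b8d2f2462da280b8029e0085a01b38005ca13f92a009b005a500770c024303b,
  0x131459b5159d4544901d8c6c75b30635824e009b,
  0x155d6876a4ad834d221608aa817f28aba13f2e099af98b8da6a8339792b0031405c00510c0f50077,
  0x14a0ad0015f, 0x46117203bf30ed, 0xa50, 0x2940d0d1d402c00a9, 0x37486093,
  0x1005ec0179a4d6617f4007b9db491b4270672f55a013a2ae07fbc97079a16c6d1892a56005cd00770c024303b,
  0x461599f440b6da234164c56363ac7612c4a11200aee001600bf802fa00b7802d7640016db5d5caaf530b88008a948389b047802c2002f802a20022a268c18d60d1202bd00772a499a752280051560e3,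
  0x40171b2167ae65400052c01470060500774cd3a9140028ab088061,
  0x20069a001f9400153b820cda19cac00c0051cc18e509f8026c014b, 0x1005cf000b9427e009b,
  0x65087005cf000b34116b10fd43040187a60520e2002c2002f8008a89880afb45540185002e40183401dd0c00183b01e9524cd3a9140028ab0880610c024303b,
  0xaea8c18eb0735c98005d60d78100189450b088063, 0x1599a864ae4, 0x4016d0050eb059]

def hints2 : List ℕ := [
  0x30077ec22f580baa0febfaef5c1125843801cb882f2650b4024500bb8306d03b28da48ce53e3698d90b258c002cb089,
  0x4017d,
  0x86026a822cc07a00c9d26b3000bfa6157b036ec1734fad057c9f8a29782febbc0072c007b9db491b4270672d03dbd56804e8ab81fef25c1e685b1b4624a958017300646d0a54f800c7a00ef5590c572005455e0018200c6d30385e5755a10f5858a720062e31590049cc91365838c80630c024303b,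
  0x2548a44ea800f53e530ac346b9400766e8010d5780060c61ce00758012600ca936,
  0x15fca2800e39f9a4abe1b4339681edeab4027455c0ff792e0f3, 0x200b5802db3a80145, 0x1ac43c00b9,
  0x230accfa205b4d059,
  0x3a2ae07fb83ce516d0067ceb0033600ce99c006440199c6d558303dae4003fd5ed614c33179c0077370022a52230bf389b047802c2002fdc0bb705c8008a0086accac49401452a40035802a289a30630c024303b,
  0xe8ab81fee0f3, 0xd5e0067e9a661f36b160e9205b4d059,
  0xe02eea2ab0171818d7f1610e68698034b28b680347740fb65ebbc521000fc39b036e503f1b05c9463394f8da5a0af8b680199,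
  0x4019fabd68ab04558324500bd15aa001a5945b401a3,
  0x401a93ec7e360b928d4fad019c291b0879b4800f749561a2a831c007600868012600d39d6b3d3931b5400c0f4019d001ff58662f3800ee6e8c2fc018faac0033dc0bb5ca981c2f200d0802a289a30630c024303b,
  0x6e05d, 0x4e1794514c0010dae400d6c6146803b8035600358031a89a30635838c8063,
  0x200788c14a8a2003b004340093,
  0x7000b0047f001dc1592b611f5d57cb374617e00d680362b0801af430af000c18c39c01975838c8063,
  0x750c9cc5e7024617f7f001ad9403400c1003ac3007006cc01975838c8063, 0x37f330770030400eb,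
  0x6b0e7385e5661600e8a33077,
  0x34c0a45722a5185fec07a8052e6e800f460a5be4703cc0076ba8010d0024d3300372af000c18c39c01b7006d48063,
  0x1004e50087,
  0x12c68f335c2db901005926c00dedc1db588de30d0d889402007ebf30093551b037da0a7db0b0daeae55f0617bc002f50b38c2fcb19d4c20e009bc959ba9800296b08a42010f7f0a929c,
  0x1203a57564a4064eb08b, 0x1385ed72563728043d61b200e09601600dfa9c, 0x6b0d9,
  0x1ac22c00ef00714b00b, 0x10071c01c3, 0x751add449c016d5828c0065ac1dc00b3,
  0x14491822ae838325372cad447d60bf005b4019d, 0x1d46b75127005b400db, 0x401cd,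
  0xac16a00bba3acfda430a5dc, 0x1402b751622, 0x1abd3ea9a53a9433c816d,
  0xa4e0029450d1582d731b9481283f98a25c828b41840075c01d53f051a9f5a045400a8d62ea00acea1df55930572c546eae0b93ac68398039600ced9eac114016dcc5e6e12c1a753960a34dd7029aeaac1dc00b3b464d34460c69614e2e4cc1df000b2c227025fcd80ff50e9d810401d1141e65089,
  0x8023e0032c617e6e850035395c8303d2c20c01c900764b19da60520a90039f001e8c14b9420041381e6003b0043400950024c01bb,
  0x10036401db, 0x401b9, 0x10070401c7, 0x10049e31590019f30003c25805dfc006e73077,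
  0x400e9003ac01dd0078c01df, 0x560d3, 0x1405f4d00f, 0x709676,
  0x31863803d6b91142c2945557540016008fd60d60033803d200f3d61db8114e001d60074ca14a8585079,
  0x14003f285de,
  0x300add283a097950b14345935c0a3d371001ebbe9b064dcad85b7286c1afb05c946a7d680015100564b0b9,
  0x6930a013b032a144bca858a1ad7028f4df4d8324d15c400424d6148007c401ef5cda84ca2ad47a750efc74982b962a2c01d340035b705c9525c80086cea4517029a7c5840069ad4b455400b3ac435754001696230e32b9b0208c2f380058a002b066e44ac1ae30e70079401bb,
  0x4b005ac24c00d9, 0x2004a803a20033ca10798001f3007d401e5,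
  0x20067a00b200e59e63755cad7530ab0522be4007a703c8c14b4fb61f5800ef61d1a9d1831e7800436b0755d51871803ceb6b000bbf9b01fea1d3b020803a2004a8012654a30e7141e401bb,
  0x9610f7928077547d43003140f5506b, 0x14299822ad8183252f21a, 0x10068c01fb,
  0x12c74ed007946e50077007fc01fd339a84c9b4d47a401518c7d530460c7185fc61478a801ad5d40093dc0a7583a803ce0059a164b11871a9cd8107603fc002c5001b82e630e7,
  0x20093c62b20033e600080401f9007dc01f5007b650890079401bb,
  0x1800eeb0d10043400930080650a58c38f000bac1ad60d15d56843ec07a9c80203141e401bb,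
  0x6003bac34630e358347000b, 0x802776b8f35723386e8da200b24db603d,
  0x7580033b9bb001d3d0009b80413b087a7cd25586880163b0fae78403b7603d0081f4e530d879ce1795d56843d61629c80093,
  0x802e2803bd9eb2064aa0002da4d800f5006f6720c2f7185f9607b004de6eb42973079004c6b10d450008c801d2b094e2010f3a801f5,
  0x400d5ae5583bd30a9c520f34007a703c8019e3052ec3ea6ea003b004340093,
  0x86012008ba008a8a1615a14a9cab079,
  0x20107a00b200e5d4eac1dc3043003a6b9530291001e9c0f23052ec3ea6ea003b0043402118c2fe50a55d59b90193d80f4020d2a53a801f50082c0093,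
  0x15834401e7ac6e7026a0fea70b089ac1ac0213007d4020b0025402050079401bb,
  0x560d10079eb1b9c09a83fa9c2c226b06b, 0x1, 0x1d4865519d547d687298cc86805ec206b004e00, 0x460af,
  0x240b6984a6998dcd70cc7d56b61a008740193,
  0xaa33b282cea43346250b9315301e8043e010d9569dd529603da4c0068d9825cbc17f1a1ca758d1ebbd570748033a0036dc15e6aad03f005b6e15c19753960a3,
  0xaa33b282cea43346250b93144bad03db4104b0a5c02250079, 0x1bc98810075, 0x480d5,
  0x10088c006d0067400d7,
  0xa0e4c33f61d7acd984dea0c76c2605f202ff004556cae161f5147f660873409400b9005b40229bbc0112e1c401dc3009,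
  0x10075c808f3093e85219,
  0x70155c074f61175e1681e92e008b57f1d6bc800368033a803b99c005b402213685877d4e5828e31039464ee0ef008ad600b,
  0x761152c4c7175e4401df1b1a1c78e0970045a75a7e000da00ce99cac864016da7c6d0a354e5828e30c9ca0181da564003c022f0089ed7556ae557a980022a522e21c4d823c016100115144a12f6852d624a581ec60c73a801f5,
  0x5572842c4c6794fcb41590cd56, 0xaa2b368b0da0b352ae56c19e6880109,
  0x3706adc15e670023336918649c0ea3043e78, 0x10c024b0ef, 0x401ef008dc0239,
  0xd165423eb5202d084b8d0e5b82bed03fb832c3009,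
  0x6c4516545b6b5202d084b950efb40f4b0a5d4344022518874023d,
  0x6b220cb68490c0518b10590ef2a2db5a801eb40518818c43b28c9d02f37910077, 0x1008fc019d005b560a3,
  0x1545b68c202241a10eb5e4b40f6cf5c1d350350d10089750654300121804825ab0e650008ee794fcb41590cd56ae54c00235a7cb0b61d1d83bd662269c80118dbaac1e55e29c00474c90024f18318035b185f95c9429575561db58fae6ed80250193c000f603d0085ca94ea007d6e0b90085402050079401bb,
  0x200cee009bac3374617e00958035a00938023ab094e644009140217007d6e0b90085402050079401bb,
  0x8033bac0012dc0077370031f185f800ce00d68024e008ea9cd80f6e0b9,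
  0x800ce0093d4e002ceb0775393ab000b2c226b06b0085c02495d49c802470085402050079401bb, 0xdfc, 0x401c7,
  0x37cb3179007a6500d0c01e50a50092c024f0081401bb, 0x401e9003bc30079429400c1,
  0x8025a00ce900ffb08fd4ed8934b007ac1dd756009bac05077003bf374617e00338035a00938023aa72e0b9,
  0x15209710f661375860ec10600228033a58039c153ac00131c00745079]

def hints3 : List ℕ := [
  0x15fc0071a8ad2400b99b42c74f611f8c18cce26107792b003b45540051006145017401dcc9200e328438024e00d6c617f82802574cc8a161003ea8603009003040255b82e401e3b893f603d583976009,
  0xafe514b005da07b6804803d600d1de400666e0f342d8d80173401dc3009,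
  0x26480127006b630a30096c61798c4967e5643355ab9530385e6d087ac2c539004b28603009003040255b82e401e3b893f603d583976009,
  0x5322300566ab5722c67698148800f460a580104b24d800ecb24fcf00086abc003040093, 0x4020b,
  0x2a874c033abc00219004f4b0a5d43440225401dcb059, 0x6e1f5c9c4d8b15b,
  0x651ad1828c816da754d080094c50027a204c864af1c01798b69a6b858690138cc154803f2e5902975c1ae4d80265,
  0x97200476e16d0099f011e6587d75093145e6a76a35b4a960bf, 0x131459b5159586b751513b1640016d,
  0x264901613d00135804d20131dc1da9829ac0ef5859e223e0300580217af80053d858761099464c3009cc18737401370068e4aa7db04c802635881d61628a002619d49f2b91633b0020d6136a831800ff872003bcf0008c8c2f28076804aaa700093009740253b893f603d583976009,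
  0x18c3fe3059, 0x1009ac0269, 0x1d46b75127,
  0x4f017eac174cc13ca4800b6804e65c0d9132a540138d40009be8d12230c80130d720546e0ed32c9829d623778301512596f8e16141d4436099d820d30efacc70fa861368c10009b4185600354db037988d8424f826447b0b0d7cd42cf5f000a618048a0079830ac12760a009bc959b9720026200dc803be0136daeae458ced30290a8fec007b00208c14b584daa0c6003f9649f872003bcf0008c8c2f28076804aa012f80126012e804a6728d15c49e54b603d583976009,
  0xad24a55d2920635a4f200a32e13e0d916032c878965be4b883a885e0b45eeb3686d826530efac24f6083,
  0x432730c5b500a3, 0x97cc540067ea0b4324e1eb0018cf3172d813c9b004f3482e16d, 0x40279, 0x1b99490005d,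
  0x804fa4d89c17c, 0x12b1b093ec4a6a8acca1bbada006d00864b059,
  0x2ba2509b4ed0041a60c677b4d2022c16cb08ba0184b0fb5e19ca702a49f80449614b49951fbbb16825960df660c7401afa86e9d0,
  0xda2c3b073d6ad849f6253948655159d6ca832c00da0141804320142dc19fb027dc0da01409e6009fd131600ebaae2660ee00dc804ee4ca952302c16400d9,
  0x3706b9e800a1eda004f670fa861368004ac006aa3619354db0379884c88e9f57c0c0245003cc186e24f3947d8d6148547f6003d182960041,
  0x3500027f00196b077002cc303d00a2400e9,
  0x6515bb84002ed4e00a2cd1161336b96219ae458ce9aca60522003d1829600415418f0e400765927e780043400d90024c0067,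
  0x4028500a0cb0075d57133077006e40277387d4309b4608004ac006aa1536c0de6213223a7d5f251931400f3061b893cd6148547f6003d182960041,
  0x12c27f53620, 0x1b757093d6ab847700a5a2cbc097163a78e2d007946e50077,
  0x2b612f003ff18faec0de9911d3e9e580aa9613f6804e8ab8324029300a46e0d72c56ed2792e570299c137583b80166181e8051f71278c2f2584c801d36bab91633b4c0d21483cc762e64007b53860a580106e12c17ea831e1c800ece51649f67b3c0021a688995404e4548019d00744028d0024c0067,
  0x180564b219, 0x970,
  0x4d917000a640297279492a75c2b3c4caa00033a00e8cea007d40295001fc01edd810705560d791080632c02f603b0093c0275,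
  0x29813b6a1df732920039680b0962b65c850ed3cd5913804028052ac147a83fa9c94224b089,
  0x328addc2d46b6a72729d400fa8053b5f16d00236181ed60ef2852a9c1400cb089,
  0x750c1c08b0718053eb929f460c6baaf960ac002eb06b00a6ce26c1ae5700251, 0x14013f6109,
  0x400d1489b049961b3681eda0138d952531405d50efbd580aa8019f001e9c0f230529ba,
  0x29e2304554346774e0a9549acc26156bc17f00347792e0f3,
  0x1006a402a73ad67a725400067401d15849750c142d004dca1129633063,
  0x2a297f163a7b02fde400897000b1405d2c0607a0154ac0160152a00ee649005926d77b3c61c,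
  0x23052e5e5fdb092a8a2c74f605fbc80112e0016280ba580c0f50077, 0x1941def26c1277079c049e95b605f,
  0xca3eb8e001a9,
  0x20154a32cbc98bc8055ebc001a32c22402b13ad67a72540006756125d43050b401372844a58cc18c02ad,
  0x71c161138bb605fd4c586ce20, 0x1d437d2c0607b88002b5,
  0x3b02fada2c7d7102162c74cb15500ade003d381e460a50043401ad8c28c02b300aaeef678c3840649f6ca0402bcf2d867760b928c01519484315c95e15200307603d00635755a10e9cab0d3ac2c430095838c80630c0ec02a1,
  0x100a8eb900183b0e8c61ce00759524513aab10d007d402b9ac34eb0b1ac24c02a1, 0x802b33f3605f,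
  0x258fae202c74cb155, 0x3a849aa0776805ea80014750df, 0x402bf,
  0xec126a28b1f52c74c0051401dc02c300b0402bd800f7000b18296509fc14703cc007755b255f2004350c5725d4006c8018318738012699801b70078c01df00aec30095838c80610c0ec02a1,
  0x501b9001fe50a5, 0x67e004c6a2800e9543a54e001a3b01eaf0543bd00792c29450030c0f40225401dc02c7,
  0x1d80f6e1c79464c5003, 0x37cb3179007a6500d00b2c02c94064c02c7,
  0x4ae1469c9014bd9eaad502792c07a007e9ba5e15c800dd2c74d6a5a00e004bca372a7100773826ce0d1,
  0x4d917032c014b805324f2921320067401d1, 0x4016dd46b4027fa9c0168d403d06d0b05d00af6ab572182a6e0ef,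
  0x6019d2c16562972c93f1452a1d20068af0543bd00792c29750d100895007700b4f603d0047c500300b3c80632c02c024f00b3402c7,
  0x4016d009fd60a3, 0xec07a0168a014bb020ec076570016dd46b402d7a807a0024d0093d60a3,
  0xdf2cc5e401e900b6400653755c8011b5a9583ba9c942252c461c79830805aa0163e1c800ec01eb980573c0021a0069aea00367624f0024c01e30077eb093,
  0x33caab53e80a5ca315c0072d01612c56cb91e6a9d3a93e6c0d700209649b001d9649e0086801277139d720046d6a560ee7068a9c8c38e30e7,
  0x400d5, 0x402cdbbc0058e780095560e5c3880c98a037702a805bf7f3000b, 0x96077b0e8ec07a0151a9c,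
  0x400b12c80033cfc80344b00b5140170aa1d2a877804c6bc0013d2c296ef0044b9e30e200ef7ca3093182a6e11f003a402e35d49993e15200b1c02dfc002eb0b1,
  0x6f9560ef9285079599588bec07a01659019200faa7c00b9402c700b7f000b00b76b0d3ac2c402db00b1402a1,
  0x4016d0017401070063ed08758397226c07a9cb61e7007d6b0b1, 0x6955c2005b6515b, 0x26490161,
  0x3188faa600a8d3223, 0x3a433f4a0feb163803a6903510d5f08d35093, 0x4d1b9,
  0x805e26849ea1bba9802f3b3c6827d240025402ebd424c0273d42cc5079007a560e5d80f402cb4064c00ef5d4006ca660078c01df00ba6fe21600b9e30e700b1402a1,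
  0x100a44303d, 0x5022700b1e30e7,
  0x201789a127a86eea600bcf50930025560bf009acf46be5824c01e9cdc283c805dab072ec07ba97b801de80c98021aba800d94cc00f1803be017adfc1400c02f700be402e700b1402a1,
  0x402ef28c572722a3fa0135d4080104b24d00bb6ef6c3ebafb4e6785824f37004ab87160e5003bd01938c24ee11f003a402e35d499ab0b100beca9005eb7f05003cc18402f700be402e700b1402a1,
  0xd9ea81708019d00b4401cd, 0x26c8b819600a5c0299, 0x9c503a8369fa9dda939ea52e6980958,
  0x9c5da5600303,
  0x1ac52d29401cba830863d78022e5cac2450f1c3d38592e0a0c7a1a316dc6870869c1df78a30ed3f42822860166a8505bd89f6776c0ca01829a08628fa960066804cc0c3a965aca34973292006024cb6299b8550002d93d16b8da4fcb895f0d6005de520e21462b8004a805fe40feec083910b00b003bc024f,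
  0x804e601758060eac802d3547f660152c93c00d34c20d660021bb127803ea006c805fe0049ac2006b7220049a5805e61520127805fb7f05003cc18402f700be630a300b9c02c5ac24c02a1,
  0x1d80f6009bbe4ba9392c24cbceb0b10078c00eb0c01e50a500c2402c5ac24c02a1, 0x6b06b5d5b01ea72,
  0x1007bc00d3007ae000b94556b06b, 0x12706d0f31e800b4402ff, 0x13417f50bf3b0758005d,
  0x9e83246d0dd138, 0xea57a628976380c114d10d, 0x520286a2c8d097638402a43045008940313,
  0x2a81eca49b98529a21ba886a349479f317d, 0x40313, 0x100c6d00a9]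

def hints4 : List ℕ := [
  0x154b5ed301418a8b6980,
  0xa0cb8bb4c01c0a72800dd61444cb075b8347516dd423cd299c01286ec01060190a3cd824d19161daa296007508bfb105a00b7064e8a,
  0x258faa845fc1822aa1df681e80647a98031f2d53cad057c2c56c02d900c74031900c5e9f1462b876002eb325708005d3755380315007d400d900c463063007ac01efb697044e1cb85b631250ca5c61799420f603d0047c030f00934024f,
  0x37cb317900c95017d942254e001d61803801d32852a16, 0x80297a97bec01257002eb0036401df,
  0x36892c601e4028aa137a927acab989b802ebc89a97ba72007d40329,
  0x9e832518a89baaf90180802da585cd3e4e470bcec33a00faae48c18d75003cf58efe04d41fc032b,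
  0x18c6b60301ae4518dd1b42b8648be005d6016c801b201868049a01968652e002ed4e002cd6a560ee7068a9c9422630e3cc18402f9,
  0x6dd518ad4a8b6aa603458971923b07a000b9,
  0x1abd314bda2d85b4dc18ad89bcbb1d818bb4ca50e25d788bc5a53345b475c24f5822e2ad47ad552c20668769a013a965da016b2ac85ccad549102352f801808062a4c8d04f009ff629900cc51e2f0004f6ef65eb697044a001f872e1211406ee16d207f43297d8106b06bb817722100c65805801de0127dfcc002ee055,
  0xa046a018a805ae0198dc19f6d2e16d0ca5ee05d, 0x4da17c00b66e099b83bcb00b,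
  0xd249c801998060200dc932004369529c374016c80662af0c96014b6804e8400cd5782a1df681ea00f25852ea1a20112a00ef77b3c5b4c3928c986012019bdc2da194bec0835835e442c02c00ef0093efe292c002c02f9,
  0x1009cc02eb, 0x2011a9c4, 0x1334a88a93e, 0xa86,
  0x29854aa5bfaab626fc4db0b6a6c2c19eaf53ac9d314bca0cf689441b82c5e7024fb839cc5662eea82faa13268819d8ac11462ed32962097178a2caa8d0edb849ed00b00d04d1eb5e1804ce38,
  0x6b045943bcd0edb402c0341, 0x1, 0x40317,
  0x1b435c03472f0a85c8069340fe8068b8e3531614a01a1de2d1d8a8d009c8da965acab217333b524d245f1023527001808062a4c8d04f009ff6299d09882e16d0ca5ee05d,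
  0x1c7058528066a018b9923b07a000b900d2f42620,
  0x5691c68294a0253b83774d5607aa979c05d668faa02f37049964b4a66c45a52e0190aa2da8091e5c52258faaf0943b6d03d,
  0x2b615d296cd591b5c5a602779516d405a131c4a1da01a796a9e568251fdb8266be1b43245f2921e8ac16400b9,
  0x6e0c7943b6d00b5414ec85cca480180932d8a640351d439f53620,
  0x100d340353a7c5803dc11200dca28cc1df2f5b4b85b43297,
  0x258ad805b2798dd692002c4035528c570033b00ce6ef678c3818048066e40fe8652e00fa801b3b020d60d791080632c02c00ef0093efe292c002c032f00be40327,
  0xa0222016b804e7503511b4017cf464acdc00868029600dcac1cbb01eec012570033b0036401df18d1ee05d,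
  0xe4a003bd66560eeb9160e5d80f402cbac2c401f5,
  0x805da01ac86603300a8021b873624f006e4300900b2f60092b8019d801b200ef806b601abdfcc002c032f00be40327,
  0x805fe00f0e442c02e5097006e73077, 0x1ab88aa9e6a1df5d202ed, 0x4e258cac3556077b606585347ac9ceb0b9,
  0x25a950cf, 0x56299805b40365,
  0x1ae801b1806c3598eea0c6b4b004556cb0fa8a3fb30438060200a09a04a4c800b9, 0x6b33b, 0x281a0a24,
  0x9ce0c17f32810c1b6e0061727180e01737070e00bb620d2bd547d7611b001e75043d83a6e059,
  0x22876ea49e28fad63269e0516db4166705c400db4d6006deb09331f,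
  0x22868e62aa938022920be40371b8bb55315b2cb14b9de8035cb5202d4d9c970033a00b6806d201b3da013681ee01126937ca44ebc0b0a58c18e000b,
  0x3301ec00066291d12e0026651d1989f650b9, 0x1001b400d7,
  0x30076e32c4cadb552b8587d5192a07f59051fd9821cd22700266016d34096cf006d2005cce4005b4037700dd4ef16a404a975aa2db717bd18ac074d1f5941aee11b5414e50ed00dcf251614b0068e6033879a905ba408d4ae06087b004a03264030e000601afc60c70005dded388022e1c5641804dfc00bdc02f9,
  0x14c33d07262db6ba82979f8ad8e2530d10b0faa6693401e8007bb041a100042c00454cc7cb03bd418c5079,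
  0x1acbfeb2d72cd9ccb4c2c36c28297b1871351fd57099a4ab638266b0efac3deb2f9587d5080008a300bcc1db5872806f7a831ec016b049e6eb8db400efac1dd4e0a0f3b01e806f201afc60c70005803dfa72e089c381804d7cbf9704c8a007983099200bb402f73685f002f9,
  0x18c7d71a46177b0eb802160022daec613f350635151832e6e5fc011ccc09b5f2e36d003bc013d0c02450030c10d2c0044a803b8c2f28076a9cb893c02f9,
  0x1005b4019d9422750c15828f52f7185eee0ef,
  0xe1c0c026ef1668201bf807020074a9cd80f7492c1a33076d61cb6843d61629c802f9,
  0xe78bbc8076e1cd80f4300900b2c5003,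
  0x34fb62d18c18d75006ee00f3802db58dcd60d7813507f5828ebe00703583a9c1a318728607aa4802f9,
  0x100def375c6da0077d60ef1831dc1120086ec07b5868e920c026be2010f7f2e08300e1402cb1400f3061,
  0x575460c77ca9f57c5824f051462b870689a01e01c38607a01c4807069f002f9, 0x575460c77ca9f146,
  0x5752660079eb1b9cc1deb06bc09a83f8070201c6d7c3834630e52cd04303d00e2401df00e2c02f9, 0x2998035f,
  0x8045b579141f65844b8a41607e01139d63f000ceec6ee01bbea4f3b0e8802db4fb1c2c1475f251b9ac1d4e09b38344303d4f91831952,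
  0x9a017b16ea643b9a9571646a8329f162c30041d96b40b14b9de9e458b6960b25a80367,
  0x55301a304badd6a6cf5a9516d00e55603d5494f00a5543a400d1,
  0x100846ef0072fa1150efb40f6e2f9b894f50d1008970e200ee1804ca3275f2e0990c10c5003cc184039300e4630632b8baafe6c01280c9e000601c795200d7402f900c9c030b,
  0xe03a77028af05fd681eaa49a2805de425c670c91e62e401169baabca831dde00545146783eda4ab125585870a42260089cb03fca07e36377d49e761d128d4f803918c18d755fc4064ceb0071b2844952,
  0x7619da7c4074c60c6b068aea0079f52c7d80f4039bc090068ea183a8748033a01bb802da01c6d7ca9cb051da00e0059d60ee704d9c1a2a7250894b11871e60c201cc806fa6d0be15200d7402f900c9c030b,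
  0x201c3a7c368407497c58345751e80079c016dac6e6b06bc09a83fac14601c0d60eea7230e3,
  0xce4009aea01e85824f375c6da0077d60efb01edfc00b2f000b00e7c02f9,
  0x1b4a5cc91ba94164f35b4947452019cc6da886a862c296e0e95f1a86eea600bcf50933b153ae12c17e194c804d67a1609394d0752918026f370c2f200a5a9cb893c5079d80f402f9,
  0xa604eda877dcca482876d4e5828eb2270046eb077d81054e6c07f28448607ab0728a00658448042e01d1a7200e8402f9,
  0x13cc6709c2067aac8e0d18c396b077430b0518660200b69e82b99bb60094064c03a5b815402f9,
  0x750e90047c02ff,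
  0x10024c01ef98054da17c00b6400d3ac1dd7540016181e8a0065844d60d7b01e8075201269601601278074e01ce95200d7402f900c9c030b,
  0xaa52e62897004d73900141b2000b69e8584940051cc5e4303d0c024303b, 0xa1e4b90072a90147f4003d,
  0xab6ac635294c1db58928008a01d780283640016d006765089,
  0x2a804aa077a131c162aa00adaa52e628026b9c800a0d90005b754200ee01d6a180030630e7,
  0xaa52e62897004d73900141005b400d73cc670b0a52c55402c1d245f2315126c64802ed, 0x154a5cc512e,
  0x3390026b0050560bf002e403b700145007700ed403b3cdc30bc8607bac1495c49a01d89058e417cec23e0035c60c7afa53415d486000c18c39c30092018c303b,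
  0x804d73903279, 0x3a8feea3fe704cac3ea843600b, 0x1d6580b51ff, 0x359b5d64fe5c1605900daeb19d,
  0x6b3afb402e524f,
  0x4b1d3d4c0028ea800f0c03c156c1860ac0e2a4003bf00ef6925ccd424e7252a002e4037700eef5063d802d60939427c01e9cdd71b68077286000c18c39c30092018c303b,
  0x1d81ae30e92c936003b36800868012600c299cac00c0051d83b50071cc18e509f8026c014b,
  0x432974016403c73257905017401df30638026c014b,
  0x20069803de00a9dc10718a88021a64802ed00f2760ed401c730638026c014b,
  0x99c2c294be005824d900453cc64802ed,
  0x506564249618ef6a6ce808b5402db8cb416aaa3128e8d607a01e1da0177031aa0772927da00faa2f212e1405c0051401dc03cd00f2f50933b1b14c801af4a800b956c28bc86182b0388007a01df8077b9831d649bb005ca13f004dca6839b8014b4e401e2ec07a86000c10c02560e320184303b,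
  0x6605f202fec158cd8504e2152d8bff61d1,
  0x6d3af3434c02b594937534a3d2a97ce63eb404da842c366600920b2f60e3ce13027e02abb13f9f6b8edcd657238854a98166d7b0dcec3ebb06c95cd8c7403d180c04b0b90024f60ef3887631fd5849f0b03d2c107052c1a2ba90b6a192b6b000b2c226b06bc0801e7a180030630e75838c8063,
  0xea3fa188fad2c011451fd587d660873409731794029750c9ac1cf02001af7f250890032400c10c01c03d35838c8063,
  0x37cb3179, 0x73b0075600f595c8002e5155d80ecb089ac1ac8063,
  0x7511f59570ae6103fb59e8805a201d4ca107b01e807b3a93e900c60127807ae80beca1121803ca14a85803d5,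
  0x6003dcec0049e929805403ab2b8baa000bd80ecb089ac1af603dd49f403a92018cb00b0093c02f900f6c03d5,
  0x1ae46e8029d0019403a700e1cf4002da9f080e958345752c14601ebea4fa548011bac1d4b341d80fd60e3c002c021700f7402f900f6c03d5,
  0x13245c8dd002a26d0be0040230aaa62b7b02e9f80016403df3d000b6c60c6ba960a300f5f527d2a4008dd60eb1871a9cd80fd60e30c0f7000b2c224021700f7630e700f6c03d5,
  0x36d28b5a602a85cd6a, 0x1ac11560c9d47af50e3,
  0x2b01ee014a8001ca0f201f1a02f346144007ca480b09f947d50077]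

def hints5 : List ℕ := [
  0x1d89bcbb50e581065079b4a6550b900f8edd518947357b0013280fea4e347d55212e511882d03d946e73087b8b1c00b500f9c60631402ef219c324798b91ba00544da2c22f88a0020118555315b58d9f605d3f06876802371871a9c00bdc303d185e7000b1400630e7,
  0x4f30024e5c8be005db18a89b400e1c03e900f84eb0033a01bb802da9f0b03d203a6306358345752c14601ebea4fb9b8a900237583aa9cd80fd60e394224303d58397000b2c224021700f7630e700f6c03d5,
  0x134ebd0091ac5dc50ed,
  0xe1c00fae925cc00fb6a72c146008dd60eb5913ec082a73603f94224303d58397000b2c224021700f7630e700f6c03d5,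
  0x154d9e775a147a94b9a603382e22c24500092a62b6b1b39f8d817728000b201d5807df58aaea1329d9625a1a773081fd00fb4b03d203a560d1b84ba93754e5828c03d7d49f6e0532a4008dd60eb5913ec0831871a9cd80fd60e394224303d58397000b14004021700f7630e700f6c03d5,
  0x2403f8029601c09600e59a0ca13ea73603d, 0xe12cbda48038900e173061, 0x120d1f527f,
  0xea11fb13e807ee692e61aad46b560bf, 0x1009af50fd,
  0x8070601fa9b400df4be00372012e8021a3052e5e2905980ec1ae01d5e78ca187003859c87a29254000fe403fbd418d6093b8db400ef00f5c30430c027306100fcd00edb893f603d4021c03f100f7402f900f6c03d5,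
  0xa644b5868ec7af6843a72,
  0x3299eaa0ba01f1d16d4d9550bd54bb76151d86b693598b89a93cd3ed851cb0d794cfcb16d2c8a127e2f051429a0e12bbcbf8615540116e089,
  0x31940960dbb02cda0a7db0e8a66ac436b0b1,
  0xca67f71a49618aa12e22551429a0afed835f6315b953bb506d38c56003f7d4a5f60675980201af0bbd9e1144007e703c9ba0100403ffb820ebe1b425c802c97c543bed03dd4a4ee2f9b894f50d1008950077185e500edb893c02f9,
  0x2a81603d,
  0x1c027d7f62e0101d782a197717cdc4a6672ef5a4fa8022dc112798c9005da0202807fb390f41d8a49502a71aa00fe560bf00fef252c12771b6801de01eb8608601658a0079830807e60074a9c58397603d4021c03f100f7402f900f6c03d5,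
  0x4b3010100c03d1ac436b0b1,
  0x154d9ce34ee2b1b18a807efa94bec3c658f0a8a00af762d94c56d63653f1b02e800b20205c60cb5f0da17c347af52939489ee25300896b10dac2c5007740096003dc248a002ed8cb1eb09bb822403ffc39b07680813390f4524a81538d5007f201fdac12771b6801de01eb860861804805962801e60c201f9801d2a73603d4021c03f100f7402f900f6c03d5,
  0x31940da02c1b760592c2e60301a7db1af948c2489ab407381de32c7, 0x1b40fee0cb,
  0x902db4d1554a18fb1f6802ae00afe9045c586bd5e3ed4c0a41c4d823c01610011402275c8581f9c43a8a0b03b,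
  0x760592cfe69f0046a01e8803c2581f952201870003,
  0x902db4d0c255e9431cfb4a15fb1f6802be523481c4581fc01610011402275c929279607e710ea280104cb03b010563065af86d350e93ac7a0019d00ddc016d5828eef060761804c65ef5a03801260207ca2f25927c658fb0768a0079830a7cd49f4a95fc201870003,
  0x13cd185f99c2f880229b4bbd53a310318876e0ef, 0x10100cb0b980c0761d14cc8a0e079,
  0x63281b40585cd3080c069f1c0f3b0e88046ba70b03fb45f6b093,
  0x20201961730180ec752710eec23e89b49612bbc30aaa008a020d8083b94003ab0105cb0830c10c03918c18f527d5d454b375fcd8025019320184040d00f7402f900f6c03d5,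
  0xd0017a2156101cabd260edd0ca327d506cf701edc77a6131c16825c0116d5e450417c9f63f04074ec3a3b05c946a7c01c9d7c36852250a9b45f46155d3800499d63d000ce806ee00b6e1c5828c011b00eaeb0753826ce0d12cd06b07900bdc041f00e463063d49f575152cdd7f360094064c8061c000c040d00f7402f900f6c03d5,
  0x1518bd27d203cf1838d06cf71df984b8ef4b0872d0a92792e338798022d375578015145158929f658401139482c0fcfc6c6efa93cec3a34f80393af85f0da0024f5a0380842758f40033a01bb802db53960a30046c03abb814eb0753826ce0d12cd06b07900bdc041f00e463063d49f575152cdd7f360094064c8061c000c040d00f7402f900f6c03d5,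
  0xc62a32855e92b8bccf4006ee008d8012600979c1371872d60f20077a284cc0076da10f0005a72,
  0x21804e1c0045f3061, 0x25cae3013cd410ce17c8c2fc3301,
  0x2bf2ec565f35929ac08a638e3b7378b14bd742c165015663a01b0aa2dba831ad2982968c6008aada0093240b0fa9d600ebc51fd00c06cf0028268129329c964000b9005b40367,
  0x1a2da8869a1db291aca847a93192e0067400b9008a4042bd08a877da07b7129ea1a20112a00eeaca5193d889ee0998c32750e90c10f3061ac1cc02f9,
  0x40429, 0x1ac7d401d1, 0x1010b4042fb740176a9c2c20c3043,
  0x66235d11a1a6059203940369bdcb03bdb0ac94c534738edeb273ae95857d663a01b0806ce813eea0c6b4a60a5a0a5f50d100897004556cae161f5401dc03af147f4030143000a09a04a4c960a3002e4016d010cf50e9cc186b073b815402f9,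
  0xa002dd5a2316db7d6b8cb2a80d0a5475611298639c1da1a03a4c5f9597cd64a71976e61a3ab360b9,
  0xec0b258cec06034f80437, 0x2bb2e1d34fd0022e4eb83b720666c00f4b15bb89fe32bd,
  0x1b8bfee2d7010ecda57c010e651fd800ff62278c32402ed, 0x1b8bfee2d7,
  0x345ac4006932876aeec702805ac0d08808ef6a27a6000367b515d3200052f99b003d2c56ee27f8caf6da06532021f96a2ccecda5a02c67402ed,
  0x760592c6760301, 0x259fcec0bf3c800f1,
  0x10ca64f3200bf18518088b001dc007b1963dc682518044301104043dacc740361d47f750635a5414be008aada0093570b0faab200ebc51fd00c050c0028268129325828ec80017200b6805da021ae1c0109f50e95385841860862801e60c28a13327c,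
  0x14017c3299, 0xcc67a74a316d, 0x6b9530, 0x1b83445155c305bb0b2000cd9e316d0112f30d18cbb760b9,
  0x1cc344044b, 0x1a316e9516dad545ac42ee581a1310120,
  0x7194a7dbaaae1fd540fcd22750d717bca1da284dc64cab06080113a9b546200114c0083,
  0xd18948d6dd564b8bb65077d08a877da07b7129ea1a20112a00ee022ae40ccd680b19d0110f003dd813cb15b40cf634433cd6d03299010fcda1617301808089fa8feea0c6b4a60a5a0a5f004556d0049ab8587d5591d600ebc51fd43167801413409560a39c8005cd40005b4044d,
  0x7615fd827d7e1c14a94801413409400b9,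
  0x200ce9a80600b6808b3a191a462daa90b724031145aef500cf16193063800feb2180d889ee099b90fd060085f6e8b2005db00b6dc112703ca4a2d4bfad74a0ef3c9456c0b3680b0d7,
  0x68b6a21a6876ca46b2a11ea4c64b8019d002e40229,
  0x31940960dbb02c80857b1138089e0200ea0c73052d052eb13ee008aada0093240ae161f53ac01d78a3fb67801413409672590002e4016d01174b0a5d43a6b073,
  0x2a98edc19f29e8808020176808bf84ad03d401e4b0a5,
  0x562970117cb059aad71a4aa17aa12e2255e0a285341c257797f0c2aa8022dc1120217dbab8b5cce17c01184045bb4027422a1df681e9614b7129ea1a20112a00ee0226ea1d2a7202990c10c02f9,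
  0xe013ebfb170080ebc150cb2c294ce1e6408d4be5de2e44d90045b8224c9005da0231ab201067280088e022bea1d2a70b0830c10f30618c39d3327c,
  0x18ca04b377d8166b367, 0x1011475063982968297c01155b2b8587d403af147f401413409400b9,
  0x808ba803c9614a7580377, 0x6e315b4a5e510f,
  0x7510da2c6876ca46b2a119a886023686012023592eb83a40229401e4b0a5d43440225008fd0077006773061,
  0x3a886ca84745a537780fdd50d7, 0x3a886ca84668a8ca21329bbd0e, 0x13519ed301011cc0471,
  0xda52e0238dc0ca023a92eb4026d03d, 0x6e315b4a5ee065,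
  0x2a81dd62d44375093945b68b4a6ef6228c50e530b5b6063b4f5e894a3d698fe8a1234a1544da89b0d6d96509b0a8a4ab411552ed2c165451648ca04b377,
  0xa3ad443555516b5940350a3b0d01fbd64543255028a011ef5367,
  0xec1c75805d6a011f404795e16803dc58e023b9a3eb40bce8abc80208ca326310e808de758019d00ddc016d011a6a81f88cbb75279d82e4a35bad43a43043d49f6b073,
  0x550f3, 0x404773ac00cede400dde50ed005b71c00822b051ca326310edc1df8ba30e7, 0x1002e4046f,
  0x4342fccbc6b31dc658022ab8587d4e0910026403af147f40301b3c00a09a04a4ca72590002e4016d012152051654676c3200169831d643008325227d43440225401dc0483ad501dda4a941dd50e92c786e09701206327d2d53c8b3778ca06d0008fe0233d66cf5f0042fb740176c00131963801cf2854dc683b076808ca022b8089b1824ea1d20218a9c2c20c30431400f306101094ae66ed8027527dac1cefe100c38001805f28a133001db6843c00169c80423,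
  0x3583b801dfb01edfc00b2c5003,
  0x258e9da00f28dc8059371ded62f37135c689a01f6ca157872b227d7da8608016200868033ba480377005b6b1b9b8bcf026a0feb05196172008d80127702980703583a9c1367068c61cb284496683583c805ee181e809120243805f28a133001db6843c00169c80423,
  0x650a9003ac00932c226fe560e61803801d32852809168a133001db6843c00169c80423,
  0xca152007580126580680182af0303b, 0xec01e0049c624b9da50a9, 0x37063ea6943b6e11b, 0x10054632ed,
  0x40377942ac016d,
  0x6726c1720234d400125c0495182973179800ee030142c585cca112008680127a864adac002cb089011348061,
  0x1000fd5c401cb30aaa1e, 0xa9e5b958c68093601d780283640016d006765089, 0xaa6024b80051,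
  0x18c2fc0449, 0x154025503b341ae524d,
  0x25a1611b25c8d0b1550124d5200946b074ea8401dc049f3ad67b333f00eec0141582fc016d,
  0x10043403cd401dc049f3b000ce801ae005c8094b9bb58292cc18f000b0127750c98101c3009,
  0x10126404a701246f92185780060c61ce024786012b071900c2181d8091a8a133001db6843c00169c80423,
  0x750c9, 0x18d2543297007bc010d0034eb059cc5e514460c7500018d42d2806ea1932a49adac002cb089,
  0x18d1363495007bed27d0034c3297]

def hints6 : List ℕ := [
  0x404a3540f5549bd438f3155344970089ac02d502a1976804afe0068ef25deb83ce6003cf0958010d012bf64ab,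
  0x6d03db4026e4930068ef2692b83cf3b0c2f31892ec0b2585cd3e80c07619d20304e179006e400718c18e000b012c4ae2c24a85b051a01e9633063,
  0x100edd64a158494049fcc5e751a30c0f630e70c024303b, 0x403ff0077c00d9,
  0xae64f180bdec1d31822a01067074da3d6b2b60c9, 0x15948044e46012e5331600b298b801da89ad087,
  0x6003b0024eb0d1, 0x531ff2c117610d, 0x75b263a64028a26, 0x1,
  0x14c7ec04bf4c68f2861c0130f42284c71704ccf2185e630eb8c494da5a02c2e69f40603b0ce95c,
  0x1341de603d94b5c60e340186542354a66e06300edcb155d424c02c1584973179c15a8d18098a02608095e025e9018289ab0b1385e763d70077c00d9012ef106a8401dc04b5012cf5491942445077b3c01fcdc2ac16400b7012ad0c2bc0030630e70c024303b,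
  0x258aaa00ee01db8096ba8a8ac0c68d054075830552662aa0044da016b092a098398bca583924f50b3d468d0b59e009cec8002da02638095a9cb636b430af000c18c39d60e32018c04a9,
  0x1d83b63125, 0x4b0b980c063125d86773b1018270bc803be57000d9012ef3179592f6509f,
  0x20092ec0d728ffc61679d8018d9524cb089d80f404cdb98005bca01a6807d409421c04cb01325396c6d6af000c18c39c30095838c80630c0ec04a9,
  0x4517958366b05900efc03bda49a88dca13e0029df2c94ba9666c49e00faa720133c00c18c39c30095838c80630c0ec04a9,
  0x749460c718758031b2a49d60e75835803d77f251550030430070134560e32018404a9, 0x20187801d65844a16,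
  0x969578700325012f46155c259a5c803eb18928c2f3990e801dfb01e809aa0126807ae80bec61cb2844801d32852a160134c04a9,
  0x1001ac80e9d893730774f97f06179,
  0x1007d73b001de703bec07b7f30e4624b28aa809b2026b8049a01eba02fb1872ca1132852a160134c04a9,
  0x802a26ea344d00c543297,
  0x195304500bb4027450052779154ab324026e9c6ce194b803c7b0e09d84d28c80e9d893e3063a81284c9c0efa4ae3f78c3a73b003c3b1b5803ea006c800bb53804a9,
  0x10024e51fb942a749001db0005a72, 0x1c140195ea5ee026f800bb53804a9,
  0x3b1e0802da9cab4bd9426752c7ac1ce5089,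
  0x660150024d33660ee00faa72d8daee6007db5913ebed430404e5c095835ea0fe0271809c2002ed4e9422404a9,
  0x801a7300ac60c60049ae4cc1dc01f58d13539540d8daee6005db693e807da5cab227d7da8609e601396b06bd41fe5089,
  0x8065782b52f7, 0x2520827d35899b64238c18d756643a51a003d1829403ab800ecb24f381e400930043404d3,
  0x4b1e9ca1b2549c67e59b5d302c9cf527d00cae3495013763063ac24c01b90ca5c01e3012bc04eda8171fbec6d600fa801b24030809d60274800bb53804a9,
  0x28a0010d012bc00ed005b6d0878002d39009de0273800bb53ae3d7d524d4e560ea704d9c1a3583ca9200bdc303d00be404db0134c04a9,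
  0xaa89bb1ddce02b0413ed72a7c7031dc6936876c0132a1361ebd83940407141757f2f0543bcb0a5b894f50d1008950077,
  0xa046a798b919200bb404f356528c9ca3fb9d861550039c0427012bc03f94cd582ca65e68a0b005a800076ad40c10f376c6d64030da10f0005809120077a72bf88585003cc18404f10134c04a9,
  0x761e9d39b127805daba90193, 0x6d03d2c2940331549340317d0876000b9,
  0x12d3c4e003aac0233e12ba16834e53ed87a7624f8c18e000b,
  0x1a01dc800d569684c8c3d640418c92ab5aaf4a5da80bce54574a82298acc3b400a50074f30775d4b3004fb341cf50e7d51a980493c6c027cdc19f6d2e083af91a268066e51a519f2b8648f46643a027b9d8002e401f5,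
  0xac4faa980db425c6700341b40f4b0a5d43440225401de5193,
  0xa07a230548066f70e3809ffaa3c9e8cc876fe2161400f3061,
  0x1209f6b91464cd18318652e5716a2ea013df60094064c0501013f4ec00173284ce60007848061c000c01f5013d6fe2161400f3061013c404a9,
  0x76363209f74e6c3d2519336c49f183195c5d5b004a032798001e1c000c01f5, 0x76193d81bcb0c52c23f6109,
  0xaa5daaa2496a2c93c8b0b90110d3223,
  0x1809cf60a32d501e0d7c01424e0ef3f46a8505bb31b13ecee9c1b032dc435852133b740116049bbbc00f5946,
  0x9c1de7eb60a3809ccd50a0b7663627d9dd3836065, 0x9663b5586155a60520e21ac014367e464fa5aa795a0,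
  0x194db6b007812a57916167283bda09e59f6aa152abad045d041822d01c69c2d0464fa5a7896a9802d6089002fe79556,
  0xa020c114ef167e25aaab406d73c805112c2957840937001fec44f742e099, 0x533b7, 0x26e80513185540515,
  0x4e0ef54bb6eb4011e588496a2c93c8b19d0110f6059,
  0x9617368162979e4588996a01434b0a5358bc00515980546155d38028c80a2e0287e120142f60675840182946,
  0x1149cd50bf545640305344594b9ac5930c0515800f460a50141c0519,
  0x8c7ae30f4aecb8dd6300dd81df00d3484b04480146a98b1cd2c5b6036b,
  0xec2fa7077dd6981dc3407c0395536c327681004f002fe327dae4028fc65f23052c007a028a80a3a703c9bad394f8b009d87a7624f8c18e000b0146ca315c349aa3ce643a007780a0a28fada97a58019a0129b8d03d454b2ae62183cc6827ac2a2016bea85e02818063a40feca13398001e1c000c01f5d8dac04b7013d50073bf88585003cc18404f10134c04a9,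
  0x650cbcc3b652f958b1f50b1d44357c005e7678d04fd424e92004e72a499c92600dcc0136283c809120290803ebb1b58096e027adfc1400c04f10134c04a9,
  0x32865e61db297cac58fa858ea21abe002f3b3c6827d24d424f636b009ce549300364e493006e4035b8026c5079c880244dfc1400c04f10134c04a9,
  0x807579426025008e7370095e7a2a05c7ee79802ed374194b80373983636b013b401e1007d400d9201870003014940523013d6fe2161400f3061013c404a9,
  0x25a55e500034c03ab00c5660250149c3297006e730009da00f0803ea006c900c3800180a4a0291809eb7f05003013c404a9,
  0x1a811a4adc7ef704cdc1deac902350c10d0193014a4f300a4e194be600078f636b013b401e1007d400d9201870003014940523013d6fe2161400f3061013c404a9,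
  0x401f50149760ed014af3061013c404a9, 0x9c0ef28fd960a60296a7c8cb1f60ed014af3061013c404a9,
  0x1945e4b24f0039f60ed, 0x195306d0091402f4500526aa55de432570b6972, 0x97240425005900bb6e16d,
  0x402d7, 0x40535, 0x180c0631ad01376b91ba001940539, 0x1014ccec4a132798053b014dc005d,
  0x1cc158fadfc, 0x195306d009, 0x22a55a613fb06beb62cdaf65252c10ed0a5,
  0xda00b8daf26c97b40bca842c365603dd838f01559e50180d3e0150cb0b9291a93e952014f6b077002ccb34100bde353100be630e7202ccb0434f95871e788c38c052f,
  0xaa02c7d57f620b8326d007, 0x651e994f5c000d, 0x4e4c333864b604f, 0x1,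
  0x2ab804818c99533e380c060299, 0x760e3, 0x80a9e586bcf2a7c02a1948d49f4b043, 0x10153cb0d7,
  0x5782a472ab930874c27d609b,
  0xec4d6594b95cd94bc05570154c055101537106a6015240547ac1ce52f31402e50a542c005a80a8a9594e10166417bac1a368529c1529f2b0e3d3987230e9942a72f6c3730003e788c38f3061014c4052f,
  0x1003a400eb, 0x46077,
  0x37203aa822990ee9ad288897756682b015253478a844ace5e188000dd943b6e2f95493c500b,
  0x6e3bfb40f6508b0157e61932d53560edd802d2e0619380b200695602ae9008a8071e688c7d6e52f54934500bb894f1519c2f87a0053ba55001d80a6f53b54935380086dc0a7583a9c136706896683583ca9200bdc303d00be4055b01564052f,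
  0x4303d3834400ef, 0x13cc0093866025ca3495, 0x4016d3d0573376c0120077dfc, 0x4853b,
  0x6e3bd946e4e0e541524b1d300fb7155c4d75913ebed4306344d3d000ce802da02b4d637202b380aca523527d800f4a954e5901e30e95828ee4a301586d007b814d655dac1d4010dcf00059805ee59a0c61cf1871a9c0156f000b2c22405632018cb00b01564052f,
  0x20219808ae011aacc9426750e9010c7527d2a4a716a1c1a37f05003cc18480632c02c0559,
  0x140166e1d1b85b43297, 0x3b1dd95cd8dad654d4cf96a000a7f582c80adf001fdc1320217805daa708063,
  0x3291adbaa31592e2ed, 0x6dd1a2a37214dcade02b9e84543bee253d4346e563008950077,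
  0xe5ed8eec00e35953533e5]

def hints7 : List ℕ := [
  0x1d956481ffc0d05656a8b980044ac2a3aa17903fa581ed63eb1824a26,
  0x4d151b90a6dd2a2db5aa8b58854266d03dc15250079,
  0x29f9764008a5a97e0a92a92780af7b25ec6abbb049c049ebc2e559b94bcb0a5, 0x963eb88250ed,
  0x6b53b2054430cfacc7484a1d50bc04515854434abad4bd086a0c6b4a8297cd30f003dc011451fd570b0facc10e6812ebed43a6b0732018cb00b,
  0xdc9c2b82e0d9b94c55099347aee539345640089b11aa17ca0b345ab1f500d240581c70182280affa98057d28d001ddd0d822c05775953533e5015e402bd2018cb00b,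
  0x1cec59d7e50a7d1a14da08c1fe790017e522ab00b0602badc676a9fb80603716bea4faacab95c5a25709921801287636ba54029bd40015c4056dc380213a9c5a87068ec0128585003cc184806301564052f,
  0x33ca3429,
  0xaa127a81d9a01758beaa80f6872ea1df58c98a0ef92ae66a85f6400089347af1b6201528ed045541b069afe0101f0155,
  0x80aaa02a6cf24000c0589800feb551d8eed654d4cf94057900af40587015d4a35c5afa93ed72b8b44ae0094370b636b014dea01e8,
  0x67e0080e592003f54bb763bb3402f426a6cebc0036d2b9721faa1de5852dc4a799b6ec6d772b18044b58c9aca9a99f2d61c7502b087af8b25e80a7f582c9a09e02baa00ee0217dbad55d402ed0162f3c29cd802480632c02c052f,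
  0x20022cca5f8c0045bd47bc81eb0113c04a34815a97a10d418e8297a2d8022ab68024e5235570b0fae84b402451fd00ebc03010020cd443b90fd50ef00504d02526567a5227b894f50d1b958c0467b20005cce400896be002da024280aea803b8085f6e802ed0115c044dccdb40235003b6b0e3599284cea1d20218ea4fa548058d56528c9dc13377b3c29c5a87068e6ed8026b07301226fe2161400f3061015ac80632c02f64ab01564052f,
  0x3299fdc693a93ca84d92bf60e50101d7f2f0543bcb0a5b894ee563008950077,
  0xe013ebfb170080ebc150cb2c294ce17c0049c6347016475575598022bca133a87480863014c948d49f4a929c2018cb00b,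
  0x101625786c6d6a8659614b500ce560b2682797cd55d400ef, 0x318a8a067a02ca972b8b44c929c,
  0x10150d666c95fb1ddd30aad299fd72b8d25426c1ca0203afe5e0a8779614b7129dcac60112a00ee02cb80b26b203a2818556e089d3802c7ab29464ee099bbd9e005855a87068ec0120077809137f10b0a007983080ad6403196017b255ac29803c052f,
  0xd16ad56d1033d8c54432990cc07604f, 0x4be6a5266d23151,
  0x120f94b0255ad49b6063b31b2b2808035f0059d0166c971a016aa98c013276200834000760e5009cd6628a14d05781c9267042e6eb55757f5de94d07226c07aa877ab2cf17f2d03d0039d00792c29402cb0122404271400f50d10c0f52c0044a803ba28b45f5354900be4059901564052f,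
  0x3804fafec5c0203af05432cb0a5,
  0x1d4434d1b9540ef5300b43a849804e67249c01377785079d80f73c5fc0039c04890109c5003cc18402f70167ed17d00be4059901564052f,
  0x100434e09bac1e402cb182a405a3d5576d17d00be4059901564052f, 0x1942240561b87a43009,
  0xeaaf67a005013b1284ba7cb45f6b093201870003bf80165dc49e02d3c0986002e80a6f53ae0ef00be4059901564052f,
  0x1801040429381e564075391830a7c5a8baad17dac24d0193, 0xeaabab0b2500912b072a010f7f05003,
  0x405ab016b764ab, 0x372cc8c0ef70f08695680f5e68b94bc5003,
  0x3a93e946d851e3065a7c00b69677771a4d60b35f0dd0652e198080b620139a84b8895782685387249a8a14d06ef00b5bb01e80912b072afeca19e2d17d0039c0427016bd50efbf868f5dc1d258528a0069600225401dc02ed016a405a500be4059901564052f,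
  0x202aedcb335a5cea3fb9a161f5b94bd2e0094301b380a6e01399e8d802ce4935399ba5341141e7226c07a0244dfc1400c02f9,
  0xd67f21963a1e56c71a0a524c18ce1e938f5ed4bd2fc681ea2ad34661651ee802fee666800c056151b94bd65872640250ec6d74a80537,
  0x4ce1b48d13405b7c0295785decf1001eec31a40fec0082029f9c0f200f0ac80f284be9c4f968bed6127800180b6aa8779a3d770749614a0112a00ef7f05003016cc05a90169402f901664052f,
  0x126c64a344d, 0x6ec18e5800f606f2c16d5300a3a582cc052f5f0b25ae2cea6342fa60028a9462b86926025,
  0x34c00587d8d8c05bdb52f4b00334025371a07a8a9655cc58545658701286e16c6d6029bd40016ee521dcf0a8fec007b943618d207f60041381e401e15901e50978c1874e27c5d568bed6126b0b0003,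
  0x402f3b3da849802db50002733d07249ea6cdd004d8a0f202da8091202df80b737f05003cc18405b30169402f901664052f,
  0x1401dc02f70c0f405c1016a402f9, 0x4517980d9d60d9009cc03bf00ef4e4930014c00ef5838c8061,
  0x433c1b85b553f7012873347009cc04b5d7c02e2ac97b98bcec07b7f2f260017a8d18a02e181ea00ee860300920184303b0030630e7,
  0x31932e202c74cb155, 0x40555943b5425601781f28601fa131c4f2,
  0xa84c0226e5635e172449614a02e580b933c8b19d4cf8c044380c07649d4ad024d96a7f7251901929f2029901134e179be592b64abb822761f5d55743009,
  0x80b8a181edc49b2aa496113b1eb8021ba7005cd0171f3c2bc0c02560e32018c303b0030630e701564052f,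
  0xaf05085852e200172e79200ef6831b53e4cf8c303dd468f619d4ac9a2049bcc5e4b53fb928c80c94f9014c8089a00c6e9c385e763d75d57cb61f5d557560e3,
  0x158bdd50454018f3155002253003203253e590385e404b5be5284ce4ad92af5541c002d2c6aaba0255a180030630e7,
  0x1d8dac03f9a49582c9c92602e2df2385e405d3b401cb1d3bf80112e0016280b8607a9610077cdc86030095838c80630c0ec00c18c39c052f,
  0x2017680b9e02e8e78430af030092018c303b0030630e701564052f,
  0x7636ba4801fcd2a01714303d3924ee24dbf97ca55492c22763d7004374e00bae02ea80ba39e10c2bc0c02480630c0ec00c10170e30e701564052f,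
  0x6d17dc89a7002535418efe6782c224055b,
  0x9c1360086a588c38f3061017653e228b45f535490176c059901564052f, 0x35872a68385e401315857cb52f7,
  0xd67a201fcd611602b3ea4fa403080bbf5839d4e5828e5089, 0x40217ac1ceb06b,
  0xdc77b724d99c3691a269e88c1cea06a3cf73081fd4dc01f6d644fafb50c10178f026a0fe02f080acb53a30e95828ee4a301584300bac1df54933826d4e67894224b3418c38f30610177402f90176c059901564052f,
  0x600c3ac74d735c7c6aa9ada1a7b221964207f537007da585cd644fafb50c129002f1952c09a83faa1d202f080acabc2003d182960041003755063a9d717c9649f28dcda00f001de1ccf1583aea92670689c136b2aee368c3965089ac1e4303d00bdc052f,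
  0x2b2a6a67ca8a3252c2141e722009137f05003,
  0x2017fd63eb284cd61c6ba9616000602f4dfc1400c05e70176405e50177402f90176c059901564052f,
  0x3aaaea7c98116b0e3, 0x270bcdf24f992805ed, 0x80946aa4da3a155473155,
  0xec147761062c08a60130635d081a0a2a9818e30454152751ad017c4d4bdb411430458c9f54216a9e4bc2d068a0068ef253e4cf8ee0f3d92752b2c24b77a003fb928d50634d10203c053202268031ba7080c1385e763d75d485a5549942252c660c602eccea017bf61f5cf0af160e32018c00c1017ae30e70176c059901564052f,
  0x1345b257ec24bb175a8a8c99698161af680b297a7c99f1c06026b364d12068f352fe2b991af26c6d76871cc0c22a55dc1835023045339582c9a09e5f032970049c02ed80a64044d,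
  0x1014dc04a1, 0x10068ee08fb927461798d2f4da161730180ec9a39ab60c9c8d6871cc0c318229e6,
  0x405f1352f43045, 0x7356c1e76876d00c62a51aa0b924ef55a75fa9805fb5fd792e0c1,
  0x2a12e3b72c6e4053b8d2f6d005185e57f6200068d54abd4c02fe8aa9b02618095e002e80a6e02fc80bee02fa9ba80a65600b,
  0x400d3,
  0xec97bb257dc92668801a3bc9b175dc1e74c061798d2f4b0d72ca5cb0b9a7d01809acd934481a3cd591ad0e39818454ab2b91822ec6d77080537,
  0x554ab32402fe8aa9a194bc0987582c80172030180bfeb092a16c146807a58cc18d600b,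
  0xea346181ee62f202eaa00ee0302a264d040609c2f2b073df2d432725561c6030080bde860b0998c39c30095838c80630c0ed5e2c0179e005f301564052f,
  0x20160e0a0c024303b, 0xce22cf8f0297c0c0430d7, 0x1c020e817b,
  0x3b248963eb9a850efb52f7607fc8c681ed00c76871cc0c22a5580b436821dc1d3182299c3413cf31380182d2b00c1ba9b54620942271b52e524181e80c12860b0990c02560e32018c303b,
  0x18c994860bb414fb64d1cd5b079e46b438e6061,
  0x1954bd529900edc005d8c1140611af8b25ee62f2b6b554d2c74f106a346858b0a52c554060f8c544e4c3b82ded27d324860b0998c39c8063,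
  0x3adb652f58a5e03012c2e4da1e8cc5e6d0072c74f51a32c55630e7, 0x5005db1d6858ae84c0892d1eb8c1150089,
  0x154e1560072c6e7232fe943b4054db438e6061018440617af8584480c1ba9ae36bc405f31b4689a02fb8607a030480c2a5c8c946146030980c0e899341018270bcac1cf7cb50c9c95587180c0202f7961321804ac1c6403186076b005e78017cc052f,
  0x4018dd8f5eb0e395527336d0030430070186560e32018f2f678017cc052f, 0x403ed, 0x75549b5804061d,
  0x3b2b1ec912b29371a016030fcc08ba97cada957c564bd,
  0x100c6403173b1708005da9d6d2e16d00c4403150ca5c61799420f603d0047c062100934024f9552650895381803e66da3054801d32852a160186f2f678017cc052f,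
  0x1014ec04af014dea7560ea706896682181e9ba, 0x20257dc132029bd4e9464ee0ef,
  0x1cd5ae0d00b0130f511f5953c80353b414f8b0d7,
  0xd0035537536700d3d0116a2c5b40629d09a87380c1a51b542bad4d490ae0062fb1b59d8013e6e0cf015d651fd00fe4005db69704cd7c5901ed549a9d70b680b7664ab093ad2f481fd3cc194ba28003bf321d0093c011f5859b88061c000e5099594c7555d00be406230186c05f301564052f,
  0x73700912031580beeac80627c39942fe00472280180c4a6e802f90188c061bcbd9e005f301564052f,
  0x20244ec01392ab0e3cc1a4832970159402ed018b6fe00472280180c4a6e802f90188c061bcbd9e005f301564052f,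
  0x20300d61ce70bca7c016b405e9, 0x2029fec957aabaac24064c0631,
  0x80667a1152c7b4024d1ebb958f50d15fc803a80b36027fa00efb1b5d40018cd5900c4e0317eaaba017c80c46030dac0179e005f301564052f,
  0x1cc91812e48,
  0xda0160249ea800d3763bdc90031b80c6baa9fea23fa965acab98b0a8acb0f67a55495901f636b8d2f6a000c02811adc18a018a992d51e43297207f4053fac7d65099d92ad142c2201870003018cd595fc0189c0239018bf555d00be406230186d600bcbd9e005f301564052f,
  0x1018c40639bf8280180c36b005e78017cc052f,
  0x100a4d32253b194250995415871a8a012bcf3000bb70b69925fc029bd4e2e56803de48d4c6b075401df54933826f1b461ca017b8607a031d80c5e017c80c46030dac0179e005f301564052f,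
  0x2029fa010e70bce60ee9f2b0e38c1865549d247a03299325693e972]

def hints8 : List ℕ := [
  0x630619811405ed, 0x100bfc01c10177c05e1ac1d4e0d194224303d,
  0x805fe00f0e000602f480c87284cac80f7f33077d55740641018f402f90188c061b017cc052f,
  0x4329700c44053fc8999b68049e01298058e0321ca132b203dfccc1df555d019065089cc18c06450186f2f678017cc052f,
  0x37249de4b40f6e0c1,
  0x27322aa68eaad0ec3ae2889aa973706e9a532a9b3e004c5560089c1c2a51c01de02a6ac00ea135c2fec4168029610f7064803460190e8a01924b54f23116829f161af3f0044d,
  0xa0cb8bb4c01c0a72800dd62c1d451133e9706e95634a655367c0098aae0e1528e00ef015356007509ae17f620b4014b087b832401a300c86e0cf,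
  0x1d92f54200c938044dea01934b5162da0325946d4d5f0ae0063f1a26ec6d767b50cfb833c03f9b84002e992a9c5a55ddeb68b20380c7f872e16d00c56d17d00c76b1258c49432975b430bc801df990eca107b01e8023e03108049a0127caa9200f5e12942950b00c8ea7250898c38f306101914061b5802f2f678017cc052f,
  0x80a82a9268a016aa55de432568039723826c00b301894064f0191d4e461c7983080c8a030dac0179e005f301564052f,
  0x6b059,
  0x232f8a80499a02e3c1b430631f5c74b005dc77f71de80a83681eda012a926aa957790c95a4fa5cae053ac1dce09b8c38f3061,
  0x13385f2e61b014ec3297, 0x1b89acbe0024e032b805da032ac697a30bca9c8c38f3061,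
  0x128db1fcd06cb0180cc52f2833961732a5e801c2682c802f2598eca2db71de9bab40f6d00954936e61bd5684d0d3ac11400892b958b0ce43ad4ab6299a807a360092a44030d60ef1a5e9c13630bca9c9422630e3cc18c0651,
  0xeac8a719651a4,
  0x2029d9e880d9c065d207f4011f003bf30a90093c065bbf84030dc0a7583bc697a30bca9c9422630e3cc18c0651,
  0x279aa719cb854a8e4c3d8a663151a807a0c91720197c0659ac1de30e3cc1840651,
  0x279aa719cb854a8e4c3d8a663151a807a0c9172, 0xd90b9953a7200a77b14b9e8,
  0x4d0d3954bd6b2a08b18afabad57c5053f8c89ed0e934c0631f501976d0e3d5915000d8c03ceb5c2a55b14cc06ce0332eac169bb05152d4bdf603d0198e5089,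
  0x2520b0b980c04b301, 0x603018c6b6b467d82e40669, 0x3706b866d7693e972552aee3f900196e61b,
  0xd40014ee721676f490f354eb215822ea58f828066b019b70200cce0331dc0a6a7230e3cc18c0651,
  0x6e26bb582c01270195c02ed,
  0x8cbe2a0126680b8f06d0c18c7d71d2c01771dfdc77a02a0da07b6804aa49aaa55de4325693e972019c4066f01986e0538d2f4e09b002ccb3418d4c402f98c38f3061,
  0x2b2b62974dd538061fb20b6ab0453cd5913ebe5834eb073d80f655f12018e5089,
  0x32854e66da8022c624a018a8c2f2194bdfc014fc0675,
  0xaa0c7b298e6c2ea860d6016b003c6abb5aae2ed94166e0cf00286da0068e79804a1b40171019238d9f48562c378954abc54b1638068a4043caca26804c00efa927ea596b0818013275b502cad8a64065da8101b39e8d4cab1bc624a40fe8c2f20077ca1077f0053f2018c024f9552650a542c0339a9c9422630e3cc18c0651,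
  0x100d151a6a5da004cd2ad8a640651, 0x4054dac02d7f620b4014b087b832401a3,
  0x2a817f560160324e0112033edde5418f6641, 0x5331bad41e30638002f624f,
  0x6d227d8306008900c856009a018e024f2d5882d0059e57064da0019f74553e01924b0d79f8003bd30b45f6b09301a04d11c67e520e56c17397ae0890045404af4003c00eb019fc0059,
  0x328778c97b0001909139835c63fb2911a612e89801f5cd8deb54dcf0703bddec380341dc19f6d2be5c2da64805bb,
  0x7152a973a80e1eb8d13400632700342ec52e033dea8f2033cea6558de31255b430bce643a0077dfc014fc80630093e5549942950b00ce6a7230e3cc18c0651,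
  0x3a88faca8130e0365,
  0x1bd5a297862e5097249cf29f899f1c694356231fbc706886ecc6f3005ca1de429f9023f0001800df9c29f10ade523619dad10e31fd4c25e306344c32a4dd0007d60007cd8df0956a9b9e0e077bbd8700059,
  0x202f8a86d811d1a00133a2ad03b3439d0077, 0x1d990405db,
  0x809873c8032158a67644db40a937ec1d34f954bd2c35e0089d824e986ca6202a6ac00e719f948d82e57f65e4c8940115b822401ef8c325000f003ac068fb45f6b093,
  0x1ad41ce33f5826c80e98002f2f003ea8a004af4003c0059, 0x4054dac02d7f5de5418f6641,
  0x40691b833c0681b6803349c67fb05c803d6648e367cbd70448652e00339ba0045401ef4003c00eb01a57176a8552af4500d1a0345e2001a1c0689001663125207f46179cc87400ef9420efe00a7e033b9522018c024f9552650a542c0339a9c9422630e3cc18c0651,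
  0x80c420257801d6026a9611201eba16,
  0x80a9abfa30e901a6603675957064da00a9bb456380187c500bd4d28aaada2c2240549ac89f5f2c1a7583980cebb01ecabe2034b900c60127caa932852a16019ce5089cc18c0651,
  0xa06da2803e608a4052e34d5a36b0a9415275f6041402ee0c99455400c3401cd6a001820064a1695524806301a6f3061,
  0xd2a0023ea01e8cc5e63045d4307569d5838c8061,
  0x3b02f9611201589483f07d8eb146d82e4b653d8a640443014d4044d,
  0x24028da97b68719a07b303080c2f71b597c01a84b03d4d24c32970019eb407,
  0x101246521d01a8f63d7385e73063, 0x20324da013b25e80347792e0f3,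
  0x3705aca9822805dc18202a380d4e02a6a6c1aa8318c2fb77804918c38f3061,
  0x760e58d57406a72c066516d0067d154608a758008f,
  0x8a7caa1360d30153406a70038c61798d2f404dd01aacb3bba607e0a455e28c7d8e50008a5a4d9c43a9a51800ce0352eca7e00dca692777ab407,
  0x1b2153b6297,
  0x101aacfc55e28c29fb9693671a3900a37d2d4bd2c066d0e3340f660618c114008f01abc06ad9c9b29fc001600dca692777ab40701aa7560b,
  0xce401abf6297,
  0x689508580f54f17081946806138f96b16db411601995a46f2d453c8ca66ae1cd670305c03de72f8cc2f21a5e96eacd06303d3981c30e34c18eb5495803eb00d3e8558d299355ab599cc1640bcda97b4e10341340f66061d5945154608a82a4dc2a55b14cd40,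
  0xe0a9e81b5967eea9a3dde8c35ce617985e4b74a03a1a98c607a7303861c69831ea6d7ab0b95600dace535a55ab5994ed54e4e60b34a5d5367d5ad4817938306d4bd543469c5a1c6681ecc0c3ab28a2ab00030bdc6d7428be0652e00338095e7a20367,
  0x8088602f79468c3a6e4a32c93c0093,
  0x90c16023380a2a99f1c0602703c9468d56f286c01e035ce9c80a64044dd8f5ce179,
  0x946ca0728010d00114e21d001ad34a3d893763d7, 0xec95699861552182c0515,
  0x10024f61f5ca0035fa68ad8057500d7a580380d76035bce401acf629701ad406b1d582f3179d7cb25edfc2a529a080d3e85800c18c39c069d9552560e32018c069b9422630e3cc18c0651,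
  0x99c40166e61b0ca5c00cf, 0x1b928c010d, 0x6e6b58d2f4b089,
  0x802a31859dc76f7414200126abb3c5c947283bc61d3725a80ce340bc80a82b6b04a31818c06c7bc97060ea7c602b29363740361805da0360a1601a74069b8c38f3063,
  0x7560b2a40359e0ad5b1f603d8101e5549, 0x12c02401512c0f760ef5c8b68018d,
  0xecca30180964e6ba16d224b9b2e3045b47ac0127d5b0432970033c06cbd4326040701b3534933695a0380d5285800c18c39c069d9552560e32018c069bcc18c0651,
  0x6e0898c304054100434500b54936e6cb552aef25c1937036da4fb1a4a99201b0f3061, 0xd61cab09142cc,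
  0xdcc36670be1b4007bc00d38c18f63d701b4c010dd4304b089c08036580da2036780d92858069d95526500d5838c806301a6e30e3cc18c0651,
  0x80cc718ac80d96034f80daa0364a1601a76500d2018c069bcc18c0651, 0x630452018f56d7,
  0x20135eb0b8db406cbac1df603d01b64008f, 0x4006fd2000fa80372b163ac2959457500132aa800ef955240083,
  0x1408d506d30035402dfac1dc0253,
  0xca1e79c0011358b1e56510021c0099554036ecaa92036fec11e522b6690045400590020ca91d620187000301b6c0651,
  0x6b07795524024fc002cb089, 0x406e101b8c06d90023c0651, 0x10c0f6b07900be404270156c010d,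
  0x1215beb4438c7f480e9d893e000b, 0x8013a2868da01648256d3943b5007901686e253,
  0x1549ad660bd501ee127b8bb4900013b003bea601baeda2046aac8303d00be70966c3f9b0edde2cd066003cf030aa80dce03728068f7885045d422715690b424d62c7019765651207f6b06f0026400833ac0127801df9854a03264030e0006036f80db6037180db20047d240d82f6299a800331c62a301b38062a71b3972d51e7604f01b5c0651,
  0x406770093f54110094f321d01b7c02f901b8d006bd813c0651,
  0x1007bc00d3007ac048f001fee36b8c49406ef42c0376c62a2018a972,
  0x36a51ca3d79807ca97b18aaa06da9790063212acc21614a5a35316abab031a3458bdd503d1501d60c9481a849aa40128ceb1a01eb074ac97b98bce3a4130751a341b4ee3d7d80f630935838c80610c0ec06d7,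
  0x749561c7186380da600f5ea193583980ab71873e00165844e0401bcce0e58c496b515b3cb290b52a80d9560e32018c06d9d5b5c0651,
  0x6500d01a7f000b2018c0651, 0x34a8008f,
  0x371b580c2e5c8be138b85b405bb401dc303dd468f3179c00756531d51e4f400df286000c101bdc06f55838c80630c024303b01b6756d701b5c0651,
  0x2522b54f800f4b24d18294b24f00e14009301b9c0651,
  0x2a886dfa207ef511f38a44e07f0c7af53edac2473e601dabf0e6f1d5abd26280b4544d29947dab8e601182963563ad5446155358028a9c68e594b946ca0037eaca2021f500601671b5651d582e30459c869006f9d8a66a0406ceab1b9e85396aae9523924f372c1cbb01e80912ac8303d2cd06e05500be40651,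
  0x55045d9876854d959440493, 0x1b982cbc503faa83296a55acd014a0b3a9b392e94dde516dc718803045,
  0x3291aaad67282cd6ad09580580c1b883456a80e024980e07a9805a1c25778615540116e089,
  0x80e025b28a7200af766d3800fc0587ae452004a10044eb16195946d00bd501c049301c0ce079]

def hints9 : List ℕ := [
  0x7605f00384066b,
  0x19594406e9d501c0703ac24d756a601c1ce07900406e65101c16e0cf015d632bdb691ac39b401c24ae4e43ac037cec533500f42d40c10eb077d802501932a44030e0006ac830091400c303d2cd06e05500be406fb01bc40651,
  0xaada603069aa9baa03e36a00483521900277604fb867404a1ac58530031501e50efb6871b2e9058b1e5651,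
  0x35a33ec0bfb05c80cd60334d7c40cf5565db9b5ee65101c363443,
  0x556d301834d54dd501f1b500241a90c8013bb027a021201409e6ac58530031501e50efd4d1a33dcca26e8070fb6871b3e9058b1e5651,
  0x650ef1501d3003d4da976dcca279a315901c440347c5578b480a08ab163caca26804ea596004cac2067596500df3b14c80cbb01b3e0a20187000301b5c0651,
  0x9c0f2038180e0b694b98a3b1282c806938e03045, 0xe70cb47db4f1482d946003f,
  0x3291aaad67282cd6aac02eef2008a038be8494154060dc41a2b54070124c0715,
  0x1398dc05a101c5cb1b95146839dc5ee6849aa0a7881524f0124ee253, 0xdde016850045,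
  0x26854cc02f72f8a6a9b708996ca2703c80e3b8328861da02bddce136820a00f2038a80e37717cdcdaf712980e33706780aeb482e6afa5d704c938af96d2e0d78d134e367,
  0x1009f49b5c2da038fea8f20389903fb7cb30a90093c070b2a44030ab20c02450032cd06e05500be406fb01bc40651,
  0x804fa4dae16d, 0x802c3b36dec11fb05cda2aa7d801252915868c007f1860dc1331a2680e477cb321d,
  0x1207f40713cc2a4024fac1cc8061, 0x25232f1f60038f626b4cf96b1eb, 0x3b320e5e2905196219,
  0x2b93626b01ca6b1eb, 0x1d9b8f66d9d9b6eb0e301cb401612112653e301cac0059,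
  0x12d4ecb0c74d53460ed5d858658c14b1a3c9fe5418e003b,
  0x80e5e0221ec172039580e63b02cc619e0080c657b1ac39b42d94407092b8b52b077d8025019301c9e726c53350007250109c07212a44030e0006037fab20c02450030c0f4b341b815402f901bec0651,
  0x36805dc18f2876ea80f7065ea6, 0x80e12280195c2cd04066900164066b,
  0x10122406cbd4bdc806101cdcb3b7375732880e6a79aa74e4d4bb406f9d8a6402f901b5c0651,
  0x505698c24ce4070122752f7d80f402f9, 0x6e0998d56e35318c24c073720184073b8d134e36500be40651,
  0x1bc9aa03dc197a9ae651,
  0x18c40e35318c24c073701cf7321dcdc4030e0006039d9ba8d134e36501cfc073901ccc02f901bec06f101b5c0651,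
  0x1ac34eb4034d7c763a9d82e5654d,
  0x2435790c8a432ee702ca5c07438c7f650d7b4a5e5059b6970b6992016ecb00b01b5c0651,
  0x40743001a766898c7f406e99435e56475840ceb6c53301b380e8a628ec006938e00225d893e000b8c18ca96c08382830452018cb00b01b5c0651,
  0x76741d847cb045d834d222a0b4115452febc858e9e2001d1e3063cd877090c2aa30bcdde5418c068f539b3208608b94000ef182a4024f003a650a542d8d8055b0094c074101bec06d7,
  0x1ad4b01fec89b3ca0099b409852800ef4fad17dd9b64b0d701a0766f9344a28e33f2900334dc19e72b60b95fc00f5e5e007beda5c1128022e1c0045400592c74ef20c2f2958a96200c1154e6442018c00efcc8771b2da0c01d5e004a6017ca1601b5c0651,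
  0x11415530a5d9b675c6cdf2719fec89a68b2f5a2fa72b5367401170e0095e034980692008a800b2958067bc7054b60415b5a9802250c11722100c65805801df990e8016a0127a16b8154025301b5c0651,
  0x154c040349c6c6aa6d18b74aaf9d00ad4a8b6ea6cfb22680aeb7067e1cb959c30092cd06e055,
  0x31881a5601cf4074f549be0089cd4586bc01329852800ef4c2d17dac24c0681003be5099d9b67372ca62025780a6bb37cada38cfca41a2019a4b301395b05c8022a002c95220187000300be49c1920ca5c0651,
  0x1ac1dc03d701cef603d, 0x4d017d847c80e9,
  0x7608398117555d4c325210008aa39262a2f2aa11f69201d55651010f7d000bf38d1e9f40603a80b30128d97806d338d5acce5040116be6aca3928d22ac6f49164bd00e1430091400e3045b8db400ef3901f52ed01be6b07780d9c073940cf40753d835e35312a4b072ec07a03a8805f203a680e9799a39e632471b39ba0ca5c006701d2406fb01bc40651,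
  0x33936299, 0x7321dc000f371e801d67317901d5c0651,
  0x1207f40689d8104024d2c02f30a90093c025300be4075b01bec0651,
  0x1d9914066915b67336d0187e30c72cedc0699007aeb227cf079ab0d9592f6515500f5c030f5b46ea50a542c02ad952c09a83fca112a73000b2c2240651,
  0x80a7603ac9676e039b9e63757328acabb8d8b34100bdc02f98c39c075fc08a73000b2c224075d01bec06f101b5c0651,
  0x80a767203ada2c224075338d9630e7, 0x1c08039ba9c2c2240651,
  0x9c80e1804ec07a039c80eca03ac9b401d8ee05500be40651, 0x4b3410c026e055,
  0x6366d8d9c7055d8cbde32c72d947094620696235318c24e34bd01cdf321dcdc039c80ed37f08061c000c07670152d349300c56ef5680f87032970019c02f901d840651,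
  0x10103eb443203a7653f8c18d35f1cd8dc01f50039c05318c40d2c46a631849c697a039b9ba01cfc0059,
  0x20207d68864074eca7f18319ba4d7c73637007d50045b835c0531d83b407232cd04076901db400ef00166e055,
  0x101c0748002272af9ea80e0249c6aea0381ec0b3a9a30cf00406e651015d632bdb691ac39b42d94407372b91a5ead4ac1de307fc25b004a03260298ec1da0393dde381dc303d3acb6b0e16682acb629901da4073901dbca95fc20187000301daee05500be4076101b5c0651,
  0x7371e8cc8740759, 0xc61ca7203e60c286005310198ee055,
  0x1adcc7665158d9f653f450028aa6be3001ee6c6e01ffc658e802280a637041e4a381dd2c001df872b07701da76759,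
  0x80a76b5354938c24c073901ddf560b8d4c54e152141e7603d01dc4077501dac02f901d840651,
  0x4dd5cca2039bca1db812d007595754e005ee181eada2c224077901dd4076b00be4076101b5c0651,
  0x1014ef54933901cb089, 0x10093c0773cc5e6fe00efa7a0075901dec077501dac02f901d840651,
  0x1d9946b54d0187e5155ac89f603fadb4c05632018c024f955265089,
  0x766db2ca5c82f7b4294d003d99473b56a9a030f95c9455752f95b5b24dacd8ab25e952,
  0x90aea9aa4ecec258e9ea6943bc64bd8000cd1000df9c0d61ca215bf6689d8676b4438c7f480e98c18f653f4d7c401f5cd8dd0045cf19daef1c0ef8723125185e400efd80f4078301e04a9100c60127caa92a7030450c01c00e9942950b63601dfc076101b5c0651,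
  0x4b03dcc1e6b5159524ed0a5a559dab54d01bde51550030c00c10032430090c0ec0651,
  0xdc6d6030b8652e5f0073fd7d284f9e89552702540d592650870132c078701be480630c024303b01b6756d701e14076101b5c0651,
  0x406cb01bdc80610c024303b01e240651, 0x731793d17f006f50132c007f8c39c078b01be4806301b640651,
  0x406cb01bdc06f501e1c300701e34806101e240651,
  0x6c854eac114067594bcc053fcc15835900c60127caa921803ca14a8580651,
  0x6e6f9b8be6e651943b6d0075957402f70c0f4b089, 0x13385f004a18c2fd005f, 0x4056301224024f,
  0x13387261c62a231a380f2a7a0079701e4c02f901e44078f01e2406d7,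
  0x4e347be87d80755cc1e4a400da60300e5e,
  0x12915aa78c2aa03cddc1326d0be6c04ab288087d4071b56518c1175793c94691004501acc0489558dcb4a3cc18f560b8d4c500ed01b2d4e152d80f402f901e640651,
  0x4057501c76e799, 0x100895007718d1c0127b9a24079f0106400e701b9f306100be40799,
  0x40225401dc6347b99440127, 0x155abd5651324bc00575b9e66e2f9b894ee68901e8c0239401140769cc186e055,
  0x6e78501cd43009b997407a501e84304301e6406d7,
  0x19d86860ea68f73cea1eb9ddec46a20182e8b1653373ac8604a82ccd2eac11401151402ee799b8be4b90024f732e8021b6803ea926b2aee36ac1d4b0892cd06b0790158c02f70c0f407a72b854b60094064c8061c000c079d00be4079901b5c0651,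
  0x10c3b55089b9ea6e2edb95d5579955a26e7a3352f4d1ebb9da6e0af015d50077b8be6e2532d526e7991400ee6db40426d60b2e44d802ed,
  0x10c3b5508995906e7a9401dee7aba0874071d01e7cb0a5b9e66e6d7,
  0x1395b0b69c67fb328946cbda4b280021a03d6dceb26d0ce17c01e8d0045b8224076901eaee055,
  0x407a74022c07af1400c07a901eac079901b5c0651,
  0xdceef73d8aad5e0305dceb3282c992a5c1812dc58f73cc9720049ed0071402eb045d524ce09b595771b60a00bdc303d01ec6e65dd8a5c075901ea407ab00be4079901b5c0651,
  0x6505955abee7b10c096e777cc21c060bb9d64c952e818dec85cf33681e9720049ee2f9a9d6803ca372803bea926b2aee3601da402f70c0f7000b2c22407ab,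
  0x1b9e6407358c24ee65d, 0x377b0e2008a03b480f6e03d9dfc01ed407ab00be4079901b5c0651,
  0x40225b994500770ca5c02ed40116ef61c01da6e055, 0xc6e62672e785401ac3009,
  0xa046b735997cb9ee6e651b401f5493595771b1c136ac802f70c0f407bd, 0x407bb, 0x100896e651401dc3297,
  0x948ad53c6155,
  0x330768008b983c901d203698095e03e2d6ca349360d701e74a91c92792a0407579b01ea03272aa4801de811a80dbe5cae0893cc017680f8603e0dfc564b68076901efc00cf01ee6e05500be4079901b5c0651,
  0x2723cd646b393629701d6407c701ee402f901e640651, 0x655490c01e50a501f240799,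
  0x6d6f914a5ed6f5b5b66d61b3299822a02da802ea0172194ba00b25f000cf,
  0x12c0f6d0a5cc1e73b56a9b39006f5a81b18080d5f53807cdb556d00994c1a860eaa936864e04b47ac80a5c695854ca01bab46ca2aa0061801820064ad401be560e32018c30090c0ec06d9d5b5ee7cb01f2c079901b5c0651]

def hints10 : List ℕ := [
  0xe62aaa81ea600641b6dccbba98a80d5fb14b80dea0265cada7716b80f465f0ce2180030630e701f3c06f95838c806101b66e7cb01f2c079901b5c0651,
  0x12ca5f66f5d994767cb, 0xa24b47ae5341,
  0x330768c02f5871ec23e4074e60f20369e4abe55b288077ba83180faa03e9963a658aa80582025780f8bb3acec1ae6807ac97a54af2662f3b01edfcd550634bdd468e725ccb2153b629701bd4c900a7373578652e802c97c0033c07d1430af000c18c39c07cf01be560e32018c06d9d5b5ee7cb01f2c079901b5c0651,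
  0x4060dd5536e6cbd4d706599c0c026e7cb, 0x10132c07d701f6500590033c07d101f3c303bb9f2c07cb01e6406d7,
  0x961328022a01db94001eb, 0x38294960006b6b603d402954e2bc8c7ac07db, 0x14717022a465184022aac,
  0x29fa0045, 0x1c957cb5f60494224b00b, 0x4b7e11402e57dbc41aa15d5c1938dad7db4b095800c9,
  0x6ff60ccd190327666407ae57e1, 0x2b3ed86fd2b4ae077, 0xacfb733f0ad2cc0ad807eb, 0x701666,
  0x14b484a67e357d8f0603d987ac50e9, 0x1ac11557ed, 0xa38, 0xa38cc24c07f5, 0x757e9, 0x74463e,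
  0x32bf6cafb6bd14623854492007fb0c226800bcc39e67db, 0xe2ab9fb6f120fbeb692b2182dfcc37ed, 0x6d0c9,
  0x630edd9fbc5045, 0x199fff226afbb5bfc9601781351eb0df84d7f9, 0x199f9407fba002c07fd,
  0xe028c1e6624f, 0x1403a53007, 0x4d7dd5819bf0e100a6bed8100b98007f3b9f6c07db, 0x757edda0376805,
  0xdfc20186680b, 0x14038ce00b,
  0xc607a1849cd0039e8e811d43a6607fbb483f1ac1db40aaecfe2b8100935b9801edf00204e880dce03757db,
  0x523238020565809cc3a6e04541f6f580d, 0x155f8c57e7, 0x65803,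
  0x14f8840beb012b33580b4c93f57f70e06f58079a00680894df6d07db, 0x6d801a011457e1,
  0xe6cc1f6c081f5a03c6805, 0x1d87ae37ef, 0x4b7db16014680f,
  0x437dbb6086580f81f6d57db020965823a1f6c57db, 0x6080d, 0x70766a, 0x1c1d9a8082b, 0x8608a9a96027a,
  0xaafb62c06eb01e04178d0521bede9a3a036380f020a56829, 0xdac9e95c2bf55e,
  0x69a570abd3ead157e9e95400833, 0x946, 0x128c7e00837, 0x1, 0x7382d2039e88299a0a537db,
  0x2aaad6286ae15822d5e020ce6297,
  0x29ab007f0c3b438191818d601a126a62f24a126b5808352ca5c00b9504bd91a6141838d51240ac115300b9a0bd0829c1f6e57db,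
  0x23031861da6849a88941155227438a5e503dc219e8882dcacb8030a5, 0x1ae0ece347,
  0x13b84b10020ead1632d179b605eaf75023610cb7101cf414b9d0739c16d66,
  0x74a67ccb92c0ccd05b4076e523811739642380f5356b05bae93d5014abb8082f96077582955f6e682919f6e5829220376829d603e680fae03ed8271a0a4d8290df6c5829ba0a757db8e03c0831020a56829,
  0x10203ee829a20a63829b5f6d07db, 0x102124084b, 0xdcc40266a06105767b1200132a83bdaca20b67a550,
  0x2589031283a85b2616d, 0xc007b9d880c9ce0ae6045, 0x13f00422946d49f760b9, 0x28b9646d08a9f80855,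
  0x500edc244031ec08b7400853, 0x38680857, 0x50835,
  0x1b4557abf1652e0420810bb4416e144c02c085b4f88a13362c, 0x1318750941623b40428cf4a69578885d,
  0x102186ce548b9d64a905465a0e56845b61442b35029e960aa80705f314bd5e009f6e845,
  0x1141df056045838c80612a4b073810b70415a6016004ce14b594416d504f95f9145702c9f6af6708a0431ad0ba041fa902ca5d0f00172970600b0217cd0ed548ae000ed584742ca10b26c2ca70b2b42c910b2042cada5a0bb16b2f6220756e2fc8213538295f48414cb09b5c24aeaae0a6684dda125084b160a6e84b1a0a7584d3a03ed8298e136d84dce137384ba20a4d82941f6d384bc2137084bba0a6884da212e68291612cb829adf6d37db,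
  0x274278105ab423eb08a88a7c2d07a702cad0ca704ca0eb61a223845a0559b16238b04041e810cab076961daa88e8594e16568592e16488595a0b99782dc5f90426a7052bea584dae126b8294212c5829ba136e84b1a0a7584d3a03ed8298e137384dce12e8829360a507db4e12f084dc212ee829a2136884b9a0a4584b2e0a6b7db4df6c084d,
  0x14e19d6f2d4ba126b84ba213657db8df6d584b421350867, 0xa9a561a822adec212ee84d8e0a40869,
  0x2bf3384d19f6f38293a12f67db,
  0x256b085d3e59d25867d6166e86bda1b6e86d820a5084b561aee829d5f6f684b3a13438295a12cb86b2e12cb84d020a6386b,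
  0x852, 0x872, 0x11941606871, 0x1, 0x43877, 0x4c45de131870874a0c703808758510000877, 0x83a,
  0x11d0130b87d, 0x700b9021bd6829da1b4584b561acd829,
  0x66859021ad084d3a1af086d0e0a5684b2e0a4b84b8e1ac0829, 0x4304f, 0x3568e60b,
  0x8d10a5c43a062510928299, 0x198f5d586bba20cb7db8e0a5084b41f6cd829,
  0x31805dfec206a0d4abc0a5d61fb, 0x2b0bce624a8d83341, 0x221053038, 0x1, 0x1c21cc587b,
  0x46889162565e6e867561a300bcc5542f0c0407ec5531]

def hints11 : List ℕ := [
  0x408910224c882002440c86b1188440da3d0112b008d8970225ce88f0e23ce88d0e234b87f161e4d87f021e508794e1fcd879221fd087f99575587fad574e879b4264e87f3682a619bec1c02619dec0264e21a9866e23099390aa619a16282619ce3930f6099c509a619c22130e50ed214c680ed1930cb4c33646c40a71069c37e10d65c40a10df9c359d29a22d58810e20c386f821ac58812e20cb86fa21aeb88b0e204886fae1ac88290d30c68813a20ce86f42136d86b194c6e7db0220c086f8e1acb84b020a568811a20c686f961ac682902204d86fba1ae37db3a205686fd61ad682942204586f9a1acd84b160a4586b222055883561bf686b1612d5829,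
  0x1021e758679a1ac68813a1bd58295612cd829,
  0x29a0e80195536e82f361ae6883a212c37dbb5f6f38292212d582921f6c5829, 0x785308d52ad3045,
  0xa6a7d46849b18e34f68089f2181e08e6faba22444328ac5b444bca1f92a55a34a841a12d2404956a55a142b0a6b32200c7a8049a016703185e88013853018600f953018409f10091c130ed4c320264009181907354c33493e889b82267586fa130c389d8226f0899b61bf089b9620e586f5493e689bd6266e8833a274d81dda264b86b1493e5899da20f07db8e20f58818e1bc086b82277689bb626768819a1be884b0df6e6899c21bd386bce266b88396206b86f221ac889db5f6cb7db0e0a6e899821beb84b0e1ae3899ce20f386fce0a5089dd5f6c07db560a4089d4212e57db21f6c5829,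
  0x3562be22e361b6d8995622c68a15612e37db,
  0x508893087e02826987749fc06642266b8a398c0668670226738a15a26c686f02274589b4e26738831a206d86b2227438994e0a607db0e1be086b0e0a4389bae1ae87db15f6e5829a228707db35f6ed829,
  0x8714288888291a12c886bce1af384b, 0x17d85849ef0628cbb8e66e7ad82b0e3c0,
  0xbd60024f8e1715204549001ec4683a06211c16148042068a293e2713b3441d109b84528d1422c4ea1e0220ce89d9626eb883da27488a7c220e384d9a29438a7b620f584dce26e08835a12d08a101f6ee89bda20ee82936284d89d0e12e87db59f6c8829b6294d88b5a285689d3612f37db0df6d3829,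
  0x4886bb62ac08ab]

theorem hints0_check : checkLemmas clauses hints0 0 = true := by decide +kernel

theorem hints1_check : checkLemmas clauses hints1 100 = true := by decide +kernel

theorem hints2_check : checkLemmas clauses hints2 200 = true := by decide +kernel

theorem hints3_check : checkLemmas clauses hints3 300 = true := by decide +kernel

theorem hints4_check : checkLemmas clauses hints4 400 = true := by decide +kernel

theorem hints5_check : checkLemmas clauses hints5 500 = true := by decide +kernel

theorem hints6_check : checkLemmas clauses hints6 600 = true := by decide +kernel

theorem hints7_check : checkLemmas clauses hints7 700 = true := by decide +kernel

theorem hints8_check : checkLemmas clauses hints8 800 = true := by decide +kernel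

theorem hints9_check : checkLemmas clauses hints9 900 = true := by decide +kernel

theorem hints10_check : checkLemmas clauses hints10 1000 = true := by decide +kernel

theorem hints11_check : checkLemmas clauses hints11 1100 = true := by decide +kernel

/-! ### Soundness of the refutation checker -/

theorem force_eq {α : Type} (n : ℕ) (k : ℕ → α) : force n k = k n := by cases n <;> rfl

/-- A proper colouring with four colours of the surviving vertices. -/
structure IsColoring (χ : ℕ → ℕ) : Prop where
  lt_four : ∀ p, χ p < 4
  ne : ∀ p < 984, ∀ w < 984, dist (pt p) (pt w) = 1 → χ p ≠ χ w

/-- A proper colouring that extends the colouring `icoColor` of the icosahedron. -/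
structure IsNormalColoring (χ : ℕ → ℕ) : Prop extends IsColoring χ where
  eq_icoColor : ∀ p < 24, χ p = icoColor p

/-- The bits of `F` stand for colours that do not occur. -/
def Excludes (χ : ℕ → ℕ) (F : ℕ) : Prop := ∀ p, ∀ c < 4, F.testBit (4 * p + c) = true → χ p ≠ c

variable {χ : ℕ → ℕ} {F : ℕ}

theorem Excludes.lor {G : ℕ} (hF : Excludes χ F) (hG : Excludes χ G) : Excludes χ (F ||| G) := by
  intro p c hc h
  rw [Nat.testBit_or, Bool.or_eq_true] at h
  exact h.elim (hF p c hc) (hG p c hc)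

theorem Excludes.zero : Excludes χ 0 := fun p c _ h => by simp at h

theorem excludes_shiftLeft {s p : ℕ} (hs : s < 16) (h : s.testBit (χ p) = false) :
    Excludes χ (s <<< (4 * p)) := by
  intro q c hc hb heq
  rw [Nat.testBit_shiftLeft, Bool.and_eq_true, decide_eq_true_iff] at hb
  have h4 : 4 * q + c - 4 * p < 4 := by
    by_contra hlt
    have h16 : 2 ^ 4 ≤ 2 ^ (4 * q + c - 4 * p) := Nat.pow_le_pow_right (by norm_num) (by omega)
    rw [Nat.testBit_lt_two_pow (by omega)] at hb
    exact Bool.noConfusion hb.2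
  obtain rfl : p = q := by omega
  rw [Nat.add_sub_cancel_left, ← heq, h] at hb
  exact Bool.noConfusion hb.2

theorem testBit_nbrMask {p k : ℕ} :
    (nbrMask p).testBit k = true ↔ ∃ w ∈ coreNbr p, 4 * w = k := by
  rw [nbrMask]
  induction coreNbr p with
  | nil => simp
  | cons w l ih =>
    rw [List.foldr_cons, List.exists_mem_cons_iff, ← ih]
    change (1 <<< (4 * w) ||| _).testBit k = true ↔ _
    rw [Nat.testBit_or, Bool.or_eq_true, Nat.shiftLeft_eq, one_mul, Nat.testBit_two_pow,
      decide_eq_true_iff]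

theorem mem_coreNbr {p w : ℕ} : w ∈ coreNbr p ↔ p < 984 ∧ w < 984 ∧ w ∈ nbr p := by
  rw [coreNbr]
  by_cases h : p < 984
  · rw [show Nat.blt p 984 = true by rwa [Nat.blt_eq], cond_true, List.mem_filter, Nat.blt_eq]
    tauto
  · rw [show Nat.blt p 984 = false by rw [← Bool.not_eq_true, Nat.blt_eq]; exact h, cond_false]
    simp [h]

theorem dist_of_mem_coreNbr {p w : ℕ} (h : w ∈ coreNbr p) : dist (pt p) (pt w) = 1 := by
  rw [mem_coreNbr] at h
  exact (dist_pt_eq_one_iff_mem_nbr (h.1.trans (by norm_num)) (valid_of_mem_nbr h.2.2)).2 h.2.2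

theorem excludes_nbrMask (hχ : IsColoring χ) (p : ℕ) : Excludes χ (nbrMask p <<< χ p) := by
  intro w c hc hb heq
  have h4 := hχ.lt_four p
  rw [Nat.testBit_shiftLeft, Bool.and_eq_true, decide_eq_true_iff, testBit_nbrMask] at hb
  obtain ⟨h1, u, hu, h2⟩ := hb
  obtain ⟨rfl, h3⟩ : u = w ∧ c = χ p := by omega
  have h5 := mem_coreNbr.1 hu
  exact hχ.ne p h5.1 u h5.2.1 (dist_of_mem_coreNbr hu) (by omega)

theorem testBit_window {p c : ℕ} (hc : c < 4) :
    (Nat.mod (Nat.shiftRight F (Nat.mul 4 p)) 16).testBit c = F.testBit (4 * p + c) := by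
  change (F >>> (4 * p) % 2 ^ 4).testBit c = _
  rw [Nat.testBit_mod_two_pow, decide_eq_true hc, Bool.true_and, Nat.testBit_shiftRight]

/-- The result `n` of a step codes a contradiction or a set of excluded colours. -/
def Sound (χ : ℕ → ℕ) (n : ℕ) : Prop := n ≠ 0 ∧ ∀ F, n = F + 1 → Excludes χ F

theorem sound_succ (h : Excludes χ F) : Sound χ (Nat.succ F) :=
  ⟨Nat.succ_ne_zero F, fun _ h' => Nat.succ.inj h' ▸ h⟩

theorem sound_propagate (hχ : IsColoring χ) (p : ℕ) (hF : Excludes χ F) :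
    Sound χ (propagate p F) := by
  have hn (c : ℕ) (hc : c < 4)
      (h : (Nat.mod (Nat.shiftRight F (Nat.mul 4 p)) 16).testBit c = true) : χ p ≠ c :=
    hF p c hc (by rwa [testBit_window hc] at h)
  have h4 := hχ.lt_four p
  have hm := excludes_nbrMask hχ p
  rw [propagate]
  generalize Nat.mod (Nat.shiftRight F (Nat.mul 4 p)) 16 = n at hn
  simp only [Bool.cond_eq_ite, nat_beq_eq, decide_eq_true_iff]
  have key (k : ℕ) (hk : χ p = k) : Sound χ (Nat.succ (Nat.lor F (Nat.shiftLeft (nbrMask p) k))) :=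
    sound_succ (hF.lor (hk ▸ hm))
  split_ifs with h h h h h
  · subst h
    have := hn 0 (by decide) (by decide); have := hn 1 (by decide) (by decide)
    have := hn 2 (by decide) (by decide)
    exact key 3 (by omega)
  · subst h
    have := hn 0 (by decide) (by decide); have := hn 1 (by decide) (by decide)
    have := hn 3 (by decide) (by decide)
    exact key 2 (by omega)
  · subst h
    have := hn 0 (by decide) (by decide); have := hn 2 (by decide) (by decide)
    have := hn 3 (by decide) (by decide)
    exact key 1 (by omega)
  · subst h
    have := hn 1 (by decide) (by decide); have := hn 2 (by decide) (by decide)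
    have := hn 3 (by decide) (by decide)
    exact key 0 (by omega)
  · subst h
    have := hn 0 (by decide) (by decide); have := hn 1 (by decide) (by decide)
    have := hn 2 (by decide) (by decide); have := hn 3 (by decide) (by decide)
    omega
  · exact sound_succ hF

/-- The clause `C` holds for the colouring `χ`. -/
def Holds (χ : ℕ → ℕ) (C : ℕ) : Prop :=
  ∃ k, ((C >>> (14 * k + 10)) % 16).testBit (χ ((C >>> (14 * k)) % 1024)) = true

theorem not_holds_zero : ¬ Holds χ 0 := by rintro ⟨k, h⟩; simp at h

theorem holds_iff {C : ℕ} : Holds χ C ↔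
    (((C >>> 10) % 16).testBit (χ (C % 1024)) = true) ∨ Holds χ (C >>> 14) := by
  have e (k a : ℕ) : C >>> 14 >>> (14 * k + a) = C >>> (14 * (k + 1) + a) := by
    rw [← Nat.shiftRight_add]; congr 1; ring
  constructor
  · rintro ⟨k, h⟩
    match k with
    | 0 => exact Or.inl h
    | k + 1 =>
      have := e k 0
      rw [add_zero, add_zero] at this
      exact Or.inr ⟨k, by rwa [e, this]⟩
  · rintro (h | ⟨k, h⟩)
    · exact ⟨0, h⟩
    · refine ⟨k + 1, ?_⟩
      have := e k 0
      rw [add_zero, add_zero] at this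
      rwa [e, this] at h

/-- The symmetry with the given tables maps colourings to colourings. -/
def IsSymmetry (row crow e : ℕ) : Prop :=
  ∀ χ, IsNormalColoring χ → ∃ χ', IsNormalColoring χ' ∧ ∀ p, ∀ S < 16, S.testBit (χ' p) = true →
    (crow >>> (4 * S)).testBit (χ (symCode row (cond (Nat.beq e 1) (conjCode p) p))) = true

theorem useClause_succ (row crow e F fuel C a : ℕ) : useClause row crow e F (fuel + 1) C a =
    cond (Nat.beq C 0)
      (cond (Nat.beq a 0) 0
        (force (Nat.div a 16) fun p =>
          force (Nat.lor F (Nat.shiftLeft (Nat.xor (Nat.mod a 16) 15) (Nat.mul 4 p))) fun F' =>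
            propagate p F'))
      (force (Nat.mod C 1024) fun p =>
        force (symCode row (cond (Nat.beq e 1) (conjCode p) p)) fun p' =>
          force (Nat.land (Nat.shiftRight crow (Nat.mul 4 (Nat.mod (Nat.shiftRight C 10) 16)))
            (Nat.sub 15 (Nat.mod (Nat.shiftRight F (Nat.mul 4 p')) 16))) fun r =>
              cond (Nat.beq r 0) (useClause row crow e F fuel (Nat.shiftRight C 14) a)
                (cond (Nat.beq a 0) (useClause row crow e F fuel (Nat.shiftRight C 14)
                  (Nat.add (Nat.mul 16 p') r)) (Nat.succ F))) :=
  rfl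

theorem testBit_allowed {p : ℕ} {m : ℕ} (hF : Excludes χ F) (h4 : χ p < 4)
    (hm : m.testBit (χ p) = true) :
    (m &&& (15 - F >>> (4 * p) % 16)).testBit (χ p) = true := by
  rw [Nat.testBit_and, hm, Bool.true_and]
  have hn : (F >>> (4 * p) % 16).testBit (χ p) = false := by
    rw [Bool.eq_false_iff]
    exact fun hb => hF p (χ p) h4 ((testBit_window h4).symm.trans hb) rfl
  have hlt : F >>> (4 * p) % 16 < 16 := Nat.mod_lt _ (by norm_num)
  have all : ∀ n < 16, ∀ c < 4, n.testBit c = false → (15 - n).testBit c = true := by decide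
  exact all _ hlt _ h4 hn

theorem sound_useClause {χ' : ℕ → ℕ} {row crow e : ℕ} (hχ : IsColoring χ)
    (h : ∀ p, ∀ S < 16, S.testBit (χ' p) = true →
      (crow >>> (4 * S)).testBit (χ (symCode row (cond (Nat.beq e 1) (conjCode p) p))) = true)
    (hF : Excludes χ F) (fuel : ℕ) : ∀ C a, Holds χ' C ∨ (a % 16).testBit (χ (a / 16)) = true →
      Sound χ (useClause row crow e F fuel C a) := by
  induction fuel with
  | zero => exact fun _ _ _ => sound_succ hF
  | succ fuel ih =>
    intro C a hCa
    have hS := h (C % 1024) (C >>> 10 % 16) (Nat.mod_lt _ (by norm_num))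
    simp only [useClause_succ, force_eq, nat_mod_eq]
    generalize symCode row _ = p' at hS
    have h4 := hχ.lt_four p'
    have hS' := fun hb => testBit_allowed hF h4 (hS hb)
    change _ → (Nat.land (Nat.shiftRight crow (Nat.mul 4 (Nat.shiftRight C 10 % 16)))
      (Nat.sub 15 (Nat.shiftRight F (Nat.mul 4 p') % 16))).testBit (χ p') = true at hS'
    have hr : Nat.land (Nat.shiftRight crow (Nat.mul 4 (Nat.shiftRight C 10 % 16)))
      (Nat.sub 15 (Nat.shiftRight F (Nat.mul 4 p') % 16)) ≤ 15 :=
      Nat.and_le_right.trans (Nat.sub_le _ _)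
    generalize Nat.land _ _ = r at hS' hr
    simp only [Bool.cond_eq_ite, nat_beq_eq, decide_eq_true_iff]
    split_ifs with h1 h2 h3 h5
    · subst h1 h2
      exact absurd hCa (by simpa using not_holds_zero)
    · subst h1
      refine sound_propagate hχ _ (hF.lor (excludes_shiftLeft (Nat.xor_lt_two_pow (n := 4)
        (Nat.mod_lt _ (by norm_num)) (by norm_num)) ?_))
      change (a % 16 ^^^ 15).testBit (χ (a / 16)) = false
      rw [Nat.testBit_xor, hCa.resolve_left not_holds_zero]
      have h15 : ∀ c < 4, Nat.testBit 15 c = true := by decide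
      rw [h15 _ (hχ.lt_four _)]
      rfl
    · subst h3
      exact ih _ _ (hCa.imp_left fun hC => (holds_iff.1 hC).resolve_left fun hb => by
        simpa using hS' hb)
    · subst h5
      refine ih _ _ ?_
      rcases holds_iff.1 (hCa.resolve_right (by simp)) with hb | hC
      · right
        have e1 : (Nat.mul 16 p').add r % 16 = r := by
          change (16 * p' + r) % 16 = r
          omega
        have e2 : (Nat.mul 16 p').add r / 16 = p' := by
          change (16 * p' + r) / 16 = p'
          omega
        rw [e1, e2]
        exact hS' hb
      · exact Or.inl hC
    · exact sound_succ hF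

theorem sound_assume (hχ : IsColoring χ) (fuel : ℕ) : ∀ C F, ¬ Holds χ C → Excludes χ F →
    Sound χ (assume fuel C F) := by
  induction fuel with
  | zero => exact fun _ _ _ hF => sound_succ hF
  | succ fuel ih =>
    intro C F hC hF
    have e : assume (fuel + 1) C F = cond (Nat.beq C 0) (Nat.succ F)
      (Nat.rec 0 (fun F' _ => force (Nat.shiftRight C 14) fun C' => assume fuel C' F')
        (force (Nat.mod C 1024) fun p =>
          force (Nat.lor F (Nat.shiftLeft (Nat.mod (Nat.shiftRight C 10) 16) (Nat.mul 4 p)))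
            fun F' => propagate p F')) := rfl
    rw [e]
    simp only [force_eq, Bool.cond_eq_ite]
    split_ifs with h
    · exact sound_succ hF
    · rw [holds_iff, not_or, Bool.not_eq_true] at hC
      have hs := sound_propagate hχ (Nat.mod C 1024) (hF.lor (excludes_shiftLeft (p := C % 1024)
        (Nat.mod_lt (C >>> 10) (by norm_num : 16 > 0)) hC.1))
      change Sound χ (Nat.rec 0 _ (propagate _ (F ||| (C >>> 10 % 16) <<< (4 * (C % 1024)))))
      change Sound χ (propagate _ (F ||| (C >>> 10 % 16) <<< (4 * (C % 1024)))) at hs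
      generalize propagate _ _ = n at hs
      match n with
      | 0 => exact absurd rfl hs.1
      | n + 1 => exact ih _ _ hC.2 (hs.2 n rfl)

/-- The clauses with numbers below `i` hold for all colourings. -/
def HoldBelow (db : Tree) (i : ℕ) : Prop := ∀ j < i, ∀ χ, IsNormalColoring χ → Holds χ (db.get j)

theorem sound_useLemma {db : Tree} {i : ℕ} (hsym : ∀ t e,
      IsSymmetry (mulRows.getD t 0) (colorRows.getD t 0xffffffffffffffff) e)
    (hdb : HoldBelow db i) (hχ : IsNormalColoring χ) (hF : Excludes χ F) (j t e : ℕ) :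
    Sound χ (useLemma db i j t e F) := by
  rw [useLemma]
  simp only [force_eq, Bool.cond_eq_ite, Nat.blt_eq]
  split_ifs with h
  · obtain ⟨χ', h1, h2⟩ := hsym t e χ hχ
    exact sound_useClause hχ.toIsColoring h2 hF _ _ _ (Or.inl (hdb j h χ' h1))
  · exact sound_succ hF

theorem runHints_sound {db : Tree} {i : ℕ} (hsym : ∀ t e,
      IsSymmetry (mulRows.getD t 0) (colorRows.getD t 0xffffffffffffffff) e)
    (hdb : HoldBelow db i) (hχ : IsNormalColoring χ) (fuel : ℕ) : ∀ h F, Excludes χ F →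
      runHints db i fuel h F = false := by
  induction fuel with
  | zero => exact fun _ _ _ => rfl
  | succ fuel ih =>
    intro h F hF
    have e : runHints db i (fuel + 1) h F = cond (Nat.ble h 1) false
      (cond (Nat.beq (Nat.mod h 2) 0)
        (Nat.rec true (fun F' _ => force (Nat.shiftRight h 11) fun h' => runHints db i fuel h' F')
          (force (Nat.mod (Nat.shiftRight h 1) 1024) fun p => propagate p F))
        (Nat.rec true (fun F' _ => force (Nat.shiftRight h 18) fun h' => runHints db i fuel h' F')
          (force (Nat.mod (Nat.shiftRight h 1) 2048) fun j =>
            force (Nat.mod (Nat.shiftRight h 12) 32) fun t =>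
              force (Nat.mod (Nat.shiftRight h 17) 2) fun e => useLemma db i j t e F))) := rfl
    have key (n h' : ℕ) (hn : Sound χ n) :
        (Nat.rec true (fun F' _ => runHints db i fuel h' F') n : Bool) = false := by
      match n with
      | 0 => exact absurd rfl hn.1
      | n + 1 => exact ih _ _ (hn.2 n rfl)
    rw [e]
    simp only [force_eq, Bool.cond_eq_ite]
    split_ifs
    · rfl
    · exact key _ _ (sound_propagate hχ.toIsColoring _ hF)
    · exact key _ _ (sound_useLemma hsym hdb hχ hF _ _ _)

theorem excludes_initialMask (hχ : IsNormalColoring χ) : Excludes χ initialMask := by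
  have key (l : List ℕ) (hl : ∀ p ∈ l, p < 24) : Excludes χ
      (l.foldr (fun p m => Nat.lor (Nat.lor (Nat.shiftLeft (nbrMask p) (icoColor p))
        (Nat.shiftLeft (Nat.sub 15 (Nat.shiftLeft 1 (icoColor p))) (Nat.mul 4 p))) m) 0) := by
    induction l with
    | nil => exact Excludes.zero
    | cons p l ih =>
      have hp := hχ.eq_icoColor p (hl p List.mem_cons_self)
      have h4 := hχ.lt_four p
      rw [List.foldr_cons]
      refine ((hp ▸ excludes_nbrMask hχ.toIsColoring p).lor (excludes_shiftLeft ?_ ?_)).lor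
        (ih fun q hq => hl q (List.mem_cons_of_mem p hq))
      · exact (Nat.sub_le 15 _).trans_lt (by norm_num)
      · have all : ∀ c < 4, (Nat.sub 15 (Nat.shiftLeft 1 c)).testBit c = false := by decide
        rw [← hp]
        exact all _ h4
  exact key icoCodes (by decide)

theorem holds_of_checkLemma {db : Tree} {i h : ℕ} (hsym : ∀ t e,
      IsSymmetry (mulRows.getD t 0) (colorRows.getD t 0xffffffffffffffff) e)
    (hdb : HoldBelow db i) (hc : checkLemma db i h = true) (hχ : IsNormalColoring χ) :
    Holds χ (db.get i) := by
  by_contra hC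
  rw [checkLemma, force_eq] at hc
  have hs := sound_assume hχ.toIsColoring 64 _ _ hC (excludes_initialMask hχ)
  generalize assume 64 _ _ = n at hs hc
  match n with
  | 0 => exact absurd rfl hs.1
  | n + 1 =>
    have := runHints_sound hsym hdb hχ 256 h n (hs.2 n rfl)
    exact Bool.noConfusion (this.symm.trans hc)

theorem holdBelow_of_checkLemmas {db : Tree} (hsym : ∀ t e,
      IsSymmetry (mulRows.getD t 0) (colorRows.getD t 0xffffffffffffffff) e) (hs : List ℕ) :
    ∀ i, checkLemmas db hs i = true → HoldBelow db i → HoldBelow db (i + hs.length) := by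
  induction hs with
  | nil => exact fun _ _ h => h
  | cons h hs ih =>
    intro i hc hdb
    have hc' : (checkLemma db i h && checkLemmas db hs (i + 1)) = true := hc
    rw [Bool.and_eq_true] at hc'
    have := ih (i + 1) hc'.2 fun j hj χ hχ => by
      rcases Nat.lt_succ_iff_lt_or_eq.1 hj with hj | rfl
      · exact hdb j hj χ hχ
      · exact holds_of_checkLemma hsym hdb hc'.1 hχ
    rwa [List.length_cons, add_comm hs.length, ← add_assoc]

/-! ### Symmetries of colourings -/

/-- The code of the image of the point with code `p` under `t`, possibly not normalized. -/
def rotCode (t p : ℕ) : ℕ := p - p % 24 + tMul t (p % 24)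

theorem rotCode_lt {t p : ℕ} (ht : t < 24) (hp : p < 984) : rotCode t p < 984 := by
  have := tMul_lt ht (Nat.mod_lt p (by norm_num : 24 > 0))
  rw [rotCode]
  omega

theorem point3_rotCode {t : ℕ} (ht : t < 24) (p : ℕ) :
    point3 (rotCode t p) = act t (point3 p) := by
  rw [← point3_codeAct ht, codeAct_eq_normalize ht, point3_normalize, rotCode]
  congr 2
  omega

/-- A map of codes that preserves the adjacency of the surviving vertices. -/
structure IsAutomorphism (f : ℕ → ℕ) : Prop where
  lt : ∀ p < 984, f p < 984
  dist_eq : ∀ p < 984, ∀ w < 984, dist (pt p) (pt w) = 1 → dist (pt (f p)) (pt (f w)) = 1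

theorem IsAutomorphism.comp {f g : ℕ → ℕ} (hf : IsAutomorphism f) (hg : IsAutomorphism g) :
    IsAutomorphism (f ∘ g) :=
  ⟨fun p hp => hf.lt _ (hg.lt p hp), fun p hp w hw h =>
    hf.dist_eq _ (hg.lt p hp) _ (hg.lt w hw) (hg.dist_eq p hp w hw h)⟩

theorem IsAutomorphism.iterate {f : ℕ → ℕ} (hf : IsAutomorphism f) (n : ℕ) :
    IsAutomorphism f^[n] := by
  induction n with
  | zero => exact ⟨fun _ h => h, fun _ _ _ _ h => h⟩
  | succ n ih => exact ih.comp hf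

theorem isAutomorphism_rotCode {t : ℕ} (ht : t < 24) : IsAutomorphism (rotCode t) := by
  refine ⟨fun p hp => rotCode_lt ht hp, fun p hp w hw h => ?_⟩
  have hp' := rotCode_lt ht hp
  have hw' := rotCode_lt ht hw
  rw [dist_pt_eq_one_iff (by omega) (by omega)] at h ⊢
  rw [point3_rotCode ht, point3_rotCode ht, dot3_act, h]

/-- A check that a map of codes preserves adjacency. -/
def checkMap (f : ℕ → ℕ) : Bool := (List.range 984).all fun p => Nat.blt (f p) 984 &&
  (Nat.beq (normalize (f p)) (normalize (f (normalize p))) &&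
    force (nbrMask (f p)) fun m => (coreNbr p).all fun w => Nat.testBit m (Nat.mul 4 (f w)))

theorem pt_normalize (v : ℕ) : pt (normalize v) = pt v := congrArg toE (point3_normalize v)

theorem normalize_lt {v n : ℕ} (h : v < n) : normalize v < n := by
  rw [normalize_eq]; split_ifs <;> omega

theorem isAutomorphism_of_checkMap {f : ℕ → ℕ} (h : checkMap f = true) : IsAutomorphism f := by
  have h' : ∀ p < 984, f p < 984 ∧ normalize (f p) = normalize (f (normalize p)) ∧
      ∀ w ∈ coreNbr p, f w ∈ coreNbr (f p) := by
    intro p hp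
    have := getD_eq_true_of_all_range h hp
    simp only [force_eq, Bool.and_eq_true, Nat.blt_eq, Nat.beq_eq, List.all_eq_true,
      testBit_nbrMask] at this
    refine this.imp_right fun h => h.imp_right fun h w hw => ?_
    obtain ⟨u, hu, h4⟩ := h w hw
    have : u = f w := Nat.eq_of_mul_eq_mul_left (by norm_num) h4
    exact this ▸ hu
  refine ⟨fun p hp => (h' p hp).1, fun p hp w hw hd => ?_⟩
  have hv := valid_normalize (hw.trans (by norm_num : 984 < 3144))
  rw [← pt_normalize w, dist_pt_eq_one_iff_mem_nbr (by omega) hv] at hd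
  have := dist_of_mem_coreNbr ((h' p hp).2.2 _ (mem_coreNbr.2 ⟨hp, normalize_lt hw, hd⟩))
  rwa [← pt_normalize (f (normalize w)), ← (h' w hw).2.1, pt_normalize] at this

theorem checkMap_conjCode : checkMap conjCode = true := by decide +kernel

def rotationCodes : List ℕ := [0, 3, 5, 6, 8, 11, 13, 14, 16, 19, 21, 22]

/-- The action of the rotation `t` on the colours of the icosahedron. -/
def colorAct (t c : ℕ) : ℕ := icoColor (tMul (tInv t) c)

theorem icoColor_lt (p : ℕ) : icoColor p < 4 := Nat.mod_lt _ (by norm_num)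

theorem colorAct_spec : ∀ t ∈ rotationCodes, t < 24 ∧
    (∀ u < 24, ((mulRows.getD t 0) >>> (5 * u)) % 32 = tMul t u) ∧
    (∀ c < 4, ∀ d < 4, colorAct t c = colorAct t d → c = d) ∧
    (∀ p < 24, colorAct t (icoColor (tMul t p)) = icoColor p) ∧
    ∀ S < 16, ∀ c < 4, S.testBit (colorAct t c) = true →
      ((colorRows.getD t 0xffffffffffffffff) >>> (4 * S)).testBit c = true := by
  decide +kernel

theorem testBit_all_colors : ∀ S < 16, ∀ c < 4,
    (0xffffffffffffffff >>> (4 * S)).testBit c = true := by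
  decide +kernel

theorem colorRows_getD (t : ℕ) (ht : t ∉ rotationCodes) :
    colorRows.getD t 0xffffffffffffffff = 0xffffffffffffffff := by
  by_cases h : t < 24
  · have all : ∀ t < 24, t ∉ rotationCodes →
        colorRows.getD t 0xffffffffffffffff = 0xffffffffffffffff := by decide +kernel
    exact all t h ht
  · exact List.getD_eq_default _ _ (by simpa [colorRows] using h)

theorem isAutomorphism_cond (e : ℕ) :
    IsAutomorphism fun p => cond (Nat.beq e 1) (conjCode p) p := by
  cases Nat.beq e 1
  · exact ⟨fun _ h => h, fun _ _ _ _ h => h⟩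
  · exact isAutomorphism_of_checkMap checkMap_conjCode

theorem cond_conjCode (e : ℕ) {p : ℕ} (hp : p < 24) : cond (Nat.beq e 1) (conjCode p) p = p := by
  have : conjCode p = p := by rw [conjCode, show Nat.blt p 24 = true by rwa [Nat.blt_eq], cond_true]
  rw [this, Bool.cond_self]

theorem isSymmetry_getD (t e : ℕ) :
    IsSymmetry (mulRows.getD t 0) (colorRows.getD t 0xffffffffffffffff) e := by
  intro χ hχ
  by_cases ht : t ∈ rotationCodes
  · obtain ⟨h24, h1, h2, h3, h4⟩ := colorAct_spec t ht
    have hf := (isAutomorphism_rotCode h24).comp (isAutomorphism_cond e)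
    have hs (p : ℕ) : symCode (mulRows.getD t 0) p = rotCode t p := by
      rw [rotCode, ← h1 _ (Nat.mod_lt _ (by norm_num))]
      rfl
    refine ⟨fun p => colorAct t (χ (rotCode t (cond (Nat.beq e 1) (conjCode p) p))),
      ⟨⟨fun p => icoColor_lt _, fun p hp w hw hd heq => ?_⟩, fun p hp => ?_⟩, fun p S hS hb => ?_⟩
    · exact hχ.ne _ (hf.lt p hp) _ (hf.lt w hw) (hf.dist_eq p hp w hw hd)
        (h2 _ (hχ.lt_four _) _ (hχ.lt_four _) heq)
    · have hr : rotCode t p = tMul t p := by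
        rw [rotCode, Nat.mod_eq_of_lt hp, Nat.sub_self, Nat.zero_add]
      simp only [cond_conjCode e hp]
      rw [hr, hχ.eq_icoColor _ (tMul_lt h24 hp), h3 p hp]
    · rw [hs]
      exact h4 S hS _ (hχ.lt_four _) hb
  · refine ⟨χ, hχ, fun p S hS _ => ?_⟩
    rw [colorRows_getD t ht]
    exact testBit_all_colors S hS _ (hχ.lt_four _)

theorem not_isNormalColoring (χ : ℕ → ℕ) : ¬ IsNormalColoring χ := by
  intro hχ
  have step (hs : List ℕ) (i k : ℕ) (hk : i + hs.length = k)
      (h : checkLemmas clauses hs i = true) (h' : HoldBelow clauses i) : HoldBelow clauses k :=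
    hk ▸ holdBelow_of_checkLemmas isSymmetry_getD hs i h h'
  have h0 : HoldBelow clauses 0 := fun j hj => absurd hj (Nat.not_lt_zero j)
  have h1 := step _ _ 100 (by decide +kernel) hints0_check h0
  have h2 := step _ _ 200 (by decide +kernel) hints1_check h1
  have h3 := step _ _ 300 (by decide +kernel) hints2_check h2
  have h4 := step _ _ 400 (by decide +kernel) hints3_check h3
  have h5 := step _ _ 500 (by decide +kernel) hints4_check h4
  have h6 := step _ _ 600 (by decide +kernel) hints5_check h5
  have h7 := step _ _ 700 (by decide +kernel) hints6_check h6
  have h8 := step _ _ 800 (by decide +kernel) hints7_check h7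
  have h9 := step _ _ 900 (by decide +kernel) hints8_check h8
  have h10 := step _ _ 1000 (by decide +kernel) hints9_check h9
  have h11 := step _ _ 1100 (by decide +kernel) hints10_check h10
  have h12 := step _ _ 1111 (by decide +kernel) hints11_check h11
  have hlast : clauses.get 1110 = 0 := by decide +kernel
  exact not_holds_zero (hlast ▸ h12 1110 (by norm_num) χ hχ)

/-! ### The colourings of the icosahedron -/

/-- For each code `t`, the rotation `ρ` of order five satisfies `ρ t = t' ρ ^ j`; the list of the
pairs `(t', j)`. -/
def rotationTable : List (ℕ × ℕ) := [(0, 1), (12, 3), (15, 2), (3, 4), (4, 4), (8, 2), (11, 3),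
  (7, 1), (16, 4), (2, 2), (1, 3), (19, 1), (20, 1), (6, 3), (5, 2), (23, 4), (21, 3), (10, 1),
  (9, 4), (22, 2), (17, 2), (14, 4), (13, 1), (18, 3)]

/-- The action of `ρ` on codes. -/
def rhoCode (v : ℕ) : ℕ :=
  force (Nat.div v 24) fun q =>
    cond (Nat.beq q 0) (normalize (rotationTable.getD v (0, 0)).1)
      (force (Nat.sub q 1) fun r =>
        Nat.add (Nat.mul 24 (Nat.add (Nat.add 1 (Nat.sub r (Nat.mod r 5)))
          (Nat.mod (Nat.add r (rotationTable.getD (Nat.mod v 24) (0, 0)).2) 5)))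
          (rotationTable.getD (Nat.mod v 24) (0, 0)).1)

theorem checkMap_rhoCode : checkMap rhoCode = true := by decide +kernel

/-- Ten symmetries of the icosahedron. -/
def icoSymmetry (k v : ℕ) : ℕ := normalize (rhoCode^[k % 5] ((rotCode 7)^[k / 5] (normalize v)))

theorem isAutomorphism_normalize : IsAutomorphism normalize :=
  ⟨fun _ hp => normalize_lt hp, fun p _ w _ h => by rwa [pt_normalize, pt_normalize]⟩

theorem isAutomorphism_icoSymmetry (k : ℕ) : IsAutomorphism (icoSymmetry k) :=
  isAutomorphism_normalize.comp (((isAutomorphism_of_checkMap checkMap_rhoCode).iterate _).comp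
    (((isAutomorphism_rotCode (by norm_num)).iterate _).comp isAutomorphism_normalize))

/-- The sets of neighbours on the icosahedron. -/
def icoAdjacency : List ℕ := [
  0xc0a04, 0x30a08, 0xc0501, 0x30502, 0, 0, 0, 0, 0xa040c, 0xa0803, 0x5010c, 0x50203, 0, 0, 0,
  0, 0x40c0a, 0x8030a, 0x10c05, 0x20305]

theorem icoAdjacency_spec : ∀ p ∈ icoCodes, ∀ w ∈ icoCodes,
    (icoAdjacency.getD p 0).testBit w = true → w ∈ nbr p := by
  decide +kernel

/-- The proper colourings of the given vertices of the icosahedron. -/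
def icoColorings : List ℕ → List (List ℕ)
  | [] => [[]]
  | p :: l => (icoColorings l).flatMap fun cs => ((List.range 4).filter fun c =>
      (l.zip cs).all fun x => !(Nat.testBit (icoAdjacency.getD p 0) x.1 && Nat.beq c x.2)).map
        fun c => c :: cs

theorem map_mem_icoColorings {χ : ℕ → ℕ} (hχ : IsColoring χ) (l : List ℕ)
    (hl : ∀ p ∈ l, p ∈ icoCodes) : l.map χ ∈ icoColorings l := by
  induction l with
  | nil => exact List.mem_singleton_self _
  | cons p l ih =>
    rw [List.forall_mem_cons] at hl
    rw [icoColorings, List.mem_flatMap]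
    refine ⟨l.map χ, ih hl.2, List.mem_map.2 ⟨χ p, List.mem_filter.2
      ⟨List.mem_range.2 (hχ.lt_four p), ?_⟩, rfl⟩⟩
    rw [List.all_eq_true]
    rintro ⟨w, d⟩ hw
    rw [← List.map_id l, List.map_map, List.zip_map', List.mem_map] at hw
    obtain ⟨u, hu, h⟩ := hw
    obtain ⟨rfl, rfl⟩ := Prod.mk.inj h
    rw [Bool.not_eq_true', ← Bool.not_eq_true, Bool.and_eq_true, nat_beq_eq, decide_eq_true_iff]
    rintro ⟨h1, h2⟩
    have hp := ((mem_icoCodes_iff p).1 hl.1).1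
    have hu' := (mem_icoCodes_iff u).1 (hl.2 u hu)
    refine hχ.ne p (by omega) u (by omega) ?_ h2
    exact (dist_pt_eq_one_iff_mem_nbr (by omega) hu'.2).2
      (icoAdjacency_spec p hl.1 u (hl.2 u hu) h1)

/-- The position of a vertex of the icosahedron in `icoCodes`. -/
def icoIndex (v : ℕ) : ℕ := Nat.add (Nat.mul 4 (Nat.div v 8)) (Nat.mod v 8)

theorem icoIndex_spec : ∀ v ∈ icoCodes, icoIndex v < icoCodes.length ∧
    icoCodes.getD (icoIndex v) 0 = v := by decide +kernel

theorem getD_map_icoIndex (χ : ℕ → ℕ) {v : ℕ} (hv : v ∈ icoCodes) :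
    (icoCodes.map χ).getD (icoIndex v) 0 = χ v := by
  obtain ⟨h1, h2⟩ := icoIndex_spec v hv
  rw [List.getD_eq_getElem _ _ h1] at h2
  rw [List.getD_eq_getElem _ _ (by rwa [List.length_map]), List.getElem_map, h2]

/-- The colour of the image of a vertex. -/
def imageColor (cs : List ℕ) (k v : ℕ) : ℕ := cs.getD (icoIndex (icoSymmetry k v)) 0

/-- Up to symmetry and the names of the colours, the icosahedron has only one colouring. -/
theorem icoColorings_check : ((icoColorings icoCodes).all fun cs => (List.range 10).any fun k =>
    (icoCodes.all fun p => Nat.beq (imageColor cs k p) (imageColor cs k (icoColor p))) &&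
    (List.range 4).all fun c => (List.range c).all fun d =>
      !Nat.beq (imageColor cs k c) (imageColor cs k d)) = true := by
  decide +kernel

theorem icoSymmetry_mem : ∀ k < 10, ∀ p < 24, icoSymmetry k p ∈ icoCodes := by decide +kernel

theorem icoColor_normalize : ∀ p < 24, icoColor (normalize p) = icoColor p := by decide +kernel

theorem not_isColoring (χ : ℕ → ℕ) : ¬ IsColoring χ := by
  intro hχ
  obtain ⟨k, hk, h⟩ := List.any_eq_true.1 (List.all_eq_true.1 icoColorings_check _
    (map_mem_icoColorings hχ icoCodes fun _ h => h))
  rw [List.mem_range] at hk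
  set f := icoSymmetry k with hf
  have himg (p : ℕ) (hp : p < 24) : imageColor (icoCodes.map χ) k p = χ (f p) :=
    getD_map_icoIndex χ (icoSymmetry_mem k hk p hp)
  have hfn (p : ℕ) (hp : p < 24) : f (normalize p) = f p := by
    rw [hf, icoSymmetry, icoSymmetry,
      normalize_of_valid (valid_normalize (hp.trans (by norm_num : 24 < 3144)))]
  simp only [Bool.and_eq_true, List.all_eq_true, List.mem_range, Bool.not_eq_true',
    nat_beq_eq, decide_eq_true_iff, decide_eq_false_iff_not] at h
  have h1 (p : ℕ) (hp : p < 24) : χ (f p) = χ (f (icoColor p)) := by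
    have hv : normalize p ∈ icoCodes := (mem_icoCodes_iff _).2
      ⟨normalize_lt hp, valid_normalize (hp.trans (by norm_num : 24 < 3144))⟩
    have := h.1 _ hv
    rw [himg _ (normalize_lt hp), hfn p hp, icoColor_normalize p hp,
      himg _ ((icoColor_lt p).trans (by norm_num))] at this
    exact this
  have h2 (c : ℕ) (hc : c < 4) (d : ℕ) (hd : d < 4) (hcd : χ (f c) = χ (f d)) : c = d := by
    rcases lt_trichotomy c d with hlt | heq | hlt
    · have := h.2 d hd c hlt
      rw [himg _ (by omega), himg _ (by omega)] at this
      exact absurd hcd.symm this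
    · exact heq
    · have := h.2 c hc d hlt
      rw [himg _ (by omega), himg _ (by omega)] at this
      exact absurd hcd this
  have hsurj : Function.Surjective fun c : Fin 4 => (⟨χ (f c), hχ.lt_four _⟩ : Fin 4) :=
    Finite.injective_iff_surjective.1 fun c d hcd =>
      Fin.ext (h2 c c.2 d d.2 (congrArg Fin.val hcd))
  choose g hg using hsurj
  have hg' (v : ℕ) : χ (f (g ⟨χ (f v), hχ.lt_four _⟩)) = χ (f v) := congrArg Fin.val (hg _)
  have hauto := isAutomorphism_icoSymmetry k
  refine not_isNormalColoring (fun v => g ⟨χ (f v), hχ.lt_four _⟩)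
    ⟨⟨fun v => (g _).2, fun p hp w hw hd heq => ?_⟩, fun p hp => ?_⟩
  · refine hχ.ne _ (hauto.lt p hp) _ (hauto.lt w hw) (hauto.dist_eq p hp w hw hd) ?_
    rw [← hf, ← hg' p, ← hg' w]
    exact congrArg (fun c => χ (f c)) heq
  · exact h2 _ (g _).2 _ (icoColor_lt p) ((hg' p).trans (h1 p hp))

theorem not_colorable_four : ¬ (codeGraph core).Colorable 4 := by
  rintro ⟨C⟩
  have hmem {p : ℕ} (hp : p < 984) : normalize p ∈ codes core := by
    rw [mem_codes]
    have := normalize_lt hp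
    refine ⟨valid_normalize (by omega), ?_⟩
    rw [core, Nat.blt_eq]
    omega
  refine not_isColoring (fun p => if hp : p < 984 then C ⟨normalize p, hmem hp⟩ else 0)
    ⟨fun p => ?_, fun p hp w hw hd heq => ?_⟩
  · split_ifs
    · exact (C _).2
    · norm_num
  · rw [dif_pos hp, dif_pos hw] at heq
    rw [← pt_normalize p, ← pt_normalize w, dist_pt_eq_one_iff_mem_nbr
      ((normalize_lt hp).trans (by norm_num)) (mem_codes.1 (hmem hw)).1] at hd
    exact C.valid (v := ⟨_, hmem hp⟩) (w := ⟨_, hmem hw⟩) hd (Fin.ext heq)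

end

end SphereGraphs

theorem mainTheorem5 :
    -- the two factors are unit distance graphs in the sphere of radius `r₂`
    greatIcosahedron ⊆ Metric.sphere 0 r₂ ∧
    IsUnitDistanceEmbedding L10_1 r₂ h10_1 ∧
    -- the distance product
    (distanceProduct H12_2 H10_1).chromaticNumber = 5 ∧
    (distanceProductVerts H12_2 H10_1).ncard = 3132 ∧
    (distanceProduct H12_2 H10_1).edgeSet.ncard = 10230 ∧
    -- its reduction
    (survivors (distanceProduct H12_2 H10_1) 4).ncard = 972 ∧
    G972.edgeSet.ncard = 4110 ∧
    G972.chromaticNumber = 5 :=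
  ⟨greatIcosahedron_subset_sphere, isUnitDistanceEmbedding_h10_1,
    (chromaticNumber_eq_five not_colorable_four).1, ncard_distanceProductVerts,
    ncard_edgeSet_product, ncard_survivors, ncard_edgeSet_G972,
    (chromaticNumber_eq_five not_colorable_four).2⟩
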